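/- **Theorem 3.3.** Let $1<\alpha,\beta\le 2$, $T,x_r,y_r>0$, $\Omega=(0,x_r)\times(0,y_r)$. Let $a,b$ be twice continuously differentiable on $\overline\Omega$ with $0<a_0\le a\le a_1$, $0<b_0\le b\le b_1$ on $\Omega$. Let $u$ be an exact solution of $$u_{tt}=a\,\frac{\partial^\alpha u}{\partial|x|^\alpha}+b\,\frac{\partial^\beta u}{\partial|y|^\beta}+f\quad\text{in }\Omega\times[0,T],\qquad u(\cdot,0)=\varphi,\quad u_t(\cdot,0)=\psi\ \text{ in }\Omega,$$ with $u=0$ on $\partial\Omega$ and $u$ extended by $0$ outside $\Omega$. Here $\frac{\partial^\alpha u}{\partial |x|^\alpha}=-\kappa_\alpha({}_0D_x^\alpha+{}_xD_{x_r}^\alpha)u$, $\kappa_\alpha=\frac1{2\cos(\alpha\pi/2)}$, with the Riemann–Liouville derivatives $${}_0D_x^\alpha w(x)=\frac1{\Gamma(n-\alpha)}\frac{d^n}{dx^n}\int_0^x(x-\xi)^{n-\alpha-1}w(\xi)\,d\xi,\qquad {}_xD_{x_r}^\alpha w(x)=\frac{(-1)^n}{\Gamma(n-\alpha)}\frac{d^n}{dx^n}\int_x^{x_r}(\xi-x)^{n-\alpha-1}w(\xi)\,d\xi$$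 ($n-1\le\alpha<n$), and similarly in $y$ on $(0,y_r)$. Assume that $u$ is sufficiently smooth: $u\in C^8(S_\alpha\times S_\beta\times[0,T])$, where $S_\alpha=\mathbb R$ if $\alpha<2$ and $S_\alpha=[0,x_r]$ if $\alpha=2$, and $S_\beta=\mathbb R$ if $\beta<2$ and $S_\beta=[0,y_r]$ if $\beta=2$. For positive integers $N_x,N_y,N_t$ put $h_x=x_r/N_x$, $h_y=y_r/N_y$, $\tau=T/N_t$, $x_i=ih_x$, $y_j=jh_y$, $t_k=k\tau$. Let $g_0^\alpha=1$, $g_m^\alpha=(1-\frac{\alpha+1}m)g_{m-1}^\alpha$, $\varphi_0^\alpha=\frac\alpha2g_0^\alpha$, $\varphi_m^\alpha=\frac\alpha2g_m^\alpha+\frac{2-\alpha}2g_{m-1}^\alpha$ ($m\ge1$). Let $B_\alpha$ be the matrix of size $N_x-1$ with entries $(B_\alpha)_{i,l}=\varphi^\alpha_{l-i+1}$ for $l\ge i-1$ and $0$ otherwise, let $\nabla_{h_x}^\alpha=-\frac{\kappa_\alpha}{h_x^\alpha}(B_\alpha+B_\alpha^{T})$, and let $\Lambda_{h_x}^\alpha$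 be the positive square root of $-\nabla_{h_x}^\alpha$; these act in the $x$ direction on grid functions $v=(v_{i,j})_{1\le i\le N_x-1,\,1\le j\le N_y-1}$. Define $\nabla_{h_y}^\beta,\Lambda_{h_y}^\beta$ in the same way in the $y$ direction. Let $\|v\|^2=h_xh_y\sum_{i,j}v_{i,j}^2$. For $\frac14\le\theta\le1$ let $u^0,\dots,u^{N_t}$ be grid functions that satisfy at all interior nodes $u^0=\varphi$, $u^1=\varphi+\tau\psi+\frac{\tau^2}2\big[(a\nabla_{h_x}^\alpha+b\nabla_{h_y}^\beta)u^0+f^0\big]$ and, for $1\le k\le N_t-1$, $$\begin{aligned}(1-\theta\tau^2a\nabla_{h_x}^\alpha)(1-\theta\tau^2b\nabla_{h_y}^\beta)u^{k+1}&=\big[2(1-\theta\tau^2a\nabla_{h_x}^\alpha)(1-\theta\tau^2b\nabla_{h_y}^\beta)+\tau^2a\nabla_{h_x}^\alpha+\tau^2b\nabla_{h_y}^\beta\big]u^k\\&\quad-(1-\theta\tau^2a\nabla_{h_x}^\alpha)(1-\theta\tau^2b\nabla_{h_y}^\beta)u^{k-1}+\tau^2f^k,\end{aligned}$$ where $f^k_{i,j}=f(x_i,y_j,t_k)$.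 Let $e^k_{i,j}=u(x_i,y_j,t_k)-u^k_{i,j}$, $e_{\bar t}^{k+1}=(e^{k+1}-e^k)/\tau$ and $$\begin{aligned}E^k&=\|e_{\bar t}^{k+1}\|^2+\tfrac14\|\sqrt a(\Lambda_{h_x}^\alpha e^{k+1}+\Lambda_{h_x}^\alpha e^k)\|^2+\tfrac14(4\theta-1)\|\sqrt a(\Lambda_{h_x}^\alpha e^{k+1}-\Lambda_{h_x}^\alpha e^k)\|^2\\&\quad+\tfrac14\|\sqrt b(\Lambda_{h_y}^\beta e^{k+1}+\Lambda_{h_y}^\beta e^k)\|^2+\tfrac14(4\theta-1)\|\sqrt b(\Lambda_{h_y}^\beta e^{k+1}-\Lambda_{h_y}^\beta e^k)\|^2+\theta^2\tau^6\|\sqrt{ab}\,\Lambda_{h_x}^\alpha\Lambda_{h_y}^\beta e_{\bar t}^{k+1}\|^2.\end{aligned}$$ Then $E^k=\mathcal O\big((\tau^2+h_x^2+h_y^2)^2\big)$: there are constants $C,\tau_0>0$, independent of $N_x,N_y,N_t,k$ and $\theta\in[\frac14,1]$, such that whenever $\tau\le\tau_0$ (with no restriction on $h_x,h_y$), $$E^k\le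 C(\tau^2+h_x^2+h_y^2)^2\qquad(0\le k\le N_t-1).$$ -/

import Mathlib

open Set

open scoped MatrixOrder

noncomputable section

namespace RieszWave

/-! ### The space-Riesz fractional derivative on an interval -/

/-- The integer `n` with `n - 1 ≤ α < n`. -/
def rlOrder (α : ℝ) : ℕ := ⌊α⌋₊ + 1

/-- Left Riemann-Liouville derivative of order `α` with base point `0`. -/
def rlLeft (α : ℝ) (w : ℝ → ℝ) (x : ℝ) : ℝ :=
  1 / Real.Gamma (rlOrder α - α) *
    iteratedDeriv (rlOrder α)
      (fun z : ℝ => ∫ ξ in (0 : ℝ)..z, (z - ξ) ^ ((rlOrder α : ℝ) - α - 1) * w ξ) x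

/-- Right Riemann-Liouville derivative of order `α` with base point `L`. -/
def rlRight (α L : ℝ) (w : ℝ → ℝ) (x : ℝ) : ℝ :=
  (-1) ^ rlOrder α / Real.Gamma (rlOrder α - α) *
    iteratedDeriv (rlOrder α)
      (fun z : ℝ => ∫ ξ in z..L, (ξ - z) ^ ((rlOrder α : ℝ) - α - 1) * w ξ) x

/-- `κ_α = 1 / (2 cos (α π / 2))`, negative for `1 < α ≤ 2`. -/
def kappa (α : ℝ) : ℝ := 1 / (2 * Real.cos (α * Real.pi / 2))

/-- The Riesz derivative `∂^α w / ∂|x|^α` on the interval `(0, L)`. -/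
def rieszDeriv (α L : ℝ) (w : ℝ → ℝ) (x : ℝ) : ℝ :=
  -kappa α * (rlLeft α w x + rlRight α L w x)

/-! ### The exact solution -/

/-- `u` solves `u_tt = a ∂^α u/∂|x|^α + b ∂^β u/∂|y|^β + f` on `(0,xr) × (0,yr)` for
`t ∈ [0, T]`, with initial value `φ`, initial velocity `ψ` and the homogeneous Dirichlet condition,
`u` being extended by zero outside the open rectangle.
The time derivatives at the end points of `[0, T]` are one-sided. -/
structure IsExactSolution (α β T xr yr : ℝ) (a b : ℝ → ℝ → ℝ) (f : ℝ → ℝ → ℝ → ℝ)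
    (φ ψ : ℝ → ℝ → ℝ) (u : ℝ → ℝ → ℝ → ℝ) : Prop where
  equation : ∀ x ∈ Ioo 0 xr, ∀ y ∈ Ioo 0 yr, ∀ t ∈ Icc 0 T,
    iteratedDerivWithin 2 (fun s => u x y s) (Icc 0 T) t
      = a x y * rieszDeriv α xr (fun ξ => u ξ y t) x
        + b x y * rieszDeriv β yr (fun η => u x η t) y + f x y t
  initial_value : ∀ x ∈ Ioo 0 xr, ∀ y ∈ Ioo 0 yr, u x y 0 = φ x y
  initial_velocity : ∀ x ∈ Ioo 0 xr, ∀ y ∈ Ioo 0 yr,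
    derivWithin (fun s => u x y s) (Icc 0 T) 0 = ψ x y
  dirichlet : ∀ x y : ℝ, ¬ (x ∈ Ioo 0 xr ∧ y ∈ Ioo 0 yr) → ∀ t ∈ Icc 0 T, u x y t = 0

/-- The set of values of one space variable over which the exact solution has to be smooth:
the closed interval for the classical (local) second derivative `α = 2`; the whole line, i.e.
smoothness of the extension by zero, for a fractional (nonlocal) derivative. -/
def smoothSet (α L : ℝ) : Set ℝ := {x | α = 2 → x ∈ Icc 0 L}

/-- Regularity of the exact solution: eight continuous derivatives in `(x, y, t)` jointly, up to
the boundary. -/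
def IsRegular (α β T xr yr : ℝ) (u : ℝ → ℝ → ℝ → ℝ) : Prop :=
  ContDiffOn ℝ 8 (fun p : ℝ × ℝ × ℝ => u p.1 p.2.1 p.2.2)
    (smoothSet α xr ×ˢ smoothSet β yr ×ˢ Icc 0 T)

/-! ### The discrete Riesz operators -/

/-- `g_m^α = (-1)^m binom(α, m)`. -/
def glCoeff (α : ℝ) : ℕ → ℝ
  | 0 => 1
  | m + 1 => (1 - (α + 1) / ((m : ℝ) + 1)) * glCoeff α m

/-- `φ_m^α`, the weighted and shifted coefficients. -/
def wsCoeff (α : ℝ) : ℕ → ℝ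
  | 0 => α / 2 * glCoeff α 0
  | m + 1 => α / 2 * glCoeff α (m + 1) + (2 - α) / 2 * glCoeff α m

/-- The Toeplitz matrix `B_α` with entries `φ_{l-i+1}^α` for `l ≥ i - 1` and `0` otherwise. -/
def matB (α : ℝ) (n : ℕ) : Matrix (Fin n) (Fin n) ℝ :=
  Matrix.of fun i l => if (i : ℕ) ≤ (l : ℕ) + 1 then wsCoeff α ((l : ℕ) + 1 - (i : ℕ)) else 0

/-- The discrete Riesz derivative `∇_h^α = -(κ_α / h^α) (B_α + B_αᵀ)` on `n` interior nodes. -/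
def nablaMat (α h : ℝ) (n : ℕ) : Matrix (Fin n) (Fin n) ℝ :=
  (-kappa α / h ^ α) • (matB α n + (matB α n).transpose)

/-- `Λ_h^α`, the positive square root of `-∇_h^α`. -/
def lambdaMat (α h : ℝ) (n : ℕ) : Matrix (Fin n) (Fin n) ℝ :=
  CFC.sqrt (-nablaMat α h n)

/-! ### Grid functions on the interior nodes `(x_i, y_j)`, `1 ≤ i ≤ Nx - 1`, `1 ≤ j ≤ Ny - 1` -/

/-- Grid functions on the interior nodes; the index `i : Fin (Nx - 1)` stands for the node
`x_{i+1} = (i + 1) h_x`. A grid function is understood to be zero on the boundary nodes. -/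
abbrev Grid (Nx Ny : ℕ) := Matrix (Fin (Nx - 1)) (Fin (Ny - 1)) ℝ

/-- Restriction of a function on the rectangle to the interior nodes. -/
def sample (xr yr : ℝ) (Nx Ny : ℕ) (w : ℝ → ℝ → ℝ) : Grid Nx Ny :=
  Matrix.of fun i j => w (((i : ℕ) + 1) * (xr / Nx)) (((j : ℕ) + 1) * (yr / Ny))

/-- A one-dimensional matrix acting in the `x` direction. -/
def actX {Nx Ny : ℕ} (A : Matrix (Fin (Nx - 1)) (Fin (Nx - 1)) ℝ) (v : Grid Nx Ny) : Grid Nx Ny :=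
  Matrix.of fun i j => ∑ l, A i l * v l j

/-- A one-dimensional matrix acting in the `y` direction. -/
def actY {Nx Ny : ℕ} (A : Matrix (Fin (Ny - 1)) (Fin (Ny - 1)) ℝ) (v : Grid Nx Ny) : Grid Nx Ny :=
  Matrix.of fun i j => ∑ l, A j l * v i l

/-- Pointwise product of grid functions. -/
def pmul {Nx Ny : ℕ} (c v : Grid Nx Ny) : Grid Nx Ny := Matrix.of fun i j => c i j * v i j

/-- Squared discrete norm `‖v‖² = h_x h_y ∑ v_{i,j}²`. -/
def normSq {Nx Ny : ℕ} (hx hy : ℝ) (v : Grid Nx Ny) : ℝ := hx * hy * ∑ i, ∑ j, v i j ^ 2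

/-- `a ∇_{h_x}^α v`. -/
def opX (α xr yr : ℝ) (a : ℝ → ℝ → ℝ) {Nx Ny : ℕ} (v : Grid Nx Ny) : Grid Nx Ny :=
  pmul (sample xr yr Nx Ny a) (actX (nablaMat α (xr / Nx) (Nx - 1)) v)

/-- `b ∇_{h_y}^β v`. -/
def opY (β xr yr : ℝ) (b : ℝ → ℝ → ℝ) {Nx Ny : ℕ} (v : Grid Nx Ny) : Grid Nx Ny :=
  pmul (sample xr yr Nx Ny b) (actY (nablaMat β (yr / Ny) (Ny - 1)) v)

/-- The factored operator `(1 - θ τ² a ∇_{h_x}^α) (1 - θ τ² b ∇_{h_y}^β) v`. -/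
def adiOp (α β θ τ xr yr : ℝ) (a b : ℝ → ℝ → ℝ) {Nx Ny : ℕ} (v : Grid Nx Ny) : Grid Nx Ny :=
  let w : Grid Nx Ny := v - (θ * τ ^ 2) • opY β xr yr b v
  w - (θ * τ ^ 2) • opX α xr yr a w

/-- `U^0, …, U^{Nt}` is the solution of the ADI-perturbed difference scheme with `τ = T / Nt`. -/
structure IsSchemeSolution (α β θ T xr yr : ℝ) (a b : ℝ → ℝ → ℝ) (f : ℝ → ℝ → ℝ → ℝ)
    (φ ψ : ℝ → ℝ → ℝ) (Nx Ny Nt : ℕ) (U : ℕ → Grid Nx Ny) : Prop where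
  start_zero : U 0 = sample xr yr Nx Ny φ
  start_one : U 1 = sample xr yr Nx Ny φ + (T / Nt) • sample xr yr Nx Ny ψ
    + ((T / Nt) ^ 2 / 2) • (opX α xr yr a (U 0) + opY β xr yr b (U 0)
      + sample xr yr Nx Ny fun x y => f x y 0)
  step : ∀ k : ℕ, 1 ≤ k → k + 1 ≤ Nt →
    adiOp α β θ (T / Nt) xr yr a b (U (k + 1))
      = (2 : ℝ) • adiOp α β θ (T / Nt) xr yr a b (U k)
        + (T / Nt) ^ 2 • opX α xr yr a (U k) + (T / Nt) ^ 2 • opY β xr yr b (U k)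
        - adiOp α β θ (T / Nt) xr yr a b (U (k - 1))
        + (T / Nt) ^ 2 • sample xr yr Nx Ny fun x y => f x y (k * (T / Nt))

/-- The error `e^k = u(·, ·, t_k) - U^k` at the interior nodes. -/
def gridError (T xr yr : ℝ) (u : ℝ → ℝ → ℝ → ℝ) {Nx Ny : ℕ} (Nt : ℕ) (U : ℕ → Grid Nx Ny)
    (k : ℕ) : Grid Nx Ny :=
  (sample xr yr Nx Ny fun x y => u x y (k * (T / Nt))) - U k

/-- The discrete energy `E^k` of a sequence of grid functions `e^k`. -/
def energy (α β θ τ xr yr : ℝ) (a b : ℝ → ℝ → ℝ) {Nx Ny : ℕ} (e : ℕ → Grid Nx Ny) (k : ℕ) : ℝ :=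
  let hx : ℝ := xr / Nx
  let hy : ℝ := yr / Ny
  let Lx : Grid Nx Ny → Grid Nx Ny := actX (lambdaMat α hx (Nx - 1))
  let Ly : Grid Nx Ny → Grid Nx Ny := actY (lambdaMat β hy (Ny - 1))
  let sa : Grid Nx Ny := sample xr yr Nx Ny fun x y => Real.sqrt (a x y)
  let sb : Grid Nx Ny := sample xr yr Nx Ny fun x y => Real.sqrt (b x y)
  let sab : Grid Nx Ny := sample xr yr Nx Ny fun x y => Real.sqrt (a x y * b x y)
  let et : Grid Nx Ny := τ⁻¹ • (e (k + 1) - e k)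
  normSq hx hy et
    + 1 / 4 * normSq hx hy (pmul sa (Lx (e (k + 1)) + Lx (e k)))
    + 1 / 4 * (4 * θ - 1) * normSq hx hy (pmul sa (Lx (e (k + 1)) - Lx (e k)))
    + 1 / 4 * normSq hx hy (pmul sb (Ly (e (k + 1)) + Ly (e k)))
    + 1 / 4 * (4 * θ - 1) * normSq hx hy (pmul sb (Ly (e (k + 1)) - Ly (e k)))
    + θ ^ 2 * τ ^ 6 * normSq hx hy (pmul sab (Lx (Ly et)))

end RieszWave

end

noncomputable section
namespace RieszWave

set_option linter.unusedSectionVars false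

/-! ### The `ℓ²` norm of two-index families -/

/-! The error solves the difference scheme with a small right side and small starting values, and
the scheme is stable in a discrete energy; a Gronwall argument joins the two.

Stability. For `1 < α ≤ 2` the matrix `-nablaMat` is symmetric, with nonpositive off-diagonal
entries and nonnegative row sums. It is therefore the Dirichlet form of a weighted graph in which
any two nodes are joined and every node has an edge to a grounded vertex carrying the row sum
(`isForm_nabla`). The gradient of this graph obeys a Leibniz rule (`grad_mul`), and the second
moment `∑ w_r (r h)²` of the weights is bounded uniformly in `h` (`exists_moment_le`). Hence
variable coefficients can be commuted through the forms with remainders of lower order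
(`abs_formX_sub_le`, `abs_form_comm_le`). The delicate term is the splitting term `a Dx (b Dy p)`
tested with `q`: `abs_formXY_sub_le` leaves a remainder in which `q` never carries the mixed
gradient, and this is what the energy can absorb with a spare factor `τ`. Testing the error equation
with `e^{k+2} - e^k` and polarizing gives `modEnergy_step`: the energy grows per step by at most
`O(τ)` times itself plus `τ` times the squared residual. No relation between `τ` and the mesh sizes
is used.

Consistency. For `1 < α < 2` both the weighted shifted Grünwald sum and the Riemann-Liouville
derivative are integrals of the fourth derivative against explicit kernels, since the function
vanishes on the negative half line. The kernels differ by `O(h² s^{1-α})`, which is integrable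
(`exists_kernel_le`). This rests on the moments of the weights: summation lowers the order of the
coefficients by one, so the third moment is governed by coefficients of order `α - 4`, and the
combination with weights `α / 2` and `(2 - α) / 2` equals `(N + 2)^{3-α} / Γ(4-α)` up to a relative
error `O(N⁻²)` (`exists_abs_wsSum_four_sub_le`). For `α = 2` the operator is the classical second
difference. Right derivatives are left derivatives of the reflected function. Because the discrete
operator is a finite linear combination, it commutes with derivatives in the remaining variables, so
the same estimates hold for time differences, for the dependence on `y`, and for the composed
operator, which takes four derivatives in `x` and four in `y`.

Starting values. `e^0` vanishes, and `e^1` is a Taylor remainder `O(τ³)` plus `τ²` times truncation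
errors (`error_one`). Its gradients have to be small too. For the Taylor remainder they follow by
interpolation between bounded quantities (`isSmall_of_mul`). A truncation error in `x` is Lipschitz
in `y`, but in `x` only its size `O(h²)` is used, and there the inverse estimate spends one power of
`h` (`exists_isSmall_of_isLipGrid`).

Finally `Λ` is a symmetric square root, so `‖Λ v‖` is the norm of the graph gradient, and the energy
of the theorem is dominated by `modEnergy` (`energy_le`). -/

/-- The `ℓ²` norm of a finite two-index family. -/
def nrm {ι γ : Type*} [Fintype ι] [Fintype γ] (f : ι → γ → ℝ) : ℝ :=
  ‖(WithLp.toLp 2 (fun p : ι × γ => f p.1 p.2) : EuclideanSpace ℝ (ι × γ))‖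

section nrm
variable {ι κ γ : Type*} [Fintype ι] [Fintype κ] [Fintype γ]

lemma nrm_nonneg (f : ι → γ → ℝ) : 0 ≤ nrm f := norm_nonneg _

lemma nrm_sq (f : ι → γ → ℝ) : nrm f ^ 2 = ∑ i, ∑ j, f i j ^ 2 := by
  rw [nrm, EuclideanSpace.norm_sq_eq, Fintype.sum_prod_type]
  simp

lemma nrm_add_le (f g : ι → γ → ℝ) : nrm (fun i j => f i j + g i j) ≤ nrm f + nrm g := by
  unfold nrm
  exact norm_add_le (WithLp.toLp 2 (fun p : ι × γ => f p.1 p.2) : EuclideanSpace ℝ (ι × γ))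
    (WithLp.toLp 2 (fun p : ι × γ => g p.1 p.2))

lemma nrm_sub_le (f g : ι → γ → ℝ) : nrm (fun i j => f i j - g i j) ≤ nrm f + nrm g := by
  unfold nrm
  exact norm_sub_le (WithLp.toLp 2 (fun p : ι × γ => f p.1 p.2) : EuclideanSpace ℝ (ι × γ))
    (WithLp.toLp 2 (fun p : ι × γ => g p.1 p.2))

lemma nrm_smul (c : ℝ) (f : ι → γ → ℝ) : nrm (fun i j => c * f i j) = |c| * nrm f := by
  unfold nrm
  exact norm_smul c (WithLp.toLp 2 (fun p : ι × γ => f p.1 p.2) : EuclideanSpace ℝ (ι × γ))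

lemma abs_sum_mul_le_nrm (f g : ι → γ → ℝ) :
    |∑ i, ∑ j, f i j * g i j| ≤ nrm f * nrm g := by
  have h := abs_real_inner_le_norm
    (WithLp.toLp 2 (fun p : ι × γ => f p.1 p.2) : EuclideanSpace ℝ (ι × γ))
    (WithLp.toLp 2 (fun p : ι × γ => g p.1 p.2))
  rw [PiLp.inner_apply, Fintype.sum_prod_type] at h
  simpa [nrm, mul_comm] using h

lemma nrm_le_of_sq_le {f : ι → γ → ℝ} {C : ℝ} (hC : 0 ≤ C) (h : ∑ i, ∑ j, f i j ^ 2 ≤ C ^ 2) :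
    nrm f ≤ C := by
  rw [← nrm_sq] at h
  exact abs_le_of_sq_le_sq' h hC |>.2

lemma nrm_mono {f g : ι → γ → ℝ} (h : ∀ i j, |f i j| ≤ |g i j|) : nrm f ≤ nrm g := by
  refine nrm_le_of_sq_le (nrm_nonneg _) ?_
  rw [nrm_sq]
  exact Finset.sum_le_sum fun i _ => Finset.sum_le_sum fun j _ => sq_le_sq.2 (h i j)

lemma nrm_mul_le {c f : ι → γ → ℝ} {C : ℝ} (hC : 0 ≤ C) (h : ∀ i j, |c i j| ≤ C) :
    nrm (fun i j => c i j * f i j) ≤ C * nrm f := by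
  have := nrm_smul C f
  rw [abs_of_nonneg hC] at this
  rw [← this]
  refine nrm_mono fun i j => ?_
  rw [abs_mul, abs_mul, abs_of_nonneg hC]
  exact mul_le_mul_of_nonneg_right (h i j) (abs_nonneg _)

lemma abs_sum_mul_mul_le {c f g : ι → γ → ℝ} {C : ℝ} (hC : 0 ≤ C) (h : ∀ i j, |c i j| ≤ C) :
    |∑ i, ∑ j, c i j * f i j * g i j| ≤ C * nrm f * nrm g :=
  (abs_sum_mul_le_nrm _ _).trans (mul_le_mul_of_nonneg_right (nrm_mul_le hC h) (nrm_nonneg _))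

lemma nrm_sq_le_of_col {f : ι → γ → ℝ} {g : ι → κ → ℝ} {C : ℝ}
    (h : ∀ i, ∑ j, f i j ^ 2 ≤ C * ∑ j, g i j ^ 2) : nrm f ^ 2 ≤ C * nrm g ^ 2 := by
  rw [nrm_sq, nrm_sq, Finset.mul_sum]
  exact Finset.sum_le_sum fun i _ => h i

lemma nrm_swap (f : ι → γ → ℝ) : nrm (fun j i => f i j) = nrm f := by
  have h : nrm (fun j i => f i j) ^ 2 = nrm f ^ 2 := by
    rw [nrm_sq, nrm_sq, Finset.sum_comm]
  exact (pow_left_inj₀ (nrm_nonneg _) (nrm_nonneg _) two_ne_zero).1 h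

lemma nrm_le_sqrt_mul {f : ι → γ → ℝ} {α β : Type*} [Fintype α] [Fintype β] {g : α → β → ℝ} {C : ℝ}
    (hC : 0 ≤ C) (h : nrm f ^ 2 ≤ C * nrm g ^ 2) : nrm f ≤ √C * nrm g := by
  refine nrm_le_of_sq_le (mul_nonneg (Real.sqrt_nonneg _) (nrm_nonneg _)) ?_
  rwa [← nrm_sq, mul_pow, Real.sq_sqrt hC]

end nrm

/-! ### Weighted graph gradients

The edges out of a node `i` are `(i, some l)` and the edge `(i, none)` to a grounded vertex. -/

section grad
variable {ι κ γ : Type*} [Fintype ι] [Fintype κ] [Fintype γ]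

/-- The value at the far end of an edge, zero at the grounded vertex. -/
def tgt (v : ι → ℝ) : Option ι → ℝ
  | none => 0
  | some l => v l

/-- The weighted gradient. -/
def grad (g : ι → Option ι → ℝ) (p : ι → ℝ) (e : ι × Option ι) : ℝ :=
  g e.1 e.2 * (p e.1 - tgt p e.2)

/-- The multiplier `g_e (c_{src} - c_{tgt})`, zero on grounded edges. -/
def edgeMul (g : ι → Option ι → ℝ) (c : ι → ℝ) (e : ι × Option ι) : ℝ :=
  match e.2 with
  | none => 0
  | some l => g e.1 (some l) * (c e.1 - c l)

/-- The multiplier `|g_e| ρ_e`, zero on grounded edges. -/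
def edgeLen (g : ι → Option ι → ℝ) (ρ : ι → ι → ℝ) (e : ι × Option ι) : ℝ :=
  match e.2 with
  | none => 0
  | some l => |g e.1 (some l)| * ρ e.1 l

/-- Leibniz rule with the coefficient taken at the source. The far value vanishes at the grounded
vertex, so grounded edges contribute no commutator and the coefficient needs no value there. -/
lemma grad_mul (g : ι → Option ι → ℝ) (c p : ι → ℝ) (e : ι × Option ι) :
    grad g (fun i => c i * p i) e = c e.1 * grad g p e + edgeMul g c e * tgt p e.2 := by
  obtain ⟨i, _ | l⟩ := e <;> simp [grad, edgeMul, tgt] <;> ring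

lemma grad_add (g : ι → Option ι → ℝ) (p q : ι → ℝ) (e : ι × Option ι) :
    grad g (fun i => p i + q i) e = grad g p e + grad g q e := by
  obtain ⟨i, _ | l⟩ := e <;> simp [grad, tgt] <;> ring

lemma grad_sub (g : ι → Option ι → ℝ) (p q : ι → ℝ) (e : ι × Option ι) :
    grad g (fun i => p i - q i) e = grad g p e - grad g q e := by
  obtain ⟨i, _ | l⟩ := e <;> simp [grad, tgt] <;> ring

lemma grad_const_mul (g : ι → Option ι → ℝ) (c : ℝ) (p : ι → ℝ) (e : ι × Option ι) :
    grad g (fun i => c * p i) e = c * grad g p e := by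
  obtain ⟨i, _ | l⟩ := e <;> simp [grad, tgt] <;> ring

lemma grad_sum {σ : Type*} (s : Finset σ) (g : ι → Option ι → ℝ) (p : σ → ι → ℝ)
    (e : ι × Option ι) :
    grad g (fun i => ∑ k ∈ s, p k i) e = ∑ k ∈ s, grad g (p k) e := by
  obtain ⟨i, _ | l⟩ := e <;> simp [grad, tgt, mul_sub, Finset.mul_sum]

lemma tgt_mul (c : ℝ) (p : ι → ℝ) (o : Option ι) : tgt (fun i => c * p i) o = c * tgt p o := by
  cases o <;> simp [tgt]

lemma abs_edgeMul_le {g : ι → Option ι → ℝ} {ρ : ι → ι → ℝ} {c : ι → ℝ} {L : ℝ}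
    (h : ∀ i l, |c i - c l| ≤ L * ρ i l) (e : ι × Option ι) :
    |edgeMul g c e| ≤ L * edgeLen g ρ e := by
  obtain ⟨i, _ | l⟩ := e
  · simp [edgeMul, edgeLen]
  · simp only [edgeMul, edgeLen, abs_mul]
    calc _ ≤ |g i (some l)| * (L * ρ i l) := mul_le_mul_of_nonneg_left (h i l) (abs_nonneg _)
      _ = _ := by ring

lemma abs_edgeMul_sub_le {g : ι → Option ι → ℝ} {ρ : ι → ι → ℝ} {c c' : ι → ℝ} {L : ℝ}
    (h : ∀ i l, |c i - c l - (c' i - c' l)| ≤ L * ρ i l) (e : ι × Option ι) :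
    |edgeMul g c e - edgeMul g c' e| ≤ L * edgeLen g ρ e := by
  have : edgeMul g c e - edgeMul g c' e = edgeMul g (fun i => c i - c' i) e := by
    obtain ⟨i, _ | l⟩ := e <;> simp [edgeMul]
    ring
  rw [this]
  refine abs_edgeMul_le (fun i l => ?_) e
  convert h i l using 2
  ring

lemma edgeLen_nonneg {g : ι → Option ι → ℝ} {ρ : ι → ι → ℝ} (hρ : ∀ i l, 0 ≤ ρ i l)
    (e : ι × Option ι) : 0 ≤ edgeLen g ρ e := by
  obtain ⟨i, _ | l⟩ := e
  · simp [edgeLen]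
  · exact mul_nonneg (abs_nonneg _) (hρ _ _)

/-- The gradient in the first variable. -/
def gradX (g : ι → Option ι → ℝ) (p : ι → γ → ℝ) (e : ι × Option ι) (j : γ) : ℝ :=
  grad g (fun i => p i j) e

/-- The gradient in the second variable. -/
def gradY (g : κ → Option κ → ℝ) (p : γ → κ → ℝ) (i : γ) (f : κ × Option κ) : ℝ :=
  grad g (p i) f

/-- Summing over the sources first, each target value collects exactly the second moment of the
weights at that node. -/
lemma sum_edgeLen_tgt_le {g : ι → Option ι → ℝ} {ρ : ι → ι → ℝ} {M : ℝ}
    (hM : ∀ l, ∑ i, g i (some l) ^ 2 * ρ i l ^ 2 ≤ M) (v : ι → ℝ) :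
    ∑ e, (edgeLen g ρ e * tgt v e.2) ^ 2 ≤ M * ∑ l, v l ^ 2 := by
  rw [Fintype.sum_prod_type]
  simp only [Fintype.sum_option, edgeLen, tgt, mul_pow, sq_abs]
  simp only [mul_zero, ne_eq, OfNat.ofNat_ne_zero, not_false_eq_true, zero_pow, zero_add]
  rw [Finset.sum_comm, Finset.mul_sum]
  refine Finset.sum_le_sum fun l _ => ?_
  rw [← Finset.sum_mul]
  exact mul_le_mul_of_nonneg_right (hM l) (sq_nonneg _)

lemma nrm_edgeLen_tgtX_le {g : ι → Option ι → ℝ} {ρ : ι → ι → ℝ} {M : ℝ} (hM0 : 0 ≤ M)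
    (hM : ∀ l, ∑ i, g i (some l) ^ 2 * ρ i l ^ 2 ≤ M) (v : ι → γ → ℝ) :
    nrm (fun (e : ι × Option ι) j => edgeLen g ρ e * tgt (fun i => v i j) e.2) ≤ √M * nrm v := by
  rw [← nrm_swap v, ← nrm_swap]
  exact nrm_le_sqrt_mul hM0 (nrm_sq_le_of_col fun j => sum_edgeLen_tgt_le hM fun i => v i j)

lemma nrm_edgeLen_tgtY_le {g : κ → Option κ → ℝ} {ρ : κ → κ → ℝ} {M : ℝ} (hM0 : 0 ≤ M)
    (hM : ∀ l, ∑ i, g i (some l) ^ 2 * ρ i l ^ 2 ≤ M) (v : γ → κ → ℝ) :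
    nrm (fun i (f : κ × Option κ) => edgeLen g ρ f * tgt (v i) f.2) ≤ √M * nrm v :=
  nrm_le_sqrt_mul hM0 (nrm_sq_le_of_col fun i => sum_edgeLen_tgt_le hM (v i))

/-- The commutator of the gradient with a multiplication. -/
lemma gradX_mul (g : ι → Option ι → ℝ) (c p : ι → γ → ℝ) (e : ι × Option ι) (j : γ) :
    gradX g (fun i j => c i j * p i j) e j
      = c e.1 j * gradX g p e j + edgeMul g (fun i => c i j) e * tgt (fun i => p i j) e.2 :=
  grad_mul _ _ _ _

lemma gradY_mul (g : κ → Option κ → ℝ) (c p : γ → κ → ℝ) (i : γ) (f : κ × Option κ) :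
    gradY g (fun i j => c i j * p i j) i f
      = c i f.1 * gradY g p i f + edgeMul g (c i) f * tgt (p i) f.2 :=
  grad_mul _ _ _ _

/-- The Lipschitz constant may depend on the second index. This is needed when the coefficient is
itself an edge multiplier in the other variable, whose size varies from edge to edge. -/
lemma nrm_commX_le {g : ι → Option ι → ℝ} {ρ : ι → ι → ℝ} {M : ℝ} (hM0 : 0 ≤ M)
    (hρ : ∀ i l, 0 ≤ ρ i l)
    (hM : ∀ l, ∑ i, g i (some l) ^ 2 * ρ i l ^ 2 ≤ M) {c : ι → γ → ℝ} {Λ : γ → ℝ}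
    (hc : ∀ i l j, |c i j - c l j| ≤ Λ j * ρ i l) (p : ι → γ → ℝ) :
    nrm (fun (e : ι × Option ι) j => edgeMul g (fun i => c i j) e * tgt (fun i => p i j) e.2)
      ≤ √M * nrm (fun i j => Λ j * p i j) := by
  refine le_trans (nrm_mono fun e j => ?_)
    (nrm_edgeLen_tgtX_le (ρ := ρ) hM0 hM (fun i j => Λ j * p i j))
  rw [tgt_mul, abs_mul, abs_mul, abs_mul, abs_of_nonneg (edgeLen_nonneg hρ e), ← mul_assoc]
  refine mul_le_mul_of_nonneg_right ?_ (abs_nonneg _)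
  calc _ ≤ Λ j * edgeLen g ρ e := abs_edgeMul_le (fun i l => hc i l j) e
    _ ≤ |Λ j| * edgeLen g ρ e :=
      mul_le_mul_of_nonneg_right (le_abs_self _) (edgeLen_nonneg hρ e)
    _ = _ := mul_comm _ _

lemma nrm_commX_le' {g : ι → Option ι → ℝ} {ρ : ι → ι → ℝ} {M L : ℝ} (hM0 : 0 ≤ M) (hL : 0 ≤ L)
    (hρ : ∀ i l, 0 ≤ ρ i l)
    (hM : ∀ l, ∑ i, g i (some l) ^ 2 * ρ i l ^ 2 ≤ M) {c : ι → γ → ℝ}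
    (hc : ∀ i l j, |c i j - c l j| ≤ L * ρ i l) (p : ι → γ → ℝ) :
    nrm (fun (e : ι × Option ι) j => edgeMul g (fun i => c i j) e * tgt (fun i => p i j) e.2)
      ≤ L * √M * nrm p := by
  have h := nrm_commX_le hM0 hρ hM (Λ := fun _ => L) hc p
  rw [nrm_smul, abs_of_nonneg hL] at h
  calc _ ≤ _ := h
    _ = _ := by ring

/-- A matrix is the Dirichlet form of a weighted gradient. -/
def IsForm (g : ι → Option ι → ℝ) (A : Matrix ι ι ℝ) : Prop :=
  ∀ p q : ι → ℝ, ∑ i, (∑ l, A i l * p l) * q i = ∑ e, grad g p e * grad g q e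

/-- A matrix acting in the first variable. -/
def mulX (A : Matrix ι ι ℝ) (v : ι → γ → ℝ) (i : ι) (j : γ) : ℝ := ∑ l, A i l * v l j

/-- A matrix acting in the second variable. -/
def mulY (B : Matrix κ κ ℝ) (v : γ → κ → ℝ) (i : γ) (j : κ) : ℝ := ∑ l, B j l * v i l

lemma IsForm.sum_mulX {g : ι → Option ι → ℝ} {A : Matrix ι ι ℝ} (h : IsForm g A)
    (p q : ι → γ → ℝ) :
    ∑ i, ∑ j, mulX A p i j * q i j = ∑ e, ∑ j, gradX g p e j * gradX g q e j := by
  rw [Finset.sum_comm, Finset.sum_comm (f := fun e j => gradX g p e j * gradX g q e j)]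
  exact Finset.sum_congr rfl fun j _ => h (fun i => p i j) (fun i => q i j)

lemma IsForm.sum_mulY {g : κ → Option κ → ℝ} {B : Matrix κ κ ℝ} (h : IsForm g B)
    (p q : γ → κ → ℝ) :
    ∑ i, ∑ j, mulY B p i j * q i j = ∑ i, ∑ f, gradY g p i f * gradY g q i f :=
  Finset.sum_congr rfl fun i _ => h (p i) (q i)

lemma gradY_mulX (g : κ → Option κ → ℝ) (A : Matrix ι ι ℝ) (v : ι → κ → ℝ) (i : ι)
    (f : κ × Option κ) : gradY g (mulX A v) i f = mulX A (gradY g v) i f := by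
  unfold gradY mulX
  rw [grad_sum]
  simp only [grad_const_mul]

/-- Symmetric leading part of `⟨a D p, q⟩` in the first variable. -/
lemma abs_formX_sub_le {g : ι → Option ι → ℝ} {ρ : ι → ι → ℝ} {M L : ℝ} {A : Matrix ι ι ℝ}
    (hA : IsForm g A) (hM0 : 0 ≤ M) (hL : 0 ≤ L) (hρ : ∀ i l, 0 ≤ ρ i l)
    (hM : ∀ l, ∑ i, g i (some l) ^ 2 * ρ i l ^ 2 ≤ M) {c : ι → γ → ℝ}
    (hc : ∀ i l j, |c i j - c l j| ≤ L * ρ i l) (p q : ι → γ → ℝ) :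
    |∑ i, ∑ j, c i j * mulX A p i j * q i j
        - ∑ e, ∑ j, c e.1 j * gradX g p e j * gradX g q e j|
      ≤ L * √M * nrm (gradX g p) * nrm q := by
  have h1 : ∑ i, ∑ j, c i j * mulX A p i j * q i j
      = ∑ i, ∑ j, mulX A p i j * (c i j * q i j) :=
    Finset.sum_congr rfl fun i _ => Finset.sum_congr rfl fun j _ => by ring
  -- The coefficient is moved onto the test function before summing by parts, so the commutator
  -- falls on `q`, which enters the error without a gradient.
  rw [h1, hA.sum_mulX p (fun i j => c i j * q i j), ← Finset.sum_sub_distrib]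
  simp only [← Finset.sum_sub_distrib]
  have h2 : ∀ (e : ι × Option ι) j, gradX g p e j * gradX g (fun i j => c i j * q i j) e j
      - c e.1 j * gradX g p e j * gradX g q e j
      = gradX g p e j * (edgeMul g (fun i => c i j) e * tgt (fun i => q i j) e.2) := by
    intro e j
    rw [gradX_mul]; ring
  simp only [h2]
  refine (abs_sum_mul_le_nrm _ _).trans ?_
  calc _ ≤ nrm (gradX g p) * (L * √M * nrm q) :=
        mul_le_mul_of_nonneg_left (nrm_commX_le' hM0 hL hρ hM hc q) (nrm_nonneg _)
    _ = _ := by ring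

/-- Symmetric leading part of `⟨b D p, q⟩` in the second variable. -/
lemma abs_formY_sub_le {g : κ → Option κ → ℝ} {ρ : κ → κ → ℝ} {M L : ℝ} {B : Matrix κ κ ℝ}
    (hB : IsForm g B) (hM0 : 0 ≤ M) (hL : 0 ≤ L) (hρ : ∀ i l, 0 ≤ ρ i l)
    (hM : ∀ l, ∑ i, g i (some l) ^ 2 * ρ i l ^ 2 ≤ M) {c : γ → κ → ℝ}
    (hc : ∀ i j m, |c i j - c i m| ≤ L * ρ j m) (p q : γ → κ → ℝ) :
    |∑ i, ∑ j, c i j * mulY B p i j * q i j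
        - ∑ i, ∑ f, c i f.1 * gradY g p i f * gradY g q i f|
      ≤ L * √M * nrm (gradY g p) * nrm q := by
  have h := abs_formX_sub_le (γ := γ) hB hM0 hL hρ hM (c := fun j i => c i j)
    (fun j m i => hc i j m) (fun j i => p i j) (fun j i => q i j)
  rw [Finset.sum_comm, Finset.sum_comm (s := (Finset.univ : Finset (κ × Option κ))), nrm_swap q,
    ← nrm_swap (gradX g _)] at h
  exact h

/-- The commutator of a Dirichlet form with a multiplication is of lower order, on one side. -/
lemma abs_form_comm_le {g : ι → Option ι → ℝ} {ρ : ι → ι → ℝ} {M L K : ℝ}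
    (hM0 : 0 ≤ M) (hL : 0 ≤ L) (hK : 0 ≤ K) (hρ : ∀ i l, 0 ≤ ρ i l)
    (hg : ∀ i l, g i (some l) ^ 2 = g l (some i) ^ 2) (hρs : ∀ i l, ρ i l = ρ l i)
    (hM : ∀ l, ∑ i, g i (some l) ^ 2 * ρ i l ^ 2 ≤ M) {c : ι → γ → ℝ}
    (hc : ∀ i l j, |c i j - c l j| ≤ L * ρ i l)
    (hσ : ∀ i j, |∑ l, g i (some l) ^ 2 * (c i j - c l j)| ≤ K * (1 + |g i none|))
    (p q : ι → γ → ℝ) :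
    |∑ e, ∑ j, gradX g (fun i j => c i j * p i j) e j * gradX g q e j
        - ∑ e, ∑ j, c e.1 j * gradX g p e j * gradX g q e j|
      ≤ (L * √M + 2 * K) * (nrm (gradX g p) + nrm p) * nrm q := by
  -- The error is `∑ g² (c_i - c_l) p_l (q_i - q_l)`. Exchanging `i` and `l` in the part with `q_l`
  -- turns it into `∑ g² (c_i - c_l) (p_i + p_l) q_i`, and `p_i + p_l = 2 p_i - (p_i - p_l)`. No
  -- difference of `q` remains; the price is the second difference sum `∑_l g² (c_i - c_l)`.
  have key : ∑ e, ∑ j, gradX g (fun i j => c i j * p i j) e j * gradX g q e j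
        - ∑ e, ∑ j, c e.1 j * gradX g p e j * gradX g q e j
      = - ∑ e : ι × Option ι, ∑ j, (edgeMul g (fun i => c i j) e * gradX g p e j) * q e.1 j
        + 2 * ∑ i, ∑ j, (∑ l, g i (some l) ^ 2 * (c i j - c l j)) * p i j * q i j := by
    rw [← Finset.sum_sub_distrib]
    simp only [← Finset.sum_sub_distrib]
    have h1 : ∀ (e : ι × Option ι) j, gradX g (fun i j => c i j * p i j) e j * gradX g q e j
      - c e.1 j * gradX g p e j * gradX g q e j
        = edgeMul g (fun i => c i j) e * tgt (fun i => p i j) e.2 * gradX g q e j := by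
      intro e j; rw [gradX_mul]; ring
    simp only [h1]
    rw [Finset.sum_comm, Finset.sum_comm (s := (Finset.univ : Finset (ι × Option ι))),
      Finset.sum_comm (s := (Finset.univ : Finset ι)), ← Finset.sum_neg_distrib, Finset.mul_sum,
      ← Finset.sum_add_distrib]
    refine Finset.sum_congr rfl fun j _ => ?_
    simp only [Fintype.sum_prod_type, Fintype.sum_option, edgeMul, gradX, grad, tgt]
    simp only [zero_mul, zero_add]
    have h2 : ∑ i, ∑ l, g i (some l) * (c i j - c l j) * p l j * (g i (some l) * (q i j - q l j))
        = ∑ i, ∑ l, g i (some l) ^ 2 * (c i j - c l j) * p l j * q i j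
          + ∑ i, ∑ l, g i (some l) ^ 2 * (c i j - c l j) * p i j * q i j := by
      have h3 : ∑ i, ∑ l, g i (some l) ^ 2 * (c i j - c l j) * p i j * q i j
          = ∑ i, ∑ l, g i (some l) ^ 2 * (c l j - c i j) * p l j * q l j := by
        rw [Finset.sum_comm]
        refine Finset.sum_congr rfl fun l _ => Finset.sum_congr rfl fun i _ => ?_
        rw [hg]
      rw [h3, ← Finset.sum_add_distrib]
      refine Finset.sum_congr rfl fun l _ => ?_
      rw [← Finset.sum_add_distrib]
      refine Finset.sum_congr rfl fun i _ => ?_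
      ring
    rw [h2, Finset.mul_sum, ← Finset.sum_neg_distrib, ← Finset.sum_add_distrib,
      ← Finset.sum_add_distrib]
    refine Finset.sum_congr rfl fun i _ => ?_
    rw [Finset.sum_mul, Finset.sum_mul, Finset.mul_sum, ← Finset.sum_neg_distrib,
      ← Finset.sum_add_distrib, ← Finset.sum_add_distrib]
    refine Finset.sum_congr rfl fun l _ => ?_
    ring
  have b1 : |∑ e : ι × Option ι, ∑ j, (edgeMul g (fun i => c i j) e * gradX g p e j) * q e.1 j|
      ≤ L * √M * nrm (gradX g p) * nrm q := by
    have e1 : ∀ (e : ι × Option ι) (j : γ), |edgeMul g (fun i => c i j) e * q e.1 j|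
        ≤ L * (edgeLen g ρ e * |q e.1 j|) := by
      intro e j
      rw [abs_mul, ← mul_assoc]
      exact mul_le_mul_of_nonneg_right (abs_edgeMul_le (fun i l => hc i l j) e) (abs_nonneg _)
    have e2 : nrm (fun (e : ι × Option ι) j => edgeMul g (fun i => c i j) e * q e.1 j)
        ≤ L * √M * nrm q := by
      have e3 : nrm (fun (e : ι × Option ι) j => edgeLen g ρ e * q e.1 j) ≤ √M * nrm q := by
        rw [← nrm_swap q, ← nrm_swap]
        refine nrm_le_sqrt_mul hM0 (nrm_sq_le_of_col fun j => ?_)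
        rw [Fintype.sum_prod_type]
        simp only [Fintype.sum_option, edgeLen, mul_pow, sq_abs]
        simp only [ne_eq, OfNat.ofNat_ne_zero, not_false_eq_true, zero_pow, zero_mul, zero_add]
        rw [Finset.mul_sum]
        refine Finset.sum_le_sum fun l _ => ?_
        rw [← Finset.sum_mul]
        refine mul_le_mul_of_nonneg_right (le_trans (le_of_eq ?_) (hM l)) (sq_nonneg _)
        exact Finset.sum_congr rfl fun i _ => by rw [hg, hρs]
      calc _ ≤ nrm (fun (e : ι × Option ι) j => L * (edgeLen g ρ e * q e.1 j)) := by
            refine nrm_mono fun e j => (e1 e j).trans (le_of_eq ?_)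
            rw [abs_mul, abs_mul, abs_of_nonneg hL, abs_of_nonneg (edgeLen_nonneg hρ e)]
        _ ≤ L * (√M * nrm q) := by
            rw [nrm_smul, abs_of_nonneg hL]
            exact mul_le_mul_of_nonneg_left e3 hL
        _ = _ := by ring
    calc _ = |∑ e : ι × Option ι, ∑ j, gradX g p e j * (edgeMul g (fun i => c i j) e * q e.1 j)| := by
          congr 1
          exact Finset.sum_congr rfl fun e _ => Finset.sum_congr rfl fun j _ => by ring
      _ ≤ _ := abs_sum_mul_le_nrm _ _
      _ ≤ nrm (gradX g p) * (L * √M * nrm q) := mul_le_mul_of_nonneg_left e2 (nrm_nonneg _)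
      _ = _ := by ring
  have b2 : |∑ i, ∑ j, (∑ l, g i (some l) ^ 2 * (c i j - c l j)) * p i j * q i j|
      ≤ K * (nrm (gradX g p) + nrm p) * nrm q := by
    refine (abs_sum_mul_le_nrm _ _).trans (mul_le_mul_of_nonneg_right ?_ (nrm_nonneg _))
    -- `g i none * p i j` is the component of the gradient on the grounded edge. It absorbs the
    -- growth of the second difference sums near the boundary allowed by `hσ`.
    have e1 : nrm (fun i j => |g i none * p i j|) ≤ nrm (gradX g p) := by
      refine nrm_le_of_sq_le (nrm_nonneg _) ?_
      rw [nrm_sq, Fintype.sum_prod_type]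
      refine Finset.sum_le_sum fun i _ => ?_
      rw [Fintype.sum_option]
      refine le_add_of_le_of_nonneg (le_of_eq ?_)
        (Finset.sum_nonneg fun _ _ => Finset.sum_nonneg fun _ _ => sq_nonneg _)
      exact Finset.sum_congr rfl fun j _ => by simp [gradX, grad, tgt, mul_pow]
    have e2 : nrm (fun i j => |p i j|) ≤ nrm p := nrm_mono fun i j => by rw [abs_abs]
    calc _ ≤ nrm (fun i j => K * (|g i none * p i j| + |p i j|)) := by
          refine nrm_mono fun i j => ?_
          rw [abs_mul, abs_of_nonneg (by positivity : 0 ≤ K * (|g i none * p i j| + |p i j|)), abs_mul]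
          calc _ ≤ K * (1 + |g i none|) * |p i j| :=
                mul_le_mul_of_nonneg_right (hσ i j) (abs_nonneg _)
            _ = _ := by ring
      _ = K * nrm (fun i j => |g i none * p i j| + |p i j|) := by
          rw [nrm_smul, abs_of_nonneg hK]
      _ ≤ K * (nrm (gradX g p) + nrm p) :=
          mul_le_mul_of_nonneg_left ((nrm_add_le _ _).trans (add_le_add e1 e2)) hK
  rw [key]
  have hn := nrm_nonneg p
  calc _ ≤ L * √M * nrm (gradX g p) * nrm q + 2 * (K * (nrm (gradX g p) + nrm p) * nrm q) := by
        refine (abs_add_le _ _).trans (add_le_add ?_ ?_)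
        · rwa [abs_neg]
        · rw [abs_mul, abs_two]
          exact mul_le_mul_of_nonneg_left b2 zero_le_two
    _ ≤ _ := by
        have : 0 ≤ L * √M * nrm p * nrm q := by
          have := nrm_nonneg q
          positivity
        nlinarith

end grad

/-! ### The mixed form of the splitting term -/

section cross
variable {ι κ γ : Type*} [Fintype ι] [Fintype κ] [Fintype γ]

/-- A Dirichlet form on a line of nodes with distances `ρ`, whose edge weights have a second moment
bounded by `S ^ 2`. -/
structure IsLineForm (A : Matrix ι ι ℝ) (g : ι → Option ι → ℝ) (ρ : ι → ι → ℝ) (S : ℝ) : Prop where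
  form : IsForm g A
  dist_nonneg : ∀ i l, 0 ≤ ρ i l
  dist_symm : ∀ i l, ρ i l = ρ l i
  weight_symm : ∀ i l, g i (some l) ^ 2 = g l (some i) ^ 2
  moment : ∀ l, ∑ i, g i (some l) ^ 2 * ρ i l ^ 2 ≤ S ^ 2

/-- Discrete regularity of a coefficient with respect to two families of nodes. -/
structure IsGridCoeff (gx : ι → Option ι → ℝ) (ρx : ι → ι → ℝ) (ρy : κ → κ → ℝ) (S : ℝ)
    (c : ι → κ → ℝ) : Prop where
  bound : ∀ i j, |c i j| ≤ S
  lipX : ∀ i l j, |c i j - c l j| ≤ S * ρx i l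
  lipY : ∀ i j m, |c i j - c i m| ≤ S * ρy j m
  mixed : ∀ i l j m, |c i j - c i m - (c l j - c l m)| ≤ S * ρx i l * ρy j m
  secondX : ∀ i j, |∑ l, gx i (some l) ^ 2 * (c i j - c l j)| ≤ S * (1 + |gx i none|)

lemma gradX_tgt (g : ι → Option ι → ℝ) (q : ι → κ → ℝ) (e : ι × Option ι) (f : κ × Option κ) :
    gradX g (fun i (f : κ × Option κ) => tgt (q i) f.2) e f = tgt (gradX g q e) f.2 := by
  obtain ⟨i, _ | l⟩ := e <;> obtain ⟨j, _ | m⟩ := f <;> simp [gradX, grad, tgt]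

lemma mulX_tgt (A : Matrix ι ι ℝ) (q : ι → κ → ℝ) (i : ι) (f : κ × Option κ) :
    mulX A (fun i (f : κ × Option κ) => tgt (q i) f.2) i f = tgt (mulX A q i) f.2 := by
  obtain ⟨j, _ | m⟩ := f <;> simp [mulX, tgt]

variable {A : Matrix ι ι ℝ} {B : Matrix κ κ ℝ} {gx : ι → Option ι → ℝ} {gy : κ → Option κ → ℝ}
  {ρx : ι → ι → ℝ} {ρy : κ → κ → ℝ} {S : ℝ}

lemma IsLineForm.nrm_edgeLen_tgtX_le (hX : IsLineForm A gx ρx S) (hS : 1 ≤ S) (v : ι → γ → ℝ) :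
    nrm (fun (e : ι × Option ι) j => edgeLen gx ρx e * tgt (fun i => v i j) e.2) ≤ S * nrm v := by
  have := RieszWave.nrm_edgeLen_tgtX_le (sq_nonneg S) hX.moment v
  rwa [Real.sqrt_sq (by linarith)] at this

lemma IsLineForm.nrm_edgeLen_tgtY_le (hY : IsLineForm B gy ρy S) (hS : 1 ≤ S) (v : γ → κ → ℝ) :
    nrm (fun i (f : κ × Option κ) => edgeLen gy ρy f * tgt (v i) f.2) ≤ S * nrm v := by
  have := RieszWave.nrm_edgeLen_tgtY_le (sq_nonneg S) hY.moment v
  rwa [Real.sqrt_sq (by linarith)] at this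

lemma IsLineForm.nrm_gradX_mul_le (hX : IsLineForm A gx ρx S) (hS : 1 ≤ S) {c : ι → γ → ℝ}
    (hb : ∀ i j, |c i j| ≤ S) (hc : ∀ i l j, |c i j - c l j| ≤ S * ρx i l) (p : ι → γ → ℝ) :
    nrm (gradX gx fun i j => c i j * p i j) ≤ S ^ 2 * (nrm (gradX gx p) + nrm p) := by
  have h1 := nrm_commX_le' (γ := γ) (sq_nonneg S) (by linarith : 0 ≤ S) hX.dist_nonneg hX.moment hc p
  rw [Real.sqrt_sq (by linarith)] at h1
  have h2 : nrm (fun (e : ι × Option ι) j => c e.1 j * gradX gx p e j) ≤ S * nrm (gradX gx p) :=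
    nrm_mul_le (by linarith) fun e j => hb _ _
  have h3 : nrm (gradX gx fun i j => c i j * p i j)
      = nrm (fun (e : ι × Option ι) j => c e.1 j * gradX gx p e j
        + edgeMul gx (fun i => c i j) e * tgt (fun i => p i j) e.2) := by
    congr 1; funext e j; exact gradX_mul _ _ _ _ _
  rw [h3]
  have h4 := nrm_nonneg (gradX gx p)
  calc _ ≤ _ := nrm_add_le _ _
    _ ≤ S * nrm (gradX gx p) + S * S * nrm p := add_le_add h2 h1
    _ ≤ _ := by nlinarith [mul_nonneg (mul_nonneg (by linarith : 0 ≤ S) (by linarith : 0 ≤ S - 1)) h4]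

lemma IsLineForm.nrm_gradY_mul_le (hY : IsLineForm B gy ρy S) (hS : 1 ≤ S) {c : γ → κ → ℝ}
    (hb : ∀ i j, |c i j| ≤ S) (hc : ∀ i j m, |c i j - c i m| ≤ S * ρy j m) (p : γ → κ → ℝ) :
    nrm (gradY gy fun i j => c i j * p i j) ≤ S ^ 2 * (nrm (gradY gy p) + nrm p) := by
  have h := hY.nrm_gradX_mul_le (γ := γ) hS (c := fun j i => c i j) (fun j i => hb i j)
    (fun j m i => hc i j m) (fun j i => p i j)
  rw [nrm_swap p] at h
  rw [← nrm_swap, ← nrm_swap (gradY gy p)]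
  exact h

/-- Symmetric leading part of `⟨a Dx (b Dy p), q⟩`. -/
lemma abs_formXY_sub_le (hX : IsLineForm A gx ρx S) (hY : IsLineForm B gy ρy S) (hS : 1 ≤ S)
    {a b : ι → κ → ℝ} (ha : IsGridCoeff gx ρx ρy S a) (hb : IsGridCoeff gx ρx ρy S b)
    (p q : ι → κ → ℝ) :
    |∑ i, ∑ j, a i j * mulX A (fun i j => b i j * mulY B p i j) i j * q i j
        - ∑ e, ∑ f, (a e.1 f.1 * b e.1 f.1) * gradX gx (gradY gy p) e f * gradX gx (gradY gy q) e f|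
      ≤ 8 * S ^ 5 * (nrm (gradX gx (gradY gy p)) + nrm (gradY gy p))
          * (nrm (gradX gx q) + nrm (gradY gy q) + nrm q) := by
  have S0 : 0 ≤ S := by linarith
  have sqS : √(S ^ 2) = S := Real.sqrt_sq S0
  set q' : ι → κ → ℝ := fun i j => a i j * q i j with hq'
  set P : ι → κ × Option κ → ℝ := gradY gy p with hP
  set Y : ι → κ × Option κ → ℝ := gradY gy q' with hYd
  set z : ι → κ → ℝ := mulX A q' with hz
  set μa : ι → κ × Option κ → ℝ := fun i f => edgeMul gy (a i) f with hμa
  set μb : ι → κ × Option κ → ℝ := fun i f => edgeMul gy (b i) f with hμb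
  set qt : ι → κ × Option κ → ℝ := fun i f => tgt (q i) f.2 with hqt
  set qt' : ι → κ × Option κ → ℝ := fun i f => tgt (q' i) f.2 with hqt'
  set GP := gradX gx P with hGP
  set GQ := gradX gx (gradY gy q) with hGQ
  set Z := nrm (gradX gx q) + nrm (gradY gy q) + nrm q with hZ
  set X := nrm GP + nrm P with hXd
  have n1 := nrm_nonneg GP
  have n2 := nrm_nonneg P
  have n3 := nrm_nonneg (gradX gx q)
  have n4 := nrm_nonneg (gradY gy q)
  have n5 := nrm_nonneg q
  have S12 : S ≤ S ^ 2 := by nlinarith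
  have X0 : 0 ≤ X := by positivity
  have Z0 : 0 ≤ Z := by positivity
  have absμa : ∀ i f, |μa i f| ≤ S * edgeLen gy ρy f := fun i f =>
    abs_edgeMul_le (fun j m => ha.lipY i j m) f
  have absμb : ∀ i f, |μb i f| ≤ S * edgeLen gy ρy f := fun i f =>
    abs_edgeMul_le (fun j m => hb.lipY i j m) f
  have dμa : ∀ i l f, |μa i f - μa l f| ≤ (S * edgeLen gy ρy f) * ρx i l := fun i l f => by
    refine (abs_edgeMul_sub_le (ρ := ρy) (L := S * ρx i l) (fun j m => ha.mixed i l j m) f).trans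
      (le_of_eq (by ring))
  have dμb : ∀ i l f, |μb i f - μb l f| ≤ (S * edgeLen gy ρy f) * ρx i l := fun i l f => by
    refine (abs_edgeMul_sub_le (ρ := ρy) (L := S * ρx i l) (fun j m => hb.mixed i l j m) f).trans
      (le_of_eq (by ring))
  have lx := fun e => edgeLen_nonneg (g := gx) hX.dist_nonneg e
  have ly := fun e => edgeLen_nonneg (g := gy) hY.dist_nonneg e
  -- norms of the transformed test functions
  have bq'X : nrm (gradX gx q') ≤ S ^ 2 * Z := by
    refine (hX.nrm_gradX_mul_le hS ha.bound ha.lipX q).trans ?_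
    exact mul_le_mul_of_nonneg_left (by linarith) (by positivity)
  have bY : nrm Y ≤ S ^ 2 * Z := by
    refine (hY.nrm_gradY_mul_le hS ha.bound ha.lipY q).trans ?_
    exact mul_le_mul_of_nonneg_left (by linarith) (by positivity)
  -- splitting
  have split : ∑ i, ∑ j, a i j * mulX A (fun i j => b i j * mulY B p i j) i j * q i j
      = ∑ e, ∑ f, gradX gx (fun i f => b i f.1 * P i f) e f * gradX gx Y e f
        + ∑ e, ∑ f, gradX gx (fun i f => μb i f * P i f) e f * gradX gx qt' e f := by
    calc _ = ∑ i, ∑ j, mulX A (fun i j => b i j * mulY B p i j) i j * q' i j :=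
          Finset.sum_congr rfl fun i _ => Finset.sum_congr rfl fun j _ => by simp only [hq']; ring
      _ = ∑ i, ∑ j, mulX A q' i j * (b i j * mulY B p i j) := by
          rw [hX.form.sum_mulX, hX.form.sum_mulX]
          exact Finset.sum_congr rfl fun i _ => Finset.sum_congr rfl fun j _ => mul_comm _ _
      _ = ∑ i, ∑ j, mulY B p i j * (b i j * z i j) :=
          Finset.sum_congr rfl fun i _ => Finset.sum_congr rfl fun j _ => by ring
      _ = ∑ i, ∑ f, P i f * gradY gy (fun i j => b i j * z i j) i f :=
          hY.form.sum_mulY p (fun i j => b i j * z i j)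
      _ = ∑ i, ∑ f, mulX A Y i f * (b i f.1 * P i f) + ∑ i, ∑ f, mulX A qt' i f * (μb i f * P i f) := by
          rw [← Finset.sum_add_distrib]
          refine Finset.sum_congr rfl fun i _ => ?_
          rw [← Finset.sum_add_distrib]
          refine Finset.sum_congr rfl fun f _ => ?_
          rw [gradY_mul, gradY_mulX, mulX_tgt]
          ring
      _ = _ := by
          rw [hX.form.sum_mulX, hX.form.sum_mulX]
          congr 1 <;>
          exact Finset.sum_congr rfl fun i _ => Finset.sum_congr rfl fun j _ => mul_comm _ _
  -- Here the one-sided commutator is indispensable: a plain Leibniz estimate would leave `gradX gx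
  -- Y`, that is, the mixed gradient of `q`.
  have e1 : |∑ e, ∑ f, gradX gx (fun i f => b i f.1 * P i f) e f * gradX gx Y e f
      - ∑ e, ∑ f, b e.1 f.1 * GP e f * gradX gx Y e f| ≤ 3 * S ^ 4 * X * Z := by
    have h := abs_form_comm_le (γ := κ × Option κ) (sq_nonneg S) S0 S0 hX.dist_nonneg
      hX.weight_symm hX.dist_symm hX.moment (c := fun i f => b i f.1)
      (fun i l f => hb.lipX i l f.1) (fun i f => hb.secondX i f.1) P Y
    rw [sqS] at h
    refine h.trans ?_
    have : S * S + 2 * S ≤ 3 * S ^ 2 := by nlinarith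
    calc _ ≤ (3 * S ^ 2) * X * (S ^ 2 * Z) := by gcongr; exact nrm_nonneg _
      _ = _ := by ring
  have gY : ∀ (e : ι × Option ι) f, gradX gx Y e f = a e.1 f.1 * GQ e f
      + (edgeMul gx (fun i => a i f.1) e * tgt (fun i => gradY gy q i f) e.2
        + (μa e.1 f * tgt (gradX gx q e) f.2
          + edgeMul gx (fun i => μa i f) e * tgt (fun i => qt i f) e.2)) := by
    intro e f
    have h1 : Y = fun i f => a i f.1 * gradY gy q i f + μa i f * qt i f := by
      funext i f; exact gradY_mul _ _ _ _ _
    have h2 : gradX gx Y e f = gradX gx (fun i (f : κ × Option κ) => a i f.1 * gradY gy q i f) e f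
        + gradX gx (fun i f => μa i f * qt i f) e f := by
      rw [h1]; exact grad_add _ _ _ _
    rw [h2, gradX_mul gx (fun i (f : κ × Option κ) => a i f.1), gradX_mul gx μa, gradX_tgt]
    ring
  have c1 : nrm (fun (e : ι × Option ι) (f : κ × Option κ) =>
      edgeMul gx (fun i => a i f.1) e * tgt (fun i => gradY gy q i f) e.2) ≤ S ^ 3 * nrm (gradY gy q) := by
    have h := nrm_commX_le' (γ := κ × Option κ) (sq_nonneg S) S0 hX.dist_nonneg hX.moment
      (c := fun i f => a i f.1) (fun i l f => ha.lipX i l f.1) (gradY gy q)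
    rw [sqS] at h
    refine h.trans (mul_le_mul_of_nonneg_right ?_ n4)
    nlinarith
  have c2g : ∀ (μ : ι → κ × Option κ → ℝ) (w : ι × Option ι → κ → ℝ),
      (∀ i f, |μ i f| ≤ S * edgeLen gy ρy f) →
      nrm (fun (e : ι × Option ι) (f : κ × Option κ) => μ e.1 f * tgt (w e) f.2) ≤ S ^ 2 * nrm w := by
    intro μ w hμ
    have h := hY.nrm_edgeLen_tgtY_le hS w
    calc _ ≤ nrm (fun (e : ι × Option ι) (f : κ × Option κ) => S * (edgeLen gy ρy f * tgt (w e) f.2)) := by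
          refine nrm_mono fun e f => ?_
          rw [abs_mul, abs_mul, abs_mul, abs_of_nonneg S0, abs_of_nonneg (ly f), ← mul_assoc]
          exact mul_le_mul_of_nonneg_right (hμ _ _) (abs_nonneg _)
      _ = S * _ := by rw [nrm_smul, abs_of_nonneg S0]
      _ ≤ S * (S * nrm w) := mul_le_mul_of_nonneg_left h S0
      _ = _ := by ring
  have c2 := c2g μa (gradX gx q) absμa
  -- The only place where both commutators fall on `q`. The mixed second difference of `a` supplies
  -- one factor of distance in each variable, and each factor is paid for by one second moment.
  have c3 : nrm (fun (e : ι × Option ι) (f : κ × Option κ) =>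
      edgeMul gx (fun i => μa i f) e * tgt (fun i => qt i f) e.2) ≤ S ^ 3 * nrm q := by
    have h := nrm_commX_le (γ := κ × Option κ) (sq_nonneg S) hX.dist_nonneg hX.moment
      (c := μa) (Λ := fun f => S * edgeLen gy ρy f) dμa qt
    rw [sqS] at h
    have h2 := hY.nrm_edgeLen_tgtY_le hS q
    have h3 : nrm (fun i f => S * edgeLen gy ρy f * qt i f)
        = S * nrm (fun i (f : κ × Option κ) => edgeLen gy ρy f * tgt (q i) f.2) := by
      rw [← abs_of_nonneg S0, ← nrm_smul, abs_of_nonneg S0]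
      congr 1; funext i f; simp only [hqt]; ring
    rw [h3] at h
    calc _ ≤ _ := h
      _ ≤ S * (S * (S * nrm q)) := by gcongr
      _ = _ := by ring
  have e2 : |∑ e, ∑ f, b e.1 f.1 * GP e f * gradX gx Y e f
      - ∑ e, ∑ f, (a e.1 f.1 * b e.1 f.1) * GP e f * GQ e f| ≤ 3 * S ^ 4 * X * Z := by
    rw [← Finset.sum_sub_distrib]
    simp only [← Finset.sum_sub_distrib]
    have h1 : ∀ (e : ι × Option ι) (f : κ × Option κ), b e.1 f.1 * GP e f * gradX gx Y e f
        - a e.1 f.1 * b e.1 f.1 * GP e f * GQ e f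
        = b e.1 f.1 * GP e f * (edgeMul gx (fun i => a i f.1) e * tgt (fun i => gradY gy q i f) e.2
        + (μa e.1 f * tgt (gradX gx q e) f.2
          + edgeMul gx (fun i => μa i f) e * tgt (fun i => qt i f) e.2)) := by
      intro e f; rw [gY]; ring
    simp only [h1]
    refine (abs_sum_mul_mul_le S0 fun (e : ι × Option ι) (f : κ × Option κ) => hb.bound e.1 f.1).trans ?_
    have S23 : S ^ 2 ≤ S ^ 3 := pow_le_pow_right₀ hS (by norm_num)
    have h2 := (nrm_add_le (fun (e : ι × Option ι) (f : κ × Option κ) =>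
      edgeMul gx (fun i => a i f.1) e * tgt (fun i => gradY gy q i f) e.2) (fun e f =>
      μa e.1 f * tgt (gradX gx q e) f.2
          + edgeMul gx (fun i => μa i f) e * tgt (fun i => qt i f) e.2)).trans
      (add_le_add c1 ((nrm_add_le _ _).trans (add_le_add c2 c3)))
    have h3 : S ^ 3 * nrm (gradY gy q) + (S ^ 2 * nrm (gradX gx q) + S ^ 3 * nrm q) ≤ S ^ 3 * Z := by
      nlinarith [mul_le_mul_of_nonneg_right S23 n3]
    calc _ ≤ S * X * (S ^ 3 * Z) := by
          gcongr
          · exact nrm_nonneg _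
          · linarith
          · exact h2.trans h3
      _ ≤ 3 * (S * X * (S ^ 3 * Z)) := by
          have : 0 ≤ S * X * (S ^ 3 * Z) := by positivity
          linarith
      _ = _ := by ring
  have e3 : |∑ e, ∑ f, gradX gx (fun i f => μb i f * P i f) e f * gradX gx qt' e f|
      ≤ 2 * S ^ 5 * X * Z := by
    have h1 : ∑ e, ∑ f, gradX gx (fun i f => μb i f * P i f) e f * gradX gx qt' e f
        = ∑ e, ∑ f, GP e f * (μb e.1 f * tgt (gradX gx q' e) f.2)
          + ∑ e, ∑ f, edgeMul gx (fun i => μb i f) e * tgt (fun i => P i f) e.2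
              * tgt (gradX gx q' e) f.2 := by
      rw [← Finset.sum_add_distrib]
      refine Finset.sum_congr rfl fun e _ => ?_
      rw [← Finset.sum_add_distrib]
      refine Finset.sum_congr rfl fun f _ => ?_
      rw [gradX_mul gx μb, gradX_tgt]
      ring
    have h2 : |∑ e, ∑ f, GP e f * (μb e.1 f * tgt (gradX gx q' e) f.2)| ≤ S ^ 5 * X * Z := by
      refine (abs_sum_mul_le_nrm _ _).trans ?_
      have S45 : S ^ 4 ≤ S ^ 5 := pow_le_pow_right₀ hS (by norm_num)
      calc _ ≤ X * (S ^ 2 * (S ^ 2 * Z)) := by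
            gcongr
            · exact nrm_nonneg _
            · linarith
            · exact (c2g μb (gradX gx q') absμb).trans (by gcongr)
        _ = S ^ 4 * X * Z := by ring
        _ ≤ _ := by gcongr
    have h3 : |∑ e, ∑ f, edgeMul gx (fun i => μb i f) e * tgt (fun i => P i f) e.2
              * tgt (gradX gx q' e) f.2| ≤ S ^ 5 * X * Z := by
      have h4 : ∀ (e : ι × Option ι) (f : κ × Option κ),
          |edgeMul gx (fun i => μb i f) e * tgt (fun i => P i f) e.2 * tgt (gradX gx q' e) f.2|
          ≤ |edgeLen gx ρx e * tgt (fun i => P i f) e.2|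
            * |S * (edgeLen gy ρy f * tgt (gradX gx q' e) f.2)| := by
        intro e f
        have := abs_edgeMul_le (g := gx) (ρ := ρx) (fun i l => dμb i l f) e
        simp only [abs_mul, abs_of_nonneg S0, abs_of_nonneg (lx e), abs_of_nonneg (ly f)]
        calc _ ≤ (S * edgeLen gy ρy f * edgeLen gx ρx e) * |tgt (fun i => P i f) e.2|
                * |tgt (gradX gx q' e) f.2| := by gcongr
          _ = _ := by ring
      have h5 : nrm (fun (e : ι × Option ι) (f : κ × Option κ) =>
          |edgeLen gx ρx e * tgt (fun i => P i f) e.2|) ≤ S * nrm P :=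
        (nrm_mono fun e f => by rw [abs_abs]).trans (hX.nrm_edgeLen_tgtX_le hS P)
      have h6 : nrm (fun (e : ι × Option ι) (f : κ × Option κ) =>
          |S * (edgeLen gy ρy f * tgt (gradX gx q' e) f.2)|) ≤ S * (S * nrm (gradX gx q')) := by
        refine (nrm_mono (g := fun (e : ι × Option ι) (f : κ × Option κ) =>
          S * (edgeLen gy ρy f * tgt (gradX gx q' e) f.2)) fun e f => by rw [abs_abs]).trans ?_
        rw [nrm_smul, abs_of_nonneg S0]
        exact mul_le_mul_of_nonneg_left (hY.nrm_edgeLen_tgtY_le hS _) S0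
      calc _ ≤ ∑ e : ι × Option ι, ∑ f : κ × Option κ, |edgeLen gx ρx e * tgt (fun i => P i f) e.2|
            * |S * (edgeLen gy ρy f * tgt (gradX gx q' e) f.2)| := by
            refine (Finset.abs_sum_le_sum_abs _ _).trans (Finset.sum_le_sum fun e _ => ?_)
            exact (Finset.abs_sum_le_sum_abs _ _).trans (Finset.sum_le_sum fun f _ => h4 e f)
        _ ≤ _ := le_abs_self _
        _ ≤ _ := abs_sum_mul_le_nrm _ _
        _ ≤ (S * X) * (S * (S * (S ^ 2 * Z))) := by
            gcongr
            · exact nrm_nonneg _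
            · exact h5.trans (mul_le_mul_of_nonneg_left (by linarith) S0)
            · exact h6.trans (by gcongr)
        _ = _ := by ring
    rw [h1]
    calc _ ≤ _ := abs_add_le _ _
      _ ≤ _ := add_le_add h2 h3
      _ = _ := by ring
  rw [split]
  have S45 : S ^ 4 * X * Z ≤ S ^ 5 * X * Z := by
    have : S ^ 4 ≤ S ^ 5 := pow_le_pow_right₀ hS (by norm_num)
    gcongr
  rw [abs_le] at e1 e2 e3 ⊢
  constructor <;> linarith [e1.1, e1.2, e2.1, e2.2, e3.1, e3.2]

end cross

/-! ### The energy estimate for one time step -/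

section step
variable {ι κ γ : Type*} [Fintype ι] [Fintype κ] [Fintype γ]

/-- The weighted quadratic form `∑ c f²`. -/
def wsq (c f : ι → γ → ℝ) : ℝ := ∑ i, ∑ j, c i j * f i j ^ 2

lemma wsq_nonneg {c f : ι → γ → ℝ} (hc : ∀ i j, 0 ≤ c i j) : 0 ≤ wsq c f :=
  Finset.sum_nonneg fun i _ => Finset.sum_nonneg fun j _ => mul_nonneg (hc i j) (sq_nonneg _)

lemma mul_nrm_sq_le_wsq {c f : ι → γ → ℝ} {m : ℝ} (hc : ∀ i j, m ≤ c i j) :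
    m * nrm f ^ 2 ≤ wsq c f := by
  rw [nrm_sq, Finset.mul_sum]
  refine Finset.sum_le_sum fun i _ => ?_
  rw [Finset.mul_sum]
  exact Finset.sum_le_sum fun j _ => mul_le_mul_of_nonneg_right (hc i j) (sq_nonneg _)

lemma wsq_le_mul_nrm_sq {c f : ι → γ → ℝ} {m : ℝ} (hc : ∀ i j, c i j ≤ m) :
    wsq c f ≤ m * nrm f ^ 2 := by
  rw [nrm_sq, Finset.mul_sum]
  refine Finset.sum_le_sum fun i _ => ?_
  rw [Finset.mul_sum]
  exact Finset.sum_le_sum fun j _ => mul_le_mul_of_nonneg_right (hc i j) (sq_nonneg _)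

lemma sum_polar (c f g u v : ι → γ → ℝ) (hu : ∀ i j, u i j = f i j - g i j)
    (hv : ∀ i j, v i j = f i j + g i j) :
    ∑ i, ∑ j, c i j * u i j * v i j = wsq c f - wsq c g := by
  rw [wsq, wsq, ← Finset.sum_sub_distrib]
  refine Finset.sum_congr rfl fun i _ => ?_
  rw [← Finset.sum_sub_distrib]
  refine Finset.sum_congr rfl fun j _ => ?_
  rw [hu, hv]; ring

lemma nrm_eq_of_forall {f g : ι → γ → ℝ} (h : ∀ i j, f i j = g i j) : nrm f = nrm g := by
  congr 1; funext i j; exact h i j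

variable (gx : ι → Option ι → ℝ) (gy : κ → Option κ → ℝ)

/-- The quadratic form of `a Dx + b Dy`. -/
def formSum (a b s : ι → κ → ℝ) : ℝ :=
  wsq (fun (e : ι × Option ι) j => a e.1 j) (gradX gx s)
    + wsq (fun i (f : κ × Option κ) => b i f.1) (gradY gy s)

/-- The energy in which the stability estimate is carried out; `d` stands for the difference and `s`
for the sum of two consecutive grid functions. -/
def modEnergy (a b : ι → κ → ℝ) (θ τ : ℝ) (d s : ι → κ → ℝ) : ℝ :=
  nrm d ^ 2 / τ ^ 2 + 1 / 4 * formSum gx gy a b s + (θ - 1 / 4) * formSum gx gy a b d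
    + θ ^ 2 * τ ^ 2 * wsq (fun (e : ι × Option ι) (f : κ × Option κ) => a e.1 f.1 * b e.1 f.1)
        (gradX gx (gradY gy d))
    + τ ^ 2 * nrm (gradY gy d) ^ 2

variable {gx gy} {A : Matrix ι ι ℝ} {B : Matrix κ κ ℝ}
  {ρx : ι → ι → ℝ} {ρy : κ → κ → ℝ} {S m θ τ : ℝ} {a b : ι → κ → ℝ}

lemma formSum_ge (hm : 0 ≤ m) (ha0 : ∀ i j, m ≤ a i j) (hb0 : ∀ i j, m ≤ b i j) (s : ι → κ → ℝ) :
    m * nrm (gradX gx s) ^ 2 ≤ formSum gx gy a b s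
      ∧ m * nrm (gradY gy s) ^ 2 ≤ formSum gx gy a b s := by
  have h1 := mul_nrm_sq_le_wsq (c := fun (e : ι × Option ι) j => a e.1 j) (f := gradX gx s)
    fun e j => ha0 e.1 j
  have h2 := mul_nrm_sq_le_wsq (c := fun i (f : κ × Option κ) => b i f.1) (f := gradY gy s)
    fun i f => hb0 i f.1
  have h3 : 0 ≤ m * nrm (gradX gx s) ^ 2 := by positivity
  have h4 : 0 ≤ m * nrm (gradY gy s) ^ 2 := by positivity
  unfold formSum
  constructor <;> linarith

/-- Every norm is read off one term of the energy. The factor `4 / m` covers the weight `1 / 4`, the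
bound `θ² ≥ 1 / 16` and the lower bound `m²` of `a b`. Gradients of `d` come with `√(θ - 1 / 4)`,
which is no information at `θ = 1 / 4`; the last bound, from the added term of the energy, does not
degenerate. -/
lemma modEnergy_bounds (hm : 0 < m) (hm1 : m ≤ 1) (ha0 : ∀ i j, m ≤ a i j) (hb0 : ∀ i j, m ≤ b i j)
    (hτ : 0 < τ) (hθ : 1 / 4 ≤ θ) (d s : ι → κ → ℝ) {ω : ℝ} (hω : 0 ≤ ω)
    (hE : modEnergy gx gy a b θ τ d s ≤ ω ^ 2) :
    nrm d ≤ τ * ω ∧ nrm (gradX gx s) ≤ 4 / m * ω ∧ nrm (gradY gy s) ≤ 4 / m * ω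
      ∧ √(θ - 1 / 4) * nrm (gradX gx d) ≤ 4 / m * ω ∧ √(θ - 1 / 4) * nrm (gradY gy d) ≤ 4 / m * ω
      ∧ τ * nrm (gradX gx (gradY gy d)) ≤ 4 / m * ω ∧ τ * nrm (gradY gy d) ≤ ω := by
  have f1 : 0 ≤ nrm d ^ 2 / τ ^ 2 := by positivity
  obtain ⟨f2, f2'⟩ := formSum_ge (gx := gx) (gy := gy) hm.le ha0 hb0 s
  obtain ⟨f3, f3'⟩ := formSum_ge (gx := gx) (gy := gy) hm.le ha0 hb0 d
  have f4 := mul_nrm_sq_le_wsq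
    (c := fun (e : ι × Option ι) (f : κ × Option κ) => a e.1 f.1 * b e.1 f.1)
    (f := gradX gx (gradY gy d)) (m := m ^ 2) fun e f => by
      rw [sq]; exact mul_le_mul (ha0 _ _) (hb0 _ _) hm.le (hm.le.trans (ha0 _ _))
  have f5 : 0 ≤ τ ^ 2 * nrm (gradY gy d) ^ 2 := by positivity
  have hθ0 : 0 ≤ θ - 1 / 4 := by linarith
  have p2 : 0 ≤ formSum gx gy a b s := le_trans (by positivity) f2
  have p3 : 0 ≤ (θ - 1 / 4) * formSum gx gy a b d :=
    mul_nonneg hθ0 (le_trans (by positivity) f3)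
  have p4 : 0 ≤ θ ^ 2 * τ ^ 2 * wsq (fun (e : ι × Option ι) (f : κ × Option κ) => a e.1 f.1 * b e.1 f.1)
        (gradX gx (gradY gy d)) := mul_nonneg (by positivity) (le_trans (by positivity) f4)
  unfold modEnergy at hE
  have hmm : m ^ 2 ≤ m := by nlinarith
  have key : ∀ {r : ℝ}, 0 ≤ r → m ^ 2 * r ^ 2 ≤ 16 * ω ^ 2 → r ≤ 4 / m * ω := by
    intro r hr h
    rw [div_mul_eq_mul_div, le_div_iff₀ hm]
    exact abs_le_of_sq_le_sq' (by nlinarith) (by positivity) |>.2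
  refine ⟨?_, ?_, ?_, ?_, ?_, ?_, ?_⟩
  · have h : nrm d ^ 2 / τ ^ 2 ≤ ω ^ 2 := by linarith
    rw [div_le_iff₀ (by positivity)] at h
    exact abs_le_of_sq_le_sq' (by nlinarith) (by positivity) |>.2
  · refine key (nrm_nonneg _) ?_
    nlinarith [mul_le_mul_of_nonneg_right hmm (sq_nonneg (nrm (gradX gx s)))]
  · refine key (nrm_nonneg _) ?_
    nlinarith [mul_le_mul_of_nonneg_right hmm (sq_nonneg (nrm (gradY gy s)))]
  · refine key (mul_nonneg (Real.sqrt_nonneg _) (nrm_nonneg _)) ?_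
    rw [mul_pow, Real.sq_sqrt hθ0]
    have := mul_le_mul_of_nonneg_left ((mul_le_mul_of_nonneg_right hmm
      (sq_nonneg (nrm (gradX gx d)))).trans f3) hθ0
    have h3 := sq_nonneg ω
    linarith
  · refine key (mul_nonneg (Real.sqrt_nonneg _) (nrm_nonneg _)) ?_
    rw [mul_pow, Real.sq_sqrt hθ0]
    have := mul_le_mul_of_nonneg_left ((mul_le_mul_of_nonneg_right hmm
      (sq_nonneg (nrm (gradY gy d)))).trans f3') hθ0
    have h3 := sq_nonneg ω
    linarith
  · refine key (mul_nonneg hτ.le (nrm_nonneg _)) ?_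
    have h1 := mul_le_mul_of_nonneg_left f4 (by positivity : 0 ≤ θ ^ 2 * τ ^ 2)
    have h2 : (1 / 16 : ℝ) ≤ θ ^ 2 := by nlinarith
    have h3 := mul_le_mul_of_nonneg_right h2
      (by positivity : 0 ≤ τ ^ 2 * (m ^ 2 * nrm (gradX gx (gradY gy d)) ^ 2))
    nlinarith
  · exact abs_le_of_sq_le_sq' (by nlinarith) hω |>.2

lemma modEnergy_nonneg (hm : 0 ≤ m) (ha0 : ∀ i j, m ≤ a i j) (hb0 : ∀ i j, m ≤ b i j)
    (hθ : 1 / 4 ≤ θ) (d s : ι → κ → ℝ) : 0 ≤ modEnergy gx gy a b θ τ d s := by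
  obtain ⟨f2, _⟩ := formSum_ge (gx := gx) (gy := gy) hm ha0 hb0 s
  obtain ⟨f3, _⟩ := formSum_ge (gx := gx) (gy := gy) hm ha0 hb0 d
  have f4 := wsq_nonneg
    (c := fun (e : ι × Option ι) (f : κ × Option κ) => a e.1 f.1 * b e.1 f.1)
    (f := gradX gx (gradY gy d)) fun e f =>
      mul_nonneg (hm.trans (ha0 _ _)) (hm.trans (hb0 _ _))
  have hθ0 : 0 ≤ θ - 1 / 4 := by linarith
  have p2 : 0 ≤ formSum gx gy a b s := le_trans (by positivity) f2
  have p3 : 0 ≤ formSum gx gy a b d := le_trans (by positivity) f3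
  unfold modEnergy
  positivity

/-- The norms of sums and differences of two consecutive differences, in terms of the energy. -/
lemma modEnergy_pair_bounds (hm : 0 < m) (hm1 : m ≤ 1) (ha0 : ∀ i j, m ≤ a i j)
    (hb0 : ∀ i j, m ≤ b i j) (hτ : 0 < τ) (hθ : 1 / 4 ≤ θ) (hθ1 : θ ≤ 1)
    {d₁ d₀ s₁ s₀ p q s' : ι → κ → ℝ} (hp : ∀ i j, p i j = d₁ i j - d₀ i j)
    (hq : ∀ i j, q i j = d₁ i j + d₀ i j)
    (hqs : ∀ i j, q i j = s₁ i j - s₀ i j) (hs : ∀ i j, s' i j = s₁ i j + s₀ i j)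
    {ω : ℝ} (hω0 : 0 ≤ ω) (hE₁ : modEnergy gx gy a b θ τ d₁ s₁ ≤ ω ^ 2)
    (hE₀ : modEnergy gx gy a b θ τ d₀ s₀ ≤ ω ^ 2) :
    nrm q ≤ 2 * τ * ω ∧ nrm (gradX gx q) ≤ 8 * (1 / m) * ω ∧ nrm (gradY gy q) ≤ 8 * (1 / m) * ω
      ∧ nrm (gradX gx s') ≤ 8 * (1 / m) * ω ∧ nrm (gradY gy s') ≤ 8 * (1 / m) * ω
      ∧ (θ - 1 / 4) * nrm (gradX gx p) ≤ 8 * (1 / m) * ω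
      ∧ (θ - 1 / 4) * nrm (gradY gy p) ≤ 8 * (1 / m) * ω
      ∧ τ * nrm (gradX gx (gradY gy p)) ≤ 8 * (1 / m) * ω ∧ τ * nrm (gradY gy p) ≤ 2 * ω := by
  obtain ⟨u1, u2, u3, u4, u5, u6, u7⟩ := modEnergy_bounds (gx := gx) (gy := gy) hm hm1 ha0 hb0 hτ hθ
    d₁ s₁ hω0 hE₁
  obtain ⟨v1, v2, v3, v4, v5, v6, v7⟩ := modEnergy_bounds (gx := gx) (gy := gy) hm hm1 ha0 hb0 hτ hθ
    d₀ s₀ hω0 hE₀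
  have hk4 : 4 / m = 4 * (1 / m) := by ring
  rw [hk4] at u2 u3 u4 u5 u6 v2 v3 v4 v5 v6
  generalize 1 / m = k at *
  obtain rfl : p = fun i j => d₁ i j - d₀ i j := by funext i j; exact hp i j
  obtain rfl : s' = fun i j => s₁ i j + s₀ i j := by funext i j; exact hs i j
  have hθ0 : 0 ≤ θ - 1 / 4 := by linarith only [hθ]
  -- The energy controls the gradients with the root of `θ - 1 / 4`, the equation contains the full
  -- factor; `θ ≤ 1` makes the latter smaller.
  have rt : θ - 1 / 4 ≤ √(θ - 1 / 4) := by
    have rt1 : √(θ - 1 / 4) ≤ 1 := Real.sqrt_le_iff.2 ⟨zero_le_one, by linarith only [hθ1]⟩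
    calc θ - 1 / 4 = √(θ - 1 / 4) * √(θ - 1 / 4) := (Real.mul_self_sqrt hθ0).symm
      _ ≤ √(θ - 1 / 4) * 1 := mul_le_mul_of_nonneg_left rt1 (Real.sqrt_nonneg _)
      _ = _ := mul_one _
  have nxp : nrm (gradX gx fun i j => d₁ i j - d₀ i j) ≤ nrm (gradX gx d₁) + nrm (gradX gx d₀) :=
    (nrm_eq_of_forall fun e j => grad_sub _ _ _ _).trans_le (nrm_sub_le _ _)
  have nyp : nrm (gradY gy fun i j => d₁ i j - d₀ i j) ≤ nrm (gradY gy d₁) + nrm (gradY gy d₀) :=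
    (nrm_eq_of_forall fun e j => grad_sub _ _ _ _).trans_le (nrm_sub_le _ _)
  have ggp : nrm (gradX gx (gradY gy fun i j => d₁ i j - d₀ i j))
      ≤ nrm (gradX gx (gradY gy d₁)) + nrm (gradX gx (gradY gy d₀)) := by
    rw [show (gradY gy fun i j => d₁ i j - d₀ i j) = fun i f => gradY gy d₁ i f - gradY gy d₀ i f by
      funext i f; exact grad_sub _ _ _ _]
    exact (nrm_eq_of_forall fun e j => grad_sub _ _ _ _).trans_le (nrm_sub_le _ _)
  have mul4 : ∀ {x y z : ℝ}, x ≤ y + z → √(θ - 1 / 4) * y ≤ 4 * k * ω → √(θ - 1 / 4) * z ≤ 4 * k * ω →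
      0 ≤ x → (θ - 1 / 4) * x ≤ 8 * k * ω := by
    intro x y z h1 h2 h3 h4
    calc _ ≤ √(θ - 1 / 4) * (y + z) := mul_le_mul rt h1 h4 (Real.sqrt_nonneg _)
      _ ≤ _ := by linarith only [h2, h3]
  refine ⟨?_, ?_, ?_, ?_, ?_, mul4 nxp u4 v4 (nrm_nonneg _), mul4 nyp u5 v5 (nrm_nonneg _), ?_, ?_⟩
  · rw [nrm_eq_of_forall hq]; refine (nrm_add_le d₁ d₀).trans ?_; linarith only [u1, v1]
  -- Written through the sums `s` instead of the differences `d`, the gradients of `q` are bounded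
  -- uniformly in `θ` and without a factor `1 / τ`.
  · obtain rfl : q = fun i j => s₁ i j - s₀ i j := by funext i j; exact hqs i j
    refine (nrm_eq_of_forall fun e j => grad_sub _ _ _ _).trans_le ((nrm_sub_le _ _).trans
      (?_ : nrm (gradX gx s₁) + nrm (gradX gx s₀) ≤ _))
    linarith only [u2, v2]
  · obtain rfl : q = fun i j => s₁ i j - s₀ i j := by funext i j; exact hqs i j
    refine (nrm_eq_of_forall fun e j => grad_sub _ _ _ _).trans_le ((nrm_sub_le _ _).trans
      (?_ : nrm (gradY gy s₁) + nrm (gradY gy s₀) ≤ _))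
    linarith only [u3, v3]
  · refine (nrm_eq_of_forall fun e j => grad_add _ _ _ _).trans_le ((nrm_add_le _ _).trans
      (?_ : nrm (gradX gx s₁) + nrm (gradX gx s₀) ≤ _))
    linarith only [u2, v2]
  · refine (nrm_eq_of_forall fun e j => grad_add _ _ _ _).trans_le ((nrm_add_le _ _).trans
      (?_ : nrm (gradY gy s₁) + nrm (gradY gy s₀) ≤ _))
    linarith only [u3, v3]
  · have := mul_le_mul_of_nonneg_left ggp hτ.le
    linarith only [this, u6, v6]
  · have := mul_le_mul_of_nonneg_left nyp hτ.le
    linarith only [this, u7, v7]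

/-- The remainder terms of the energy identity, as an inequality between real numbers. -/
lemma step_arith {S k θ τ ω nq nxq nyq nxs nys nxp nyp ngp nr : ℝ} (hS : 1 ≤ S) (hk : 1 ≤ k)
    (hτ : 0 < τ) (hτ1 : τ ≤ 1) (hθ : 1 / 4 ≤ θ) (hθ1 : θ ≤ 1) (hω : 0 ≤ ω)
    (pq : 0 ≤ nq) (pxq : 0 ≤ nxq) (pyq : 0 ≤ nyq) (pr : 0 ≤ nr)
    (bq : nq ≤ 2 * τ * ω) (bxq : nxq ≤ 8 * k * ω) (byq : nyq ≤ 8 * k * ω)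
    (bxs : nxs ≤ 8 * k * ω) (bys : nys ≤ 8 * k * ω)
    (bxp : (θ - 1 / 4) * nxp ≤ 8 * k * ω) (byp : (θ - 1 / 4) * nyp ≤ 8 * k * ω)
    (bgp : τ * ngp ≤ 8 * k * ω) (byp' : τ * nyp ≤ 2 * ω) :
    (θ - 1 / 4) * (S * S * nxp * nq) + (θ - 1 / 4) * (S * S * nyp * nq)
      + 1 / 4 * (S * S * nxs * nq) + 1 / 4 * (S * S * nys * nq)
      + θ ^ 2 * τ ^ 2 * (8 * S ^ 5 * (ngp + nyp) * (nxq + nyq + nq))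
      + nr * nq + τ ^ 2 * (nyp * nyq)
      ≤ 2000 * S ^ 5 * k ^ 2 * τ * ω ^ 2 + τ * nr ^ 2 := by
  have S0 : 0 ≤ S := by linarith only [hS]
  have k0 : 0 ≤ k := by linarith only [hk]
  have kω : 0 ≤ k * ω := mul_nonneg k0 hω
  have hτω : 0 ≤ τ * ω ^ 2 := by positivity
  set U := S ^ 5 * k ^ 2 * (τ * ω ^ 2) with hU
  have base : S ^ 2 * k * (τ * ω ^ 2) ≤ U := by
    have h1 : S ^ 2 ≤ S ^ 5 := pow_le_pow_right₀ hS (by norm_num)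
    have h2 : k ≤ k ^ 2 := le_self_pow₀ hk (by norm_num)
    rw [hU]
    gcongr
  have S21 : 1 ≤ S ^ 2 := one_le_pow₀ hS
  have r1 : ∀ {x}, (θ - 1 / 4) * x ≤ 8 * k * ω → (θ - 1 / 4) * (S * S * x * nq) ≤ 16 * U := by
    intro x hx
    calc _ = S ^ 2 * ((θ - 1 / 4) * x) * nq := by ring
      _ ≤ S ^ 2 * (8 * k * ω) * nq := by gcongr
      _ ≤ S ^ 2 * (8 * k * ω) * (2 * τ * ω) := by gcongr
      _ = 16 * (S ^ 2 * k * (τ * ω ^ 2)) := by ring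
      _ ≤ _ := by linarith only [base]
  have r3 : ∀ {x}, x ≤ 8 * k * ω → S * S * x * nq ≤ 16 * U := by
    intro x hx
    calc _ ≤ S * S * (8 * k * ω) * nq := by gcongr
      _ ≤ S * S * (8 * k * ω) * (2 * τ * ω) := by gcongr
      _ = 16 * (S ^ 2 * k * (τ * ω ^ 2)) := by ring
      _ ≤ _ := by linarith only [base]
  -- Of the two powers of `τ`, one pays for the gradients of `p` and the other survives as the
  -- factor needed for Gronwall. With the mixed gradient on `q` both would be spent.
  have r5 : θ ^ 2 * τ ^ 2 * (8 * S ^ 5 * (ngp + nyp) * (nxq + nyq + nq)) ≤ 8 * 180 * U := by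
    have t1 : τ * (ngp + nyp) ≤ 10 * k * ω := by
      have := mul_le_mul_of_nonneg_right hk hω
      linarith only [this, bgp, byp']
    have t2 : nxq + nyq + nq ≤ 18 * k * ω := by
      have : τ * ω ≤ k * ω := mul_le_mul_of_nonneg_right (hτ1.trans hk) hω
      linarith only [this, bxq, byq, bq]
    have t3 : θ ^ 2 ≤ 1 := pow_le_one₀ (by linarith only [hθ]) hθ1
    have t4 : 0 ≤ nxq + nyq + nq := by positivity
    calc _ = θ ^ 2 * (τ * (8 * S ^ 5 * (τ * (ngp + nyp)) * (nxq + nyq + nq))) := by ring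
      _ ≤ θ ^ 2 * (τ * (8 * S ^ 5 * (10 * k * ω) * (nxq + nyq + nq))) := by gcongr
      _ ≤ 1 * (τ * (8 * S ^ 5 * (10 * k * ω) * (18 * k * ω))) := by gcongr
      _ = _ := by rw [hU]; ring
  have r8 : τ * ω ^ 2 ≤ U := by
    refine le_trans ?_ base
    calc _ = 1 * 1 * (τ * ω ^ 2) := by ring
      _ ≤ _ := by gcongr
  have r6 : nr * nq ≤ τ * nr ^ 2 + τ * ω ^ 2 := by
    have h1 : nr * nq ≤ nr * (2 * τ * ω) := mul_le_mul_of_nonneg_left bq pr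
    have h2 := mul_nonneg hτ.le (sq_nonneg (nr - ω))
    linarith only [h1, h2]
  have r7 : τ ^ 2 * (nyp * nyq) ≤ 16 * U := by
    calc _ = τ * ((τ * nyp) * nyq) := by ring
      _ ≤ τ * ((2 * ω) * nyq) := by gcongr
      _ ≤ τ * ((2 * ω) * (8 * k * ω)) := by gcongr
      _ = 16 * (1 * k * (τ * ω ^ 2)) := by ring
      _ ≤ 16 * (S ^ 2 * k * (τ * ω ^ 2)) := by gcongr
      _ ≤ _ := by linarith only [base]
  have U0 : 0 ≤ U := by positivity
  -- The constants collected above add up to 1497, and 2000 is a round bound.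
  have fin : 2000 * S ^ 5 * k ^ 2 * τ * ω ^ 2 = 2000 * U := by rw [hU]; ring
  rw [fin]
  linarith only [r1 bxp, r1 byp, r3 bxs, r3 bys, r5, r6, r7, r8, U0]

/-- One step of the energy estimate. -/
lemma modEnergy_step (hX : IsLineForm A gx ρx S) (hY : IsLineForm B gy ρy S) (hS : 1 ≤ S)
    (ha : IsGridCoeff gx ρx ρy S a) (hb : IsGridCoeff gx ρx ρy S b)
    (hm : 0 < m) (hm1 : m ≤ 1) (ha0 : ∀ i j, m ≤ a i j) (hb0 : ∀ i j, m ≤ b i j)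
    (hτ : 0 < τ) (hτ1 : τ ≤ 1) (hθ : 1 / 4 ≤ θ) (hθ1 : θ ≤ 1)
    {d₁ d₀ s₁ s₀ p q s' R : ι → κ → ℝ} (hp : ∀ i j, p i j = d₁ i j - d₀ i j)
    (hq : ∀ i j, q i j = d₁ i j + d₀ i j)
    (hqs : ∀ i j, q i j = s₁ i j - s₀ i j) (hs : ∀ i j, s' i j = s₁ i j + s₀ i j)
    (heq : ∀ i j, p i j
      + (θ - 1 / 4) * τ ^ 2 * (a i j * mulX A p i j + b i j * mulY B p i j)
      + θ ^ 2 * τ ^ 4 * (a i j * mulX A (fun i j => b i j * mulY B p i j) i j)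
      + τ ^ 2 / 4 * (a i j * mulX A s' i j + b i j * mulY B s' i j)
      = τ ^ 2 * R i j) :
    modEnergy gx gy a b θ τ d₁ s₁ - modEnergy gx gy a b θ τ d₀ s₀
      ≤ 2000 * S ^ 5 * (1 / m) ^ 2 * τ
          * (modEnergy gx gy a b θ τ d₁ s₁ + modEnergy gx gy a b θ τ d₀ s₀)
        + τ * nrm R ^ 2 := by
  have S0 : 0 ≤ S := by linarith only [hS]
  have sqS : √(S ^ 2) = S := Real.sqrt_sq S0
  have E1n : 0 ≤ modEnergy gx gy a b θ τ d₁ s₁ := modEnergy_nonneg hm.le ha0 hb0 hθ _ _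
  have E0n : 0 ≤ modEnergy gx gy a b θ τ d₀ s₀ := modEnergy_nonneg hm.le ha0 hb0 hθ _ _
  obtain ⟨ω, hω0, hω2⟩ : ∃ ω, 0 ≤ ω ∧ ω ^ 2
      = modEnergy gx gy a b θ τ d₁ s₁ + modEnergy gx gy a b θ τ d₀ s₀ :=
    ⟨_, Real.sqrt_nonneg _, Real.sq_sqrt (add_nonneg E1n E0n)⟩
  obtain ⟨bq, bxq, byq, bxs, bys, bxp, byp, bgp, byp'⟩ := modEnergy_pair_bounds (gx := gx) (gy := gy)
    hm hm1 ha0 hb0 hτ hθ hθ1 hp hq hqs hs hω0 (by linarith only [hω2, E0n])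
    (by linarith only [hω2, E1n])
  have arith := step_arith hS ((one_le_div hm).2 hm1) hτ hτ1 hθ hθ1 hω0 (nrm_nonneg q)
    (nrm_nonneg _) (nrm_nonneg _) (nrm_nonneg R) bq bxq byq bxs bys bxp byp bgp byp'
  clear bq bxq byq bxs bys bxp byp bgp byp'
  rw [← hω2]
  have fp : p = fun i j => d₁ i j - d₀ i j := by funext i j; exact hp i j
  have fs : s' = fun i j => s₁ i j + s₀ i j := by funext i j; exact hs i j
  have fq : q = fun i j => d₁ i j + d₀ i j := by funext i j; exact hq i j
  have fqs : q = fun i j => s₁ i j - s₀ i j := by funext i j; exact hqs i j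
  have gxp : ∀ e j, gradX gx p e j = gradX gx d₁ e j - gradX gx d₀ e j := fun e j => by
    rw [fp]; exact grad_sub _ _ _ _
  have gxq : ∀ e j, gradX gx q e j = gradX gx d₁ e j + gradX gx d₀ e j := fun e j => by
    rw [fq]; exact grad_add _ _ _ _
  have gxs : ∀ e j, gradX gx s' e j = gradX gx s₁ e j + gradX gx s₀ e j := fun e j => by
    rw [fs]; exact grad_add _ _ _ _
  have gxq' : ∀ e j, gradX gx q e j = gradX gx s₁ e j - gradX gx s₀ e j := fun e j => by
    rw [fqs]; exact grad_sub _ _ _ _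
  have gyp : ∀ i f, gradY gy p i f = gradY gy d₁ i f - gradY gy d₀ i f := fun e j => by
    rw [fp]; exact grad_sub _ _ _ _
  have gyq : ∀ i f, gradY gy q i f = gradY gy d₁ i f + gradY gy d₀ i f := fun e j => by
    rw [fq]; exact grad_add _ _ _ _
  have gys : ∀ i f, gradY gy s' i f = gradY gy s₁ i f + gradY gy s₀ i f := fun e j => by
    rw [fs]; exact grad_add _ _ _ _
  have gyq' : ∀ i f, gradY gy q i f = gradY gy s₁ i f - gradY gy s₀ i f := fun e j => by
    rw [fqs]; exact grad_sub _ _ _ _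
  have ggp : ∀ e f, gradX gx (gradY gy p) e f
      = gradX gx (gradY gy d₁) e f - gradX gx (gradY gy d₀) e f := fun e f => by
    rw [show gradY gy p = fun i f => gradY gy d₁ i f - gradY gy d₀ i f by funext i f; exact gyp i f]
    exact grad_sub _ _ _ _
  have ggq : ∀ e f, gradX gx (gradY gy q) e f
      = gradX gx (gradY gy d₁) e f + gradX gx (gradY gy d₀) e f := fun e f => by
    rw [show gradY gy q = fun i f => gradY gy d₁ i f + gradY gy d₀ i f by funext i f; exact gyq i f]
    exact grad_add _ _ _ _
  have fx1 := abs_formX_sub_le hX.form (sq_nonneg S) S0 hX.dist_nonneg hX.moment ha.lipX p q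
  have fx2 := abs_formX_sub_le hX.form (sq_nonneg S) S0 hX.dist_nonneg hX.moment ha.lipX s' q
  have fy1 := abs_formY_sub_le hY.form (sq_nonneg S) S0 hY.dist_nonneg hY.moment hb.lipY p q
  have fy2 := abs_formY_sub_le hY.form (sq_nonneg S) S0 hY.dist_nonneg hY.moment hb.lipY s' q
  have fxy := abs_formXY_sub_le hX hY hS ha hb p q
  have sw : ∀ {α β : Type _} [Fintype α] [Fintype β] (c s r : α → β → ℝ),
      ∑ e, ∑ j, c e j * s e j * r e j = ∑ e, ∑ j, c e j * r e j * s e j := fun c s r =>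
    Finset.sum_congr rfl fun i _ => Finset.sum_congr rfl fun j _ => by ring
  -- Two polarizations of the same test function. Against `p = d₁ - d₀` it is used as `q = d₁ + d₀`,
  -- against `s' = s₁ + s₀` as `q = s₁ - s₀`. All leading terms become differences of squares, that
  -- is, increments of the energy.
  rw [sum_polar (fun (e : ι × Option ι) j => a e.1 j) _ _ _ _ gxp gxq, sqS] at fx1
  rw [sum_polar (fun i (f : κ × Option κ) => b i f.1) _ _ _ _ gyp gyq, sqS] at fy1
  rw [sum_polar (fun (e : ι × Option ι) (f : κ × Option κ) => a e.1 f.1 * b e.1 f.1)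
    _ _ _ _ ggp ggq] at fxy
  rw [sw (fun (e : ι × Option ι) j => a e.1 j),
    sum_polar (fun (e : ι × Option ι) j => a e.1 j) _ _ _ _ gxq' gxs, sqS] at fx2
  rw [sw (fun i (f : κ × Option κ) => b i f.1),
    sum_polar (fun i (f : κ × Option κ) => b i f.1) _ _ _ _ gyq' gys, sqS] at fy2
  have fd : ∑ i, ∑ j, p i j * q i j = nrm d₁ ^ 2 - nrm d₀ ^ 2 := by
    have := sum_polar (fun _ _ => (1 : ℝ)) d₁ d₀ p q hp hq
    simpa [wsq, nrm_sq] using this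
  -- This concerns the term `τ² ‖gradY d‖²` of the energy, which the scheme does not supply. It was
  -- added because the remainder of the mixed form contains `‖gradY p‖`, and its increment is
  -- estimated directly: `τ² ‖gradY p‖ ‖gradY q‖` is `O(τ)` times the energy.
  have fcb := abs_sum_mul_le_nrm (gradY gy p) (gradY gy q)
  have fc : ∑ i, ∑ f, gradY gy p i f * gradY gy q i f
      = nrm (gradY gy d₁) ^ 2 - nrm (gradY gy d₀) ^ 2 := by
    have := sum_polar (fun _ _ => (1 : ℝ)) _ _ _ _ gyp gyq
    simpa [wsq, nrm_sq] using this
  have fr := abs_sum_mul_le_nrm R q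
  rw [fc] at fcb
  clear gxp gxq gxs gxq' gyp gyq gys gyq' ggp ggq fc
  have tested : (∑ i, ∑ j, p i j * q i j)
      + (θ - 1 / 4) * τ ^ 2 * (∑ i, ∑ j, a i j * mulX A p i j * q i j
          + ∑ i, ∑ j, b i j * mulY B p i j * q i j)
      + θ ^ 2 * τ ^ 4 * (∑ i, ∑ j, a i j * mulX A (fun i j => b i j * mulY B p i j) i j * q i j)
      + τ ^ 2 / 4 * (∑ i, ∑ j, a i j * mulX A s' i j * q i j
          + ∑ i, ∑ j, b i j * mulY B s' i j * q i j)
      = τ ^ 2 * ∑ i, ∑ j, R i j * q i j := by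
    simp only [Finset.mul_sum, ← Finset.sum_add_distrib]
    refine Finset.sum_congr rfl fun i _ => Finset.sum_congr rfl fun j _ => ?_
    rw [← mul_assoc (τ ^ 2) (R i j), ← heq i j]
    ring
  rw [fd] at tested
  clear fd heq fp fs fq fqs hp hq hqs hs ha hb ha0 hb0 hX hY
  unfold modEnergy formSum
  generalize ∑ i, ∑ j, a i j * mulX A p i j * q i j = X1 at *
  generalize ∑ i, ∑ j, b i j * mulY B p i j * q i j = Y1 at *
  generalize ∑ i, ∑ j, a i j * mulX A (fun i j => b i j * mulY B p i j) i j * q i j = XY at *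
  generalize ∑ i, ∑ j, a i j * mulX A s' i j * q i j = X2 at *
  generalize ∑ i, ∑ j, b i j * mulY B s' i j * q i j = Y2 at *
  generalize ∑ i, ∑ j, R i j * q i j = RQ at *
  have hθ0 : 0 ≤ θ - 1 / 4 := by linarith only [hθ]
  have w1 := mul_le_mul_of_nonneg_left (neg_le_of_abs_le fx1) hθ0
  have w2 := mul_le_mul_of_nonneg_left (neg_le_of_abs_le fy1) hθ0
  have w3 := neg_le_of_abs_le fx2
  have w4 := neg_le_of_abs_le fy2
  have w5 := mul_le_mul_of_nonneg_left (neg_le_of_abs_le fxy) (by positivity : 0 ≤ θ ^ 2 * τ ^ 2)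
  have w6 := mul_le_mul_of_nonneg_left (le_of_abs_le fcb) (sq_nonneg τ)
  have w7 := le_of_abs_le fr
  have tested' : (nrm d₁ ^ 2 / τ ^ 2 - nrm d₀ ^ 2 / τ ^ 2) + (θ - 1 / 4) * (X1 + Y1)
      + θ ^ 2 * τ ^ 2 * XY + 1 / 4 * (X2 + Y2) = RQ := by
    have : τ ^ 2 ≠ 0 := by positivity
    field_simp
    linear_combination 4 * tested
  linarith only [arith, w1, w2, w3, w4, w5, w6, w7, tested']

/-- A discrete Gronwall inequality. -/
lemma discrete_gronwall {E : ℕ → ℝ} {C τ T ρ : ℝ} {N : ℕ} (hE : ∀ k, 0 ≤ E k) (hC : 0 ≤ C)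
    (hτ : 0 < τ) (hCτ : C * τ ≤ 1 / 2) (hN : N * τ ≤ T)
    (hstep : ∀ k, k + 1 < N → E (k + 1) - E k ≤ C * τ * (E (k + 1) + E k) + τ * ρ) (hρ : 0 ≤ ρ) :
    ∀ k, k < N → E k ≤ Real.exp (4 * C * T) * (E 0 + 2 * T * ρ) := by
  have main : ∀ k, k < N → E k ≤ (1 + 4 * (C * τ)) ^ k * (E 0 + 2 * (k * τ) * ρ) := by
    intro k
    induction k with
    | zero => intro _; simp
    | succ k ih =>
      intro hk
      have h1 := hstep k hk
      have h2 := ih (by omega)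
      have hx : 0 ≤ C * τ := by positivity
      -- For `0 ≤ x ≤ 1 / 2` one has `1 + x ≤ (1 - x) (1 + 4 x)` and `1 ≤ 2 (1 - x)`, so the
      -- implicit term is divided out at the price of the factors 4 and 2.
      have h3 : E (k + 1) ≤ (1 + 4 * (C * τ)) * E k + 2 * τ * ρ := by
        have : (1 - C * τ) * E (k + 1) ≤ (1 + C * τ) * E k + τ * ρ := by linarith
        have h5 : (1 - C * τ) * E (k + 1)
            ≤ (1 - C * τ) * ((1 + 4 * (C * τ)) * E k + 2 * τ * ρ) := by
          have e1 : (1 + C * τ) * E k ≤ (1 - C * τ) * (1 + 4 * (C * τ)) * E k :=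
            mul_le_mul_of_nonneg_right (by nlinarith) (hE k)
          have e2 : 1 * (τ * ρ) ≤ (2 * (1 - C * τ)) * (τ * ρ) :=
            mul_le_mul_of_nonneg_right (by linarith) (by positivity)
          linarith
        exact le_of_mul_le_mul_left h5 (by linarith)
      have h4 : 1 ≤ (1 + 4 * (C * τ)) ^ (k + 1) := one_le_pow₀ (by linarith)
      calc _ ≤ _ := h3
        _ ≤ (1 + 4 * (C * τ)) * ((1 + 4 * (C * τ)) ^ k * (E 0 + 2 * (k * τ) * ρ))
            + (1 + 4 * (C * τ)) ^ (k + 1) * (2 * τ * ρ) := by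
          have h6 : 1 * (2 * τ * ρ) ≤ (1 + 4 * (C * τ)) ^ (k + 1) * (2 * τ * ρ) :=
            mul_le_mul_of_nonneg_right h4 (by positivity)
          rw [one_mul] at h6
          gcongr
        _ = _ := by push_cast; ring
  intro k hk
  have hkT : k * τ ≤ T := by
    refine le_trans ?_ hN
    have : (k : ℝ) ≤ N := by exact_mod_cast hk.le
    gcongr
  refine (main k hk).trans ?_
  have h0 := hE 0
  have : (1 + 4 * (C * τ)) ^ k ≤ Real.exp (4 * C * T) := by
    calc _ ≤ Real.exp (4 * (C * τ)) ^ k := by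
          gcongr
          rw [add_comm]; exact Real.add_one_le_exp _
      _ = Real.exp (4 * C * (k * τ)) := by rw [← Real.exp_nat_mul]; congr 1; ring
      _ ≤ _ := by gcongr
  gcongr

end step

/-! ### Grünwald-Letnikov coefficients -/

lemma glCoeff_zero (α : ℝ) : glCoeff α 0 = 1 := rfl

lemma glCoeff_succ (α : ℝ) (m : ℕ) :
    glCoeff α (m + 1) = (1 - (α + 1) / ((m : ℝ) + 1)) * glCoeff α m := rfl

/-- The coefficients are those of `(1 - z)^α`. This identity is the derivative in `z`; the next two
are multiplication and division by `1 - z`. -/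
lemma succ_mul_glCoeff_succ (α : ℝ) (n : ℕ) :
    ((n : ℝ) + 1) * glCoeff α (n + 1) = -α * glCoeff (α - 1) n := by
  have hn : ∀ n : ℕ, (n : ℝ) + 1 ≠ 0 := fun n => by positivity
  induction n with
  | zero => simp [glCoeff]
  | succ n ih =>
    have h1 := hn n
    have h2 := hn (n + 1)
    rw [glCoeff_succ α (n + 1), glCoeff_succ (α - 1) n]
    push_cast at h2 ⊢
    have e1 : ((n : ℝ) + 1 + 1) * ((1 - (α + 1) / ((n : ℝ) + 1 + 1)) * glCoeff α (n + 1))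
        = ((n : ℝ) + 1 - α) * glCoeff α (n + 1) := by field_simp; ring
    rw [e1]
    have e2 : glCoeff α (n + 1) = -α * glCoeff (α - 1) n / ((n : ℝ) + 1) := by
      rw [← ih]; field_simp
    rw [e2]
    field_simp
    ring

lemma glCoeff_succ_eq_sub (α : ℝ) (n : ℕ) :
    glCoeff α (n + 1) = glCoeff (α - 1) (n + 1) - glCoeff (α - 1) n := by
  have h := succ_mul_glCoeff_succ α n
  have h1 : (n : ℝ) + 1 ≠ 0 := by positivity
  rw [glCoeff_succ (α - 1) n]
  have e2 : glCoeff α (n + 1) = -α * glCoeff (α - 1) n / ((n : ℝ) + 1) := by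
    rw [← h]; field_simp
  rw [e2]
  field_simp
  ring

lemma sum_glCoeff (α : ℝ) (n : ℕ) :
    ∑ m ∈ Finset.range (n + 1), glCoeff α m = glCoeff (α - 1) n := by
  induction n with
  | zero => simp [glCoeff]
  | succ n ih =>
    rw [Finset.sum_range_succ, ih, glCoeff_succ_eq_sub]
    ring

/-- Both factors are compared with exponentials of opposite exponent `∓ γ / (m + 1)`. -/
lemma one_sub_div_mul_rpow_le {γ : ℝ} (hγ : 0 ≤ γ) (m : ℕ) :
    (1 - γ / ((m : ℝ) + 1)) * ((m : ℝ) + 1 + 1) ^ γ ≤ ((m : ℝ) + 1) ^ γ := by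
  have hm : (0 : ℝ) < (m : ℝ) + 1 := by positivity
  have e : ((m : ℝ) + 1 + 1) = ((m : ℝ) + 1) * (1 + 1 / ((m : ℝ) + 1)) := by field_simp
  rw [e, Real.mul_rpow hm.le (by positivity)]
  have h1 : (1 + 1 / ((m : ℝ) + 1)) ^ γ ≤ Real.exp (γ / ((m : ℝ) + 1)) := by
    calc _ ≤ Real.exp (1 / ((m : ℝ) + 1)) ^ γ := by
          refine Real.rpow_le_rpow (by positivity) ?_ hγ
          rw [add_comm]; exact Real.add_one_le_exp _
      _ = _ := by rw [← Real.exp_mul]; congr 1; ring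
  have h2 : 1 - γ / ((m : ℝ) + 1) ≤ Real.exp (-(γ / ((m : ℝ) + 1))) := by
    have := Real.add_one_le_exp (-(γ / ((m : ℝ) + 1)))
    linarith
  have h3 : (1 - γ / ((m : ℝ) + 1)) * (1 + 1 / ((m : ℝ) + 1)) ^ γ ≤ 1 := by
    calc _ ≤ Real.exp (-(γ / ((m : ℝ) + 1))) * (1 + 1 / ((m : ℝ) + 1)) ^ γ :=
          mul_le_mul_of_nonneg_right h2 (by positivity)
      _ ≤ Real.exp (-(γ / ((m : ℝ) + 1))) * Real.exp (γ / ((m : ℝ) + 1)) :=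
          mul_le_mul_of_nonneg_left h1 (Real.exp_pos _).le
      _ = 1 := by rw [← Real.exp_add]; simp
  calc _ = ((m : ℝ) + 1) ^ γ * ((1 - γ / ((m : ℝ) + 1)) * (1 + 1 / ((m : ℝ) + 1)) ^ γ) := by ring
    _ ≤ ((m : ℝ) + 1) ^ γ * 1 := mul_le_mul_of_nonneg_left h3 (by positivity)
    _ = _ := mul_one _

/-- Since `δ ≤ 2`, the recursion factor is nonnegative from index 2 on, and there `|glCoeff δ m| (m
+ 1)^{δ+1}` is nonincreasing. The first values go into the constant. -/
lemma exists_abs_glCoeff_le {δ : ℝ} (h1 : -1 ≤ δ) (h2 : δ ≤ 2) :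
    ∃ C : ℝ, 0 < C ∧ ∀ m : ℕ, |glCoeff δ m| ≤ C * ((m : ℝ) + 1) ^ (-(δ + 1)) := by
  have key : ∀ C : ℝ, |glCoeff δ 2| * (3 : ℝ) ^ (δ + 1) ≤ C → ∀ m : ℕ, 2 ≤ m →
      |glCoeff δ m| * ((m : ℝ) + 1) ^ (δ + 1) ≤ C := by
    intro C hC m hm
    induction m, hm using Nat.le_induction with
    | base => convert hC using 3; norm_num
    | succ m hm ih =>
      have hm' : (2 : ℝ) ≤ m := by exact_mod_cast hm
      have hf : 0 ≤ 1 - (δ + 1) / ((m : ℝ) + 1) := by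
        rw [sub_nonneg, div_le_one (by positivity)]; linarith
      rw [glCoeff_succ, abs_mul, abs_of_nonneg hf]
      push_cast
      calc _ = |glCoeff δ m| * ((1 - (δ + 1) / ((m : ℝ) + 1)) * ((m : ℝ) + 1 + 1) ^ (δ + 1)) := by ring
        _ ≤ |glCoeff δ m| * ((m : ℝ) + 1) ^ (δ + 1) :=
            mul_le_mul_of_nonneg_left (one_sub_div_mul_rpow_le (by linarith) m) (abs_nonneg _)
        _ ≤ C := ih
  refine ⟨1 + |glCoeff δ 1| * (2 : ℝ) ^ (δ + 1) + |glCoeff δ 2| * (3 : ℝ) ^ (δ + 1),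
    by positivity, fun m => ?_⟩
  rw [Real.rpow_neg (by positivity), ← div_eq_mul_inv, le_div_iff₀ (by positivity)]
  have p1 : 0 ≤ |glCoeff δ 1| * (2 : ℝ) ^ (δ + 1) := by positivity
  have p2 : 0 ≤ |glCoeff δ 2| * (3 : ℝ) ^ (δ + 1) := by positivity
  match m with
  | 0 => simp [glCoeff_zero]; linarith
  | 1 =>
    have : ((1 : ℕ) : ℝ) + 1 = 2 := by norm_num
    rw [this]; linarith
  | m + 2 => exact key _ (by linarith) (m + 2) (by omega)

lemma glCoeff_nonneg {α : ℝ} (h1 : 1 < α) (h2 : α ≤ 2) (m : ℕ) : 0 ≤ glCoeff α (m + 2) := by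
  induction m with
  | zero => norm_num [glCoeff]; nlinarith
  | succ m ih =>
    rw [show m + 1 + 2 = (m + 2) + 1 by ring, glCoeff_succ]
    refine mul_nonneg ?_ ih
    rw [sub_nonneg, div_le_one (by positivity)]
    push_cast
    have : (0 : ℝ) ≤ m := by positivity
    linarith

lemma glCoeff_sub_one_nonpos {α : ℝ} (h1 : 1 < α) (h2 : α ≤ 2) (m : ℕ) :
    glCoeff (α - 1) (m + 1) ≤ 0 := by
  induction m with
  | zero => norm_num [glCoeff]; linarith
  | succ m ih =>
    rw [glCoeff_succ]
    refine mul_nonpos_of_nonneg_of_nonpos ?_ ih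
    rw [sub_nonneg, div_le_one (by positivity)]
    push_cast
    have : (0 : ℝ) ≤ m := by positivity
    linarith

lemma glCoeff_two (m : ℕ) : glCoeff 2 (m + 3) = 0 := by
  induction m with
  | zero => norm_num [glCoeff]
  | succ m ih => rw [show m + 1 + 3 = (m + 3) + 1 by ring, glCoeff_succ, ih, mul_zero]

/-- Comparison with the integral of the power, by induction; the increment of `R^ν / ν` is estimated
with Bernoulli's inequality for the exponent `ν ≤ 1`. -/
lemma sum_rpow_le {ν : ℝ} (h0 : 0 < ν) (h1 : ν ≤ 1) (R : ℕ) :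
    ∑ r ∈ Finset.range R, ((r : ℝ) + 1) ^ (ν - 1) ≤ (R : ℝ) ^ ν / ν := by
  induction R with
  | zero => simp [Real.zero_rpow h0.ne']
  | succ R ih =>
    rw [Finset.sum_range_succ]
    have hR : (0 : ℝ) < (R : ℝ) + 1 := by positivity
    have e : (R : ℝ) ^ ν ≤ ((R : ℝ) + 1) ^ ν * (1 - ν / ((R : ℝ) + 1)) := by
      have h3 := rpow_one_add_le_one_add_mul_self (s := -(1 / ((R : ℝ) + 1))) (p := ν)
        (by rw [neg_le_neg_iff, div_le_one hR]; linarith [(Nat.cast_nonneg R : (0 : ℝ) ≤ R)]) h0.le h1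
      have h4 : (R : ℝ) = ((R : ℝ) + 1) * (1 + -(1 / ((R : ℝ) + 1))) := by field_simp; ring
      have h5 : (0 : ℝ) ≤ 1 + -(1 / ((R : ℝ) + 1)) := by
        have : 1 / ((R : ℝ) + 1) ≤ 1 := by
          rw [div_le_one hR]; linarith [(Nat.cast_nonneg R : (0 : ℝ) ≤ R)]
        linarith
      calc (R : ℝ) ^ ν = (((R : ℝ) + 1) * (1 + -(1 / ((R : ℝ) + 1)))) ^ ν := by rw [← h4]
        _ = ((R : ℝ) + 1) ^ ν * (1 + -(1 / ((R : ℝ) + 1))) ^ ν := Real.mul_rpow hR.le h5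
        _ ≤ ((R : ℝ) + 1) ^ ν * (1 + ν * -(1 / ((R : ℝ) + 1))) :=
            mul_le_mul_of_nonneg_left h3 (by positivity)
        _ = _ := by ring
    have e2 : ((R : ℝ) + 1) ^ ν = ((R : ℝ) + 1) * ((R : ℝ) + 1) ^ (ν - 1) := by
      rw [Real.rpow_sub_one hR.ne']; field_simp
    rw [le_div_iff₀ h0] at ih ⊢
    push_cast
    have e3 : ((R : ℝ) + 1) ^ ν * (1 - ν / ((R : ℝ) + 1))
        = ((R : ℝ) + 1) ^ ν - ν * ((R : ℝ) + 1) ^ (ν - 1) := by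
      rw [e2]; field_simp
    rw [add_mul]
    linarith

/-! ### The weights of the discrete Riesz operator as a Dirichlet form -/

/-- The coupling weight of two nodes at distance `r`. -/
def lineWeight (α : ℝ) : ℕ → ℝ
  | 0 => 0
  | 1 => wsCoeff α 0 + wsCoeff α 2
  | r + 2 => wsCoeff α (r + 3)

/-- The coupling of a node to all nodes on one side at distance more than `R`. -/
def lineTail (α : ℝ) (R : ℕ) : ℝ := -wsCoeff α 1 - ∑ r ∈ Finset.range (R + 1), lineWeight α r

/-- For `α` near 1 the coefficient `wsCoeff α 2` is negative. Neighbouring nodes also receive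
`wsCoeff α 0` from the transposed matrix, and the sum is `α (α - 1) (α + 2) / 4`. -/
lemma lineWeight_nonneg {α : ℝ} (h1 : 1 < α) (h2 : α ≤ 2) (r : ℕ) : 0 ≤ lineWeight α r := by
  match r with
  | 0 => simp [lineWeight]
  | 1 => norm_num [lineWeight, wsCoeff, glCoeff]; nlinarith [mul_pos (by linarith : 0 < α) (by linarith : 0 < α - 1), mul_nonneg (mul_nonneg (by linarith : 0 ≤ α) (by linarith : 0 ≤ α - 1)) (by linarith : 0 ≤ α + 2)]
  | r + 2 =>
    have e1 := glCoeff_nonneg h1 h2 (r + 1)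
    have e2 := glCoeff_nonneg h1 h2 r
    have : lineWeight α (r + 2) = α / 2 * glCoeff α (r + 1 + 2) + (2 - α) / 2 * glCoeff α (r + 2) := rfl
    rw [this]
    have h3 : 0 ≤ (2 - α) / 2 := by linarith
    positivity

lemma sum_wsCoeff (α : ℝ) (M : ℕ) : ∑ m ∈ Finset.range (M + 2), wsCoeff α m
    = α / 2 * glCoeff (α - 1) (M + 1) + (2 - α) / 2 * glCoeff (α - 1) M := by
  rw [Finset.sum_range_succ', ← sum_glCoeff, ← sum_glCoeff]
  simp only [wsCoeff]
  rw [Finset.sum_add_distrib, ← Finset.mul_sum, ← Finset.mul_sum, Finset.sum_range_succ' _ (M + 1)]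
  ring

/-- Closed form of the tail through coefficients of order `α - 1`. Its sign and its decay follow
without any infinite series. -/
lemma lineTail_succ (α : ℝ) (R : ℕ) : lineTail α (R + 1)
    = -(α / 2 * glCoeff (α - 1) (R + 2) + (2 - α) / 2 * glCoeff (α - 1) (R + 1)) := by
  rw [← sum_wsCoeff, lineTail]
  have : ∀ R, ∑ r ∈ Finset.range (R + 2), lineWeight α r
      = ∑ m ∈ Finset.range (R + 3), wsCoeff α m - wsCoeff α 1 := by
    intro R
    induction R with
    | zero => simp [Finset.sum_range_succ, lineWeight]; ring
    | succ R ih => rw [Finset.sum_range_succ, ih, Finset.sum_range_succ _ (R + 3), lineWeight]; ring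
  rw [this]; ring

lemma lineTail_nonneg {α : ℝ} (h1 : 1 < α) (h2 : α ≤ 2) (R : ℕ) : 0 ≤ lineTail α R := by
  match R with
  | 0 => norm_num [lineTail, lineWeight, wsCoeff, glCoeff]; nlinarith
  | R + 1 =>
    rw [lineTail_succ]
    have e1 := glCoeff_sub_one_nonpos h1 h2 (R + 1)
    have e2 := glCoeff_sub_one_nonpos h1 h2 R
    have h3 : 0 ≤ (2 - α) / 2 := by linarith
    nlinarith

lemma lineTail_sub (α : ℝ) {m R : ℕ} (h : m ≤ R) :
    ∑ r ∈ Finset.Ico (m + 1) (R + 1), lineWeight α r = lineTail α m - lineTail α R := by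
  rw [lineTail, lineTail, Finset.sum_Ico_eq_sub _ (by omega)]
  ring

lemma exists_lineTail_le {α : ℝ} (h1 : 1 < α) (h2 : α ≤ 2) :
    ∃ C : ℝ, 0 < C ∧ ∀ R : ℕ, lineTail α R ≤ C * ((R : ℝ) + 1) ^ (-α) := by
  obtain ⟨C, hC, h⟩ := exists_abs_glCoeff_le (δ := α - 1) (by linarith) (by linarith)
  refine ⟨C + lineTail α 0, by linarith [lineTail_nonneg h1 h2 0], fun R => ?_⟩
  have h0 := lineTail_nonneg h1 h2 0
  match R with
  | 0 => simp; linarith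
  | R + 1 =>
    rw [lineTail_succ]
    have e1 := h (R + 2)
    have e2 := h (R + 1)
    rw [show -(α - 1 + 1) = -α by ring] at e1 e2
    have e3 : (((R + 2 : ℕ) : ℝ) + 1) ^ (-α) ≤ (((R + 1 : ℕ) : ℝ) + 1) ^ (-α) := by
      refine Real.rpow_le_rpow_of_nonpos (by positivity) (by push_cast; linarith) (by linarith)
    have e4 := neg_le_of_abs_le e1
    have e5 := neg_le_of_abs_le e2
    have h3 : 0 ≤ (2 - α) / 2 := by linarith
    have e6 : 0 ≤ (((R + 1 : ℕ) : ℝ) + 1) ^ (-α) := by positivity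
    have e7 : -(C * (((R + 1 : ℕ) : ℝ) + 1) ^ (-α)) ≤ glCoeff (α - 1) (R + 2) := by
      have := mul_le_mul_of_nonneg_left e3 hC.le
      linarith
    have e8 := mul_le_mul_of_nonneg_left e7 (by linarith : 0 ≤ α / 2)
    have e9 := mul_le_mul_of_nonneg_left e5 h3
    have e10 := mul_nonneg h0 e6
    nlinarith

lemma exists_lineWeight_le {α : ℝ} (h1 : 1 < α) (h2 : α ≤ 2) :
    ∃ C : ℝ, 0 < C ∧ ∀ r : ℕ, lineWeight α r ≤ C * ((r : ℝ) + 1) ^ (-(α + 1)) := by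
  obtain ⟨C, hC, h⟩ := exists_abs_glCoeff_le (δ := α) (by linarith) (by linarith)
  have hw := lineWeight_nonneg h1 h2 1
  refine ⟨C + lineWeight α 1 * 2 ^ (α + 1), by positivity, fun r => ?_⟩
  have hw2 : 0 ≤ lineWeight α 1 * 2 ^ (α + 1) := by positivity
  match r with
  | 0 =>
    have e : lineWeight α 0 = 0 := rfl
    rw [e]; positivity
  | 1 =>
    have e : ((1 : ℕ) : ℝ) + 1 = 2 := by norm_num
    rw [e, add_mul, mul_assoc (lineWeight α 1), ← Real.rpow_add two_pos]
    simp only [add_neg_cancel, Real.rpow_zero, mul_one]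
    have : 0 ≤ C * (2 : ℝ) ^ (-(α + 1)) := by positivity
    linarith
  | r + 2 =>
    have e0 : lineWeight α (r + 2) = α / 2 * glCoeff α (r + 3) + (2 - α) / 2 * glCoeff α (r + 2) := rfl
    have e1 := le_of_abs_le (h (r + 3))
    have e2 := le_of_abs_le (h (r + 2))
    have e3 : (((r + 3 : ℕ) : ℝ) + 1) ^ (-(α + 1)) ≤ (((r + 2 : ℕ) : ℝ) + 1) ^ (-(α + 1)) := by
      refine Real.rpow_le_rpow_of_nonpos (by positivity) (by push_cast; linarith) (by linarith)
    have h3 : 0 ≤ (2 - α) / 2 := by linarith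
    have e6 : 0 ≤ (((r + 2 : ℕ) : ℝ) + 1) ^ (-(α + 1)) := by positivity
    have e7 : glCoeff α (r + 3) ≤ C * (((r + 2 : ℕ) : ℝ) + 1) ^ (-(α + 1)) := by
      have := mul_le_mul_of_nonneg_left e3 hC.le
      linarith
    have e8 := mul_le_mul_of_nonneg_left e7 (by linarith : 0 ≤ α / 2)
    have e9 := mul_le_mul_of_nonneg_left e2 h3
    have e10 := mul_nonneg hw2 e6
    rw [e0]
    nlinarith

/-- The factor `-κ_α / h^α`. -/
def lineScale (α h : ℝ) : ℝ := -kappa α / h ^ α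

lemma kappa_neg {α : ℝ} (h1 : 1 < α) (h2 : α ≤ 2) : kappa α < 0 := by
  unfold kappa
  refine div_neg_of_pos_of_neg one_pos ?_
  have : Real.cos (α * Real.pi / 2) < 0 := by
    have hpi := Real.pi_pos
    refine Real.cos_neg_of_pi_div_two_lt_of_lt ?_ ?_ <;> nlinarith
  linarith

lemma lineScale_pos {α h : ℝ} (h1 : 1 < α) (h2 : α ≤ 2) (hh : 0 < h) : 0 < lineScale α h :=
  div_pos (by linarith [kappa_neg h1 h2]) (by positivity)

lemma lineScale_mul_sq {α h : ℝ} (hh : 0 < h) : lineScale α h * h ^ 2 = -kappa α * h ^ (2 - α) := by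
  rw [lineScale, Real.rpow_sub hh]
  norm_num
  ring

/-- The second moment of the weights is bounded uniformly in the mesh size. -/
lemma exists_moment_le {α L : ℝ} (h1 : 1 < α) (h2 : α ≤ 2) (hL : 0 < L) :
    ∃ M : ℝ, 0 < M ∧ ∀ N : ℕ, 0 < N → ∀ R ≤ N,
      lineScale α (L / N) * ∑ r ∈ Finset.range R, lineWeight α r * (r * (L / N)) ^ 2 ≤ M := by
  have hκ : 0 < -kappa α := by linarith [kappa_neg h1 h2]
  rcases h2.lt_or_eq with h2' | rfl
  · obtain ⟨C, hC, hw⟩ := exists_lineWeight_le h1 h2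
    refine ⟨-kappa α * C * L ^ (2 - α) / (2 - α), by
      have : 0 < 2 - α := by linarith
      positivity, fun N hN R hR => ?_⟩
    have hN' : (0 : ℝ) < N := by exact_mod_cast hN
    have hh : 0 < L / N := by positivity
    have hν : 0 < 2 - α := by linarith
    have s1 : ∑ r ∈ Finset.range R, lineWeight α r * (r * (L / N)) ^ 2
        ≤ (C * (L / N) ^ 2) * ((R : ℝ) ^ (2 - α) / (2 - α)) := by
      refine le_trans ?_ (mul_le_mul_of_nonneg_left (sum_rpow_le hν (by linarith) R) (by positivity))
      rw [Finset.mul_sum]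
      refine Finset.sum_le_sum fun r _ => ?_
      have e : ((r : ℝ) + 1) ^ (-(α + 1)) * ((r : ℝ) + 1) ^ 2 = ((r : ℝ) + 1) ^ (2 - α - 1) := by
        rw [← Real.rpow_natCast, ← Real.rpow_add (by positivity)]
        congr 1; push_cast; ring
      calc _ ≤ (C * ((r : ℝ) + 1) ^ (-(α + 1))) * (((r : ℝ) + 1) * (L / N)) ^ 2 := by
            gcongr
            · exact hw r
            · linarith
        _ = (C * (L / N) ^ 2) * (((r : ℝ) + 1) ^ (-(α + 1)) * ((r : ℝ) + 1) ^ 2) := by ring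
        _ = _ := by rw [e]
    -- The scaling is exact: `h^{-α} h² R^{2-α} = (h R)^{2-α}`, and `h R ≤ L`.
    calc _ ≤ lineScale α (L / N) * ((C * (L / N) ^ 2) * ((R : ℝ) ^ (2 - α) / (2 - α))) :=
          mul_le_mul_of_nonneg_left s1 (lineScale_pos h1 h2 hh).le
      _ = (lineScale α (L / N) * (L / N) ^ 2) * C * ((R : ℝ) ^ (2 - α) / (2 - α)) := by ring
      _ = -kappa α * C * ((L / N) ^ (2 - α) * (R : ℝ) ^ (2 - α)) / (2 - α) := by
          rw [lineScale_mul_sq hh]; ring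
      _ ≤ _ := by
          gcongr
          rw [← Real.mul_rpow hh.le (by positivity)]
          refine Real.rpow_le_rpow (by positivity) ?_ hν.le
          rw [div_mul_eq_mul_div, div_le_iff₀ hN']
          have : (R : ℝ) ≤ N := by exact_mod_cast hR
          gcongr
  -- At `α = 2` the previous constant blows up like `1 / (2 - α)`, but then only nearest neighbours
  -- carry weight.
  · refine ⟨-kappa 2 * lineWeight 2 1 + 1, by
      have := lineWeight_nonneg h1 h2 1
      positivity, fun N hN R hR => ?_⟩
    have hN' : (0 : ℝ) < N := by exact_mod_cast hN
    have hh : 0 < L / N := by positivity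
    have s1 : ∑ r ∈ Finset.range R, lineWeight 2 r * (r * (L / N)) ^ 2
        ≤ lineWeight 2 1 * (L / N) ^ 2 := by
      have : ∀ r ∈ Finset.range R, lineWeight 2 r * (r * (L / N)) ^ 2
          = if r = 1 then lineWeight 2 1 * (L / N) ^ 2 else 0 := by
        intro r _
        match r with
        | 0 => simp
        | 1 => simp
        | r + 2 =>
          simp only [Nat.reduceEqDiff, if_false]
          have : lineWeight 2 (r + 2) = 2 / 2 * glCoeff 2 (r + 3) + (2 - 2) / 2 * glCoeff 2 (r + 2) := rfl
          rw [this, glCoeff_two]; simp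
      rw [Finset.sum_congr rfl this, Finset.sum_ite_eq']
      split_ifs
      · exact le_rfl
      · exact mul_nonneg (lineWeight_nonneg h1 h2 1) (sq_nonneg _)
    calc _ ≤ lineScale 2 (L / N) * (lineWeight 2 1 * (L / N) ^ 2) :=
          mul_le_mul_of_nonneg_left s1 (lineScale_pos h1 h2 hh).le
      _ = (lineScale 2 (L / N) * (L / N) ^ 2) * lineWeight 2 1 := by ring
      _ = -kappa 2 * lineWeight 2 1 := by rw [lineScale_mul_sq hh]; simp
      _ ≤ _ := by linarith

/-- The number of mesh widths between two nodes. -/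
def nodeDist {n : ℕ} (i l : Fin n) : ℕ := ((i : ℕ) - l) + ((l : ℕ) - i)

lemma nodeDist_comm {n : ℕ} (i l : Fin n) : nodeDist i l = nodeDist l i := add_comm _ _

/-- The edge weights of the discrete Riesz operator. -/
def edgeW (α h : ℝ) (n : ℕ) (i : Fin n) : Option (Fin n) → ℝ
  | none => √(lineScale α h * (lineTail α i + lineTail α (n - 1 - i)))
  | some l => √(lineScale α h * lineWeight α (nodeDist i l) / 2)

lemma edgeW_some_sq {α h : ℝ} (h1 : 1 < α) (h2 : α ≤ 2) (hh : 0 < h) {n : ℕ} (i l : Fin n) :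
    edgeW α h n i (some l) ^ 2 = lineScale α h * lineWeight α (nodeDist i l) / 2 :=
  Real.sq_sqrt (div_nonneg (mul_nonneg (lineScale_pos h1 h2 hh).le (lineWeight_nonneg h1 h2 _))
    zero_le_two)

lemma edgeW_none_sq {α h : ℝ} (h1 : 1 < α) (h2 : α ≤ 2) (hh : 0 < h) {n : ℕ} (i : Fin n) :
    edgeW α h n i none ^ 2 = lineScale α h * (lineTail α i + lineTail α (n - 1 - i)) :=
  Real.sq_sqrt (mul_nonneg (lineScale_pos h1 h2 hh).le
    (add_nonneg (lineTail_nonneg h1 h2 _) (lineTail_nonneg h1 h2 _)))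

/-- The node `i` occurs as `r = 0` in both sums on the right; `hG` makes the double count harmless.
-/
lemma sum_fin_split {n : ℕ} (i : Fin n) (G : ℕ → ℝ) (hG : G i = 0) :
    ∑ l : Fin n, G l = ∑ r ∈ Finset.range ((i : ℕ) + 1), G (i - r)
      + ∑ r ∈ Finset.range (n - i), G (i + r) := by
  rw [Fin.sum_univ_eq_sum_range (fun l => G l) n]
  have h1 : n = (i : ℕ) + (n - i) := by omega
  have h2 := Finset.sum_range_reflect G ((i : ℕ) + 1)
  simp only [Nat.add_sub_cancel] at h2
  rw [h2, Finset.sum_range_succ, hG, add_zero]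
  conv_lhs => rw [h1]
  rw [Finset.sum_range_add]

lemma sum_nodeDist {n : ℕ} (i : Fin n) (F : ℕ → ℕ → ℝ) (hF : F i 0 = 0) :
    ∑ l : Fin n, F l (nodeDist i l) = ∑ r ∈ Finset.range ((i : ℕ) + 1), F (i - r) r
      + ∑ r ∈ Finset.range (n - i), F (i + r) r := by
  have := sum_fin_split i (fun l => F l (((i : ℕ) - l) + (l - i))) (by simpa using hF)
  refine this.trans ?_
  congr 1
  · refine Finset.sum_congr rfl fun r hr => ?_
    rw [Finset.mem_range] at hr
    congr 1; omega
  · refine Finset.sum_congr rfl fun r hr => ?_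
    congr 1; omega

lemma sum_lineWeight_nodeDist {α : ℝ} {n : ℕ} (i : Fin n) :
    ∑ l : Fin n, lineWeight α (nodeDist i l)
      = -2 * wsCoeff α 1 - (lineTail α i + lineTail α (n - 1 - i)) := by
  rw [sum_nodeDist i (fun _ r => lineWeight α r) rfl, lineTail, lineTail]
  have : n - 1 - i + 1 = n - i := by omega
  rw [this]; ring

lemma neg_nablaMat_apply (α h : ℝ) {n : ℕ} (i l : Fin n) :
    (-nablaMat α h n) i l = lineScale α h *
      ((if i = l then -2 * wsCoeff α 1 else 0) - lineWeight α (nodeDist i l)) := by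
  have e : (-nablaMat α h n) i l = -(lineScale α h * (matB α n i l + matB α n l i)) := rfl
  rw [e]
  have : matB α n i l + matB α n l i
      = (if i = l then 2 * wsCoeff α 1 else 0) + lineWeight α (nodeDist i l) := by
    have w2 : ∀ r, 2 ≤ r → lineWeight α r = wsCoeff α (r + 1) := by
      intro r hr
      obtain ⟨k, rfl⟩ := Nat.exists_eq_add_of_le' hr
      rfl
    simp only [matB, Matrix.of_apply, nodeDist]
    rcases lt_trichotomy (i : ℕ) l with hil | hil | hil
    · have hne : i ≠ l := fun h => by rw [h] at hil; exact lt_irrefl _ hil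
      rw [if_pos (by omega), if_neg hne]
      by_cases h1 : (l : ℕ) = i + 1
      · rw [if_pos (by omega)]
        rw [show (l : ℕ) + 1 - i = 2 by omega, show (i : ℕ) + 1 - l = 0 by omega,
          show (i : ℕ) - l + (l - i) = 1 by omega]
        simp [lineWeight]; ring
      · rw [if_neg (by omega), w2 _ (by omega)]
        rw [show (i : ℕ) - l + (l - i) + 1 = l + 1 - i by omega]; ring
    · have hne : i = l := Fin.ext hil
      subst hne
      simp [lineWeight]; ring
    · have hne : i ≠ l := fun h => by rw [h] at hil; exact lt_irrefl _ hil
      rw [if_pos (by omega : (l : ℕ) ≤ i + 1), if_neg hne]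
      by_cases h1 : (i : ℕ) = l + 1
      · rw [if_pos (by omega)]
        rw [show (i : ℕ) + 1 - l = 2 by omega, show (l : ℕ) + 1 - i = 0 by omega,
          show (i : ℕ) - l + (l - i) = 1 by omega]
        simp [lineWeight]
      · rw [if_neg (by omega), w2 _ (by omega)]
        rw [show (i : ℕ) - l + (l - i) + 1 = i + 1 - l by omega]
  rw [this]
  split_ifs <;> ring

/-- A symmetric matrix is the Dirichlet form of its off-diagonal entries plus the diagonal form of
its row sums. Each pair of nodes occurs as two directed edges, which is the reason for the factor `1
/ 2` in `edgeW`. The row sum at `i` consists of the two tails cut off at the ends of the interval,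
and it is the square of the grounded weight. -/
lemma isForm_nabla {α h : ℝ} (h1 : 1 < α) (h2 : α ≤ 2) (hh : 0 < h) (n : ℕ) :
    IsForm (edgeW α h n) (-nablaMat α h n) := by
  intro p q
  rw [Fintype.sum_prod_type]
  simp only [Fintype.sum_option, grad, tgt, sub_zero]
  set c := lineScale α h
  set ω : Fin n → Fin n → ℝ := fun i l => lineWeight α (nodeDist i l) with hω
  have hsymm : ∀ i l, ω i l = ω l i := fun i l => by simp only [hω, nodeDist_comm]
  have e1 : ∀ i, edgeW α h n i none * p i * (edgeW α h n i none * q i)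
      = c * (-2 * wsCoeff α 1 - ∑ l, ω i l) * (p i * q i) := by
    intro i
    rw [sum_lineWeight_nodeDist, show edgeW α h n i none * p i * (edgeW α h n i none * q i)
      = edgeW α h n i none ^ 2 * (p i * q i) by ring, edgeW_none_sq h1 h2 hh]
    ring
  have e2 : ∀ i l, edgeW α h n i (some l) * (p i - p l) * (edgeW α h n i (some l) * (q i - q l))
      = c * ω i l / 2 * ((p i - p l) * (q i - q l)) := by
    intro i l
    rw [show edgeW α h n i (some l) * (p i - p l) * (edgeW α h n i (some l) * (q i - q l))
      = edgeW α h n i (some l) ^ 2 * ((p i - p l) * (q i - q l)) by ring, edgeW_some_sq h1 h2 hh]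
  simp only [e1, e2, neg_nablaMat_apply, Finset.sum_add_distrib]
  have e3 : ∑ i, ∑ l, c * ω i l / 2 * ((p i - p l) * (q i - q l))
      = ∑ i, ∑ l, (c * ω i l * (p i * q i) - c * ω i l * p l * q i) := by
    have s1 : ∑ i, ∑ l, c * ω i l * (p l * q l) = ∑ i, ∑ l, c * ω i l * (p i * q i) := by
      rw [Finset.sum_comm]
      refine Finset.sum_congr rfl fun i _ => Finset.sum_congr rfl fun l _ => by rw [hsymm]
    have s2 : ∑ i, ∑ l, c * ω i l * p i * q l = ∑ i, ∑ l, c * ω i l * p l * q i := by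
      rw [Finset.sum_comm]
      refine Finset.sum_congr rfl fun i _ => Finset.sum_congr rfl fun l _ => by rw [hsymm]
    have s3 : ∑ i, ∑ l, c * ω i l / 2 * ((p i - p l) * (q i - q l))
        = (1 / 2) * (∑ i, ∑ l, c * ω i l * (p i * q i) + ∑ i, ∑ l, c * ω i l * (p l * q l)
          - ∑ i, ∑ l, c * ω i l * p i * q l - ∑ i, ∑ l, c * ω i l * p l * q i) := by
      simp only [← Finset.sum_add_distrib, ← Finset.sum_sub_distrib, Finset.mul_sum]
      refine Finset.sum_congr rfl fun i _ => Finset.sum_congr rfl fun l _ => by ring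
    rw [s3, s1, s2]
    simp only [Finset.sum_sub_distrib]
    ring
  rw [e3, ← Finset.sum_add_distrib]
  refine Finset.sum_congr rfl fun i _ => ?_
  have e4 : ∑ l, c * ((if i = l then -2 * wsCoeff α 1 else 0) - lineWeight α (nodeDist i l)) * p l
      = c * (-2 * wsCoeff α 1) * p i - ∑ l, c * ω i l * p l := by
    rw [show c * (-2 * wsCoeff α 1) * p i
      = ∑ l, (if i = l then c * (-2 * wsCoeff α 1) * p l else 0) by simp,
      ← Finset.sum_sub_distrib]
    refine Finset.sum_congr rfl fun l _ => ?_
    simp only [hω]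
    split_ifs <;> ring
  rw [e4, Finset.sum_sub_distrib, ← Finset.sum_mul, ← Finset.mul_sum]
  have e5 : ∑ l, c * ω i l * p l * q i = (∑ l, c * ω i l * p l) * q i := by rw [Finset.sum_mul]
  rw [e5]
  ring

/-- The distance between two nodes. -/
def nodeLen (h : ℝ) {n : ℕ} (i l : Fin n) : ℝ := nodeDist i l * h

lemma sum_weight_dist_le {α h M : ℝ} (h1 : 1 < α) (h2 : α ≤ 2) (hh : 0 < h) {n : ℕ}
    (hM : ∀ R ≤ n, lineScale α h * ∑ r ∈ Finset.range R, lineWeight α r * (r * h) ^ 2 ≤ M)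
    (i : Fin n) : ∑ l, edgeW α h n i (some l) ^ 2 * nodeLen h i l ^ 2 ≤ M := by
  have e : ∑ l, edgeW α h n i (some l) ^ 2 * nodeLen h i l ^ 2
      = lineScale α h / 2 * ∑ l : Fin n, lineWeight α (nodeDist i l) * (nodeDist i l * h) ^ 2 := by
    rw [Finset.mul_sum]
    refine Finset.sum_congr rfl fun l _ => ?_
    rw [edgeW_some_sq h1 h2 hh, nodeLen]
    ring
  rw [e, sum_nodeDist i (fun _ r => lineWeight α r * (r * h) ^ 2) (by simp)]
  have m1 := hM (i + 1) (by omega)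
  have m2 := hM (n - i) (by omega)
  linarith

lemma isLineForm_nabla {α h S : ℝ} (h1 : 1 < α) (h2 : α ≤ 2) (hh : 0 < h) {n : ℕ}
    (hM : ∀ R ≤ n, lineScale α h * ∑ r ∈ Finset.range R, lineWeight α r * (r * h) ^ 2 ≤ S ^ 2) :
    IsLineForm (-nablaMat α h n) (edgeW α h n) (nodeLen h) S where
  form := isForm_nabla h1 h2 hh n
  dist_nonneg i l := by unfold nodeLen; positivity
  dist_symm i l := by unfold nodeLen; rw [nodeDist_comm]
  weight_symm i l := by rw [edgeW_some_sq h1 h2 hh, edgeW_some_sq h1 h2 hh, nodeDist_comm]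
  moment l := by
    have : ∀ i, edgeW α h n i (some l) ^ 2 * nodeLen h i l ^ 2
        = edgeW α h n l (some i) ^ 2 * nodeLen h l i ^ 2 := fun i => by
      rw [edgeW_some_sq h1 h2 hh, edgeW_some_sq h1 h2 hh, nodeLen, nodeLen, nodeDist_comm]
    simp only [this]
    exact sum_weight_dist_le h1 h2 hh hM l

/-- The symmetric second differences of a coefficient cancel up to the coupling to the outside. -/
lemma abs_sum_weight_sub_le {α h M K : ℝ} (h1 : 1 < α) (h2 : α ≤ 2) (hh : 0 < h) {n : ℕ}
    (hM0 : 0 ≤ M) (hK : 0 ≤ K)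
    (hM : ∀ R ≤ n, lineScale α h * ∑ r ∈ Finset.range R, lineWeight α r * (r * h) ^ 2 ≤ M)
    (c : ℕ → ℝ) (hc : ∀ i < n, ∀ l < n, ∀ r, (i = l + r ∨ l = i + r) → |c i - c l| ≤ K * (r * h))
    (hc2 : ∀ i r, r ≤ i → i + r < n → |2 * c i - c (i - r) - c (i + r)| ≤ K * (r * h) ^ 2)
    (i : Fin n) :
    |∑ l : Fin n, edgeW α h n i (some l) ^ 2 * (c i - c l)|
      ≤ K * (M + 1) * (1 + |edgeW α h n i none|) := by
  have c0 := (lineScale_pos h1 h2 hh).le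
  have wn := fun r => lineWeight_nonneg h1 h2 r
  have hi := i.2
  set s := lineScale α h
  set w := lineWeight α
  -- Up to the distance `m` both nodes `i - r` and `i + r` exist, and the pair gives a second
  -- difference of `c`. Beyond `m` only one side is left, and only the first difference is
  -- available.
  set m := min (i : ℕ) (n - 1 - i) with hm
  have e : ∑ l : Fin n, edgeW α h n i (some l) ^ 2 * (c i - c l)
      = s / 2 * (∑ r ∈ Finset.range (m + 1), w r * (2 * c i - c (i - r) - c (i + r))
        + ∑ r ∈ Finset.Ico (m + 1) ((i : ℕ) + 1), w r * (c i - c (i - r))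
        + ∑ r ∈ Finset.Ico (m + 1) (n - 1 - i + 1), w r * (c i - c (i + r))) := by
    have e1 : ∑ l : Fin n, edgeW α h n i (some l) ^ 2 * (c i - c l)
        = s / 2 * ∑ l : Fin n, w (nodeDist i l) * (c i - c l) := by
      rw [Finset.mul_sum]
      refine Finset.sum_congr rfl fun l _ => ?_
      rw [edgeW_some_sq h1 h2 hh]; ring
    rw [e1, sum_nodeDist i (fun l r => w r * (c i - c l)) (by simp)]
    have e2 : n - i = n - 1 - i + 1 := by omega
    rw [e2, ← Finset.sum_range_add_sum_Ico _ (by omega : m + 1 ≤ (i : ℕ) + 1),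
      ← Finset.sum_range_add_sum_Ico (fun r => w r * (c i - c (i + r)))
        (by omega : m + 1 ≤ n - 1 - (i : ℕ) + 1)]
    have e3 : ∑ r ∈ Finset.range (m + 1), w r * (2 * c i - c (i - r) - c (i + r))
        = ∑ r ∈ Finset.range (m + 1), w r * (c i - c (i - r))
          + ∑ r ∈ Finset.range (m + 1), w r * (c i - c (i + r)) := by
      rw [← Finset.sum_add_distrib]
      exact Finset.sum_congr rfl fun r _ => by ring
    rw [e3]; ring
  have kill : s * lineTail α m ≤ edgeW α h n i none ^ 2 := by
    rw [edgeW_none_sq h1 h2 hh]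
    have t1 := lineTail_nonneg h1 h2 i
    have t2 := lineTail_nonneg h1 h2 (n - 1 - i)
    refine mul_le_mul_of_nonneg_left ?_ c0
    rcases min_choice (i : ℕ) (n - 1 - i) with hh' | hh' <;> rw [hm, hh'] <;> linarith
  have b1 : s * |∑ r ∈ Finset.range (m + 1), w r * (2 * c i - c (i - r) - c (i + r))| ≤ K * M := by
    have : |∑ r ∈ Finset.range (m + 1), w r * (2 * c i - c (i - r) - c (i + r))|
        ≤ K * ∑ r ∈ Finset.range (m + 1), w r * (r * h) ^ 2 := by
      rw [Finset.mul_sum]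
      refine (Finset.abs_sum_le_sum_abs _ _).trans (Finset.sum_le_sum fun r hr => ?_)
      rw [Finset.mem_range] at hr
      rw [abs_mul, abs_of_nonneg (wn r)]
      calc _ ≤ w r * (K * (r * h) ^ 2) :=
            mul_le_mul_of_nonneg_left (hc2 i r (by omega) (by omega)) (wn r)
        _ = _ := by ring
    calc _ ≤ s * (K * ∑ r ∈ Finset.range (m + 1), w r * (r * h) ^ 2) :=
          mul_le_mul_of_nonneg_left this c0
      _ = K * (s * ∑ r ∈ Finset.range (m + 1), w r * (r * h) ^ 2) := by ring
      _ ≤ K * M := mul_le_mul_of_nonneg_left (hM _ (by omega)) hK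
  -- Cauchy-Schwarz on the unpaired part: the weights beyond `m` sum to at most `lineTail α m`,
  -- which is dominated by the squared grounded weight, while the weights times squared distances
  -- are bounded by the second moment.
  have b2 : ∀ (R : ℕ) (f : ℕ → ℝ), R + 1 ≤ n → m ≤ R → (∀ r, r ≤ R → |f r| ≤ K * (r * h)) →
      s * |∑ r ∈ Finset.Ico (m + 1) (R + 1), w r * f r| ≤ K * (M + 1) * |edgeW α h n i none| := by
    intro R f hR hmR hf
    have s1 : |∑ r ∈ Finset.Ico (m + 1) (R + 1), w r * f r|
        ≤ K * ∑ r ∈ Finset.Ico (m + 1) (R + 1), √(w r) * (√(w r) * (r * h)) := by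
      rw [Finset.mul_sum]
      refine (Finset.abs_sum_le_sum_abs _ _).trans (Finset.sum_le_sum fun r hr => ?_)
      rw [Finset.mem_Ico] at hr
      rw [abs_mul, abs_of_nonneg (wn r), ← mul_assoc (√(w r)), Real.mul_self_sqrt (wn r)]
      calc _ ≤ w r * (K * (r * h)) := mul_le_mul_of_nonneg_left (hf r (by omega)) (wn r)
        _ = _ := by ring
    have s2 := Finset.sum_mul_sq_le_sq_mul_sq (Finset.Ico (m + 1) (R + 1))
      (fun r => √(w r)) (fun r => √(w r) * (r * h))
    have s3 : ∑ r ∈ Finset.Ico (m + 1) (R + 1), √(w r) ^ 2 ≤ lineTail α m := by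
      simp only [Real.sq_sqrt (wn _)]
      rw [lineTail_sub α hmR]
      linarith [lineTail_nonneg h1 h2 R]
    have s4 : s * ∑ r ∈ Finset.Ico (m + 1) (R + 1), (√(w r) * (r * h)) ^ 2 ≤ M := by
      refine le_trans (mul_le_mul_of_nonneg_left ?_ c0) (hM (R + 1) hR)
      simp only [mul_pow, Real.sq_sqrt (wn _)]
      rw [← Finset.sum_range_add_sum_Ico _ (by omega : m + 1 ≤ R + 1)]
      exact le_add_of_nonneg_left (Finset.sum_nonneg fun r _ => mul_nonneg (wn r) (by positivity))
    set Z := ∑ r ∈ Finset.Ico (m + 1) (R + 1), √(w r) * (√(w r) * (r * h)) with hZ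
    have s5 : (s * Z) ^ 2 ≤ ((M + 1) * |edgeW α h n i none|) ^ 2 := by
      calc (s * Z) ^ 2 = s * s * Z ^ 2 := by ring
        _ ≤ s * s * ((∑ r ∈ Finset.Ico (m + 1) (R + 1), √(w r) ^ 2)
            * ∑ r ∈ Finset.Ico (m + 1) (R + 1), (√(w r) * (r * h)) ^ 2) :=
            mul_le_mul_of_nonneg_left s2 (mul_nonneg c0 c0)
        _ = (s * ∑ r ∈ Finset.Ico (m + 1) (R + 1), √(w r) ^ 2)
            * (s * ∑ r ∈ Finset.Ico (m + 1) (R + 1), (√(w r) * (r * h)) ^ 2) := by ring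
        _ ≤ edgeW α h n i none ^ 2 * M := by
            refine mul_le_mul ((mul_le_mul_of_nonneg_left s3 c0).trans kill) s4 ?_ (sq_nonneg _)
            exact mul_nonneg c0 (Finset.sum_nonneg fun r _ => sq_nonneg _)
        _ ≤ edgeW α h n i none ^ 2 * (M + 1) ^ 2 :=
            mul_le_mul_of_nonneg_left (by nlinarith) (sq_nonneg _)
        _ = _ := by rw [mul_pow, sq_abs]; ring
    have s6 : s * Z ≤ (M + 1) * |edgeW α h n i none| :=
      abs_le_of_sq_le_sq' s5 (by positivity) |>.2
    calc _ ≤ s * (K * Z) := mul_le_mul_of_nonneg_left s1 c0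
      _ = K * (s * Z) := by ring
      _ ≤ K * ((M + 1) * |edgeW α h n i none|) := mul_le_mul_of_nonneg_left s6 hK
      _ = _ := by ring
  have b3 := b2 i (fun r => c i - c (i - r)) (by omega) (min_le_left _ _)
    (fun r hr => hc i (by omega) (i - r) (by omega) r (Or.inl (by omega)))
  have b4 := b2 (n - 1 - i) (fun r => c i - c (i + r)) (by omega) (min_le_right _ _)
    (fun r hr => hc i (by omega) (i + r) (by omega) r (Or.inr rfl))
  rw [e, abs_mul, abs_of_nonneg (by positivity : 0 ≤ s / 2)]
  have t := abs_add_three (∑ r ∈ Finset.range (m + 1), w r * (2 * c i - c (i - r) - c (i + r)))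
    (∑ r ∈ Finset.Ico (m + 1) ((i : ℕ) + 1), w r * (c i - c (i - r)))
    (∑ r ∈ Finset.Ico (m + 1) (n - 1 - (i : ℕ) + 1), w r * (c i - c (i + r)))
  have t2 := mul_le_mul_of_nonneg_left t (by positivity : 0 ≤ s / 2)
  have : 0 ≤ K * M := by positivity
  have : 0 ≤ K * (M + 1) * |edgeW α h n i none| := by positivity
  linarith

/-- The inverse estimate for the discrete gradient. -/
lemma sum_grad_sq_le {α h : ℝ} (h1 : 1 < α) (h2 : α ≤ 2) (hh : 0 < h) {n : ℕ} (v : Fin n → ℝ) :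
    ∑ e, grad (edgeW α h n) v e ^ 2 ≤ 4 * |wsCoeff α 1| * lineScale α h * ∑ i, v i ^ 2 := by
  rw [Fintype.sum_prod_type]
  simp only [Fintype.sum_option, grad, tgt, sub_zero, mul_pow, Finset.sum_add_distrib]
  have c0 := (lineScale_pos h1 h2 hh).le
  have wn := fun r => lineWeight_nonneg h1 h2 r
  set s := lineScale α h with hs
  have e1 : ∑ i, ∑ l, edgeW α h n i (some l) ^ 2 * (v i - v l) ^ 2
      ≤ ∑ i, (2 * ∑ l, s * lineWeight α (nodeDist i l)) * v i ^ 2 := by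
    have : ∑ i, ∑ l, s * lineWeight α (nodeDist i l) * v l ^ 2
        = ∑ i, (∑ l, s * lineWeight α (nodeDist i l)) * v i ^ 2 := by
      rw [Finset.sum_comm]
      refine Finset.sum_congr rfl fun i _ => ?_
      rw [Finset.sum_mul]
      exact Finset.sum_congr rfl fun l _ => by rw [nodeDist_comm]
    have e2 : ∑ i, (2 * ∑ l, s * lineWeight α (nodeDist i l)) * v i ^ 2
        = ∑ i, ∑ l, s * lineWeight α (nodeDist i l) * (v i ^ 2 + v l ^ 2) := by
      simp only [mul_add, Finset.sum_add_distrib]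
      rw [this, ← Finset.sum_add_distrib]
      refine Finset.sum_congr rfl fun i _ => ?_
      rw [← Finset.sum_mul]; ring
    rw [e2]
    refine Finset.sum_le_sum fun i _ => Finset.sum_le_sum fun l _ => ?_
    rw [edgeW_some_sq h1 h2 hh]
    have := mul_nonneg c0 (wn (nodeDist i l))
    nlinarith [mul_nonneg this (sq_nonneg (v i + v l))]
  calc _ ≤ ∑ i, edgeW α h n i none ^ 2 * v i ^ 2
        + ∑ i, (2 * ∑ l, s * lineWeight α (nodeDist i l)) * v i ^ 2 := by gcongr
    _ = ∑ i, (edgeW α h n i none ^ 2 + 2 * ∑ l, s * lineWeight α (nodeDist i l)) * v i ^ 2 := by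
        rw [← Finset.sum_add_distrib]; exact Finset.sum_congr rfl fun i _ => by ring
    _ ≤ _ := by
        rw [Finset.mul_sum]
        refine Finset.sum_le_sum fun i _ => mul_le_mul_of_nonneg_right ?_ (sq_nonneg _)
        rw [edgeW_none_sq h1 h2 hh, ← Finset.mul_sum, sum_lineWeight_nodeDist]
        have t1 := lineTail_nonneg h1 h2 i
        have t2 := lineTail_nonneg h1 h2 (n - 1 - i)
        have := neg_le_abs (wsCoeff α 1)
        calc _ = s * (4 * -wsCoeff α 1 - (lineTail α i + lineTail α (n - 1 - i))) := by ring
          _ ≤ s * (4 * |wsCoeff α 1|) := mul_le_mul_of_nonneg_left (by linarith) c0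
          _ = _ := by ring

/-- The local discrete energy of a grid function whose extension by zero is Lipschitz. -/
lemma exists_row_grad_sq_le_of_lipschitz {α L : ℝ} (h1 : 1 < α) (h2 : α ≤ 2) (hL : 0 < L) :
    ∃ M : ℝ, 0 < M ∧ ∀ N : ℕ, 0 < N → ∀ (v : Fin (N - 1) → ℝ) (K : ℝ), 0 ≤ K →
      (∀ i l, |v i - v l| ≤ K * nodeLen (L / N) i l) →
      (∀ i : Fin (N - 1), |v i| ≤ K * (((i : ℕ) + 1) * (L / N))) →
      (∀ i : Fin (N - 1), |v i| ≤ K * (((N - 1 - 1 - (i : ℕ) : ℕ) + 1) * (L / N))) →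
      ∀ i, ∑ o, grad (edgeW α (L / N) (N - 1)) v (i, o) ^ 2 ≤ M * K ^ 2 := by
  obtain ⟨M, hM0, hM⟩ := exists_moment_le h1 h2 hL
  obtain ⟨C, hC, ht⟩ := exists_lineTail_le h1 h2
  have hκ : 0 < -kappa α := by linarith [kappa_neg h1 h2]
  have hν : 0 ≤ 2 - α := by linarith
  refine ⟨M + 2 * (-kappa α * C * L ^ (2 - α)), by positivity, fun N hN v K hK hv hv1 hv2 => ?_⟩
  have hN' : (0 : ℝ) < N := by exact_mod_cast hN
  have hh : 0 < L / N := by positivity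
  set h := L / N with hhd
  have c0 := (lineScale_pos h1 h2 hh).le
  -- The grounded weight is singular near the boundary, of order `((r + 1) h)^{-α}`. A function with
  -- a Lipschitz extension by zero is `O((r + 1) h)` there, and `2 - α ≥ 0` keeps the product
  -- bounded.
  have side : ∀ (x : ℝ) (r : ℕ), r + 1 ≤ N → |x| ≤ K * (((r : ℕ) + 1) * h) →
      lineScale α h * lineTail α r * x ^ 2 ≤ -kappa α * C * L ^ (2 - α) * K ^ 2 := by
    intro x r hr hx
    have hx2 : x ^ 2 ≤ (K * (((r : ℕ) + 1) * h)) ^ 2 := by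
      rw [← sq_abs]; exact pow_le_pow_left₀ (abs_nonneg _) hx 2
    have e1 : ((r : ℝ) + 1) ^ (-α) * ((r : ℝ) + 1) ^ 2 = ((r : ℝ) + 1) ^ (2 - α) := by
      rw [← Real.rpow_natCast, ← Real.rpow_add (by positivity)]
      congr 1; push_cast; ring
    calc _ ≤ lineScale α h * (C * ((r : ℝ) + 1) ^ (-α)) * (K * (((r : ℕ) + 1) * h)) ^ 2 := by
          have := ht r
          have := lineTail_nonneg h1 h2 r
          gcongr
      _ = (lineScale α h * h ^ 2) * C * (((r : ℝ) + 1) ^ (-α) * ((r : ℝ) + 1) ^ 2) * K ^ 2 := by ring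
      _ = -kappa α * C * (h ^ (2 - α) * ((r : ℝ) + 1) ^ (2 - α)) * K ^ 2 := by
          rw [e1, lineScale_mul_sq hh]; ring
      _ ≤ _ := by
          rw [← Real.mul_rpow hh.le (by positivity)]
          gcongr
          rw [hhd, div_mul_eq_mul_div, div_le_iff₀ hN']
          have : (r : ℝ) + 1 ≤ N := by exact_mod_cast hr
          gcongr
  intro i
  simp only [Fintype.sum_option, grad, tgt, sub_zero, mul_pow]
  have i2 := i.2
  have r1 : ∑ l, edgeW α h (N - 1) i (some l) ^ 2 * (v i - v l) ^ 2 ≤ K ^ 2 * M := by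
    refine le_trans ?_ (mul_le_mul_of_nonneg_left (sum_weight_dist_le (n := N - 1) h1 h2 hh
      (fun R hR => hM N hN R (by omega)) i) (sq_nonneg K))
    rw [Finset.mul_sum]
    refine Finset.sum_le_sum fun l _ => ?_
    have : (v i - v l) ^ 2 ≤ (K * nodeLen h i l) ^ 2 := by
      rw [← sq_abs]; exact pow_le_pow_left₀ (abs_nonneg _) (hv i l) 2
    calc _ ≤ edgeW α h (N - 1) i (some l) ^ 2 * (K * nodeLen h i l) ^ 2 :=
          mul_le_mul_of_nonneg_left this (sq_nonneg _)
      _ = _ := by ring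
  have r2 : edgeW α h (N - 1) i none ^ 2 * v i ^ 2 ≤ 2 * (-kappa α * C * L ^ (2 - α)) * K ^ 2 := by
    rw [edgeW_none_sq h1 h2 hh]
    have q1 := side (v i) i (by omega) (hv1 i)
    have q2 := side (v i) (N - 1 - 1 - i) (by omega) (hv2 i)
    linarith
  linarith

/-- The discrete energy of a grid function whose extension by zero is Lipschitz. -/
lemma exists_sum_grad_sq_le_of_lipschitz {α L : ℝ} (h1 : 1 < α) (h2 : α ≤ 2) (hL : 0 < L) :
    ∃ M : ℝ, 0 < M ∧ ∀ N : ℕ, 0 < N → ∀ (v : Fin (N - 1) → ℝ) (K : ℝ), 0 ≤ K →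
      (∀ i l, |v i - v l| ≤ K * nodeLen (L / N) i l) →
      (∀ i : Fin (N - 1), |v i| ≤ K * (((i : ℕ) + 1) * (L / N))) →
      (∀ i : Fin (N - 1), |v i| ≤ K * (((N - 1 - 1 - (i : ℕ) : ℕ) + 1) * (L / N))) →
      ∑ e, grad (edgeW α (L / N) (N - 1)) v e ^ 2 ≤ M * K ^ 2 * N := by
  obtain ⟨M, hM0, hM⟩ := exists_row_grad_sq_le_of_lipschitz h1 h2 hL
  refine ⟨M, hM0, fun N hN v K hK hv hv1 hv2 => ?_⟩
  rw [Fintype.sum_prod_type]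
  calc _ ≤ ∑ i : Fin (N - 1), M * K ^ 2 :=
        Finset.sum_le_sum fun i _ => hM N hN v K hK hv hv1 hv2 i
    _ = ((N - 1 : ℕ) : ℝ) * (M * K ^ 2) := by simp
    _ ≤ N * (M * K ^ 2) := by
        have : ((N - 1 : ℕ) : ℝ) ≤ N := by exact_mod_cast Nat.sub_le _ _
        gcongr
    _ = _ := by ring

/-! ### Second order asymptotics of the Grünwald-Letnikov coefficients -/

/-- Each one-sided remainder is monotone, because Bernoulli-type bounds for the exponent `q - 1`
control its derivative. The lower one comes from the upper one for `2 - q`, the two powers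
multiplying to `1 + x`. -/
lemma abs_one_add_rpow_sub_le {q x : ℝ} (h1 : 1 < q) (h2 : q < 2) (hx : 0 ≤ x) :
    |(1 + x) ^ q - (1 + q * x + q * (q - 1) / 2 * x ^ 2)| ≤ x ^ 3 := by
  have hd : ∀ y : ℝ, 0 ≤ y → HasDerivAt (fun y : ℝ => (1 + y) ^ q) (q * (1 + y) ^ (q - 1)) y := by
    intro y hy
    have := ((hasDerivAt_id y).const_add 1).rpow_const (p := q) (Or.inl (by simp; linarith))
    simpa using this
  have up : ∀ y : ℝ, 0 ≤ y → (1 + y) ^ (q - 1) ≤ 1 + (q - 1) * y := fun y hy =>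
    rpow_one_add_le_one_add_mul_self (by linarith) (by linarith) (by linarith)
  have lo : ∀ y : ℝ, 0 ≤ y → 1 + (q - 1) * y - y ^ 2 ≤ (1 + y) ^ (q - 1) := by
    intro y hy
    have e1 : (1 + y) ^ (2 - q) ≤ 1 + (2 - q) * y :=
      rpow_one_add_le_one_add_mul_self (by linarith) (by linarith) (by linarith)
    have e2 : (1 + y) ^ (q - 1) * (1 + y) ^ (2 - q) = 1 + y := by
      rw [← Real.rpow_add (by linarith)]
      rw [show q - 1 + (2 - q) = 1 by ring, Real.rpow_one]
    have e3 : 1 + y ≤ (1 + y) ^ (q - 1) * (1 + (2 - q) * y) := by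
      calc _ = (1 + y) ^ (q - 1) * (1 + y) ^ (2 - q) := e2.symm
        _ ≤ _ := mul_le_mul_of_nonneg_left e1 (Real.rpow_nonneg (by linarith) _)
    have e4 : 0 < 1 + (2 - q) * y := by nlinarith
    refine le_of_mul_le_mul_right (le_trans ?_ e3) e4
    have : (q - 1) * (2 - q) ≤ 1 := by nlinarith
    have y3 : 0 ≤ (2 - q) * y ^ 3 := by
      have : 0 ≤ 2 - q := by linarith
      positivity
    nlinarith [mul_le_mul_of_nonneg_right this (sq_nonneg y)]
  rw [abs_le]
  constructor
  · have mono : MonotoneOn (fun y : ℝ => (1 + y) ^ q - (1 + q * y + q * (q - 1) / 2 * y ^ 2) + y ^ 3)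
        (Ici 0) := by
      have hder : ∀ y : ℝ, 0 ≤ y → HasDerivAt
          (fun y : ℝ => (1 + y) ^ q - (1 + q * y + q * (q - 1) / 2 * y ^ 2) + y ^ 3)
          (q * (1 + y) ^ (q - 1) - (q + q * (q - 1) / 2 * (2 * y)) + 3 * y ^ 2) y := by
        intro y hy
        have h3 := (((hasDerivAt_id y).const_mul q).const_add 1).add
          ((hasDerivAt_pow 2 y).const_mul (q * (q - 1) / 2))
        have := ((hd y hy).sub h3).add (hasDerivAt_pow 3 y)
        exact this.congr_deriv (by norm_num)
      refine monotoneOn_of_deriv_nonneg (convex_Ici 0)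
        (fun y hy => (hder y hy).continuousAt.continuousWithinAt)
        (fun y hy => (hder y (interior_subset hy)).differentiableAt.differentiableWithinAt)
        fun y hy => ?_
      have hy0 : 0 ≤ y := interior_subset hy
      rw [(hder y hy0).deriv]
      nlinarith [lo y hy0, sq_nonneg y]
    have := mono (mem_Ici.2 le_rfl) (mem_Ici.2 hx) hx
    norm_num at this
    linarith
  · have mono : MonotoneOn (fun y : ℝ => (1 + q * y + q * (q - 1) / 2 * y ^ 2) - (1 + y) ^ q)
        (Ici 0) := by
      have hder : ∀ y : ℝ, 0 ≤ y → HasDerivAt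
          (fun y : ℝ => (1 + q * y + q * (q - 1) / 2 * y ^ 2) - (1 + y) ^ q)
          ((q + q * (q - 1) / 2 * (2 * y)) - q * (1 + y) ^ (q - 1)) y := by
        intro y hy
        have h3 := (((hasDerivAt_id y).const_mul q).const_add 1).add
          ((hasDerivAt_pow 2 y).const_mul (q * (q - 1) / 2))
        have := h3.sub (hd y hy)
        exact this.congr_deriv (by norm_num)
      refine monotoneOn_of_deriv_nonneg (convex_Ici 0)
        (fun y hy => (hder y hy).continuousAt.continuousWithinAt)
        (fun y hy => (hder y (interior_subset hy)).differentiableAt.differentiableWithinAt)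
        fun y hy => ?_
      have hy0 : 0 ≤ y := interior_subset hy
      rw [(hder y hy0).deriv]
      nlinarith [up y hy0]
    have := mono (mem_Ici.2 le_rfl) (mem_Ici.2 hx) hx
    norm_num at this
    have : 0 ≤ x ^ 3 := by positivity
    linarith

/-- A convergent sequence whose increments are `O(n⁻³)` converges at the rate `n⁻²`. -/
lemma abs_sub_lim_le_of_increments {y : ℕ → ℝ} {l C : ℝ} (hC : 0 ≤ C)
    (hl : Filter.Tendsto y Filter.atTop (nhds l))
    (hy : ∀ n : ℕ, |y (n + 1) - y n| ≤ C / ((n : ℝ) + 1) ^ 3) (n : ℕ) :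
    |y n - l| ≤ 4 * C / ((n : ℝ) + 1) ^ 2 := by
  have hz : Filter.Tendsto (fun n : ℕ => 4 * C / ((n : ℝ) + 1) ^ 2) Filter.atTop (nhds 0) := by
    have h1 := (tendsto_one_div_add_atTop_nhds_zero_nat (𝕜 := ℝ)).pow 2
    have h2 := h1.const_mul (4 * C)
    simp only [ne_eq, OfNat.ofNat_ne_zero, not_false_eq_true, zero_pow, mul_zero] at h2
    refine h2.congr fun n => ?_
    rw [div_pow, one_pow]; ring
  -- `4 C / (n + 1)²` decreases at least as fast as the increments can grow, so subtracting it makes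
  -- `y` monotone and adding it makes `y` antitone, with the same limit.
  have step : ∀ n : ℕ, C / ((n : ℝ) + 1) ^ 3
      ≤ 4 * C / ((n : ℝ) + 1) ^ 2 - 4 * C / (((n + 1 : ℕ) : ℝ) + 1) ^ 2 := by
    intro n
    have hn : (0 : ℝ) ≤ n := Nat.cast_nonneg n
    push_cast
    rw [div_sub_div _ _ (by positivity) (by positivity), div_le_div_iff₀ (by positivity) (by positivity)]
    have h1 : ((n : ℝ) + 1) ^ 2 * ((n : ℝ) + 1 + 1) ^ 2
        ≤ 4 * (((n : ℝ) + 1 + 1) ^ 2 - ((n : ℝ) + 1) ^ 2) * ((n : ℝ) + 1) ^ 3 := by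
      have : ((n : ℝ) + 1 + 1) ^ 2 ≤ 4 * (((n : ℝ) + 1 + 1) ^ 2 - ((n : ℝ) + 1) ^ 2) * ((n : ℝ) + 1) := by
        nlinarith
      nlinarith [mul_le_mul_of_nonneg_left this (sq_nonneg ((n : ℝ) + 1))]
    nlinarith [mul_le_mul_of_nonneg_left h1 hC]
  have mono : Monotone fun n : ℕ => y n - 4 * C / ((n : ℝ) + 1) ^ 2 := by
    refine monotone_nat_of_le_succ fun n => ?_
    have := step n
    have := neg_le_of_abs_le (hy n)
    linarith
  have anti : Antitone fun n : ℕ => y n + 4 * C / ((n : ℝ) + 1) ^ 2 := by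
    refine antitone_nat_of_succ_le fun n => ?_
    have := step n
    have := le_of_abs_le (hy n)
    linarith
  have l1 := mono.ge_of_tendsto (by simpa using hl.sub hz) n
  have l2 := anti.le_of_tendsto (by simpa using hl.add hz) n
  rw [abs_le]
  constructor <;> linarith

/-- The weighted combination of consecutive coefficients of order `α - k`. -/
def wsSum (α : ℝ) (k : ℕ) (N : ℕ) : ℝ :=
  α / 2 * glCoeff (α - k) (N + 1) + (2 - α) / 2 * glCoeff (α - k) N

lemma wsSum_succ_sub (α : ℝ) (k N : ℕ) :
    wsSum α (k + 1) (N + 1) - wsSum α (k + 1) N = wsSum α k (N + 1) := by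
  have e : α - ((k + 1 : ℕ) : ℝ) = α - k - 1 := by push_cast; ring
  unfold wsSum
  rw [e, glCoeff_succ_eq_sub (α - k) (N + 1), glCoeff_succ_eq_sub (α - k) N]
  ring

/-- Power moments of the weights. -/
def wsMoment (α : ℝ) (k : ℕ) (N : ℕ) : ℝ :=
  ∑ m ∈ Finset.range (N + 1), wsCoeff α m * ((N : ℝ) - m) ^ k

lemma wsMoment_zero_succ (α : ℝ) (N : ℕ) : wsMoment α 0 (N + 1) = wsSum α 1 N := by
  simp [wsMoment, sum_wsCoeff, wsSum]

/-- Shifted power moments. -/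
lemma wsMoment_succ_eq (α : ℝ) (k N : ℕ) : wsMoment α (k + 1) (N + 1)
    = ∑ m ∈ Finset.range (N + 1), wsCoeff α m * ((N : ℝ) - m + 1) ^ (k + 1) := by
  rw [wsMoment, Finset.sum_range_succ]
  simp only [sub_self, ne_eq, Nat.add_eq_zero_iff, one_ne_zero, and_false, not_false_eq_true,
    zero_pow, mul_zero, add_zero]
  refine Finset.sum_congr rfl fun m _ => ?_
  push_cast; ring

lemma wsMoment_one_succ (α : ℝ) (N : ℕ) :
    wsMoment α 1 (N + 1) = wsMoment α 1 N + wsMoment α 0 N := by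
  rw [wsMoment_succ_eq, wsMoment, wsMoment, ← Finset.sum_add_distrib]
  exact Finset.sum_congr rfl fun m _ => by ring

lemma wsMoment_two_succ (α : ℝ) (N : ℕ) :
    wsMoment α 2 (N + 1) = wsMoment α 2 N + 2 * wsMoment α 1 N + wsMoment α 0 N := by
  rw [wsMoment_succ_eq, wsMoment, wsMoment, wsMoment, Finset.mul_sum, ← Finset.sum_add_distrib,
    ← Finset.sum_add_distrib]
  exact Finset.sum_congr rfl fun m _ => by ring

lemma wsMoment_three_succ (α : ℝ) (N : ℕ) : wsMoment α 3 (N + 1)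
    = wsMoment α 3 N + 3 * wsMoment α 2 N + 3 * wsMoment α 1 N + wsMoment α 0 N := by
  rw [wsMoment_succ_eq, wsMoment, wsMoment, wsMoment, wsMoment, Finset.mul_sum, Finset.mul_sum,
    ← Finset.sum_add_distrib, ← Finset.sum_add_distrib, ← Finset.sum_add_distrib]
  exact Finset.sum_congr rfl fun m _ => by ring

/-- The binomial theorem gives the recursions of the moments in `N`, and `wsSum_succ_sub` those of
`wsSum`; they agree, so only the first value has to be computed. The second and the third moment are
obtained in the same way. -/
lemma wsMoment_one_eq (α : ℝ) (N : ℕ) : wsMoment α 1 (N + 2) = wsSum α 2 N := by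
  induction N with
  | zero =>
    norm_num [wsMoment, Finset.sum_range_succ, wsSum, wsCoeff, glCoeff]
    ring
  | succ N ih =>
    rw [wsMoment_one_succ, ih, wsMoment_zero_succ, ← wsSum_succ_sub α 1]
    norm_num

lemma wsMoment_two_eq (α : ℝ) (N : ℕ) :
    wsMoment α 2 (N + 2) = 2 * wsSum α 3 N - wsSum α 2 N := by
  induction N with
  | zero =>
    norm_num [wsMoment, Finset.sum_range_succ, wsSum, wsCoeff, glCoeff]
    ring
  | succ N ih =>
    have h1 := wsSum_succ_sub α 2 N
    have h2 := wsSum_succ_sub α 1 N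
    norm_num at h1 h2
    rw [wsMoment_two_succ, ih, wsMoment_one_eq, wsMoment_zero_succ]
    linarith

lemma wsMoment_three_eq (α : ℝ) (N : ℕ) :
    wsMoment α 3 (N + 3) = 6 * wsSum α 4 N + wsSum α 2 (N + 1) := by
  induction N with
  | zero =>
    norm_num [wsMoment, Finset.sum_range_succ, wsSum, wsCoeff, glCoeff]
    ring
  | succ N ih =>
    have h0 := wsSum_succ_sub α 3 N
    have h1 := wsSum_succ_sub α 2 N
    have h2 := wsSum_succ_sub α 1 N
    have h3 := wsSum_succ_sub α 1 (N + 1)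
    norm_num at h0 h1 h2 h3
    rw [wsMoment_three_succ, ih, wsMoment_two_eq, wsMoment_one_eq, wsMoment_zero_succ]
    linarith

lemma glCoeff_neg_pos {q : ℝ} (hq : 0 < q) (N : ℕ) : 0 < glCoeff (-(q + 1)) N := by
  induction N with
  | zero => simp [glCoeff_zero]
  | succ N ih =>
    rw [glCoeff_succ]
    refine mul_pos ?_ ih
    have : 0 < q / ((N : ℝ) + 1) := by positivity
    have e : (-(q + 1) + 1) / ((N : ℝ) + 1) = -(q / ((N : ℝ) + 1)) := by ring
    rw [e]; linarith

lemma prod_eq_glCoeff_neg {q : ℝ} (N : ℕ) :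
    ∏ j ∈ Finset.range (N + 1), (q + j) = q * N.factorial * glCoeff (-(q + 1)) N := by
  induction N with
  | zero => simp [glCoeff_zero]
  | succ N ih =>
    rw [Finset.prod_range_succ, ih, glCoeff_succ, Nat.factorial_succ]
    push_cast
    field_simp
    ring

/-- Euler's limit for the Gamma function: `glCoeff (-(q + 1)) N` is `∏_{j ≤ N} (q + j) / (q N!)`. -/
lemma tendsto_glCoeff_neg {q : ℝ} (hq : 0 < q) :
    Filter.Tendsto (fun N : ℕ => glCoeff (-(q + 1)) N / (N : ℝ) ^ q) Filter.atTop
      (nhds (1 / Real.Gamma (q + 1))) := by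
  have h := Real.GammaSeq_tendsto_Gamma q
  have h2 := (h.const_mul q).inv₀ (by
    have := Real.Gamma_pos_of_pos hq
    positivity)
  rw [Real.Gamma_add_one hq.ne', one_div]
  refine h2.congr fun N => ?_
  rw [Real.GammaSeq, prod_eq_glCoeff_neg]
  have h3 := glCoeff_neg_pos hq N
  have h4 : (N.factorial : ℝ) ≠ 0 := by positivity
  by_cases hN : N = 0
  · subst hN; simp [Real.zero_rpow hq.ne']
  · have : (N : ℝ) ^ q ≠ 0 := by
      have : (0 : ℝ) < N := by exact_mod_cast Nat.pos_of_ne_zero hN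
      positivity
    field_simp

/-- The ratio of consecutive terms agrees with that of a power up to third order. -/
lemma exists_ratio_sub_rpow_le {q A : ℝ} (h1 : 1 < q) (h2 : q < 2) (hA : A = (q - 1) * (2 - q) / 2)
    (n : ℕ) : |(1 + (q - 1) / ((n : ℝ) + 1)) * (1 + 1 / ((n : ℝ) + 1 + A)) - (1 + 1 / ((n : ℝ) + 1)) ^ q|
      ≤ 4 / ((n : ℝ) + 1) ^ 3 := by
  have hn : (0 : ℝ) < (n : ℝ) + 1 := by positivity
  have hA0 : 0 ≤ A := by rw [hA]; nlinarith
  have hA1 : A ≤ 1 := by rw [hA]; nlinarith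
  set x := 1 / ((n : ℝ) + 1) with hx
  have hx0 : 0 < x := by positivity
  have hx1 : x ≤ 1 := by rw [hx, div_le_one hn]; linarith [(Nat.cast_nonneg n : (0 : ℝ) ≤ n)]
  have e1 := abs_one_add_rpow_sub_le h1 h2 hx0.le
  have e2 : 1 / ((n : ℝ) + 1 + A) = x - A * x ^ 2 + A ^ 2 * x ^ 3 / (1 + A * x) := by
    rw [hx]; field_simp; ring
  have e3 : (q - 1) / ((n : ℝ) + 1) = (q - 1) * x := by rw [hx]; ring
  have e4 : 4 / ((n : ℝ) + 1) ^ 3 = 4 * x ^ 3 := by rw [hx, div_pow, one_pow]; ring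
  rw [e2, e3, e4]
  set z := A ^ 2 * x ^ 3 / (1 + A * x) with hz
  have hz0 : 0 ≤ z := by positivity
  have hz1 : z ≤ x ^ 3 := by
    rw [hz, div_le_iff₀ (by positivity)]
    have : A ^ 2 ≤ 1 := by nlinarith
    have h3 : 0 ≤ x ^ 3 := by positivity
    nlinarith [mul_nonneg hA0 hx0.le]
  -- The value of `A` is the one for which the quadratic terms cancel: `(q - 1) - A = q (q - 1) /
  -- 2`.
  have e5 : (1 + (q - 1) * x) * (1 + (x - A * x ^ 2 + z)) - (1 + q * x + q * (q - 1) / 2 * x ^ 2)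
      = (1 + (q - 1) * x) * z - (q - 1) * A * x ^ 3 := by
    rw [hA]; ring
  have b : 0 ≤ (1 + (q - 1) * x) ∧ (1 + (q - 1) * x) ≤ 2 := ⟨by nlinarith, by nlinarith⟩
  have e6 : (1 + (q - 1) * x) * z ≤ 2 * x ^ 3 := mul_le_mul b.2 hz1 hz0 (by norm_num)
  have e7 : 0 ≤ (1 + (q - 1) * x) * z := mul_nonneg b.1 hz0
  have e8 : (q - 1) * A * x ^ 3 ≤ 1 * x ^ 3 := by
    refine mul_le_mul_of_nonneg_right ?_ (by positivity); nlinarith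
  have e9 : 0 ≤ (q - 1) * A * x ^ 3 := mul_nonneg (mul_nonneg (by linarith) hA0) (by positivity)
  have h3 : 0 ≤ x ^ 3 := by positivity
  rw [abs_le] at e1 ⊢
  constructor <;> linarith [e1.1, e1.2]

/-- The source of second order accuracy. With the weights `α / 2`, `(2 - α) / 2` and the base point
`N + 2`, the term of relative order `1 / N` is absent: the quotient by `(N + 2)^{3-α}` has
increments `O(N⁻³)`, so it reaches its limit at the rate `N⁻²`. -/
lemma exists_abs_wsSum_four_sub_le {α : ℝ} (h1 : 1 < α) (h2 : α < 2) :
    ∃ C : ℝ, 0 < C ∧ ∀ N : ℕ,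
      |wsSum α 4 N - ((N : ℝ) + 2) ^ (3 - α) / Real.Gamma (4 - α)|
        ≤ C * ((N : ℝ) + 2) ^ (1 - α) := by
  set q := 3 - α with hq
  have hq1 : 1 < q := by rw [hq]; linarith
  have hq2 : q < 2 := by rw [hq]; linarith
  have hα : α = 3 - q := by rw [hq]; ring
  set A := (q - 1) * (2 - q) / 2 with hA
  have hA0 : 0 ≤ A := by rw [hA]; nlinarith
  have e4 : α - ((4 : ℕ) : ℝ) = -(q + 1) := by rw [hα]; push_cast; ring
  set g := glCoeff (-(q + 1)) with hg
  have gpos : ∀ N, 0 < g N := glCoeff_neg_pos (by linarith)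
  have gs : ∀ N : ℕ, g (N + 1) = (1 + q / ((N : ℝ) + 1)) * g N := by
    intro N; rw [hg, glCoeff_succ]; ring
  have ws : ∀ N : ℕ, wsSum α 4 N = (1 + (A + 1) / ((N : ℝ) + 1)) * g N := by
    intro N
    rw [wsSum, e4, ← hg, gs, hA, hα]; ring
  set y : ℕ → ℝ := fun N => wsSum α 4 N / ((N : ℝ) + 2) ^ q with hy
  have hlim : Filter.Tendsto y Filter.atTop (nhds (1 / Real.Gamma (q + 1))) := by
    have t1 := tendsto_glCoeff_neg (q := q) (by linarith)
    have t2 : Filter.Tendsto (fun N : ℕ => 1 + (A + 1) / ((N : ℝ) + 1)) Filter.atTop (nhds 1) := by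
      have := ((tendsto_one_div_add_atTop_nhds_zero_nat (𝕜 := ℝ)).const_mul (A + 1)).const_add 1
      simp only [mul_zero, add_zero] at this
      refine this.congr fun N => ?_
      ring
    have t3 : Filter.Tendsto (fun N : ℕ => ((N : ℝ) / ((N : ℝ) + 2)) ^ q) Filter.atTop (nhds 1) := by
      have := (tendsto_natCast_div_add_atTop (𝕜 := ℝ) 2).rpow_const (p := q) (Or.inl one_ne_zero)
      simpa using this
    have := (t2.mul t1).mul t3
    simp only [one_mul, mul_one] at this
    refine this.congr' ?_
    filter_upwards [Filter.eventually_gt_atTop 0] with N hN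
    have hN' : (0 : ℝ) < N := by exact_mod_cast hN
    rw [Real.div_rpow hN'.le (by positivity)]
    simp only [hy, ws]
    have : (N : ℝ) ^ q ≠ 0 := by positivity
    field_simp
    rw [hg]
  obtain ⟨Y, hY⟩ : ∃ Y : ℝ, ∀ N, |y N| ≤ Y := by
    obtain ⟨Y, hY⟩ := (Metric.isBounded_range_of_tendsto y hlim).exists_norm_le
    exact ⟨Y, fun N => by simpa using hY (y N) ⟨N, rfl⟩⟩
  have hY0 : 0 ≤ Y := (abs_nonneg _).trans (hY 0)
  have inc : ∀ N : ℕ, |y (N + 1) - y N| ≤ (Y * 4) / ((N : ℝ) + 1) ^ 3 := by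
    intro N
    have hn : (0 : ℝ) < (N : ℝ) + 2 := by positivity
    have r1 := exists_ratio_sub_rpow_le hq1 hq2 hA (N + 1)
    push_cast at r1
    rw [show (N : ℝ) + 1 + 1 = (N : ℝ) + 2 by ring] at r1
    set ρ := (1 + (q - 1) / ((N : ℝ) + 2)) * (1 + 1 / ((N : ℝ) + 2 + A)) with hρ
    have w1 : wsSum α 4 (N + 1) = ρ * wsSum α 4 N := by
      rw [ws, ws, gs, hρ]
      push_cast
      have : (N : ℝ) + 2 + A ≠ 0 := by positivity
      field_simp
      ring
    set s := (1 + 1 / ((N : ℝ) + 2)) ^ q with hs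
    have hs1 : 1 ≤ s := Real.one_le_rpow (by
      have : 0 < 1 / ((N : ℝ) + 2) := by positivity
      linarith) (by linarith)
    have p1 : (((N + 1 : ℕ) : ℝ) + 2) ^ q = ((N : ℝ) + 2) ^ q * s := by
      rw [hs, ← Real.mul_rpow hn.le (by positivity)]
      congr 1
      push_cast
      field_simp
      ring
    have d : y (N + 1) - y N = y N * ((ρ - s) / s) := by
      simp only [hy]
      rw [w1, p1]
      have : ((N : ℝ) + 2) ^ q ≠ 0 := by positivity
      have : s ≠ 0 := by linarith
      field_simp
    rw [d, abs_mul, abs_div (ρ - s), abs_of_pos (by linarith : 0 < s), mul_div_assoc]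
    refine mul_le_mul (hY N) ?_ (by positivity) hY0
    calc _ ≤ |ρ - s| := div_le_self (abs_nonneg _) hs1
      _ ≤ 4 / ((N : ℝ) + 2) ^ 3 := r1
      _ ≤ _ := by gcongr; norm_num
  refine ⟨4 * (Y * 4) * 4 + 1, by positivity, fun N => ?_⟩
  have fin := abs_sub_lim_le_of_increments (by positivity) hlim inc N
  have hn : (0 : ℝ) < (N : ℝ) + 2 := by positivity
  have pq : 0 < ((N : ℝ) + 2) ^ q := by positivity
  rw [show (4 : ℝ) - α = q + 1 by rw [hq]; ring, show 1 - α = q - 2 by rw [hq]; ring]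
  have e5 : wsSum α 4 N - ((N : ℝ) + 2) ^ q / Real.Gamma (q + 1)
      = ((N : ℝ) + 2) ^ q * (y N - 1 / Real.Gamma (q + 1)) := by
    simp only [hy]; field_simp
  rw [e5, abs_mul, abs_of_pos pq]
  have e6 : ((N : ℝ) + 2) ^ (q - 2) = ((N : ℝ) + 2) ^ q / ((N : ℝ) + 2) ^ 2 := by
    rw [Real.rpow_sub hn]; norm_num
  have e7 : 4 * (Y * 4) / ((N : ℝ) + 1) ^ 2 ≤ 4 * (Y * 4) * 4 / ((N : ℝ) + 2) ^ 2 := by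
    rw [div_le_div_iff₀ (by positivity) (by positivity)]
    have : ((N : ℝ) + 2) ^ 2 ≤ 4 * ((N : ℝ) + 1) ^ 2 := by
      nlinarith [(Nat.cast_nonneg N : (0 : ℝ) ≤ N)]
    nlinarith
  calc _ ≤ ((N : ℝ) + 2) ^ q * (4 * (Y * 4) * 4 / ((N : ℝ) + 2) ^ 2) :=
        mul_le_mul_of_nonneg_left (fin.trans e7) pq.le
    _ = 4 * (Y * 4) * 4 * ((N : ℝ) + 2) ^ (q - 2) := by rw [e6]; ring
    _ ≤ _ := by gcongr; linarith

/-! ### The Peano kernel of the weighted shifted Grünwald approximation -/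

lemma exists_bound_of_tail {x w : ℕ → ℝ} (hw : ∀ N, 0 < w N) (k : ℕ) {C : ℝ}
    (h : ∀ N, |x (N + k)| ≤ C * w (N + k)) : ∃ C' : ℝ, 0 < C' ∧ ∀ N, |x N| ≤ C' * w N := by
  have hs : 0 ≤ ∑ i ∈ Finset.range k, |x i| / w i :=
    Finset.sum_nonneg fun i _ => div_nonneg (abs_nonneg _) (hw i).le
  refine ⟨|C| + ∑ i ∈ Finset.range k, |x i| / w i + 1, by positivity, fun N => ?_⟩
  by_cases hN : N < k
  · have h1 : |x N| / w N ≤ ∑ i ∈ Finset.range k, |x i| / w i :=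
      Finset.single_le_sum (f := fun i => |x i| / w i)
        (fun i _ => div_nonneg (abs_nonneg _) (hw i).le) (Finset.mem_range.2 hN)
    rw [← div_le_iff₀ (hw N)]
    linarith [abs_nonneg C]
  · obtain ⟨M, rfl⟩ := Nat.exists_eq_add_of_le' (not_lt.1 hN)
    refine (h M).trans (mul_le_mul_of_nonneg_right ?_ (hw _).le)
    linarith [le_abs_self C]

lemma rpow_le_two_mul_rpow {x y s : ℝ} (_ : 0 < x) (hy : 0 < y) (hxy : y ≤ 2 * x) (hs : s ≤ 0)
    (hs1 : -1 ≤ s) : x ^ s ≤ 2 * y ^ s := by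
  have h1 : x ^ s ≤ (y / 2) ^ s := Real.rpow_le_rpow_of_nonpos (by positivity) (by linarith) hs
  refine h1.trans ?_
  rw [Real.div_rpow hy.le two_pos.le, div_le_iff₀ (by positivity)]
  have h2 : (2 : ℝ) ^ (-1 : ℝ) ≤ 2 ^ s := Real.rpow_le_rpow_of_exponent_le (by norm_num) hs1
  rw [Real.rpow_neg_one] at h2
  have : 0 < y ^ s := by positivity
  nlinarith

lemma abs_wsSum_le {α C : ℝ} {k : ℕ} (h1 : 1 < α) (h2 : α ≤ 2) {s : ℝ} (hs : s ≤ 0) (hC : 0 ≤ C)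
    (h : ∀ m : ℕ, |glCoeff (α - k) m| ≤ C * ((m : ℝ) + 1) ^ s) (N : ℕ) :
    |wsSum α k N| ≤ C * ((N : ℝ) + 1) ^ s := by
  have e1 := h (N + 1)
  have e2 := h N
  have e3 : (((N + 1 : ℕ) : ℝ) + 1) ^ s ≤ ((N : ℝ) + 1) ^ s :=
    Real.rpow_le_rpow_of_nonpos (by positivity) (by push_cast; linarith) hs
  have e4 := e1.trans (mul_le_mul_of_nonneg_left e3 hC)
  have h3 : 0 ≤ (2 - α) / 2 := by linarith
  have h4 : 0 ≤ α / 2 := by linarith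
  calc _ ≤ |α / 2 * glCoeff (α - k) (N + 1)| + |(2 - α) / 2 * glCoeff (α - k) N| := abs_add_le _ _
    _ = α / 2 * |glCoeff (α - k) (N + 1)| + (2 - α) / 2 * |glCoeff (α - k) N| := by
        rw [abs_mul, abs_mul, abs_of_nonneg h3, abs_of_nonneg h4]
    _ ≤ α / 2 * (C * ((N : ℝ) + 1) ^ s) + (2 - α) / 2 * (C * ((N : ℝ) + 1) ^ s) := by gcongr
    _ = _ := by ring

variable {α : ℝ}

/-- The true decay is `N^{-α}`; the weaker rate matches what the other moments allow. -/
lemma exists_abs_wsMoment_zero_le (h1 : 1 < α) (h2 : α < 2) :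
    ∃ C : ℝ, 0 < C ∧ ∀ N : ℕ, |wsMoment α 0 N| ≤ C * ((N : ℝ) + 1) ^ (1 - α) := by
  obtain ⟨C, hC, h⟩ := exists_abs_glCoeff_le (δ := α - 1) (by linarith) (by linarith)
  refine exists_bound_of_tail (w := fun N => ((N : ℝ) + 1) ^ (1 - α)) (fun N => by positivity) 1
    (C := 2 * C) fun N => ?_
  rw [wsMoment_zero_succ]
  have e := abs_wsSum_le (k := 1) h1 h2.le (s := 1 - α) (by linarith) hC.le (fun m => by
    have := h m
    push_cast
    refine this.trans (mul_le_mul_of_nonneg_left ?_ hC.le)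
    refine Real.rpow_le_rpow_of_exponent_le ?_ (by linarith)
    linarith [(Nat.cast_nonneg m : (0 : ℝ) ≤ m)]) N
  have e2 := rpow_le_two_mul_rpow (x := (N : ℝ) + 1) (y := ((N + 1 : ℕ) : ℝ) + 1) (s := 1 - α)
    (by positivity) (by positivity) (by push_cast; linarith [(Nat.cast_nonneg N : (0 : ℝ) ≤ N)])
    (by linarith) (by linarith)
  calc _ ≤ _ := e
    _ ≤ C * (2 * (((N + 1 : ℕ) : ℝ) + 1) ^ (1 - α)) := mul_le_mul_of_nonneg_left e2 hC.le
    _ = _ := by ring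

lemma exists_abs_wsSum_two_le (h1 : 1 < α) (h2 : α < 2) :
    ∃ C : ℝ, 0 < C ∧ ∀ N : ℕ, |wsSum α 2 N| ≤ C * ((N : ℝ) + 3) ^ (1 - α) := by
  obtain ⟨C, hC, h⟩ := exists_abs_glCoeff_le (δ := α - 2) (by linarith) (by linarith)
  refine ⟨4 * C, by positivity, fun N => ?_⟩
  have hN : (0 : ℝ) ≤ N := Nat.cast_nonneg N
  have e := abs_wsSum_le (k := 2) h1 h2.le (s := 1 - α) (by linarith) hC.le (fun m => by
    have := h m
    push_cast
    rwa [show -(α - 2 + 1) = 1 - α by ring] at this) N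
  have e2 := rpow_le_two_mul_rpow (x := (N : ℝ) + 1) (y := (N : ℝ) + 2) (s := 1 - α)
    (by positivity) (by positivity) (by linarith) (by linarith) (by linarith)
  have e3 := rpow_le_two_mul_rpow (x := (N : ℝ) + 2) (y := (N : ℝ) + 3) (s := 1 - α)
    (by positivity) (by positivity) (by linarith) (by linarith) (by linarith)
  calc _ ≤ _ := e
    _ ≤ C * (4 * ((N : ℝ) + 3) ^ (1 - α)) := mul_le_mul_of_nonneg_left (by linarith) hC.le
    _ = _ := by ring

lemma exists_abs_wsMoment_one_le (h1 : 1 < α) (h2 : α < 2) :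
    ∃ C : ℝ, 0 < C ∧ ∀ N : ℕ, |wsMoment α 1 N| ≤ C * ((N : ℝ) + 1) ^ (1 - α) := by
  obtain ⟨C, hC, h⟩ := exists_abs_wsSum_two_le h1 h2
  refine exists_bound_of_tail (w := fun N => ((N : ℝ) + 1) ^ (1 - α)) (fun N => by positivity) 2
    (C := C) fun N => ?_
  rw [wsMoment_one_eq]
  convert h N using 3
  push_cast; ring

lemma exists_abs_wsMoment_three_sub_le (h1 : 1 < α) (h2 : α < 2) :
    ∃ C : ℝ, 0 < C ∧ ∀ N : ℕ,
      |wsMoment α 3 N / 6 - (max ((N : ℝ) - 1) 0) ^ (3 - α) / Real.Gamma (4 - α)|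
        ≤ C * ((N : ℝ) + 1) ^ (1 - α) := by
  obtain ⟨C, hC, h⟩ := exists_abs_wsSum_two_le h1 h2
  obtain ⟨C', hC', h'⟩ := exists_abs_wsSum_four_sub_le h1 h2
  refine exists_bound_of_tail (x := fun N : ℕ => wsMoment α 3 N / 6
    - (max ((N : ℝ) - 1) 0) ^ (3 - α) / Real.Gamma (4 - α))
    (w := fun N => ((N : ℝ) + 1) ^ (1 - α)) (fun N => by positivity) 3
    (C := C + 2 * C') fun N => ?_
  have hN : (0 : ℝ) ≤ N := Nat.cast_nonneg N
  rw [wsMoment_three_eq, max_eq_left (by push_cast; linarith)]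
  have e1 := h (N + 1)
  have e2 := h' N
  push_cast at e1 ⊢
  rw [show (N : ℝ) + 1 + 3 = N + 3 + 1 by ring] at e1
  rw [show (N : ℝ) + 3 - 1 = N + 2 by ring]
  have e3 := rpow_le_two_mul_rpow (x := (N : ℝ) + 2) (y := (N : ℝ) + 3 + 1) (s := 1 - α)
    (by positivity) (by positivity) (by linarith) (by linarith) (by linarith)
  have e4 := mul_le_mul_of_nonneg_left e3 hC'.le
  have e5 : (6 * wsSum α 4 N + wsSum α 2 (N + 1)) / 6 - ((N : ℝ) + 2) ^ (3 - α) / Real.Gamma (4 - α)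
      = (wsSum α 4 N - ((N : ℝ) + 2) ^ (3 - α) / Real.Gamma (4 - α)) + wsSum α 2 (N + 1) / 6 := by ring
  rw [e5]
  refine (abs_add_le _ _).trans ?_
  rw [abs_div, abs_of_pos (by norm_num : (0 : ℝ) < 6)]
  linarith [abs_nonneg (wsSum α 2 (N + 1))]

/-- Linear interpolation of a truncated power. -/
lemma abs_interp_rpow_sub_le {q : ℝ} (hq1 : 1 < q) (hq2 : q < 2) (N : ℕ) {f : ℝ} (hf0 : 0 ≤ f)
    (hf1 : f ≤ 1) :
    |(1 - f) * (max ((N : ℝ) - 1) 0) ^ q + f * (max (((N + 1 : ℕ) : ℝ) - 1) 0) ^ q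
      - (max ((N : ℝ) - 1 + f) 0) ^ q| ≤ 4 * ((N : ℝ) + 1) ^ (q - 2) := by
  have q0 : q ≠ 0 := by linarith
  match N with
  | 0 =>
    have e1 : max (((0 : ℕ) : ℝ) - 1) 0 = 0 := by norm_num
    have e2 : max (((0 + 1 : ℕ) : ℝ) - 1) 0 = 0 := by norm_num
    have e3 : max (((0 : ℕ) : ℝ) - 1 + f) 0 = 0 := max_eq_right (by push_cast; linarith)
    rw [e1, e2, e3, Real.zero_rpow q0]
    norm_num
  | 1 =>
    have e1 : max (((1 : ℕ) : ℝ) - 1) 0 = 0 := by norm_num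
    have e2 : max (((1 + 1 : ℕ) : ℝ) - 1) 0 = 1 := by norm_num
    have e3 : max (((1 : ℕ) : ℝ) - 1 + f) 0 = f := by
      rw [max_eq_left] <;> push_cast <;> linarith
    rw [e1, e2, e3, Real.zero_rpow q0, Real.one_rpow]
    have b1 : f ^ q ≤ 1 := Real.rpow_le_one hf0 hf1 (by linarith)
    have b2 : 0 ≤ f ^ q := Real.rpow_nonneg hf0 _
    have b3 : (1 : ℝ) ≤ 4 * (((1 : ℕ) : ℝ) + 1) ^ (q - 2) := by
      have := rpow_le_two_mul_rpow (x := 1) (y := 2) (s := q - 2) one_pos two_pos (by norm_num)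
        (by linarith) (by linarith)
      rw [Real.one_rpow] at this
      have e : ((1 : ℕ) : ℝ) + 1 = 2 := by norm_num
      rw [e]; linarith
    rw [abs_le]
    constructor <;> linarith
  | N + 2 =>
    have hN : (0 : ℝ) ≤ N := Nat.cast_nonneg N
    push_cast
    rw [show (N : ℝ) + 2 - 1 = N + 1 by ring, show (N : ℝ) + 2 + 1 - 1 = N + 2 by ring,
      max_eq_left (by linarith), max_eq_left (by linarith), max_eq_left (by linarith)]
    set n := (N : ℝ) + 1 with hn
    have hn0 : 0 < n := by positivity
    have en : (N : ℝ) + 2 = n * (1 + 1 / n) := by rw [hn]; field_simp; ring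
    have ef : n + f = n * (1 + f / n) := by field_simp
    have pn : 0 < n ^ q := by positivity
    rw [en, ef, Real.mul_rpow hn0.le (by positivity), Real.mul_rpow hn0.le (by positivity)]
    -- Convexity fixes the sign of the interpolation error. A tangent at `n` from below and a
    -- quadratic bound at `n + 1` from above give its size `n^{q-2}`.
    have tang : 1 + q * (f / n) ≤ (1 + f / n) ^ q :=
      one_add_mul_self_le_rpow_one_add (by
        have : 0 ≤ f / n := by positivity
        linarith) hq1.le
    have sec : (1 + 1 / n) ^ q ≤ 1 + q * (1 / n) + (1 / n) ^ 2 := by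
      have e1 : (1 + 1 / n) ^ q = (1 + 1 / n) * (1 + 1 / n) ^ (q - 1) := by
        rw [Real.rpow_sub_one (by positivity)]; field_simp
      have e2 : (1 + 1 / n) ^ (q - 1) ≤ 1 + (q - 1) * (1 / n) :=
        rpow_one_add_le_one_add_mul_self (by
          have : 0 ≤ 1 / n := by positivity
          linarith) (by linarith) (by linarith)
      rw [e1]
      have e3 := mul_le_mul_of_nonneg_left e2 (by positivity : 0 ≤ 1 + 1 / n)
      nlinarith [sq_nonneg (1 / n)]
    have conv : (1 + f / n) ^ q ≤ (1 - f) * 1 + f * (1 + 1 / n) ^ q := by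
      have h := (convexOn_rpow hq1.le).2 (mem_Ici.2 zero_le_one)
        (mem_Ici.2 (by positivity : 0 ≤ 1 + 1 / n)) (by linarith : 0 ≤ 1 - f) hf0 (by ring)
      simp only [smul_eq_mul, Real.one_rpow] at h
      have e : (1 - f) * 1 + f * (1 + 1 / n) = 1 + f / n := by ring
      rw [e] at h
      exact h
    have e6 : n ^ (q - 2) = n ^ q * (1 / n) ^ 2 := by
      rw [Real.rpow_sub hn0]; norm_num; rw [div_eq_mul_inv]
    have e7 := rpow_le_two_mul_rpow (x := n) (y := (N : ℝ) + 2) (s := q - 2) hn0 (by positivity)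
      (by rw [hn]; linarith) (by linarith) (by linarith)
    have e8 := rpow_le_two_mul_rpow (x := (N : ℝ) + 2) (y := n + 2) (s := q - 2)
      (by positivity) (by positivity) (by rw [hn]; linarith) (by linarith) (by linarith)
    have e9 : n ^ (q - 2) ≤ 4 * ((N : ℝ) + 2 + 1) ^ (q - 2) := by
      rw [show (N : ℝ) + 2 + 1 = n + 2 by rw [hn]; ring]; linarith
    refine le_trans ?_ (show n ^ (q - 2) ≤ 4 * (n * (1 + 1 / n) + 1) ^ (q - 2) by
      rw [← en]; exact e9)
    have e10 : (1 - f) * n ^ q + f * (n ^ q * (1 + 1 / n) ^ q) - n ^ q * (1 + f / n) ^ q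
        = n ^ q * ((1 - f) * 1 + f * (1 + 1 / n) ^ q - (1 + f / n) ^ q) := by ring
    rw [e10, abs_mul, abs_of_pos pn, e6, abs_of_nonneg (by linarith)]
    refine mul_le_mul_of_nonneg_left ?_ pn.le
    have e11 := mul_le_mul_of_nonneg_left sec hf0
    have e12 : f * (1 / n) = f / n := by ring
    have e13 : f * (1 / n) ^ 2 ≤ 1 * (1 / n) ^ 2 := mul_le_mul_of_nonneg_right hf1 (sq_nonneg _)
    nlinarith

/-- The kernel estimate on unit cells. -/
lemma exists_kernel_cell_le (h1 : 1 < α) (h2 : α < 2) :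
    ∃ C : ℝ, 0 < C ∧ ∀ (N : ℕ) (f : ℝ), 0 ≤ f → f ≤ 1 →
      |∑ m ∈ Finset.range (N + 1), wsCoeff α m * (((N : ℝ) - m + f) ^ 3 / 6)
          - (max ((N : ℝ) - 1 + f) 0) ^ (3 - α) / Real.Gamma (4 - α)|
        ≤ C * ((N : ℝ) + 1) ^ (1 - α) := by
  obtain ⟨C0, hC0, h0⟩ := exists_abs_wsMoment_zero_le h1 h2
  obtain ⟨C1, hC1, hm1⟩ := exists_abs_wsMoment_one_le h1 h2
  obtain ⟨C3, hC3, h3⟩ := exists_abs_wsMoment_three_sub_le h1 h2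
  have hΓ : 0 < Real.Gamma (4 - α) := Real.Gamma_pos_of_pos (by linarith)
  refine ⟨C0 + C1 + C3 + 4 / Real.Gamma (4 - α), by positivity, fun N f hf0 hf1 => ?_⟩
  set Γ := Real.Gamma (4 - α)
  set p := ((N : ℝ) + 1) ^ (1 - α) with hp
  have hp0 : 0 < p := by positivity
  have a0 := h0 N
  have a1 := hm1 N
  have a3 := h3 N
  have a3' : |wsMoment α 3 (N + 1) / 6 - (max (((N + 1 : ℕ) : ℝ) - 1) 0) ^ (3 - α) / Γ| ≤ C3 * p := by
    refine (h3 (N + 1)).trans (mul_le_mul_of_nonneg_left ?_ hC3.le)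
    exact Real.rpow_le_rpow_of_nonpos (by positivity) (by push_cast; linarith) (by linarith)
  have ai := abs_interp_rpow_sub_le (q := 3 - α) (by linarith) (by linarith) N hf0 hf1
  rw [show 3 - α - 2 = 1 - α by ring, ← hp] at ai
  set Q0 := (max ((N : ℝ) - 1) 0) ^ (3 - α)
  set Q1 := (max (((N + 1 : ℕ) : ℝ) - 1) 0) ^ (3 - α)
  set Qf := (max ((N : ℝ) - 1 + f) 0) ^ (3 - α)
  -- The identity `(x + f)³ = (1 - f) x³ + f (x + 1)³ - f (1 - f) (3 x + 1 + f)` interpolates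
  -- between consecutive third moments and avoids the second moment, whose available bound is of
  -- order `N^{2-α}`, too large here.
  have split : ∑ m ∈ Finset.range (N + 1), wsCoeff α m * (((N : ℝ) - m + f) ^ 3 / 6)
      = (1 - f) * (wsMoment α 3 N / 6) + f * (wsMoment α 3 (N + 1) / 6)
        - f * (1 - f) / 6 * (3 * wsMoment α 1 N + (1 + f) * wsMoment α 0 N) := by
    rw [wsMoment_succ_eq, wsMoment, wsMoment, wsMoment]
    simp only [Finset.sum_div, Finset.mul_sum, ← Finset.sum_add_distrib, ← Finset.sum_sub_distrib]
    refine Finset.sum_congr rfl fun m _ => ?_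
    ring
  have e : ∑ m ∈ Finset.range (N + 1), wsCoeff α m * (((N : ℝ) - m + f) ^ 3 / 6) - Qf / Γ
      = (1 - f) * (wsMoment α 3 N / 6 - Q0 / Γ) + f * (wsMoment α 3 (N + 1) / 6 - Q1 / Γ)
        + ((1 - f) * Q0 + f * Q1 - Qf) / Γ
        - f * (1 - f) / 6 * (3 * wsMoment α 1 N + (1 + f) * wsMoment α 0 N) := by
    rw [split]; ring
  rw [e]
  have g1 : 0 ≤ 1 - f := by linarith
  have b1 : |(1 - f) * (wsMoment α 3 N / 6 - Q0 / Γ)| ≤ (1 - f) * (C3 * p) := by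
    rw [abs_mul, abs_of_nonneg g1]; exact mul_le_mul_of_nonneg_left a3 g1
  have b2 : |f * (wsMoment α 3 (N + 1) / 6 - Q1 / Γ)| ≤ f * (C3 * p) := by
    rw [abs_mul, abs_of_nonneg hf0]; exact mul_le_mul_of_nonneg_left a3' hf0
  have b3 : |((1 - f) * Q0 + f * Q1 - Qf) / Γ| ≤ 4 / Γ * p := by
    rw [abs_div, abs_of_pos hΓ, div_mul_eq_mul_div]
    exact div_le_div_of_nonneg_right ai hΓ.le
  have b4 : |f * (1 - f) / 6 * (3 * wsMoment α 1 N + (1 + f) * wsMoment α 0 N)|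
      ≤ C1 * p + C0 * p := by
    have c1 : f * (1 - f) / 6 ≤ 1 / 6 := by nlinarith
    have c2 : |3 * wsMoment α 1 N + (1 + f) * wsMoment α 0 N| ≤ 3 * (C1 * p) + 2 * (C0 * p) := by
      refine (abs_add_le _ _).trans ?_
      rw [abs_mul, abs_mul, abs_of_pos three_pos, abs_of_nonneg (by linarith : 0 ≤ 1 + f)]
      have : (1 + f) * |wsMoment α 0 N| ≤ 2 * (C0 * p) :=
        mul_le_mul (by linarith) a0 (abs_nonneg _) two_pos.le
      linarith
    rw [abs_mul, abs_of_nonneg (by positivity : 0 ≤ f * (1 - f) / 6)]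
    have c3 := mul_le_mul c1 c2 (abs_nonneg _) (by norm_num)
    have : 0 ≤ C1 * p := by positivity
    have : 0 ≤ C0 * p := by positivity
    linarith
  rw [abs_le] at b1 b2 b3 b4 ⊢
  constructor <;> linarith [b1.1, b1.2, b2.1, b2.2, b3.1, b3.2, b4.1, b4.2]

/-- The kernel estimate in the integration variable. -/
lemma exists_kernel_le (h1 : 1 < α) (h2 : α < 2) :
    ∃ C : ℝ, 0 < C ∧ ∀ (i : ℕ) (h s : ℝ), 0 < h → 0 < s → s ≤ (i + 1) * h →
      |h ^ (-α) * ∑ m ∈ Finset.range (i + 2), wsCoeff α m * ((max (s - m * h) 0) ^ 3 / 6)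
          - (max (s - h) 0) ^ (3 - α) / Real.Gamma (4 - α)| ≤ C * h ^ 2 * s ^ (1 - α) := by
  obtain ⟨C, hC, hk⟩ := exists_kernel_cell_le h1 h2
  refine ⟨C, hC, fun i h s hh hs hsi => ?_⟩
  set N := ⌊s / h⌋₊ with hN
  set f := s / h - N with hf
  have hsh : 0 ≤ s / h := by positivity
  have f0 : 0 ≤ f := sub_nonneg.2 (Nat.floor_le hsh)
  have f1 : f ≤ 1 := by have := (Nat.lt_floor_add_one (s / h)).le; rw [hf]; linarith
  have hNi : N ≤ i + 1 := by
    refine Nat.floor_le_of_le ?_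
    rw [div_le_iff₀ hh]; push_cast; exact hsi
  have es : s = h * (N + f) := by rw [hf]; field_simp; ring
  have sum_eq : ∑ m ∈ Finset.range (i + 2), wsCoeff α m * ((max (s - m * h) 0) ^ 3 / 6)
      = h ^ 3 * ∑ m ∈ Finset.range (N + 1), wsCoeff α m * (((N : ℝ) - m + f) ^ 3 / 6) := by
    rw [← Finset.sum_range_add_sum_Ico _ (by omega : N + 1 ≤ i + 2), Finset.mul_sum]
    have z : ∑ m ∈ Finset.Ico (N + 1) (i + 2), wsCoeff α m * ((max (s - m * h) 0) ^ 3 / 6) = 0 := by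
      refine Finset.sum_eq_zero fun m hm => ?_
      rw [Finset.mem_Ico] at hm
      have hm' : (N : ℝ) + 1 ≤ m := by exact_mod_cast hm.1
      rw [max_eq_right]
      · simp
      · rw [es]; nlinarith
    rw [z, add_zero]
    refine Finset.sum_congr rfl fun m hm => ?_
    rw [Finset.mem_range] at hm
    have hm' : (m : ℝ) ≤ N := by exact_mod_cast Nat.lt_succ_iff.1 hm
    rw [max_eq_left]
    · rw [es]; ring
    · rw [es]; nlinarith
  have e2 : max (s - h) 0 = h * max ((N : ℝ) - 1 + f) 0 := by
    rw [mul_max_of_nonneg _ _ hh.le, mul_zero, es]; ring_nf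
  have e3 : h ^ (-α) * h ^ 3 = h ^ (3 - α) := by
    rw [← Real.rpow_natCast, ← Real.rpow_add hh]; congr 1; push_cast; ring
  have e4 : h ^ (3 - α) = h ^ 2 * h ^ (1 - α) := by
    rw [← Real.rpow_natCast, ← Real.rpow_add hh]; congr 1; push_cast; ring
  rw [sum_eq, e2, Real.mul_rpow hh.le (le_max_right _ _), ← mul_assoc, e3, mul_div_assoc, ← mul_sub,
    abs_mul, abs_of_pos (by positivity)]
  have key := hk N f f0 f1
  have e5 : h ^ (1 - α) * ((N : ℝ) + 1) ^ (1 - α) ≤ s ^ (1 - α) := by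
    rw [← Real.mul_rpow hh.le (by positivity)]
    refine Real.rpow_le_rpow_of_nonpos hs ?_ (by linarith)
    rw [es]; gcongr
  calc _ ≤ h ^ (3 - α) * (C * ((N : ℝ) + 1) ^ (1 - α)) :=
        mul_le_mul_of_nonneg_left key (by positivity)
    _ = C * h ^ 2 * (h ^ (1 - α) * ((N : ℝ) + 1) ^ (1 - α)) := by rw [e4]; ring
    _ ≤ _ := mul_le_mul_of_nonneg_left e5 (by positivity)

/-! ### Riemann-Liouville derivatives of functions that vanish on a half line -/

/-- `d` lists a function and its first four derivatives on the line, the last one continuous; the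
function vanishes on the negative half line. -/
structure IsCausal (d : ℕ → ℝ → ℝ) : Prop where
  hasDerivAt : ∀ k < 4, ∀ y, HasDerivAt (d k) (d (k + 1) y) y
  continuous_four : Continuous (d 4)
  zero : ∀ y ≤ 0, d 0 y = 0

namespace IsCausal

variable {d : ℕ → ℝ → ℝ}

lemma eq_zero (hd : IsCausal d) {k : ℕ} (hk : k ≤ 3) : ∀ y ≤ 0, d k y = 0 := by
  induction k with
  | zero => exact hd.zero
  | succ k ih =>
    intro y hy
    have h1 := (hd.hasDerivAt k (by omega) y).hasDerivWithinAt (s := Iic 0)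
    have h2 : HasDerivWithinAt (d k) 0 (Iic 0) y :=
      (hasDerivWithinAt_const y (Iic 0) (0 : ℝ)).congr (fun z hz => ih (by omega) z hz)
        (ih (by omega) y hy)
    exact (uniqueDiffOn_Iic (0 : ℝ) y hy).eq_deriv _ h1 h2

lemma continuous (hd : IsCausal d) {k : ℕ} (hk : k ≤ 4) : Continuous (d k) := by
  rcases hk.lt_or_eq with h | h
  · exact continuous_iff_continuousAt.2 fun y => (hd.hasDerivAt k h y).continuousAt
  · rw [h]; exact hd.continuous_four

lemma hasDerivAt_sub_left (hd : IsCausal d) {k : ℕ} (hk : k < 4) (x s : ℝ) :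
    HasDerivAt (fun r => d k (x - r)) (-d (k + 1) (x - s)) s :=
  HasDerivAt.comp_const_sub x s (hd.hasDerivAt k hk (x - s))

/-- Taylor's formula with integral remainder. At `s = x` all boundary terms vanish because `d 0`, …,
`d 3` vanish at 0; at `s = c` only the term without a power of `s - c` is left. -/
lemma integral_cube_mul (hd : IsCausal d) {c x : ℝ} (hc : 0 ≤ c) (hcx : c ≤ x) :
    ∫ s in (0 : ℝ)..x, (max (s - c) 0) ^ 3 / 6 * d 4 (x - s) = d 0 (x - c) := by
  have h4 : Continuous fun s => d 4 (x - s) := hd.continuous_four.comp (by fun_prop)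
  have hcont : Continuous fun s => (max (s - c) 0) ^ 3 / 6 * d 4 (x - s) :=
    (by fun_prop : Continuous fun s : ℝ => (max (s - c) 0) ^ 3 / 6).mul h4
  rw [← intervalIntegral.integral_add_adjacent_intervals (b := c)
    (hcont.intervalIntegrable _ _) (hcont.intervalIntegrable _ _)]
  have e1 : ∫ s in (0 : ℝ)..c, (max (s - c) 0) ^ 3 / 6 * d 4 (x - s) = 0 := by
    rw [intervalIntegral.integral_congr (g := fun _ => (0 : ℝ)), intervalIntegral.integral_zero]
    intro s hs
    rw [uIcc_of_le hc] at hs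
    dsimp only
    rw [max_eq_right (by linarith [hs.2])]; norm_num
  have e2 : ∫ s in c..x, (max (s - c) 0) ^ 3 / 6 * d 4 (x - s)
      = ∫ s in c..x, (s - c) ^ 3 / 6 * d 4 (x - s) := by
    refine intervalIntegral.integral_congr fun s hs => ?_
    rw [uIcc_of_le hcx] at hs
    rw [max_eq_left (by linarith [hs.1])]
  have e3 := intervalIntegral.integral_eq_sub_of_hasDerivAt (a := c) (b := x)
    (f := fun s => -(d 0 (x - s) + (s - c) * d 1 (x - s) + (s - c) ^ 2 / 2 * d 2 (x - s)
      + (s - c) ^ 3 / 6 * d 3 (x - s)))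
    (f' := fun s => (s - c) ^ 3 / 6 * d 4 (x - s)) (fun s _ => by
      have hs : HasDerivAt (fun r : ℝ => r - c) 1 s := (hasDerivAt_id s).sub_const c
      have h0 := hd.hasDerivAt_sub_left (k := 0) (by norm_num) x s
      have h1 := hs.mul (hd.hasDerivAt_sub_left (k := 1) (by norm_num) x s)
      have h2 := ((hs.pow 2).div_const 2).mul (hd.hasDerivAt_sub_left (k := 2) (by norm_num) x s)
      have h3 := ((hs.pow 3).div_const 6).mul (hd.hasDerivAt_sub_left (k := 3) (by norm_num) x s)
      refine ((((h0.add h1).add h2).add h3).neg).congr_deriv ?_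
      simp only [Pi.pow_apply]
      push_cast
      ring) (((by fun_prop : Continuous fun s : ℝ => (s - c) ^ 3 / 6).mul h4).intervalIntegrable _ _)
  rw [e1, e2, e3, hd.eq_zero (k := 1) (by norm_num) _ (by simp),
    hd.eq_zero (k := 2) (by norm_num) _ (by simp), hd.eq_zero (k := 3) (by norm_num) _ (by simp),
    hd.zero _ (by simp)]
  simp

end IsCausal

/-- The kernel may be singular: the variable enters only through the smooth factor, whose derivative
is bounded on a compact set, so integrability of `k` suffices for domination. -/
lemma hasDerivAt_integral_mul_comp_sub {k v v' : ℝ → ℝ} {B : ℝ}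
    (hk : IntervalIntegrable k MeasureTheory.volume 0 B)
    (hv : ∀ y, HasDerivAt v (v' y) y) (hv' : Continuous v') (x : ℝ) :
    HasDerivAt (fun z => ∫ s in (0 : ℝ)..B, k s * v (z - s))
      (∫ s in (0 : ℝ)..B, k s * v' (x - s)) x := by
  have hvc : Continuous v := continuous_iff_continuousAt.2 fun y => (hv y).continuousAt
  obtain ⟨K, hK⟩ := (isCompact_Icc (a := x - 1 - |B|) (b := x + 1 + |B|)).exists_bound_of_continuousOn
    hv'.continuousOn
  refine (intervalIntegral.hasDerivAt_integral_of_dominated_loc_of_deriv_le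
    (F := fun z s => k s * v (z - s)) (F' := fun z s => k s * v' (z - s))
    (bound := fun s => |k s| * K) (Metric.ball_mem_nhds x one_pos) ?_ ?_ ?_ ?_ ?_ ?_).2
  · refine Filter.Eventually.of_forall fun z => ?_
    exact (hk.mul_continuousOn (by fun_prop : Continuous fun s => v (z - s)).continuousOn).aestronglyMeasurable_restrict_uIoc
  · exact hk.mul_continuousOn (by fun_prop : Continuous fun s => v (x - s)).continuousOn
  · exact (hk.mul_continuousOn (by fun_prop : Continuous fun s => v' (x - s)).continuousOn).aestronglyMeasurable_restrict_uIoc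
  · refine Filter.Eventually.of_forall fun s hs z hz => ?_
    rw [Real.norm_eq_abs, abs_mul]
    refine mul_le_mul_of_nonneg_left (hK _ ?_) (abs_nonneg _)
    rw [Metric.mem_ball, Real.dist_eq, abs_lt] at hz
    have h1 : |s| ≤ |B| := by
      rcases le_total 0 B with h | h
      · rw [uIoc_of_le h] at hs; rw [abs_of_pos hs.1, abs_of_nonneg h]; exact hs.2
      · rw [uIoc_of_ge h] at hs; rw [abs_of_nonpos hs.2, abs_of_nonpos h]; linarith [hs.1]
    have h2 := abs_le.1 h1
    constructor <;> linarith
  · exact hk.abs.mul_const K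
  · refine Filter.Eventually.of_forall fun s _ z _ => ?_
    exact (HasDerivAt.comp_sub_const z s (hv (z - s))).const_mul (k s)

lemma rlOrder_of_lt_two {α : ℝ} (h1 : 1 ≤ α) (h2 : α < 2) : rlOrder α = 2 := by
  rw [rlOrder, (Nat.floor_eq_iff (n := 1) (by linarith)).2 ⟨by exact_mod_cast h1, by norm_num; exact h2⟩]

/-- Substituting `s = z - ξ` puts `z` into the smooth factor. As the function vanishes on the
negative half line, the upper limit may be frozen at `x + 1` for `z` near `x`, and the two outer
derivatives pass under the integral. Two integrations by parts then trade `d 2` for `d 4` without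
boundary terms. -/
lemma IsCausal.rlLeft_eq {α : ℝ} (h1 : 1 < α) (h2 : α < 2) {d : ℕ → ℝ → ℝ} (hd : IsCausal d)
    {x : ℝ} (hx : 0 < x) :
    rlLeft α (d 0) x
      = ∫ s in (0 : ℝ)..x, s ^ (3 - α) / Real.Gamma (4 - α) * d 4 (x - s) := by
  have c2 : (0 : ℝ) < 2 - α := by linarith
  have hG : Real.Gamma (4 - α) = (3 - α) * ((2 - α) * Real.Gamma (2 - α)) := by
    rw [← Real.Gamma_add_one c2.ne', show 2 - α + 1 = 3 - α by ring,
      ← Real.Gamma_add_one (by linarith), show 3 - α + 1 = 4 - α by ring]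
  have hGp : 0 < Real.Gamma (2 - α) := Real.Gamma_pos_of_pos c2
  have hki : ∀ B : ℝ, IntervalIntegrable (fun s : ℝ => s ^ (1 - α)) MeasureTheory.volume 0 B :=
    fun B => intervalIntegral.intervalIntegrable_rpow' (by linarith)
  have cut : ∀ z B : ℝ, 0 ≤ z → z ≤ B → ∀ k ≤ 3,
      ∫ s in (0 : ℝ)..B, s ^ (1 - α) * d k (z - s) = ∫ s in (0 : ℝ)..z, s ^ (1 - α) * d k (z - s) := by
    intro z B hz hzB k hk
    have hi : ∀ p q : ℝ, 0 ≤ p → p ≤ q → IntervalIntegrable (fun s : ℝ => s ^ (1 - α) * d k (z - s))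
        MeasureTheory.volume p q := fun p q _ _ =>
      (intervalIntegral.intervalIntegrable_rpow' (by linarith)).mul_continuousOn
        ((hd.continuous (by omega)).comp (by fun_prop : Continuous fun s => z - s)).continuousOn
    rw [← intervalIntegral.integral_add_adjacent_intervals (hi 0 z le_rfl hz) (hi z B hz hzB),
      add_eq_left, intervalIntegral.integral_congr (g := fun _ => (0 : ℝ)),
      intervalIntegral.integral_zero]
    intro s hs
    rw [uIcc_of_le hzB] at hs
    simp only
    rw [hd.eq_zero hk _ (by linarith [hs.1]), mul_zero]
  have e1 : (fun z : ℝ => ∫ ξ in (0 : ℝ)..z, (z - ξ) ^ ((rlOrder α : ℝ) - α - 1) * d 0 ξ)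
      =ᶠ[nhds x] fun z => ∫ s in (0 : ℝ)..(x + 1), s ^ (1 - α) * d 0 (z - s) := by
    filter_upwards [Ioo_mem_nhds hx (lt_add_one x)] with z hz
    have h := intervalIntegral.integral_comp_sub_left (a := 0) (b := z)
      (fun s => s ^ (1 - α) * d 0 (z - s)) z
    simp only [sub_self, sub_zero, sub_sub_cancel] at h
    rw [cut z (x + 1) hz.1.le hz.2.le 0 (by norm_num), rlOrder_of_lt_two h1.le h2, ← h,
      show ((2 : ℕ) : ℝ) - α - 1 = 1 - α by push_cast; ring]
  have e2 : iteratedDeriv 2 (fun z => ∫ s in (0 : ℝ)..(x + 1), s ^ (1 - α) * d 0 (z - s))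
      = fun z => ∫ s in (0 : ℝ)..(x + 1), s ^ (1 - α) * d 2 (z - s) := by
    rw [iteratedDeriv_succ, iteratedDeriv_one]
    have f1 : deriv (fun z => ∫ s in (0 : ℝ)..(x + 1), s ^ (1 - α) * d 0 (z - s))
        = fun z => ∫ s in (0 : ℝ)..(x + 1), s ^ (1 - α) * d 1 (z - s) := funext fun z =>
      (hasDerivAt_integral_mul_comp_sub (hki _) (hd.hasDerivAt 0 (by norm_num))
        (hd.continuous (by norm_num)) z).deriv
    rw [f1]
    exact funext fun z => (hasDerivAt_integral_mul_comp_sub (hki _) (hd.hasDerivAt 1 (by norm_num))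
        (hd.continuous (by norm_num)) z).deriv
  have hx4 : Continuous fun s => d 4 (x - s) := hd.continuous_four.comp (by fun_prop)
  have hx3 : Continuous fun s => d 3 (x - s) := (hd.continuous (by norm_num)).comp (by fun_prop)
  have hx2 : Continuous fun s => d 2 (x - s) := (hd.continuous (by norm_num)).comp (by fun_prop)
  have hr : ∀ q : ℝ, 0 ≤ q → Continuous fun s : ℝ => s ^ q := fun q hq =>
    Real.continuous_rpow_const hq
  have i1 : IntervalIntegrable (fun s : ℝ => s ^ (1 - α) * d 2 (x - s)) MeasureTheory.volume 0 x :=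
    (hki x).mul_continuousOn hx2.continuousOn
  have i2 : IntervalIntegrable (fun s : ℝ => s ^ (3 - α) / ((2 - α) * (3 - α)) * d 4 (x - s))
      MeasureTheory.volume 0 x :=
    ((((hr (3 - α) (by linarith)).div_const _)).mul hx4).intervalIntegrable _ _
  have e3 := intervalIntegral.integral_eq_sub_of_hasDerivAt_of_le (a := 0) (b := x) hx.le
    (f := fun s => s ^ (2 - α) / (2 - α) * d 2 (x - s)
      + s ^ (3 - α) / ((2 - α) * (3 - α)) * d 3 (x - s))
    (f' := fun s => s ^ (1 - α) * d 2 (x - s) - s ^ (3 - α) / ((2 - α) * (3 - α)) * d 4 (x - s))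
    (by
      exact ((((hr (2 - α) c2.le).div_const _).mul hx2).add
        (((hr (3 - α) (by linarith)).div_const _).mul hx3)).continuousOn)
    (fun s hs => by
      have g1 := ((Real.hasDerivAt_rpow_const (p := 2 - α) (Or.inl hs.1.ne')).div_const (2 - α)).mul
        (hd.hasDerivAt_sub_left (k := 2) (by norm_num) x s)
      have g2 := ((Real.hasDerivAt_rpow_const (p := 3 - α) (Or.inl hs.1.ne')).div_const
        ((2 - α) * (3 - α))).mul (hd.hasDerivAt_sub_left (k := 3) (by norm_num) x s)
      refine (g1.add g2).congr_deriv ?_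
      have hne : (3 - α) ≠ 0 := by linarith
      rw [show 2 - α - 1 = 1 - α by ring, show 3 - α - 1 = 2 - α by ring]
      field_simp
      ring)
    (i1.sub i2)
  rw [intervalIntegral.integral_sub i1 i2, sub_self, hd.eq_zero (k := 2) (by norm_num) 0 le_rfl,
    hd.eq_zero (k := 3) (by norm_num) 0 le_rfl, Real.zero_rpow c2.ne',
    Real.zero_rpow (by linarith : (3 - α) ≠ 0)] at e3
  rw [rlLeft, rlOrder_of_lt_two h1.le h2]
  rw [rlOrder_of_lt_two h1.le h2] at e1
  rw [e1.iteratedDeriv_eq 2, e2]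
  beta_reduce
  rw [cut x (x + 1) hx.le (by linarith) 2 (by norm_num)]
  have e4 : ∫ s in (0 : ℝ)..x, s ^ (1 - α) * d 2 (x - s)
      = ∫ s in (0 : ℝ)..x, s ^ (3 - α) / ((2 - α) * (3 - α)) * d 4 (x - s) := by
    simp only [zero_div, zero_mul, mul_zero, add_zero, sub_zero] at e3
    linarith
  rw [e4, ← intervalIntegral.integral_const_mul]
  refine intervalIntegral.integral_congr fun s _ => ?_
  rw [hG]
  have hne : (3 - α) ≠ 0 := by linarith
  push_cast
  field_simp

/-! ### Taylor's formula for one-sided derivatives -/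

/-- Induction through the mean value inequality: the derivative of a remainder is the remainder of
the next function in the list. The factor `1 / n!` is given up, and derivatives relative to a set
are enough, so end points are allowed. -/
lemma abs_sub_taylor_le {S : Set ℝ} {M : ℝ} {x y : ℝ} (n : ℕ) (g : ℕ → ℝ → ℝ)
    (hS : uIcc x y ⊆ S)
    (hg : ∀ k < n, ∀ z ∈ uIcc x y, HasDerivWithinAt (g k) (g (k + 1) z) S z)
    (hM : ∀ z ∈ uIcc x y, |g n z| ≤ M) :
    |g 0 y - ∑ k ∈ Finset.range n, g k x * ((y - x) ^ k / k.factorial)| ≤ M * |y - x| ^ n := by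
  induction n generalizing g y with
  | zero => simpa using hM y right_mem_uIcc
  | succ n ih =>
    have hM0 : 0 ≤ M := (abs_nonneg _).trans (hM x left_mem_uIcc)
    set P : ℝ → ℝ := fun z => g 0 z
      - ∑ k ∈ Finset.range (n + 1), g k x * ((z - x) ^ k / k.factorial) with hP
    have hder : ∀ z ∈ uIcc x y, HasDerivWithinAt P (g 1 z
        - ∑ k ∈ Finset.range n, g (k + 1) x * ((z - x) ^ k / k.factorial)) (uIcc x y) z := by
      intro z hz
      refine ((hg 0 (by omega) z hz).mono hS).sub ?_
      have hs : ∀ k ∈ Finset.range (n + 1), HasDerivWithinAt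
          (fun z => g k x * ((z - x) ^ k / k.factorial))
          (g k x * ((k : ℝ) * (z - x) ^ (k - 1) / k.factorial)) (uIcc x y) z := fun k _ => by
        have h1 : HasDerivAt (fun z => (z - x) ^ k) ((k : ℝ) * (z - x) ^ (k - 1) * 1) z :=
          ((hasDerivAt_id z).sub_const x).pow k
        rw [mul_one] at h1
        exact ((h1.div_const _).const_mul _).hasDerivWithinAt
      refine (HasDerivWithinAt.fun_sum hs).congr_deriv ?_
      rw [Finset.sum_range_succ']
      simp only [CharP.cast_eq_zero, zero_mul, zero_div, mul_zero, add_zero]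
      refine Finset.sum_congr rfl fun k _ => ?_
      rw [Nat.factorial_succ, Nat.add_sub_cancel]
      push_cast
      have : (k.factorial : ℝ) ≠ 0 := by exact_mod_cast k.factorial_ne_zero
      have : (k : ℝ) + 1 ≠ 0 := by positivity
      field_simp
    have hbd : ∀ z ∈ uIcc x y, ‖g 1 z
        - ∑ k ∈ Finset.range n, g (k + 1) x * ((z - x) ^ k / k.factorial)‖ ≤ M * |y - x| ^ n := by
      intro z hz
      have hsub : uIcc x z ⊆ uIcc x y := uIcc_subset_uIcc_left hz
      refine (ih (y := z) (fun k => g (k + 1)) (hsub.trans hS)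
        (fun k hk w hw => hg (k + 1) (by omega) w (hsub hw)) (fun w hw => hM w (hsub hw))).trans ?_
      exact mul_le_mul_of_nonneg_left
        (pow_le_pow_left₀ (abs_nonneg _) (abs_sub_left_of_mem_uIcc hz) n) hM0
    have h := (convex_uIcc x y).norm_image_sub_le_of_norm_hasDerivWithin_le hder hbd
      left_mem_uIcc right_mem_uIcc
    have hPx : P x = 0 := by
      simp only [hP]
      rw [Finset.sum_range_succ']
      simp
    rw [hPx, sub_zero, Real.norm_eq_abs, Real.norm_eq_abs] at h
    calc |P y| ≤ M * |y - x| ^ n * |y - x| := h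
      _ = M * |y - x| ^ (n + 1) := by ring

/-! ### Truncation error of the weighted shifted Grünwald approximation -/

/-- Both terms are integrals over `[0, (i + 1) h]` of `d 4 ((i + 1) h - s)` against a kernel. The
derivative is taken one node further left than the base point of the sum, hence the shift by `h` in
its kernel. The kernels differ by `C h² s^{1-α}`, and the integral of this power gives `((i + 1)
h)^{2-α} / (2 - α)`. -/
lemma IsCausal.exists_abs_wsSum_sub_le {α : ℝ} (h1 : 1 < α) (h2 : α < 2) :
    ∃ C : ℝ, 0 < C ∧ ∀ (d : ℕ → ℝ → ℝ) (M h : ℝ) (i : ℕ), IsCausal d → 0 < h → 0 < i →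
      (∀ y ∈ Icc 0 ((i + 1) * h), |d 4 y| ≤ M) →
      |h ^ (-α) * ∑ m ∈ Finset.range (i + 2), wsCoeff α m * d 0 ((i + 1) * h - m * h)
          - rlLeft α (d 0) (i * h)| ≤ C * M * h ^ 2 * ((i + 1) * h) ^ (2 - α) := by
  obtain ⟨C, hC, hker⟩ := exists_kernel_le h1 h2
  refine ⟨C / (2 - α), div_pos hC (by linarith), fun d M h i hd hh hi hM => ?_⟩
  set X : ℝ := (i + 1) * h with hX
  have hX0 : 0 < X := by positivity
  have h4 : Continuous fun s => d 4 (X - s) := hd.continuous_four.comp (by fun_prop)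
  have hcub : ∀ c : ℝ, Continuous fun s => (max (s - c) 0) ^ 3 / 6 * d 4 (X - s) := fun c =>
    (by fun_prop : Continuous fun s : ℝ => (max (s - c) 0) ^ 3 / 6).mul h4
  have e1 : h ^ (-α) * ∑ m ∈ Finset.range (i + 2), wsCoeff α m * d 0 (X - m * h)
      = ∫ s in (0 : ℝ)..X, (h ^ (-α) * ∑ m ∈ Finset.range (i + 2),
          wsCoeff α m * ((max (s - m * h) 0) ^ 3 / 6)) * d 4 (X - s) := by
    have : ∀ s : ℝ, (h ^ (-α) * ∑ m ∈ Finset.range (i + 2),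
          wsCoeff α m * ((max (s - m * h) 0) ^ 3 / 6)) * d 4 (X - s)
        = h ^ (-α) * ∑ m ∈ Finset.range (i + 2),
          wsCoeff α m * ((max (s - m * h) 0) ^ 3 / 6 * d 4 (X - s)) := fun s => by
      rw [mul_assoc, Finset.sum_mul]
      congr 1
      exact Finset.sum_congr rfl fun m _ => by ring
    simp only [this]
    rw [intervalIntegral.integral_const_mul, intervalIntegral.integral_finsetSum]
    · congr 1
      refine Finset.sum_congr rfl fun m hm => ?_
      rw [intervalIntegral.integral_const_mul, hd.integral_cube_mul (by positivity)]
      have : (m : ℝ) ≤ i + 1 := by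
        have := Finset.mem_range.1 hm
        exact_mod_cast (by omega : m ≤ i + 1)
      rw [hX]; gcongr
    · exact fun m _ => ((hcub _).const_mul _).intervalIntegrable _ _
  have hq : Continuous fun s : ℝ => (max (s - h) 0) ^ (3 - α) / Real.Gamma (4 - α) :=
    ((Real.continuous_rpow_const (by linarith)).comp (by fun_prop :
      Continuous fun s : ℝ => max (s - h) 0)).div_const _
  have hq4 : Continuous fun s : ℝ =>
    (max (s - h) 0) ^ (3 - α) / Real.Gamma (4 - α) * d 4 (X - s) := hq.mul h4
  have e2 : rlLeft α (d 0) (i * h)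
      = ∫ s in (0 : ℝ)..X, (max (s - h) 0) ^ (3 - α) / Real.Gamma (4 - α) * d 4 (X - s) := by
    have hi' : (0 : ℝ) < i := by exact_mod_cast hi
    rw [hd.rlLeft_eq h1 h2 (by positivity), ← intervalIntegral.integral_add_adjacent_intervals
      (b := h) (hq4.intervalIntegrable _ _) (hq4.intervalIntegrable _ _),
      intervalIntegral.integral_congr (a := 0) (b := h) (g := fun _ => (0 : ℝ)),
      intervalIntegral.integral_zero, zero_add]
    · have e := intervalIntegral.integral_comp_sub_right (a := h) (b := X)
        (fun s => s ^ (3 - α) / Real.Gamma (4 - α) * d 4 (i * h - s)) h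
      rw [sub_self, show X - h = i * h by rw [hX]; ring] at e
      rw [← e]
      refine intervalIntegral.integral_congr fun s hs => ?_
      rw [uIcc_of_le (by rw [hX]; nlinarith)] at hs
      rw [max_eq_left (by linarith [hs.1]), show (i : ℝ) * h - (s - h) = X - s by rw [hX]; ring]
    · intro s hs
      rw [uIcc_of_le hh.le] at hs
      beta_reduce
      rw [max_eq_right (by linarith [hs.2]), Real.zero_rpow (by linarith), zero_div, zero_mul]
  have hksum : Continuous fun s : ℝ => h ^ (-α) * ∑ m ∈ Finset.range (i + 2),
      wsCoeff α m * ((max (s - m * h) 0) ^ 3 / 6) := by fun_prop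
  have hk4 : Continuous fun s : ℝ => (h ^ (-α) * ∑ m ∈ Finset.range (i + 2),
      wsCoeff α m * ((max (s - m * h) 0) ^ 3 / 6)) * d 4 (X - s) := hksum.mul h4
  rw [e1, e2, ← intervalIntegral.integral_sub (hk4.intervalIntegrable _ _)
    (hq4.intervalIntegrable _ _)]
  have hki : IntervalIntegrable (fun s : ℝ => C * h ^ 2 * M * s ^ (1 - α)) MeasureTheory.volume 0 X :=
    (intervalIntegral.intervalIntegrable_rpow' (by linarith)).const_mul _
  have e3 := intervalIntegral.norm_integral_le_of_norm_le hX0.le (μ := MeasureTheory.volume)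
    (f := fun s => (h ^ (-α) * ∑ m ∈ Finset.range (i + 2),
      wsCoeff α m * ((max (s - m * h) 0) ^ 3 / 6)) * d 4 (X - s)
      - (max (s - h) 0) ^ (3 - α) / Real.Gamma (4 - α) * d 4 (X - s))
    (g := fun s : ℝ => C * h ^ 2 * M * s ^ (1 - α))
    (Filter.Eventually.of_forall fun s hs => by
      rw [← sub_mul, norm_mul, Real.norm_eq_abs, Real.norm_eq_abs]
      have k1 := hker i h s hh hs.1 hs.2
      have k2 := hM (X - s) ⟨by linarith [hs.2], by linarith [hs.1]⟩
      calc _ ≤ C * h ^ 2 * s ^ (1 - α) * M :=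
            mul_le_mul k1 k2 (abs_nonneg _) (mul_nonneg (by positivity)
              (Real.rpow_nonneg hs.1.le _))
        _ = _ := by ring) hki
  rw [Real.norm_eq_abs, intervalIntegral.integral_const_mul,
    integral_rpow (Or.inl (by linarith)), show 1 - α + 1 = 2 - α by ring,
    Real.zero_rpow (by linarith)] at e3
  refine e3.trans (le_of_eq ?_)
  ring

/-! ### Smooth functions of one space variable -/

lemma smoothSet_two (L : ℝ) : smoothSet 2 L = Icc 0 L := by
  ext x; simp [smoothSet]

lemma smoothSet_of_ne {α : ℝ} (h : α ≠ 2) (L : ℝ) : smoothSet α L = univ := by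
  simp [smoothSet, h]

lemma Icc_subset_smoothSet (α L : ℝ) : Icc 0 L ⊆ smoothSet α L := fun _ hx _ => hx

lemma sub_mem_smoothSet {α L x : ℝ} (h : x ∈ smoothSet α L) : L - x ∈ smoothSet α L := fun hα =>
  ⟨by linarith [(h hα).2], by linarith [(h hα).1]⟩

/-- `d` lists a function and its first four derivatives, bounded by `M` on `[0, L]`; the function
vanishes where the Dirichlet condition asks for it. -/
structure IsSmoothLine (α L M : ℝ) (d : ℕ → ℝ → ℝ) : Prop where
  hasDeriv : ∀ k < 4, ∀ x ∈ smoothSet α L,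
    HasDerivWithinAt (d k) (d (k + 1) x) (smoothSet α L) x
  cont : ContinuousOn (d 4) (smoothSet α L)
  zero : ∀ x ∈ smoothSet α L, x ∉ Ioo 0 L → d 0 x = 0
  bound : ∀ k ≤ 4, ∀ x ∈ Icc 0 L, |d k x| ≤ M

namespace IsSmoothLine

variable {α L M M' : ℝ} {d d' : ℕ → ℝ → ℝ}

lemma sub (h : IsSmoothLine α L M d) (h' : IsSmoothLine α L M' d') :
    IsSmoothLine α L (M + M') (fun k x => d k x - d' k x) where
  hasDeriv k hk x hx := (h.hasDeriv k hk x hx).sub (h'.hasDeriv k hk x hx)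
  cont := h.cont.sub h'.cont
  zero x hx hx' := by rw [h.zero x hx hx', h'.zero x hx hx', sub_zero]
  bound k hk x hx := (abs_sub _ _).trans (add_le_add (h.bound k hk x hx) (h'.bound k hk x hx))

lemma reflect (h : IsSmoothLine α L M d) :
    IsSmoothLine α L M (fun k x => (-1) ^ k * d k (L - x)) where
  hasDeriv k hk x hx := by
    have h1 := h.hasDeriv k hk (L - x) (sub_mem_smoothSet hx)
    have h2 : HasDerivWithinAt (fun x => L - x) (-1) (smoothSet α L) x :=
      ((hasDerivAt_id x).const_sub L).hasDerivWithinAt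
    have h3 := (HasDerivWithinAt.comp x h1 h2 fun y hy => sub_mem_smoothSet hy).const_mul
      ((-1 : ℝ) ^ k)
    refine h3.congr_deriv ?_
    ring
  cont := continuousOn_const.mul (h.cont.comp (by fun_prop) fun y hy => sub_mem_smoothSet hy)
  zero x hx hx' := by
    rw [h.zero (L - x) (sub_mem_smoothSet hx) fun hc => hx' ⟨by linarith [hc.2], by linarith [hc.1]⟩,
      mul_zero]
  bound k hk x hx := by
    rw [abs_mul, abs_pow, abs_neg, abs_one, one_pow, one_mul]
    exact h.bound k hk _ ⟨by linarith [hx.2], by linarith [hx.1]⟩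

lemma isCausal (h : IsSmoothLine α L M d) (hα : α ≠ 2) : IsCausal d where
  hasDerivAt k hk y := by
    have := h.hasDeriv k hk y (by rw [smoothSet_of_ne hα]; trivial)
    rwa [smoothSet_of_ne hα, hasDerivWithinAt_univ] at this
  continuous_four := by
    have := h.cont
    rwa [smoothSet_of_ne hα, continuousOn_univ] at this
  zero y hy := h.zero y (by rw [smoothSet_of_ne hα]; trivial) fun hc => by linarith [hc.1]

/-- The sign `(-1)^n` of the right derivative cancels the one produced by differentiating a
composition with `L - x`. -/
lemma rlRight_eq_rlLeft (α L : ℝ) (w : ℝ → ℝ) (x : ℝ) :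
    rlRight α L w x = rlLeft α (fun y => w (L - y)) (L - x) := by
  rw [rlRight, rlLeft]
  have e : (fun z : ℝ => ∫ ξ in z..L, (ξ - z) ^ ((rlOrder α : ℝ) - α - 1) * w ξ)
      = fun z => (fun z : ℝ => ∫ ξ in (0 : ℝ)..z, (z - ξ) ^ ((rlOrder α : ℝ) - α - 1)
        * w (L - ξ)) (L - z) := funext fun z => by
    have h := intervalIntegral.integral_comp_sub_left (a := 0) (b := L - z)
      (fun ξ => (ξ - z) ^ ((rlOrder α : ℝ) - α - 1) * w ξ) L
    rw [sub_sub_cancel, sub_zero] at h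
    rw [← h]
    refine intervalIntegral.integral_congr fun ξ _ => ?_
    rw [sub_right_comm]
  rw [e, iteratedDeriv_comp_const_sub (rlOrder α) (fun z : ℝ => ∫ ξ in (0 : ℝ)..z,
    (z - ξ) ^ ((rlOrder α : ℝ) - α - 1) * w (L - ξ))]
  simp only [smul_eq_mul]
  rw [← mul_assoc, div_mul_eq_mul_div, ← mul_pow]
  norm_num

/-- Here `rlOrder 2 = 3`, so the kernel has exponent 0, and three derivatives act on a plain
primitive. -/
lemma rlLeft_two_eq (h : IsSmoothLine 2 L M d) {x : ℝ} (hx : x ∈ Ioo 0 L) :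
    rlLeft 2 (d 0) x = d 2 x := by
  have hr : rlOrder 2 = 3 := by simp [rlOrder]
  have hda : ∀ k < 4, ∀ z ∈ Ioo 0 L, HasDerivAt (d k) (d (k + 1) z) z := fun k hk z hz => by
    have := h.hasDeriv k hk z (by rw [smoothSet_two]; exact Ioo_subset_Icc_self hz)
    rw [smoothSet_two] at this
    exact this.hasDerivAt (Icc_mem_nhds hz.1 hz.2)
  have hc : ContinuousOn (d 0) (Icc 0 L) := fun z hz => by
    have := (h.hasDeriv 0 (by norm_num) z (by rw [smoothSet_two]; exact hz)).continuousWithinAt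
    rwa [smoothSet_two] at this
  have hn : Ioo 0 L ∈ nhds x := isOpen_Ioo.mem_nhds hx
  have e0 : (fun z : ℝ => ∫ ξ in (0 : ℝ)..z, (z - ξ) ^ ((rlOrder 2 : ℝ) - 2 - 1) * d 0 ξ)
      = fun z : ℝ => ∫ ξ in (0 : ℝ)..z, d 0 ξ := by
    rw [hr]; norm_num
  have e1 : deriv (fun z : ℝ => ∫ ξ in (0 : ℝ)..z, d 0 ξ) =ᶠ[nhds x] d 0 := by
    filter_upwards [hn] with z hz
    refine (intervalIntegral.integral_hasDerivAt_right
      ((hc.mono (Icc_subset_Icc_right hz.2.le)).intervalIntegrable_of_Icc hz.1.le)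
      ((hc.mono Ioo_subset_Icc_self).stronglyMeasurableAtFilter isOpen_Ioo z hz) ?_).deriv
    exact (hda 0 (by norm_num) z hz).continuousAt
  have e2 : deriv (d 0) =ᶠ[nhds x] d 1 := by
    filter_upwards [hn] with z hz
    exact (hda 0 (by norm_num) z hz).deriv
  rw [rlLeft, e0, hr, iteratedDeriv_succ', (e1.iteratedDeriv_eq 2), iteratedDeriv_succ',
    (e2.iteratedDeriv_eq 1), iteratedDeriv_one, (hda 1 (by norm_num) x hx).deriv]
  norm_num

/-- Linearity is not formal, since `iteratedDeriv` takes default values where derivatives do not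
exist; it is read off from the explicit formulas. -/
lemma rlLeft_sub (h1 : 1 < α) (h2 : α ≤ 2) (h : IsSmoothLine α L M d)
    (h' : IsSmoothLine α L M' d') {x : ℝ} (hx : x ∈ Ioo 0 L) :
    rlLeft α (fun y => d 0 y - d' 0 y) x = rlLeft α (d 0) x - rlLeft α (d' 0) x := by
  rcases h2.lt_or_eq with h2 | rfl
  · rw [((h.sub h').isCausal h2.ne).rlLeft_eq h1 h2 hx.1, (h.isCausal h2.ne).rlLeft_eq h1 h2 hx.1,
      (h'.isCausal h2.ne).rlLeft_eq h1 h2 hx.1]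
    have hi : ∀ {e : ℕ → ℝ → ℝ}, IsCausal e → IntervalIntegrable
        (fun s => s ^ (3 - α) / Real.Gamma (4 - α) * e 4 (x - s)) MeasureTheory.volume 0 x :=
      fun he => Continuous.intervalIntegrable
        (((Real.continuous_rpow_const (by linarith)).div_const _).mul
          (he.continuous_four.comp (by fun_prop : Continuous fun s => x - s))) _ _
    rw [← intervalIntegral.integral_sub (hi (h.isCausal h2.ne)) (hi (h'.isCausal h2.ne))]
    refine intervalIntegral.integral_congr fun s _ => ?_
    ring
  · rw [(h.sub h').rlLeft_two_eq hx, h.rlLeft_two_eq hx, h'.rlLeft_two_eq hx]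

lemma rieszDeriv_sub (h1 : 1 < α) (h2 : α ≤ 2) (h : IsSmoothLine α L M d)
    (h' : IsSmoothLine α L M' d') {x : ℝ} (hx : x ∈ Ioo 0 L) :
    rieszDeriv α L (fun y => d 0 y - d' 0 y) x
      = rieszDeriv α L (d 0) x - rieszDeriv α L (d' 0) x := by
  have e := rlLeft_sub h1 h2 h.reflect h'.reflect (x := L - x)
    ⟨by linarith [hx.2], by linarith [hx.1]⟩
  simp only [pow_zero, one_mul] at e
  rw [rieszDeriv, rieszDeriv, rieszDeriv, rlRight_eq_rlLeft, rlRight_eq_rlLeft, rlRight_eq_rlLeft,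
    rlLeft_sub h1 h2 h h' hx, e]
  ring

lemma exists_abs_rlLeft_le (h1 : 1 < α) (h2 : α ≤ 2) (L : ℝ) :
    ∃ C : ℝ, 0 < C ∧ ∀ d M, IsSmoothLine α L M d → ∀ x ∈ Ioo 0 L, |rlLeft α (d 0) x| ≤ C * M := by
  rcases h2.lt_or_eq with h2 | rfl
  · refine ⟨(|L| + 1) ^ (3 - α) / Real.Gamma (4 - α) * (|L| + 1), ?_, fun d M h x hx => ?_⟩
    · have := Real.Gamma_pos_of_pos (by linarith : 0 < 4 - α)
      positivity
    have hG := Real.Gamma_pos_of_pos (by linarith : 0 < 4 - α)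
    have hM : 0 ≤ M := (abs_nonneg _).trans (h.bound 0 (by norm_num) x (Ioo_subset_Icc_self hx))
    rw [(h.isCausal h2.ne).rlLeft_eq h1 h2 hx.1]
    have hxL : x ≤ |L| + 1 := by linarith [hx.2, le_abs_self L]
    have e := intervalIntegral.norm_integral_le_of_norm_le_const (a := 0) (b := x)
      (f := fun s => s ^ (3 - α) / Real.Gamma (4 - α) * d 4 (x - s))
      (C := (|L| + 1) ^ (3 - α) / Real.Gamma (4 - α) * M) (fun s hs => by
        rw [uIoc_of_le hx.1.le] at hs
        have k1 := h.bound 4 le_rfl (x - s) ⟨by linarith [hs.2], by linarith [hs.1, hx.2]⟩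
        have k2 : s ^ (3 - α) ≤ (|L| + 1) ^ (3 - α) :=
          Real.rpow_le_rpow hs.1.le (by linarith [hs.2]) (by linarith)
        rw [Real.norm_eq_abs, abs_mul, abs_of_nonneg (by
          have := Real.rpow_nonneg hs.1.le (3 - α); positivity)]
        gcongr)
    rw [Real.norm_eq_abs, sub_zero, abs_of_pos hx.1] at e
    refine e.trans ?_
    calc (|L| + 1) ^ (3 - α) / Real.Gamma (4 - α) * M * x
        ≤ (|L| + 1) ^ (3 - α) / Real.Gamma (4 - α) * M * (|L| + 1) := by gcongr
      _ = _ := by ring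
  · refine ⟨1, one_pos, fun d M h x hx => ?_⟩
    rw [h.rlLeft_two_eq hx, one_mul]
    exact h.bound 2 (by norm_num) x (Ioo_subset_Icc_self hx)

lemma exists_abs_rieszDeriv_le (h1 : 1 < α) (h2 : α ≤ 2) (L : ℝ) :
    ∃ C : ℝ, 0 < C ∧ ∀ d M, IsSmoothLine α L M d →
      ∀ x ∈ Ioo 0 L, |rieszDeriv α L (d 0) x| ≤ C * M := by
  obtain ⟨C, hC, h⟩ := exists_abs_rlLeft_le h1 h2 L
  have hk := kappa_neg h1 h2
  refine ⟨-kappa α * (C + C), by nlinarith, fun d M hd x hx => ?_⟩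
  rw [rieszDeriv, rlRight_eq_rlLeft, abs_mul, abs_of_pos (by linarith), mul_assoc]
  refine mul_le_mul_of_nonneg_left ?_ (by linarith)
  have e := h _ M hd.reflect (L - x) ⟨by linarith [hx.2], by linarith [hx.1]⟩
  simp only [pow_zero, one_mul] at e
  refine (abs_add_le _ _).trans ?_
  rw [add_mul]
  exact add_le_add (h d M hd x hx) e

end IsSmoothLine

/-! ### The discrete Riesz operator on samples of smooth functions -/

/-- The zero boundary values complete the truncated row to the full shifted convolution. Index `i`
is node `i + 1`, and the shift adds one more, whence `i + 2 - m`. -/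
lemma sum_matB_transpose_mul (α : ℝ) {n : ℕ} (W : ℕ → ℝ) (h0 : W 0 = 0) (hn : W (n + 1) = 0)
    (i : Fin n) :
    ∑ l, matB α n l i * W (l + 1)
      = ∑ m ∈ Finset.range ((i : ℕ) + 3), wsCoeff α m * W (i + 2 - m) := by
  have hi := i.2
  rw [Finset.sum_range_succ, Nat.sub_self, h0, mul_zero, add_zero, ← Finset.sum_range_reflect]
  simp only [matB, Matrix.of_apply]
  rw [Fin.sum_univ_eq_sum_range (fun l => (if l ≤ (i : ℕ) + 1 then wsCoeff α ((i : ℕ) + 1 - l) else 0)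
    * W (l + 1)) n]
  have e2 := Finset.sum_range_succ (fun l => (if l ≤ (i : ℕ) + 1 then wsCoeff α ((i : ℕ) + 1 - l)
    else 0) * W (l + 1)) n
  rw [hn, mul_zero, add_zero] at e2
  rw [← e2, ← Finset.sum_subset (Finset.range_subset_range.2 (by omega : (i : ℕ) + 2 ≤ n + 1))]
  · refine Finset.sum_congr rfl fun l hl => ?_
    have hl := Finset.mem_range.1 hl
    rw [if_pos (by omega), show (i : ℕ) + 2 - 1 - l = i + 1 - l by omega,
      show (i : ℕ) + 2 - (i + 1 - l) = l + 1 by omega]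
  · intro l _ hl
    rw [Finset.mem_range] at hl
    rw [if_neg (by omega), zero_mul]

lemma sum_matB_mul (α : ℝ) {n : ℕ} (W : ℕ → ℝ) (h0 : W 0 = 0) (hn : W (n + 1) = 0)
    (i : Fin n) :
    ∑ l, matB α n i l * W (l + 1)
      = ∑ m ∈ Finset.range ((i.rev : ℕ) + 3), wsCoeff α m * W (n + 1 - (i.rev + 2 - m)) := by
  rw [← sum_matB_transpose_mul α (fun j => W (n + 1 - j)) (by simpa using hn) (by simpa using h0)
    i.rev, ← Equiv.sum_comp Fin.revPerm]
  refine Finset.sum_congr rfl fun l _ => ?_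
  have hi := i.2
  have hl := l.2
  simp only [matB, Matrix.of_apply, Fin.revPerm_apply, Fin.val_rev]
  congr 1
  · by_cases h : (i : ℕ) ≤ n - (l + 1) + 1
    · rw [if_pos h, if_pos (by omega)]; congr 1; omega
    · rw [if_neg h, if_neg (by omega)]
  · congr 1; omega

lemma sum_nablaMat_mul (α h : ℝ) {n : ℕ} (W : ℕ → ℝ) (h0 : W 0 = 0) (hn : W (n + 1) = 0)
    (i : Fin n) :
    ∑ l, nablaMat α h n i l * W (l + 1)
      = lineScale α h * ((∑ m ∈ Finset.range ((i : ℕ) + 3), wsCoeff α m * W (i + 2 - m))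
        + ∑ m ∈ Finset.range ((i.rev : ℕ) + 3), wsCoeff α m * W (n + 1 - (i.rev + 2 - m))) := by
  rw [← sum_matB_transpose_mul α W h0 hn, ← sum_matB_mul α W h0 hn, ← Finset.sum_add_distrib,
    Finset.mul_sum]
  refine Finset.sum_congr rfl fun l _ => ?_
  simp only [nablaMat, Matrix.smul_apply, Matrix.add_apply, Matrix.transpose_apply, smul_eq_mul,
    lineScale]
  ring

lemma IsSmoothLine.exists_abs_wsSum_sub_le {α L : ℝ} (h1 : 1 < α) (h2 : α ≤ 2) (hL : 0 < L) :
    ∃ C : ℝ, 0 < C ∧ ∀ d M, IsSmoothLine α L M d → ∀ N : ℕ, 0 < N → ∀ i : ℕ, i + 2 ≤ N →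
      |(L / N) ^ (-α) * (∑ m ∈ Finset.range (i + 3),
          wsCoeff α m * d 0 (((i + 2 - m : ℕ) : ℝ) * (L / N)))
        - rlLeft α (d 0) ((i + 1) * (L / N))| ≤ C * M * (L / N) ^ 2 := by
  rcases h2.lt_or_eq with h2 | rfl
  · obtain ⟨C, hC, hb⟩ := IsCausal.exists_abs_wsSum_sub_le h1 h2
    refine ⟨C * L ^ (2 - α), by positivity, fun d M hd N hN i hi => ?_⟩
    have hN' : (0 : ℝ) < N := by exact_mod_cast hN
    have hiL : ((i + 1 : ℕ) + 1 : ℝ) * (L / N) ≤ L := by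
      rw [mul_div_assoc', div_le_iff₀ hN', mul_comm]
      have : ((i + 1 : ℕ) + 1 : ℝ) ≤ N := by exact_mod_cast hi
      exact mul_le_mul_of_nonneg_left this hL.le
    have hM : 0 ≤ M := (abs_nonneg _).trans (hd.bound 0 (by norm_num) 0 ⟨le_rfl, hL.le⟩)
    have h := hb d M (L / N) (i + 1) (hd.isCausal h2.ne) (by positivity) (by omega)
      (fun y hy => hd.bound 4 le_rfl y ⟨hy.1, hy.2.trans hiL⟩)
    have hp : (((i + 1 : ℕ) + 1 : ℝ) * (L / N)) ^ (2 - α) ≤ L ^ (2 - α) :=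
      Real.rpow_le_rpow (by positivity) hiL (by linarith)
    calc _ = _ := by
          push_cast
          congr 3
          refine Finset.sum_congr rfl fun m hm => ?_
          have := Finset.mem_range.1 hm
          rw [Nat.cast_sub (by omega)]
          push_cast
          congr 2
          ring
      _ ≤ _ := h
      _ ≤ C * M * (L / N) ^ 2 * L ^ (2 - α) := by gcongr
      _ = _ := by ring
  -- For `α = 2` the coefficients are 1, -2, 1, followed by zeros, and the function is smooth on
  -- `[0, L]` only. Fourth order Taylor expansions to both sides give one remainder `M h⁴` each,
  -- hence the constant 2.
  · refine ⟨2, two_pos, fun d M hd N hN i hi => ?_⟩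
    have hN' : (0 : ℝ) < N := by exact_mod_cast hN
    set h : ℝ := L / N with hh
    have hp : 0 < h := by positivity
    have hN2 : ((i : ℝ) + 2) ≤ N := by exact_mod_cast hi
    have hNh : (N : ℝ) * h = L := by rw [hh]; field_simp
    have hmem : ∀ t : ℝ, 0 ≤ t → t ≤ i + 2 → t * h ∈ Icc 0 L := fun t h0 h2 =>
      ⟨by positivity, by rw [← hNh]; gcongr; linarith⟩
    have hx : ((i : ℝ) + 1) * h ∈ Ioo 0 L :=
      ⟨by positivity, by rw [← hNh]; gcongr; linarith⟩
    have hz : ∀ m : ℕ, wsCoeff 2 (m + 3) = 0 := fun m => by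
      have : ∀ m : ℕ, glCoeff 2 (m + 3) = 0 := fun m => by
        induction m with
        | zero => norm_num [glCoeff]
        | succ m ih => rw [show m + 1 + 3 = (m + 3) + 1 by ring, glCoeff, ih, mul_zero]
      rw [wsCoeff, this]; norm_num
    have e0 : ∑ m ∈ Finset.range (i + 3), wsCoeff 2 m * d 0 (((i + 2 - m : ℕ) : ℝ) * h)
        = d 0 ((i + 2) * h) - 2 * d 0 ((i + 1) * h) + d 0 (i * h) := by
      rw [add_comm i 3, Finset.sum_range_add]
      simp only [add_comm 3, hz, zero_mul, Finset.sum_const_zero, add_zero]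
      rw [Finset.sum_range_succ, Finset.sum_range_succ, Finset.sum_range_one]
      norm_num [wsCoeff, glCoeff]
      ring
    rw [e0, hd.rlLeft_two_eq hx]
    have tay : ∀ y ∈ Icc 0 L, |d 0 y - ∑ k ∈ Finset.range 4, d k ((i + 1) * h)
        * ((y - (i + 1) * h) ^ k / k.factorial)| ≤ M * |y - (i + 1) * h| ^ 4 := fun y hy => by
      have hsub : uIcc (((i : ℝ) + 1) * h) y ⊆ Icc 0 L :=
        uIcc_subset_Icc (Ioo_subset_Icc_self hx) hy
      refine abs_sub_taylor_le 4 d (S := smoothSet 2 L) (hsub.trans (Icc_subset_smoothSet _ _))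
        (fun k hk z hz => hd.hasDeriv k hk z (Icc_subset_smoothSet _ _ (hsub hz)))
        (fun z hz => hd.bound 4 le_rfl z (hsub hz))
    have t1 := tay _ (hmem (i + 2) (by positivity) le_rfl)
    have t2 := tay _ (hmem i (by positivity) (by linarith))
    rw [show ((i : ℝ) + 2) * h - (i + 1) * h = h by ring, abs_of_pos hp] at t1
    rw [show (i : ℝ) * h - (i + 1) * h = -h by ring, abs_neg, abs_of_pos hp] at t2
    simp only [Finset.sum_range_succ, Finset.sum_range_zero, Nat.factorial] at t1 t2
    norm_num at t1 t2
    have hneg : h ^ (-2 : ℝ) = 1 / h ^ 2 := by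
      rw [Real.rpow_neg hp.le]; norm_num
    have e3 : h ^ (-2 : ℝ) * (d 0 ((i + 2) * h) - 2 * d 0 ((i + 1) * h) + d 0 (i * h))
        - d 2 ((i + 1) * h) = (d 0 ((i + 2) * h) - 2 * d 0 ((i + 1) * h) + d 0 (i * h)
          - h ^ 2 * d 2 ((i + 1) * h)) / h ^ 2 := by
      rw [hneg]; field_simp
    rw [e3, abs_div, abs_of_pos (by positivity : 0 < h ^ 2), div_le_iff₀ (by positivity)]
    rw [abs_le] at t1 t2 ⊢
    constructor <;> nlinarith [t1.1, t1.2, t2.1, t2.2]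

lemma node_mem_Ioo {L : ℝ} (hL : 0 < L) {N : ℕ} (i : Fin (N - 1)) :
    ((i : ℕ) + 1 : ℝ) * (L / N) ∈ Ioo 0 L := by
  have hi := i.2
  have hN : (0 : ℝ) < N := by exact_mod_cast (by omega : 0 < N)
  refine ⟨by positivity, ?_⟩
  rw [mul_div_assoc', div_lt_iff₀ hN, mul_comm]
  have : ((i : ℕ) + 1 : ℝ) < N := by exact_mod_cast (by omega : (i : ℕ) + 1 < N)
  gcongr

/-- The discrete Riesz derivative of a function at the interior nodes. -/
def nablaAt (α L : ℝ) (N : ℕ) (w : ℝ → ℝ) (i : Fin (N - 1)) : ℝ :=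
  ∑ l, nablaMat α (L / N) (N - 1) i l * w (((l : ℕ) + 1) * (L / N))

/-- The matrix `B` and its transpose act as the one-sided sums of the reflected function and of the
function itself, so the one-sided estimate is used twice. -/
lemma exists_abs_nablaAt_sub_le {α L : ℝ} (h1 : 1 < α) (h2 : α ≤ 2) (hL : 0 < L) :
    ∃ C : ℝ, 0 < C ∧ ∀ d M, IsSmoothLine α L M d → ∀ (N : ℕ) (i : Fin (N - 1)),
      |nablaAt α L N (d 0) i - rieszDeriv α L (d 0) (((i : ℕ) + 1) * (L / N))|
        ≤ C * M * (L / N) ^ 2 := by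
  obtain ⟨C, hC, hb⟩ := IsSmoothLine.exists_abs_wsSum_sub_le h1 h2 hL
  have hk := kappa_neg h1 h2
  refine ⟨-kappa α * (C + C), by nlinarith, fun d M hd N i => ?_⟩
  have hi := i.2
  have hN : 0 < N := by omega
  have hN' : (0 : ℝ) < N := by exact_mod_cast hN
  set h : ℝ := L / N with hh
  have hp : 0 < h := by positivity
  have hNh : (N : ℝ) * h = L := by rw [hh]; field_simp
  have e1 := sum_nablaMat_mul α h (fun j : ℕ => d 0 (j * h))
    (hd.zero _ (Icc_subset_smoothSet _ _ (by simp [hL.le])) (by simp))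
    (hd.zero _ (Icc_subset_smoothSet _ _ (by
      rw [Nat.sub_add_cancel hN, hNh]; exact ⟨hL.le, le_rfl⟩)) (by
      rw [Nat.sub_add_cancel hN, hNh]; simp)) i
  have l1 := hb d M hd N hN i (by omega)
  have l2 := hb _ M hd.reflect N hN i.rev (by rw [Fin.val_rev]; omega)
  have hrev : ((i.rev : ℕ) + 1 : ℝ) * h = L - ((i : ℕ) + 1) * h := by
    have : ((i.rev : ℕ) : ℝ) = N - 1 - (i + 1) := by
      rw [Fin.val_rev, Nat.cast_sub (by omega), Nat.cast_sub (by omega)]; push_cast; ring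
    rw [this, ← hNh]; ring
  have e2 : ∑ m ∈ Finset.range ((i.rev : ℕ) + 3), wsCoeff α m *
        d 0 (((N - 1 + 1 - (i.rev + 2 - m) : ℕ) : ℝ) * h)
      = ∑ m ∈ Finset.range ((i.rev : ℕ) + 3), wsCoeff α m *
        ((-1) ^ 0 * d 0 (L - ((i.rev + 2 - m : ℕ) : ℝ) * h)) := by
    refine Finset.sum_congr rfl fun m _ => ?_
    have : (i.rev : ℕ) + 2 - m ≤ N := by rw [Fin.val_rev]; omega
    rw [pow_zero, one_mul, Nat.sub_add_cancel hN, Nat.cast_sub this, sub_mul, hNh]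
  have e3 : nablaAt α L N (d 0) i = -kappa α * (h ^ (-α) * (∑ m ∈ Finset.range ((i : ℕ) + 3),
        wsCoeff α m * d 0 (((i + 2 - m : ℕ) : ℝ) * h))
      + h ^ (-α) * ∑ m ∈ Finset.range ((i.rev : ℕ) + 3), wsCoeff α m *
        ((-1) ^ 0 * d 0 (L - ((i.rev + 2 - m : ℕ) : ℝ) * h))) := by
    rw [← e2, nablaAt]
    push_cast at e1 ⊢
    rw [← hh, e1, lineScale, Real.rpow_neg hp.le]
    ring
  rw [← hh] at l1 l2
  rw [hrev] at l2
  rw [e3, rieszDeriv, IsSmoothLine.rlRight_eq_rlLeft, ← mul_sub, abs_mul, abs_of_pos (by linarith)]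
  simp only [pow_zero, one_mul] at l2 ⊢
  rw [mul_assoc, mul_assoc]
  refine mul_le_mul_of_nonneg_left ?_ (by linarith)
  rw [add_sub_add_comm]
  refine (abs_add_le _ _).trans ((add_le_add l1 l2).trans (le_of_eq ?_))
  ring

lemma exists_abs_nablaAt_le {α L : ℝ} (h1 : 1 < α) (h2 : α ≤ 2) (hL : 0 < L) :
    ∃ C : ℝ, 0 < C ∧ ∀ d M, IsSmoothLine α L M d → ∀ (N : ℕ) (i : Fin (N - 1)),
      |nablaAt α L N (d 0) i| ≤ C * M := by
  obtain ⟨C, hC, hb⟩ := exists_abs_nablaAt_sub_le h1 h2 hL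
  obtain ⟨C', hC', hb'⟩ := IsSmoothLine.exists_abs_rieszDeriv_le h1 h2 L
  refine ⟨C * L ^ 2 + C', by positivity, fun d M hd N i => ?_⟩
  have hi := i.2
  have hN : (1 : ℝ) ≤ N := by exact_mod_cast (by omega : 1 ≤ N)
  have hM : 0 ≤ M := (abs_nonneg _).trans (hd.bound 0 (by norm_num) 0 ⟨le_rfl, hL.le⟩)
  have k1 := hb d M hd N i
  have k2 := hb' d M hd _ (node_mem_Ioo hL i)
  have k3 : (L / N) ^ 2 ≤ L ^ 2 := by
    have := div_le_self hL.le hN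
    gcongr
  have k4 : C * M * (L / N) ^ 2 ≤ C * M * L ^ 2 := by gcongr
  have k5 := abs_sub_abs_le_abs_sub (nablaAt α L N (d 0) i)
    (rieszDeriv α L (d 0) (((i : ℕ) + 1) * (L / N)))
  nlinarith

/-! ### Partial derivatives on a box -/

/-- Directional derivative relative to a set. -/
def pdir (S : Set (ℝ × ℝ × ℝ)) (v : ℝ × ℝ × ℝ) (F : ℝ × ℝ × ℝ → ℝ) (p : ℝ × ℝ × ℝ) : ℝ :=
  fderivWithin ℝ F S p v

/-- Partial derivative in `x`. -/
abbrev pdX (S : Set (ℝ × ℝ × ℝ)) := pdir S (1, 0, 0)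

/-- Partial derivative in `y`. -/
abbrev pdY (S : Set (ℝ × ℝ × ℝ)) := pdir S (0, 1, 0)

/-- Partial derivative in `t`. -/
abbrev pdT (S : Set (ℝ × ℝ × ℝ)) := pdir S (0, 0, 1)

section box

variable {A B C : Set ℝ} {F : ℝ × ℝ × ℝ → ℝ}

lemma contDiffOn_pdir {S : Set (ℝ × ℝ × ℝ)} (hS : UniqueDiffOn ℝ S) {n m : ℕ} (hnm : m + 1 ≤ n)
    (hF : ContDiffOn ℝ n F S) (v : ℝ × ℝ × ℝ) : ContDiffOn ℝ m (pdir S v F) S :=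
  (hF.fderivWithin hS (by exact_mod_cast hnm)).clm_apply contDiffOn_const

lemma contDiffOn_pdir_iterate {S : Set (ℝ × ℝ × ℝ)} (hS : UniqueDiffOn ℝ S) {n m k : ℕ}
    (hnm : m + k ≤ n) (hF : ContDiffOn ℝ n F S) (v : ℝ × ℝ × ℝ) :
    ContDiffOn ℝ m ((pdir S v)^[k] F) S := by
  induction k generalizing m with
  | zero => exact hF.of_le (by exact_mod_cast hnm)
  | succ k ih =>
    rw [Function.iterate_succ_apply']
    exact contDiffOn_pdir hS le_rfl (ih (by omega)) v

lemma hasDerivWithinAt_pdX {n : ℕ} (hn : n ≠ 0) (hF : ContDiffOn ℝ n F (A ×ˢ B ×ˢ C)) {x y t : ℝ}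
    (hx : x ∈ A) (hy : y ∈ B) (ht : t ∈ C) :
    HasDerivWithinAt (fun x => F (x, y, t)) (pdX (A ×ˢ B ×ˢ C) F (x, y, t)) A x :=
  (hF.differentiableOn (by exact_mod_cast hn) (x, y, t)
    (show (x, y, t) ∈ A ×ˢ B ×ˢ C from ⟨hx, hy, ht⟩)).hasFDerivWithinAt.comp_hasDerivWithinAt x
    ((hasDerivWithinAt_id x A).prodMk (hasDerivWithinAt_const x A (y, t)))
    (show MapsTo (fun x => (x, y, t)) A (A ×ˢ B ×ˢ C) from fun _ hz => ⟨hz, hy, ht⟩)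

lemma hasDerivWithinAt_pdY {n : ℕ} (hn : n ≠ 0) (hF : ContDiffOn ℝ n F (A ×ˢ B ×ˢ C)) {x y t : ℝ}
    (hx : x ∈ A) (hy : y ∈ B) (ht : t ∈ C) :
    HasDerivWithinAt (fun y => F (x, y, t)) (pdY (A ×ˢ B ×ˢ C) F (x, y, t)) B y :=
  (hF.differentiableOn (by exact_mod_cast hn) (x, y, t)
    (show (x, y, t) ∈ A ×ˢ B ×ˢ C from ⟨hx, hy, ht⟩)).hasFDerivWithinAt.comp_hasDerivWithinAt y
    ((hasDerivWithinAt_const y B x).prodMk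
      ((hasDerivWithinAt_id y B).prodMk (hasDerivWithinAt_const y B t)))
    (show MapsTo (fun y => (x, y, t)) B (A ×ˢ B ×ˢ C) from fun _ hz => ⟨hx, hz, ht⟩)

lemma hasDerivWithinAt_pdT {n : ℕ} (hn : n ≠ 0) (hF : ContDiffOn ℝ n F (A ×ˢ B ×ˢ C)) {x y t : ℝ}
    (hx : x ∈ A) (hy : y ∈ B) (ht : t ∈ C) :
    HasDerivWithinAt (fun t => F (x, y, t)) (pdT (A ×ˢ B ×ˢ C) F (x, y, t)) C t :=
  (hF.differentiableOn (by exact_mod_cast hn) (x, y, t)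
    (show (x, y, t) ∈ A ×ˢ B ×ˢ C from ⟨hx, hy, ht⟩)).hasFDerivWithinAt.comp_hasDerivWithinAt t
    ((hasDerivWithinAt_const t C x).prodMk
      ((hasDerivWithinAt_const t C y).prodMk (hasDerivWithinAt_id t C)))
    (show MapsTo (fun t => (x, y, t)) C (A ×ˢ B ×ˢ C) from fun _ hz => ⟨hx, hy, hz⟩)

lemma eq_zero_of_hasDerivWithinAt {f : ℝ → ℝ} {f' x : ℝ} (hA : UniqueDiffOn ℝ A)
    (hx : x ∈ A) (hf : HasDerivWithinAt f f' A x) (h0 : ∀ z ∈ A, f z = 0) : f' = 0 :=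
  (hA x hx).eq_deriv _ hf ((hasDerivWithinAt_const x A (0 : ℝ)).congr h0 (h0 x hx))

/-- `F` vanishes at the points of the box whose first coordinate is not in `I`. -/
def VanishX (S : Set (ℝ × ℝ × ℝ)) (I : Set ℝ) (F : ℝ × ℝ × ℝ → ℝ) : Prop :=
  ∀ x y t, (x, y, t) ∈ S → x ∉ I → F (x, y, t) = 0

/-- `F` vanishes at the points of the box whose second coordinate is not in `J`. -/
def VanishY (S : Set (ℝ × ℝ × ℝ)) (J : Set ℝ) (F : ℝ × ℝ × ℝ → ℝ) : Prop :=
  ∀ x y t, (x, y, t) ∈ S → y ∉ J → F (x, y, t) = 0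

variable {n k : ℕ} {I : Set ℝ}

/-- Tangential derivatives inherit the Dirichlet condition, so the consistency estimates in `x` also
apply to derivatives in the other variables. -/
lemma VanishX.pdY (h : VanishX (A ×ˢ B ×ˢ C) I F) (hB : UniqueDiffOn ℝ B) (hn : n ≠ 0)
    (hF : ContDiffOn ℝ n F (A ×ˢ B ×ˢ C)) : VanishX (A ×ˢ B ×ˢ C) I (pdY (A ×ˢ B ×ˢ C) F) :=
  fun x _ t hp hx => eq_zero_of_hasDerivWithinAt hB hp.2.1
    (hasDerivWithinAt_pdY hn hF hp.1 hp.2.1 hp.2.2) fun z hz => h x z t ⟨hp.1, hz, hp.2.2⟩ hx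

lemma VanishX.pdT (h : VanishX (A ×ˢ B ×ˢ C) I F) (hC : UniqueDiffOn ℝ C) (hn : n ≠ 0)
    (hF : ContDiffOn ℝ n F (A ×ˢ B ×ˢ C)) : VanishX (A ×ˢ B ×ˢ C) I (pdT (A ×ˢ B ×ˢ C) F) :=
  fun x y _ hp hx => eq_zero_of_hasDerivWithinAt hC hp.2.2
    (hasDerivWithinAt_pdT hn hF hp.1 hp.2.1 hp.2.2) fun z hz => h x y z ⟨hp.1, hp.2.1, hz⟩ hx

lemma VanishY.pdX (h : VanishY (A ×ˢ B ×ˢ C) I F) (hA : UniqueDiffOn ℝ A) (hn : n ≠ 0)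
    (hF : ContDiffOn ℝ n F (A ×ˢ B ×ˢ C)) : VanishY (A ×ˢ B ×ˢ C) I (pdX (A ×ˢ B ×ˢ C) F) :=
  fun _ y t hp hx => eq_zero_of_hasDerivWithinAt hA hp.1
    (hasDerivWithinAt_pdX hn hF hp.1 hp.2.1 hp.2.2) fun z hz => h z y t ⟨hz, hp.2.1, hp.2.2⟩ hx

lemma VanishX.pdY_iterate (h : VanishX (A ×ˢ B ×ˢ C) I F) (hA : UniqueDiffOn ℝ A)
    (hB : UniqueDiffOn ℝ B) (hC : UniqueDiffOn ℝ C) (hk : k ≤ n)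
    (hF : ContDiffOn ℝ n F (A ×ˢ B ×ˢ C)) :
    VanishX (A ×ˢ B ×ˢ C) I ((RieszWave.pdY (A ×ˢ B ×ˢ C))^[k] F) := by
  induction k with
  | zero => exact h
  | succ k ih =>
    rw [Function.iterate_succ_apply']
    exact (ih (by omega)).pdY hB one_ne_zero
      (contDiffOn_pdir_iterate (hA.prod (hB.prod hC)) (by omega) hF _)

lemma VanishX.pdT_iterate (h : VanishX (A ×ˢ B ×ˢ C) I F) (hA : UniqueDiffOn ℝ A)
    (hB : UniqueDiffOn ℝ B) (hC : UniqueDiffOn ℝ C) (hk : k ≤ n)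
    (hF : ContDiffOn ℝ n F (A ×ˢ B ×ˢ C)) :
    VanishX (A ×ˢ B ×ˢ C) I ((RieszWave.pdT (A ×ˢ B ×ˢ C))^[k] F) := by
  induction k with
  | zero => exact h
  | succ k ih =>
    rw [Function.iterate_succ_apply']
    exact (ih (by omega)).pdT hC one_ne_zero
      (contDiffOn_pdir_iterate (hA.prod (hB.prod hC)) (by omega) hF _)

end box

/-! ### Smooth functions on the space-time cylinder -/

lemma uniqueDiffOn_smoothSet {α L : ℝ} (hL : 0 < L) : UniqueDiffOn ℝ (smoothSet α L) := by
  by_cases h : α = 2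
  · subst h; rw [smoothSet_two]; exact uniqueDiffOn_Icc hL
  · rw [smoothSet_of_ne h]; exact uniqueDiffOn_univ

/-- The set on which the exact solution is smooth. -/
abbrev cyl (α β T xr yr : ℝ) : Set (ℝ × ℝ × ℝ) := smoothSet α xr ×ˢ smoothSet β yr ×ˢ Icc 0 T

section cylinder

variable {α β T xr yr : ℝ} {F : ℝ × ℝ × ℝ → ℝ}

lemma uniqueDiffOn_cyl (hT : 0 < T) (hx : 0 < xr) (hy : 0 < yr) :
    UniqueDiffOn ℝ (cyl α β T xr yr) :=
  (uniqueDiffOn_smoothSet hx).prod ((uniqueDiffOn_smoothSet hy).prod (uniqueDiffOn_Icc hT))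

lemma exists_bound_cyl (hF : ContinuousOn F (cyl α β T xr yr)) :
    ∃ M : ℝ, 0 < M ∧ ∀ x ∈ Icc 0 xr, ∀ y ∈ Icc 0 yr, ∀ t ∈ Icc 0 T, |F (x, y, t)| ≤ M := by
  obtain ⟨M, hM⟩ := (isCompact_Icc.prod (isCompact_Icc.prod isCompact_Icc) :
    IsCompact (Icc 0 xr ×ˢ Icc 0 yr ×ˢ Icc 0 T)).exists_bound_of_continuousOn
    (hF.mono (prod_mono (Icc_subset_smoothSet α xr)
      (prod_mono (Icc_subset_smoothSet β yr) Subset.rfl)))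
  exact ⟨|M| + 1, by positivity, fun x hx y hy t ht =>
    ((hM (x, y, t) ⟨hx, hy, ht⟩).trans (le_abs_self M)).trans (by linarith)⟩

lemma exists_bound_cyl_iterate (hS : UniqueDiffOn ℝ (cyl α β T xr yr)) (v : ℝ × ℝ × ℝ) {n : ℕ}
    (hF : ContDiffOn ℝ n F (cyl α β T xr yr)) :
    ∃ M : ℝ, 0 < M ∧ ∀ k ≤ n, ∀ x ∈ Icc 0 xr, ∀ y ∈ Icc 0 yr, ∀ t ∈ Icc 0 T,
      |(pdir (cyl α β T xr yr) v)^[k] F (x, y, t)| ≤ M := by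
  have h : ∀ k : ℕ, ∃ M : ℝ, 0 < M ∧ (k ≤ n → ∀ x ∈ Icc 0 xr, ∀ y ∈ Icc 0 yr, ∀ t ∈ Icc 0 T,
      |(pdir (cyl α β T xr yr) v)^[k] F (x, y, t)| ≤ M) := fun k => by
    by_cases hk : k ≤ n
    · obtain ⟨M, h0, hM⟩ := exists_bound_cyl
        (contDiffOn_pdir_iterate (m := 0) hS (by omega : 0 + k ≤ n) hF v).continuousOn
      exact ⟨M, h0, fun _ => hM⟩
    · exact ⟨1, one_pos, fun h => absurd h hk⟩
  choose M h0 hM using h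
  refine ⟨∑ k ∈ Finset.range (n + 1), M k, Finset.sum_pos (fun k _ => h0 k) (by simp),
    fun k hk x hx y hy t ht => (hM k hk x hx y hy t ht).trans ?_⟩
  exact Finset.single_le_sum (f := M) (fun j _ => (h0 j).le) (Finset.mem_range.2 (by omega))

lemma exists_isSmoothLine_x (hT : 0 < T) (hx : 0 < xr) (hy : 0 < yr)
    (hF : ContDiffOn ℝ 4 F (cyl α β T xr yr)) (h0 : VanishX (cyl α β T xr yr) (Ioo 0 xr) F) :
    ∃ M : ℝ, 0 < M ∧ ∀ y ∈ Icc 0 yr, ∀ t ∈ Icc 0 T, IsSmoothLine α xr M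
      (fun k x => (pdX (cyl α β T xr yr))^[k] F (x, y, t)) := by
  have hS : UniqueDiffOn ℝ (cyl α β T xr yr) := uniqueDiffOn_cyl hT hx hy
  obtain ⟨M, hM0, hM⟩ := exists_bound_cyl_iterate hS (1, 0, 0) (n := 4) hF
  refine ⟨M, hM0, fun y hy' t ht => ⟨fun k hk x hx' => ?_, ?_, fun x hx' hxI => ?_,
    fun k hk x hx' => hM k hk x hx' y hy' t ht⟩⟩
  · rw [Function.iterate_succ_apply']
    exact hasDerivWithinAt_pdX one_ne_zero
      (contDiffOn_pdir_iterate (n := 4) hS (by omega) hF _) hx' (Icc_subset_smoothSet _ _ hy') ht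
  · exact (contDiffOn_pdir_iterate (m := 0) (n := 4) hS le_rfl hF (1, 0, 0)).continuousOn.comp
      (by fun_prop : Continuous fun x : ℝ => (x, y, t)).continuousOn
      fun x hx' => ⟨hx', Icc_subset_smoothSet _ _ hy', ht⟩
  · exact h0 x y t ⟨hx', Icc_subset_smoothSet _ _ hy', ht⟩ hxI

end cylinder

/-! ### The discrete Riesz operators on smooth functions of space and time -/

section fields

variable {α β T xr yr : ℝ} {F : ℝ × ℝ × ℝ → ℝ}

lemma nablaAt_congr {α L : ℝ} {N : ℕ} {v w : ℝ → ℝ} (hL : 0 < L) (h : ∀ x ∈ Ioo 0 L, v x = w x)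
    (i : Fin (N - 1)) : nablaAt α L N v i = nablaAt α L N w i :=
  Finset.sum_congr rfl fun l _ => by rw [h _ (node_mem_Ioo hL l)]

lemma nablaAt_eq_zero {α L : ℝ} {N : ℕ} {w : ℝ → ℝ} (hL : 0 < L) (h : ∀ x ∈ Ioo 0 L, w x = 0)
    (i : Fin (N - 1)) : nablaAt α L N w i = 0 :=
  Finset.sum_eq_zero fun l _ => by rw [h _ (node_mem_Ioo hL l), mul_zero]

lemma abs_sub_le_of_hasDerivWithinAt {S : Set ℝ} {f f' : ℝ → ℝ} {L K : ℝ} (hS : Icc 0 L ⊆ S)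
    (hf : ∀ x ∈ Icc 0 L, HasDerivWithinAt f (f' x) S x) (hK : ∀ x ∈ Icc 0 L, |f' x| ≤ K)
    {x y : ℝ} (hx : x ∈ Icc 0 L) (hy : y ∈ Icc 0 L) : |f x - f y| ≤ K * |x - y| :=
  (convex_Icc 0 L).norm_image_sub_le_of_norm_hasDerivWithin_le
    (fun z hz => (hf z hz).mono hS) hK hy hx

/-- The discrete operator is a finite sum, so it commutes with differentiation in a parameter. This
is how bounds uniform in `N` are carried over to differences in the other variables. -/
lemma hasDerivWithinAt_nablaAt {S : Set ℝ} {w w' : ℝ → ℝ → ℝ} {α L t : ℝ} {N : ℕ} (hL : 0 < L)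
    (h : ∀ x ∈ Ioo 0 L, HasDerivWithinAt (fun s => w s x) (w' t x) S t) (i : Fin (N - 1)) :
    HasDerivWithinAt (fun s => nablaAt α L N (w s) i) (nablaAt α L N (w' t) i) S t :=
  HasDerivWithinAt.fun_sum fun l _ => (h _ (node_mem_Ioo hL l)).const_mul _

lemma exists_abs_nablaAt_x_le (h1 : 1 < α) (h2 : α ≤ 2) (hT : 0 < T) (hx : 0 < xr) (hy : 0 < yr)
    (hF : ContDiffOn ℝ 4 F (cyl α β T xr yr)) (h0 : VanishX (cyl α β T xr yr) (Ioo 0 xr) F) :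
    ∃ K : ℝ, 0 < K ∧ ∀ y ∈ Icc 0 yr, ∀ t ∈ Icc 0 T, ∀ (N : ℕ) (i : Fin (N - 1)),
      |nablaAt α xr N (fun x => F (x, y, t)) i| ≤ K := by
  obtain ⟨M, hM, hl⟩ := exists_isSmoothLine_x hT hx hy hF h0
  obtain ⟨C, hC, h⟩ := exists_abs_nablaAt_le h1 h2 hx
  exact ⟨C * M, by positivity, fun y hy' t ht N i => h _ M (hl y hy' t ht) N i⟩

lemma exists_abs_nablaAt_x_sub_rieszDeriv_le (h1 : 1 < α) (h2 : α ≤ 2) (hT : 0 < T) (hx : 0 < xr)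
    (hy : 0 < yr) (hF : ContDiffOn ℝ 4 F (cyl α β T xr yr))
    (h0 : VanishX (cyl α β T xr yr) (Ioo 0 xr) F) :
    ∃ K : ℝ, 0 < K ∧ ∀ y ∈ Icc 0 yr, ∀ t ∈ Icc 0 T, ∀ (N : ℕ) (i : Fin (N - 1)),
      |nablaAt α xr N (fun x => F (x, y, t)) i
        - rieszDeriv α xr (fun x => F (x, y, t)) (((i : ℕ) + 1) * (xr / N))| ≤ K * (xr / N) ^ 2 := by
  obtain ⟨M, hM, hl⟩ := exists_isSmoothLine_x hT hx hy hF h0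
  obtain ⟨C, hC, h⟩ := exists_abs_nablaAt_sub_le h1 h2 hx
  exact ⟨C * M, by positivity, fun y hy' t ht N i => h _ M (hl y hy' t ht) N i⟩

/-- The residual of the second order time Taylor polynomial at `0`. -/
def timeRem (T : ℝ) (F : ℝ × ℝ × ℝ → ℝ) (t x y : ℝ) : ℝ :=
  F (x, y, t) - F (x, y, 0) - t * derivWithin (fun s => F (x, y, s)) (Icc 0 T) 0
    - t ^ 2 / 2 * iteratedDerivWithin 2 (fun s => F (x, y, s)) (Icc 0 T) 0

lemma derivWithin_eq_pdT {n : ℕ} (hT : 0 < T) (hn : n ≠ 0)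
    (hF : ContDiffOn ℝ n F (cyl α β T xr yr)) {x y t : ℝ}
    (hx : x ∈ Ioo 0 xr) (hy : y ∈ Ioo 0 yr) (ht : t ∈ Icc 0 T) :
    derivWithin (fun s => F (x, y, s)) (Icc 0 T) t = pdT (cyl α β T xr yr) F (x, y, t) :=
  (hasDerivWithinAt_pdT hn hF (Icc_subset_smoothSet _ _ (Ioo_subset_Icc_self hx))
    (Icc_subset_smoothSet _ _ (Ioo_subset_Icc_self hy)) ht).derivWithin (uniqueDiffOn_Icc hT t ht)

lemma iteratedDerivWithin_two_eq_pdT (hT : 0 < T) (hxr : 0 < xr) (hyr : 0 < yr)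
    (hF : ContDiffOn ℝ 2 F (cyl α β T xr yr)) {x y t : ℝ}
    (hx : x ∈ Ioo 0 xr) (hy : y ∈ Ioo 0 yr) (ht : t ∈ Icc 0 T) :
    iteratedDerivWithin 2 (fun s => F (x, y, s)) (Icc 0 T) t
      = (pdT (cyl α β T xr yr))^[2] F (x, y, t) := by
  have hS : UniqueDiffOn ℝ (cyl α β T xr yr) := uniqueDiffOn_cyl hT hxr hyr
  rw [iteratedDerivWithin_succ, iteratedDerivWithin_one,
    derivWithin_congr (fun s hs => derivWithin_eq_pdT (n := 2) hT two_ne_zero hF hx hy hs)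
    (derivWithin_eq_pdT (n := 2) hT two_ne_zero hF hx hy ht)]
  exact derivWithin_eq_pdT hT one_ne_zero (contDiffOn_pdir (n := 2) hS le_rfl hF _) hx hy ht

lemma hasDerivWithinAt_pdT_iterate (hT : 0 < T) (hxr : 0 < xr) (hyr : 0 < yr) {n k : ℕ}
    (hF : ContDiffOn ℝ n F (cyl α β T xr yr)) (hk : k < n) {x y t : ℝ}
    (hx : x ∈ Icc 0 xr) (hy : y ∈ Icc 0 yr) (ht : t ∈ Icc 0 T) :
    HasDerivWithinAt (fun s => (pdT (cyl α β T xr yr))^[k] F (x, y, s))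
      ((pdT (cyl α β T xr yr))^[k + 1] F (x, y, t)) (Icc 0 T) t := by
  rw [Function.iterate_succ_apply']
  exact hasDerivWithinAt_pdT one_ne_zero
    (contDiffOn_pdir_iterate (uniqueDiffOn_cyl hT hxr hyr) (by omega) hF _)
    (Icc_subset_smoothSet _ _ hx) (Icc_subset_smoothSet _ _ hy) ht

lemma exists_abs_time_taylor_le (hT : 0 < T) (hxr : 0 < xr) (hyr : 0 < yr) {n : ℕ}
    (hF : ContDiffOn ℝ n F (cyl α β T xr yr)) :
    ∃ K : ℝ, 0 < K ∧ ∀ x ∈ Icc 0 xr, ∀ y ∈ Icc 0 yr, ∀ s ∈ Icc 0 T, ∀ t ∈ Icc 0 T,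
      |F (x, y, t) - ∑ k ∈ Finset.range n, (pdT (cyl α β T xr yr))^[k] F (x, y, s)
        * ((t - s) ^ k / k.factorial)| ≤ K * |t - s| ^ n := by
  obtain ⟨K, hK, hb⟩ := exists_bound_cyl_iterate (uniqueDiffOn_cyl hT hxr hyr) (0, 0, 1) hF
  refine ⟨K, hK, fun x hx y hy s hs t ht => ?_⟩
  have hsub : uIcc s t ⊆ Icc 0 T := uIcc_subset_Icc hs ht
  exact abs_sub_taylor_le n (fun k t => (pdT (cyl α β T xr yr))^[k] F (x, y, t)) hsub
    (fun k hk z hz => hasDerivWithinAt_pdT_iterate hT hxr hyr hF hk hx hy (hsub hz))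
    (fun z hz => hb n le_rfl x hx y hy z (hsub hz))

/-- Taylor's formula is applied to the discrete derivative as a function of time. Its `n`-th time
derivative is the discrete derivative of the `n`-th time derivative, bounded uniformly in `N`
because four orders of smoothness are left for `x`. -/
lemma exists_abs_nablaAt_x_time_taylor_le (h1 : 1 < α) (h2 : α ≤ 2) (hT : 0 < T) (hxr : 0 < xr)
    (hyr : 0 < yr) {n m : ℕ} (hnm : 4 + n ≤ m) (hF : ContDiffOn ℝ m F (cyl α β T xr yr))
    (h0 : VanishX (cyl α β T xr yr) (Ioo 0 xr) F) :
    ∃ K : ℝ, 0 < K ∧ ∀ y ∈ Icc 0 yr, ∀ s ∈ Icc 0 T, ∀ t ∈ Icc 0 T, ∀ (N : ℕ) (i : Fin (N - 1)),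
      |nablaAt α xr N (fun x => F (x, y, t)) i - ∑ k ∈ Finset.range n,
        nablaAt α xr N (fun x => (pdT (cyl α β T xr yr))^[k] F (x, y, s)) i
          * ((t - s) ^ k / k.factorial)| ≤ K * |t - s| ^ n := by
  have hS : UniqueDiffOn ℝ (cyl α β T xr yr) := uniqueDiffOn_cyl hT hxr hyr
  obtain ⟨K, hK, hb⟩ := exists_abs_nablaAt_x_le h1 h2 hT hxr hyr
    (contDiffOn_pdir_iterate (m := 4) (k := n) hS hnm hF (0, 0, 1))
    (h0.pdT_iterate (uniqueDiffOn_smoothSet hxr) (uniqueDiffOn_smoothSet hyr)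
      (uniqueDiffOn_Icc hT) (by omega) hF)
  refine ⟨K, hK, fun y hy s hs t ht N i => ?_⟩
  have hsub : uIcc s t ⊆ Icc 0 T := uIcc_subset_Icc hs ht
  exact abs_sub_taylor_le n
    (fun k t => nablaAt α xr N (fun x => (pdT (cyl α β T xr yr))^[k] F (x, y, t)) i) hsub
    (fun k hk z hz => hasDerivWithinAt_nablaAt hxr
      (w := fun t x => (pdT (cyl α β T xr yr))^[k] F (x, y, t))
      (w' := fun t x => (pdT (cyl α β T xr yr))^[k + 1] F (x, y, t)) (fun x hx =>
      hasDerivWithinAt_pdT_iterate hT hxr hyr hF (by omega) (Ioo_subset_Icc_self hx) hy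
        (hsub hz)) i)
    (fun z hz => hb y hy z (hsub hz) N i)

lemma exists_abs_time_second_diff_sub_le (hT : 0 < T) (hxr : 0 < xr) (hyr : 0 < yr)
    (hF : ContDiffOn ℝ 4 F (cyl α β T xr yr)) :
    ∃ K : ℝ, 0 < K ∧ ∀ x ∈ Ioo 0 xr, ∀ y ∈ Ioo 0 yr, ∀ s τ : ℝ, s ∈ Icc 0 T → s - τ ∈ Icc 0 T →
      s + τ ∈ Icc 0 T → |F (x, y, s + τ) - 2 * F (x, y, s) + F (x, y, s - τ)
        - τ ^ 2 * iteratedDerivWithin 2 (fun t => F (x, y, t)) (Icc 0 T) s| ≤ K * τ ^ 4 := by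
  obtain ⟨K, hK, h⟩ := exists_abs_time_taylor_le (n := 4) hT hxr hyr hF
  refine ⟨2 * K, by positivity, fun x hx y hy s τ hs hm hp => ?_⟩
  have e1 := h x (Ioo_subset_Icc_self hx) y (Ioo_subset_Icc_self hy) s hs _ hp
  have e2 := h x (Ioo_subset_Icc_self hx) y (Ioo_subset_Icc_self hy) s hs _ hm
  rw [iteratedDerivWithin_two_eq_pdT hT hxr hyr (hF.of_le (by norm_num)) hx hy hs]
  rw [add_sub_cancel_left] at e1
  rw [sub_sub_cancel_left, abs_neg] at e2
  have hτ : |τ| ^ 4 = τ ^ 4 := by rw [← abs_pow]; exact abs_of_nonneg (by positivity)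
  rw [hτ] at e1 e2
  simp only [Finset.sum_range_succ, Finset.sum_range_zero, Nat.factorial] at e1 e2
  norm_num at e1 e2
  rw [Function.iterate_succ_apply, Function.iterate_one]
  rw [abs_le] at e1 e2 ⊢
  constructor <;> linarith [e1.1, e1.2, e2.1, e2.2]

lemma exists_abs_nablaAt_x_second_diff_le (h1 : 1 < α) (h2 : α ≤ 2) (hT : 0 < T) (hxr : 0 < xr)
    (hyr : 0 < yr) (hF : ContDiffOn ℝ 8 F (cyl α β T xr yr))
    (h0 : VanishX (cyl α β T xr yr) (Ioo 0 xr) F) :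
    ∃ K : ℝ, 0 < K ∧ ∀ y ∈ Icc 0 yr, ∀ s τ : ℝ, s ∈ Icc 0 T → s - τ ∈ Icc 0 T → s + τ ∈ Icc 0 T →
      ∀ (N : ℕ) (i : Fin (N - 1)), |nablaAt α xr N (fun x => F (x, y, s + τ)) i
        - 2 * nablaAt α xr N (fun x => F (x, y, s)) i
        + nablaAt α xr N (fun x => F (x, y, s - τ)) i| ≤ K * τ ^ 2 := by
  obtain ⟨K, hK, h⟩ := exists_abs_nablaAt_x_time_taylor_le (n := 2) (m := 8) h1 h2 hT hxr hyr
    (by norm_num) hF h0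
  refine ⟨2 * K, by positivity, fun y hy s τ hs hm hp N i => ?_⟩
  have e1 := h y hy s hs _ hp N i
  have e2 := h y hy s hs _ hm N i
  rw [add_sub_cancel_left, sq_abs] at e1
  rw [sub_sub_cancel_left, abs_neg, sq_abs] at e2
  simp only [Finset.sum_range_succ, Finset.sum_range_zero, Nat.factorial] at e1 e2
  norm_num at e1 e2
  rw [abs_le] at e1 e2 ⊢
  constructor <;> linarith [e1.1, e1.2, e2.1, e2.2]

lemma exists_abs_timeRem_le (hT : 0 < T) (hxr : 0 < xr) (hyr : 0 < yr)
    (hF : ContDiffOn ℝ 3 F (cyl α β T xr yr)) :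
    ∃ K : ℝ, 0 < K ∧ ∀ x ∈ Ioo 0 xr, ∀ y ∈ Ioo 0 yr, ∀ t ∈ Icc 0 T,
      |timeRem T F t x y| ≤ K * t ^ 3 := by
  obtain ⟨K, hK, h⟩ := exists_abs_time_taylor_le (n := 3) hT hxr hyr hF
  refine ⟨K, hK, fun x hx y hy t ht => ?_⟩
  have h0 : (0 : ℝ) ∈ Icc 0 T := ⟨le_rfl, hT.le⟩
  have e := h x (Ioo_subset_Icc_self hx) y (Ioo_subset_Icc_self hy) 0 h0 t ht
  rw [sub_zero, abs_of_nonneg ht.1] at e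
  refine le_trans (le_of_eq ?_) e
  rw [timeRem, derivWithin_eq_pdT (n := 3) hT (by norm_num) hF hx hy h0,
    iteratedDerivWithin_two_eq_pdT hT hxr hyr (hF.of_le (by norm_num)) hx hy h0]
  simp only [Finset.sum_range_succ, Finset.sum_range_zero, Nat.factorial,
    Function.iterate_succ_apply, Function.iterate_zero, id]
  norm_num
  congr 1
  ring

lemma exists_abs_nablaAt_x_timeRem_le (h1 : 1 < α) (h2 : α ≤ 2) (hT : 0 < T) (hxr : 0 < xr)
    (hyr : 0 < yr) (hF : ContDiffOn ℝ 8 F (cyl α β T xr yr))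
    (h0 : VanishX (cyl α β T xr yr) (Ioo 0 xr) F) :
    ∃ K : ℝ, 0 < K ∧ ∀ y ∈ Ioo 0 yr, ∀ t ∈ Icc 0 T, ∀ (N : ℕ) (i : Fin (N - 1)),
      |nablaAt α xr N (fun x => timeRem T F t x y) i| ≤ K * t ^ 3 := by
  obtain ⟨K, hK, h⟩ := exists_abs_nablaAt_x_time_taylor_le (n := 3) (m := 8) h1 h2 hT hxr hyr
    (by norm_num) hF h0
  refine ⟨K, hK, fun y hy t ht N i => ?_⟩
  have h0 : (0 : ℝ) ∈ Icc 0 T := ⟨le_rfl, hT.le⟩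
  have e := h y (Ioo_subset_Icc_self hy) 0 h0 t ht N i
  rw [sub_zero, abs_of_nonneg ht.1] at e
  refine le_trans (le_of_eq ?_) e
  congr 1
  rw [nablaAt_congr hxr (w := fun x => F (x, y, t) - ∑ k ∈ Finset.range 3,
    (pdT (cyl α β T xr yr))^[k] F (x, y, 0) * (t ^ k / k.factorial)) (fun x hx => by
      rw [timeRem, derivWithin_eq_pdT (n := 8) hT (by norm_num) hF hx hy h0,
        iteratedDerivWithin_two_eq_pdT hT hxr hyr (hF.of_le (by norm_num)) hx hy h0]
      simp only [Finset.sum_range_succ, Finset.sum_range_zero, Nat.factorial,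
        Function.iterate_succ_apply, Function.iterate_zero, id]
      norm_num
      ring)]
  simp only [nablaAt, mul_sub, Finset.sum_sub_distrib, Finset.mul_sum]
  congr 1
  rw [Finset.sum_comm]
  refine Finset.sum_congr rfl fun k _ => ?_
  rw [Finset.sum_mul]
  exact Finset.sum_congr rfl fun l _ => by ring

lemma VanishY.pdX_iterate (h : VanishY (cyl α β T xr yr) (Ioo 0 yr) F) (hT : 0 < T) (hxr : 0 < xr)
    (hyr : 0 < yr) {n k : ℕ} (hk : k ≤ n) (hF : ContDiffOn ℝ n F (cyl α β T xr yr)) :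
    VanishY (cyl α β T xr yr) (Ioo 0 yr) ((RieszWave.pdX (cyl α β T xr yr))^[k] F) := by
  induction k with
  | zero => exact h
  | succ k ih =>
    rw [Function.iterate_succ_apply']
    exact (ih (by omega)).pdX (uniqueDiffOn_smoothSet hxr) one_ne_zero
      (contDiffOn_pdir_iterate (uniqueDiffOn_cyl hT hxr hyr) (by omega) hF _)

/-- The truncation error of the discrete Riesz operator in `x`. -/
def truncX (α xr : ℝ) (F : ℝ × ℝ × ℝ → ℝ) (N : ℕ) (i : Fin (N - 1)) (y t : ℝ) : ℝ :=
  nablaAt α xr N (fun x => F (x, y, t)) i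
    - rieszDeriv α xr (fun x => F (x, y, t)) (((i : ℕ) + 1) * (xr / N))

/-- On the faces `y = 0` and `y = yr` all derivatives in `x` vanish, so the consistency estimate
holds there with `M = 0`. -/
lemma truncX_eq_zero (h1 : 1 < α) (h2 : α ≤ 2) (hT : 0 < T) (hxr : 0 < xr)
    (hyr : 0 < yr) (hF : ContDiffOn ℝ 4 F (cyl α β T xr yr))
    (h0 : VanishX (cyl α β T xr yr) (Ioo 0 xr) F) (h0' : VanishY (cyl α β T xr yr) (Ioo 0 yr) F)
    {y t : ℝ} (hy : y ∈ Icc 0 yr) (hy' : y ∉ Ioo 0 yr) (ht : t ∈ Icc 0 T) {N : ℕ}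
    (i : Fin (N - 1)) : truncX α xr F N i y t = 0 := by
  obtain ⟨M, hM, hl⟩ := exists_isSmoothLine_x hT hxr hyr hF h0
  obtain ⟨C, hC, h⟩ := exists_abs_nablaAt_sub_le h1 h2 hxr
  have hd := hl y hy t ht
  have hz : IsSmoothLine α xr 0 (fun k x => (pdX (cyl α β T xr yr))^[k] F (x, y, t)) :=
    ⟨hd.hasDeriv, hd.cont, hd.zero, fun k hk x hx => le_of_eq (by
      rw [h0'.pdX_iterate hT hxr hyr (n := 4) hk hF x y t
        ⟨Icc_subset_smoothSet _ _ hx, Icc_subset_smoothSet _ _ hy, ht⟩ hy', abs_zero])⟩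
  have := h _ 0 hz N i
  rw [mul_zero, zero_mul] at this
  exact abs_nonpos_iff.1 this

/-- By linearity the consistency estimate applies to the difference of two lines, whose first four
`x` derivatives are `O(|y - y'|)`. The factor `h²` is kept along with the Lipschitz factor. -/
lemma exists_abs_truncX_sub_le (h1 : 1 < α) (h2 : α ≤ 2) (hT : 0 < T) (hxr : 0 < xr)
    (hyr : 0 < yr) (hF : ContDiffOn ℝ 8 F (cyl α β T xr yr))
    (h0 : VanishX (cyl α β T xr yr) (Ioo 0 xr) F) :
    ∃ K : ℝ, 0 < K ∧ ∀ y ∈ Icc 0 yr, ∀ y' ∈ Icc 0 yr, ∀ t ∈ Icc 0 T, ∀ (N : ℕ) (i : Fin (N - 1)),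
      |truncX α xr F N i y t - truncX α xr F N i y' t| ≤ K * (xr / N) ^ 2 * |y - y'| := by
  have hS : UniqueDiffOn ℝ (cyl α β T xr yr) := uniqueDiffOn_cyl hT hxr hyr
  obtain ⟨M, hM, hl⟩ := exists_isSmoothLine_x hT hxr hyr (hF.of_le (by norm_num)) h0
  obtain ⟨C, hC, h⟩ := exists_abs_nablaAt_sub_le h1 h2 hxr
  have hb : ∀ k : ℕ, ∃ K : ℝ, 0 < K ∧ (k ≤ 4 → ∀ x ∈ Icc 0 xr, ∀ y ∈ Icc 0 yr, ∀ t ∈ Icc 0 T,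
      |pdY (cyl α β T xr yr) ((pdX (cyl α β T xr yr))^[k] F) (x, y, t)| ≤ K) := fun k => by
    by_cases hk : k ≤ 4
    · obtain ⟨K, hK, hb⟩ := exists_bound_cyl (contDiffOn_pdir (m := 0) (n := 1) hS le_rfl
        (contDiffOn_pdir_iterate (m := 1) (k := k) (n := 8) hS (by omega) hF (1, 0, 0))
        (0, 1, 0)).continuousOn
      exact ⟨K, hK, fun _ => hb⟩
    · exact ⟨1, one_pos, fun h => absurd h hk⟩
  choose K hK hb using hb
  refine ⟨C * ∑ k ∈ Finset.range 5, K k, mul_pos hC (Finset.sum_pos (fun k _ => hK k) (by simp)),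
    fun y hy y' hy' t ht N i => ?_⟩
  have hd := (hl y hy t ht).sub (hl y' hy' t ht)
  have hd' : IsSmoothLine α xr ((∑ k ∈ Finset.range 5, K k) * |y - y'|)
      (fun k x => (pdX (cyl α β T xr yr))^[k] F (x, y, t)
        - (pdX (cyl α β T xr yr))^[k] F (x, y', t)) :=
    ⟨hd.hasDeriv, hd.cont, hd.zero, fun k hk x hx => by
      refine (abs_sub_le_of_hasDerivWithinAt (Icc_subset_smoothSet β yr)
        (f := fun y => (pdX (cyl α β T xr yr))^[k] F (x, y, t)) (fun z hz =>
          hasDerivWithinAt_pdY one_ne_zero (contDiffOn_pdir_iterate (n := 8) hS (by omega) hF _)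
            (Icc_subset_smoothSet _ _ hx) (Icc_subset_smoothSet _ _ hz) ht)
        (fun z hz => hb k hk x hx z hz t ht) hy hy').trans ?_
      gcongr
      exact Finset.single_le_sum (f := K) (fun j _ => (hK j).le)
        (Finset.mem_range.2 (by omega))⟩
  have e := h _ _ hd' N i
  rw [IsSmoothLine.rieszDeriv_sub h1 h2 (hl y hy t ht) (hl y' hy' t ht) (node_mem_Ioo hxr i)] at e
  have e2 : truncX α xr F N i y t - truncX α xr F N i y' t
      = nablaAt α xr N (fun x => F (x, y, t) - F (x, y', t)) i
        - (rieszDeriv α xr (fun x => F (x, y, t)) (((i : ℕ) + 1) * (xr / N))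
          - rieszDeriv α xr (fun x => F (x, y', t)) (((i : ℕ) + 1) * (xr / N))) := by
    simp only [truncX, nablaAt, mul_sub, Finset.sum_sub_distrib]
    ring
  rw [e2]
  refine e.trans (le_of_eq ?_)
  ring

end fields

/-! ### Exchanging the space variables -/

section swap

variable {α β T xr yr : ℝ} {F : ℝ × ℝ × ℝ → ℝ}

/-- Exchange of the two space variables. -/
def swapXY (F : ℝ × ℝ × ℝ → ℝ) (p : ℝ × ℝ × ℝ) : ℝ := F (p.2.1, p.1, p.2.2)

lemma contDiffOn_swapXY {n : ℕ∞} (hF : ContDiffOn ℝ n F (cyl α β T xr yr)) :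
    ContDiffOn ℝ n (swapXY F) (cyl β α T yr xr) :=
  hF.comp (by fun_prop : ContDiff ℝ n fun p : ℝ × ℝ × ℝ => (p.2.1, p.1, p.2.2)).contDiffOn
    fun _ hp => ⟨hp.2.1, hp.1, hp.2.2⟩

lemma VanishY.swapXY {J : Set ℝ} (h : VanishY (cyl α β T xr yr) J F) :
    VanishX (cyl β α T yr xr) J (swapXY F) :=
  fun x y t hp hx => h y x t ⟨hp.2.1, hp.1, hp.2.2⟩ hx

lemma VanishX.swapXY {J : Set ℝ} (h : VanishX (cyl α β T xr yr) J F) :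
    VanishY (cyl β α T yr xr) J (swapXY F) :=
  fun x y t hp hx => h y x t ⟨hp.2.1, hp.1, hp.2.2⟩ hx

lemma nablaAt_comm {xr yr : ℝ} (w : ℝ → ℝ → ℝ) {Nx Ny : ℕ} (i : Fin (Nx - 1)) (j : Fin (Ny - 1)) :
    nablaAt α xr Nx (fun x => nablaAt β yr Ny (w x) j) i
      = nablaAt β yr Ny (fun y => nablaAt α xr Nx (fun x => w x y) i) j := by
  simp only [nablaAt, Finset.mul_sum]
  rw [Finset.sum_comm]
  exact Finset.sum_congr rfl fun _ _ => Finset.sum_congr rfl fun _ _ => by ring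

/-- The discrete `x` derivative, as a function of `y`, is again a smooth line with bounds uniform in
`Nx`. Four derivatives in `y`, each bounded by means of four derivatives in `x`, account for the
eight orders of smoothness. -/
lemma exists_abs_nablaAt_xy_le (hα : 1 < α ∧ α ≤ 2) (hβ : 1 < β ∧ β ≤ 2) (hT : 0 < T) (hxr : 0 < xr)
    (hyr : 0 < yr) (hF : ContDiffOn ℝ 8 F (cyl α β T xr yr))
    (h0 : VanishX (cyl α β T xr yr) (Ioo 0 xr) F) (h0' : VanishY (cyl α β T xr yr) (Ioo 0 yr) F) :
    ∃ K : ℝ, 0 < K ∧ ∀ t ∈ Icc 0 T, ∀ (Nx Ny : ℕ) (i : Fin (Nx - 1)) (j : Fin (Ny - 1)),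
      |nablaAt α xr Nx (fun x => nablaAt β yr Ny (fun y => F (x, y, t)) j) i| ≤ K := by
  have hS : UniqueDiffOn ℝ (cyl α β T xr yr) := uniqueDiffOn_cyl hT hxr hyr
  have hb : ∀ k : ℕ, ∃ K : ℝ, 0 < K ∧ (k ≤ 4 → ∀ y ∈ Icc 0 yr, ∀ t ∈ Icc 0 T, ∀ (N : ℕ)
      (i : Fin (N - 1)), |nablaAt α xr N
        (fun x => (pdY (cyl α β T xr yr))^[k] F (x, y, t)) i| ≤ K) := fun k => by
    by_cases hk : k ≤ 4
    · obtain ⟨K, hK, hb⟩ := exists_abs_nablaAt_x_le hα.1 hα.2 hT hxr hyr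
        (contDiffOn_pdir_iterate (m := 4) (n := 8) (k := k) hS (by omega) hF (0, 1, 0))
        (h0.pdY_iterate (n := 8) (uniqueDiffOn_smoothSet hxr) (uniqueDiffOn_smoothSet hyr)
          (uniqueDiffOn_Icc hT) (by omega) hF)
      exact ⟨K, hK, fun _ => hb⟩
    · exact ⟨1, one_pos, fun h => absurd h hk⟩
  choose K hK hb using hb
  obtain ⟨C, hC, h⟩ := exists_abs_nablaAt_le hβ.1 hβ.2 hyr
  refine ⟨C * ∑ k ∈ Finset.range 5, K k, mul_pos hC (Finset.sum_pos (fun k _ => hK k) (by simp)),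
    fun t ht Nx Ny i j => ?_⟩
  rw [nablaAt_comm]
  have hmem : ∀ x ∈ Ioo 0 xr, x ∈ smoothSet α xr := fun x hx =>
    Icc_subset_smoothSet _ _ (Ioo_subset_Icc_self hx)
  refine h (fun k y => nablaAt α xr Nx (fun x => (pdY (cyl α β T xr yr))^[k] F (x, y, t)) i) _
    ⟨fun k hk y hy => ?_, ?_, fun y hy hy' => ?_, fun k hk y hy => ?_⟩ Ny j
  · refine hasDerivWithinAt_nablaAt hxr
      (w := fun y x => (pdY (cyl α β T xr yr))^[k] F (x, y, t))
      (w' := fun y x => (pdY (cyl α β T xr yr))^[k + 1] F (x, y, t)) (fun x hx => ?_) i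
    rw [Function.iterate_succ_apply']
    exact hasDerivWithinAt_pdY one_ne_zero
      (contDiffOn_pdir_iterate (n := 8) hS (by omega) hF _) (hmem x hx) hy ht
  · refine continuousOn_finsetSum _ fun l _ => continuousOn_const.mul ?_
    exact (contDiffOn_pdir_iterate (m := 0) (k := 4) (n := 8) hS (by norm_num) hF
      (0, 1, 0)).continuousOn.comp
      (by fun_prop : Continuous fun y : ℝ => (((l : ℕ) + 1 : ℝ) * (xr / Nx), y, t)).continuousOn
      fun y hy => ⟨hmem _ (node_mem_Ioo hxr l), hy, ht⟩
  · exact nablaAt_eq_zero hxr (fun x hx => h0' x y t ⟨hmem x hx, hy, ht⟩ hy') i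
  · exact (hb k hk y hy t ht Nx i).trans (Finset.single_le_sum (f := K) (fun j _ => (hK j).le)
      (Finset.mem_range.2 (by omega)))

lemma exists_abs_nablaAt_y_sub_le (hβ : 1 < β ∧ β ≤ 2) (hT : 0 < T)
    (hxr : 0 < xr) (hyr : 0 < yr) (hF : ContDiffOn ℝ 8 F (cyl α β T xr yr))
    (h0' : VanishY (cyl α β T xr yr) (Ioo 0 yr) F) :
    ∃ K : ℝ, 0 < K ∧ ∀ x ∈ Icc 0 xr, ∀ x' ∈ Icc 0 xr, ∀ t ∈ Icc 0 T,
      ∀ (N : ℕ) (j : Fin (N - 1)), |nablaAt β yr N (fun y => F (x, y, t)) j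
        - nablaAt β yr N (fun y => F (x', y, t)) j| ≤ K * |x - x'| := by
  have hS : UniqueDiffOn ℝ (cyl α β T xr yr) := uniqueDiffOn_cyl hT hxr hyr
  have hX : ContDiffOn ℝ 4 (pdX (cyl α β T xr yr) F) (cyl α β T xr yr) :=
    contDiffOn_pdir (m := 4) (n := 8) hS (by norm_num) hF _
  have hV := h0'.pdX (n := 8) (uniqueDiffOn_smoothSet hxr) (by norm_num) hF
  obtain ⟨K, hK, hb⟩ := exists_abs_nablaAt_x_le hβ.1 hβ.2 hT hyr hxr (contDiffOn_swapXY hX)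
    hV.swapXY
  refine ⟨K, hK, fun x hx x' hx' t ht N j => ?_⟩
  refine abs_sub_le_of_hasDerivWithinAt (Icc_subset_smoothSet α xr)
    (f := fun x => nablaAt β yr N (fun y => F (x, y, t)) j) (fun z hz =>
      hasDerivWithinAt_nablaAt hyr (w := fun x y => F (x, y, t))
        (w' := fun x y => pdX (cyl α β T xr yr) F (x, y, t)) (fun y hy =>
          hasDerivWithinAt_pdX (n := 8) (by norm_num) hF (Icc_subset_smoothSet _ _ hz)
            (Icc_subset_smoothSet _ _ (Ioo_subset_Icc_self hy)) ht) j)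
    (fun z hz => hb z hz t ht N j) hx hx'

end swap

/-! ### Restriction of Lipschitz functions to the nodes -/

lemma abs_node_sub {L : ℝ} (hL : 0 < L) {N : ℕ} (i l : Fin (N - 1)) :
    |((i : ℕ) + 1 : ℝ) * (L / N) - ((l : ℕ) + 1) * (L / N)| = nodeLen (L / N) i l := by
  have h0 : 0 ≤ L / N := by positivity
  rw [← sub_mul, abs_mul, abs_of_nonneg h0, nodeLen, nodeDist]
  congr 1
  rw [add_sub_add_right_eq_sub]
  rcases le_total (i : ℕ) l with h | h
  · rw [Nat.sub_eq_zero_of_le h, zero_add, Nat.cast_sub h, abs_sub_comm, abs_of_nonneg]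
    exact sub_nonneg.2 (by exact_mod_cast h)
  · rw [Nat.sub_eq_zero_of_le h, add_zero, Nat.cast_sub h, abs_of_nonneg]
    exact sub_nonneg.2 (by exact_mod_cast h)

/-- The grid function and its extension by zero have Lipschitz constant `K`. -/
structure IsLipGrid (L : ℝ) (N : ℕ) (K : ℝ) (v : Fin (N - 1) → ℝ) : Prop where
  lip : ∀ i l, |v i - v l| ≤ K * nodeLen (L / N) i l
  left : ∀ i : Fin (N - 1), |v i| ≤ K * (((i : ℕ) + 1) * (L / N))
  right : ∀ i : Fin (N - 1), |v i| ≤ K * (((N - 1 - 1 - (i : ℕ) : ℕ) + 1) * (L / N))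

lemma isLipGrid_of_lipschitz {L K : ℝ} (hL : 0 < L) {w : ℝ → ℝ}
    (hw : ∀ x ∈ Icc 0 L, ∀ x' ∈ Icc 0 L, |w x - w x'| ≤ K * |x - x'|) (h0 : w 0 = 0) (h1 : w L = 0)
    (N : ℕ) : IsLipGrid L N K (fun i => w (((i : ℕ) + 1) * (L / N))) where
  lip i l := by
    rw [← abs_node_sub hL]
    exact hw _ (Ioo_subset_Icc_self (node_mem_Ioo hL i)) _ (Ioo_subset_Icc_self (node_mem_Ioo hL l))
  left i := by
    have hi := node_mem_Ioo hL i
    have := hw _ (Ioo_subset_Icc_self hi) 0 ⟨le_rfl, hL.le⟩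
    rwa [h0, sub_zero, sub_zero, abs_of_pos hi.1] at this
  right i := by
    have hi := node_mem_Ioo hL i
    have h := hw _ (Ioo_subset_Icc_self hi) L ⟨hL.le, le_rfl⟩
    rw [h1, sub_zero, abs_sub_comm, abs_of_pos (sub_pos.2 hi.2)] at h
    refine h.trans (le_of_eq ?_)
    have i2 := i.2
    have hN : (N : ℝ) ≠ 0 := by
      have : 0 < N := by omega
      exact_mod_cast this.ne'
    rw [Nat.cast_sub (by omega), Nat.cast_sub (by omega), Nat.cast_sub (by omega)]
    push_cast
    field_simp
    ring

/-- The commutator of the discrete Riesz operator with a multiplication. -/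
lemma exists_abs_comm_nabla_le {α L : ℝ} (h1 : 1 < α) (h2 : α ≤ 2) (hL : 0 < L) :
    ∃ M : ℝ, 0 < M ∧ ∀ (N : ℕ) (c p : Fin (N - 1) → ℝ) (S K : ℝ), 0 ≤ S → 0 ≤ K →
      (∀ i l, |c i - c l| ≤ S * nodeLen (L / N) i l) →
      (∀ i, |∑ l, edgeW α (L / N) (N - 1) i (some l) ^ 2 * (c i - c l)|
        ≤ S * (1 + |edgeW α (L / N) (N - 1) i none|)) → IsLipGrid L N K p → ∀ i,
      |∑ l, nablaMat α (L / N) (N - 1) i l * (c l * p l)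
        - c i * ∑ l, nablaMat α (L / N) (N - 1) i l * p l|
        ≤ S ^ 2 * M + M * K ^ 2 + 2 * S * (K * L + 1 + M * K ^ 2) := by
  obtain ⟨M, hM0, hM⟩ := exists_moment_le h1 h2 hL
  obtain ⟨M', hM0', hM'⟩ := exists_row_grad_sq_le_of_lipschitz h1 h2 hL
  refine ⟨M + M', by positivity, fun N c p S K hS hK hc hσ hp i => ?_⟩
  have i2 := i.2
  have hN : 0 < N := by omega
  have hN' : (0 : ℝ) < N := by exact_mod_cast hN
  have hh : 0 < L / N := by positivity
  set g := edgeW α (L / N) (N - 1) with hg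
  -- The diagonal drops out, and `(c_l - c_i) p_l = (c_i - c_l) (p_i - p_l) - p_i (c_i - c_l)`
  -- separates a product of first differences from the second difference sum of `c`.
  have e1 : ∑ l, nablaMat α (L / N) (N - 1) i l * (c l * p l)
        - c i * ∑ l, nablaMat α (L / N) (N - 1) i l * p l
      = 2 * ∑ l, g i (some l) ^ 2 * ((c i - c l) * (p i - p l))
        - 2 * p i * ∑ l, g i (some l) ^ 2 * (c i - c l) := by
    rw [Finset.mul_sum, Finset.mul_sum, Finset.mul_sum, ← Finset.sum_sub_distrib,
      ← Finset.sum_sub_distrib]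
    refine Finset.sum_congr rfl fun l _ => ?_
    rw [hg, edgeW_some_sq h1 h2 hh]
    have e := neg_nablaMat_apply α (L / N) i l
    rw [Matrix.neg_apply, neg_eq_iff_eq_neg] at e
    rw [e]
    by_cases h : i = l
    · subst h; ring
    · rw [if_neg h]; ring
  have row := hM' N hN p K hK hp.lip hp.left hp.right i
  simp only [Fintype.sum_option, grad, tgt, sub_zero, mul_pow] at row
  have q0 : 0 ≤ ∑ l, g i (some l) ^ 2 * (p i - p l) ^ 2 := Finset.sum_nonneg fun _ _ => by positivity
  have q1 : 0 ≤ g i none ^ 2 * p i ^ 2 := by positivity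
  have f1 : |∑ l, g i (some l) ^ 2 * ((c i - c l) * (p i - p l))| ≤ (S ^ 2 * M + M' * K ^ 2) / 2 := by
    have f2 := sum_weight_dist_le (n := N - 1) h1 h2 hh (fun R hR => hM N hN R (by omega)) i
    have f3 : |∑ l, g i (some l) ^ 2 * ((c i - c l) * (p i - p l))|
        ≤ ∑ l, (S ^ 2 * (g i (some l) ^ 2 * nodeLen (L / N) i l ^ 2)
          + g i (some l) ^ 2 * (p i - p l) ^ 2) / 2 := by
      refine (Finset.abs_sum_le_sum_abs _ _).trans (Finset.sum_le_sum fun l _ => ?_)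
      rw [abs_mul, abs_of_nonneg (sq_nonneg _), abs_mul]
      have k1 : (c i - c l) ^ 2 ≤ (S * nodeLen (L / N) i l) ^ 2 := by
        rw [← sq_abs]; exact pow_le_pow_left₀ (abs_nonneg _) (hc i l) 2
      have k2 : |c i - c l| * |p i - p l| ≤ ((c i - c l) ^ 2 + (p i - p l) ^ 2) / 2 := by
        rw [← sq_abs (c i - c l), ← sq_abs (p i - p l)]
        linarith [two_mul_le_add_sq |c i - c l| |p i - p l|]
      calc _ ≤ g i (some l) ^ 2 * (((S * nodeLen (L / N) i l) ^ 2 + (p i - p l) ^ 2) / 2) := by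
            refine mul_le_mul_of_nonneg_left (k2.trans ?_) (sq_nonneg _)
            linarith
        _ = _ := by ring
    refine f3.trans ?_
    rw [← Finset.sum_div, Finset.sum_add_distrib, ← Finset.mul_sum]
    have f4 := mul_le_mul_of_nonneg_left f2 (sq_nonneg S)
    linarith
  have f5 : |p i| ≤ K * L := (hp.left i).trans
    (mul_le_mul_of_nonneg_left (node_mem_Ioo hL i).2.le hK)
  -- The row energy of the Lipschitz function `p` includes the grounded edge, so the decay of `p` at
  -- the boundary compensates the singular grounded weight.
  have f6 : |p i| * |g i none| ≤ 1 + M' * K ^ 2 := by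
    have : (|p i| * |g i none|) ^ 2 = g i none ^ 2 * p i ^ 2 := by
      rw [mul_pow, sq_abs, sq_abs]; ring
    nlinarith [sq_nonneg (|p i| * |g i none| - 1)]
  rw [e1]
  have f7 : |p i| * |∑ l, g i (some l) ^ 2 * (c i - c l)| ≤ S * (K * L + (1 + M' * K ^ 2)) := by
    calc _ ≤ |p i| * (S * (1 + |g i none|)) := mul_le_mul_of_nonneg_left (hσ i) (abs_nonneg _)
      _ = S * (|p i| + |p i| * |g i none|) := by ring
      _ ≤ _ := by gcongr
  refine (abs_sub _ _).trans ?_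
  rw [abs_mul, abs_mul, abs_mul, abs_of_pos (two_pos : (0 : ℝ) < 2), mul_assoc 2 |p i|]
  have : 0 ≤ S ^ 2 * M' := by positivity
  have : 0 ≤ M * K ^ 2 := by positivity
  have : 0 ≤ S * (M * K ^ 2) := by positivity
  nlinarith

/-! ### Restriction of smooth coefficients to the grid -/

lemma exists_isGridCoeff {α xr yr : ℝ} (h1 : 1 < α) (h2 : α ≤ 2) (hxr : 0 < xr) (hyr : 0 < yr)
    {c : ℝ → ℝ → ℝ} (hc : ContDiffOn ℝ 2 (fun p : ℝ × ℝ => c p.1 p.2) (Icc 0 xr ×ˢ Icc 0 yr)) :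
    ∃ S₀ : ℝ, 0 < S₀ ∧ ∀ S ≥ S₀, ∀ Nx Ny : ℕ,
      IsGridCoeff (edgeW α (xr / Nx) (Nx - 1)) (nodeLen (xr / Nx)) (nodeLen (yr / Ny)) S
        (sample xr yr Nx Ny c) := by
  obtain ⟨M, hM0, hM⟩ := exists_moment_le h1 h2 hxr
  -- A dummy time in `[0, 1]` makes the calculus on boxes available for `c`; with exponent 2 the set
  -- `smoothSet` is the closed interval, where `c` is smooth.
  set D : Set (ℝ × ℝ × ℝ) := cyl 2 2 1 xr yr with hD
  have hDe : D = Icc 0 xr ×ˢ Icc 0 yr ×ˢ Icc 0 1 := by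
    rw [hD, cyl, smoothSet_two, smoothSet_two]
  have hS : UniqueDiffOn ℝ D := uniqueDiffOn_cyl one_pos hxr hyr
  set F : ℝ × ℝ × ℝ → ℝ := fun p => c p.1 p.2.1 with hF
  have hFc : ContDiffOn ℝ 2 F D := by
    rw [hDe]
    exact hc.comp (by fun_prop : ContDiff ℝ 2 fun p : ℝ × ℝ × ℝ => (p.1, p.2.1)).contDiffOn
      fun p hp => ⟨hp.1, hp.2.1⟩
  have hX : ContDiffOn ℝ 1 (pdX D F) D := contDiffOn_pdir (m := 1) (n := 2) hS le_rfl hFc _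
  have hXX : ContDiffOn ℝ 0 (pdX D (pdX D F)) D :=
    contDiffOn_pdir (m := 0) (n := 1) hS le_rfl hX _
  obtain ⟨K0, k0, b0⟩ := exists_bound_cyl hFc.continuousOn
  obtain ⟨K1, k1, b1⟩ := exists_bound_cyl hX.continuousOn
  obtain ⟨K2, k2, b2⟩ := exists_bound_cyl
    (contDiffOn_pdir (m := 1) (n := 2) hS le_rfl hFc (0, 1, 0)).continuousOn
  obtain ⟨K3, k3, b3⟩ := exists_bound_cyl hXX.continuousOn
  obtain ⟨K4, k4, b4⟩ := exists_bound_cyl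
    (contDiffOn_pdir (m := 0) (n := 1) hS le_rfl hX (0, 1, 0)).continuousOn
  have ht : (0 : ℝ) ∈ Icc (0 : ℝ) 1 := ⟨le_rfl, zero_le_one⟩
  have sub : ∀ L : ℝ, Icc 0 L ⊆ smoothSet 2 L := fun L => Icc_subset_smoothSet 2 L
  have lX : ∀ y ∈ Icc 0 yr, ∀ x ∈ Icc 0 xr, ∀ x' ∈ Icc 0 xr, |c x y - c x' y| ≤ K1 * |x - x'| :=
    fun y hy x hx x' hx' => abs_sub_le_of_hasDerivWithinAt (sub xr) (f := fun x => F (x, y, 0))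
      (fun z hz => hasDerivWithinAt_pdX (n := 2) two_ne_zero hFc (sub _ hz) (sub _ hy) ht)
      (fun z hz => b1 z hz y hy 0 ht) hx hx'
  have lY : ∀ x ∈ Icc 0 xr, ∀ y ∈ Icc 0 yr, ∀ y' ∈ Icc 0 yr, |c x y - c x y'| ≤ K2 * |y - y'| :=
    fun x hx y hy y' hy' => abs_sub_le_of_hasDerivWithinAt (sub yr) (f := fun y => F (x, y, 0))
      (fun z hz => hasDerivWithinAt_pdY (n := 2) two_ne_zero hFc (sub _ hx) (sub _ hz) ht)
      (fun z hz => b2 x hx z hz 0 ht) hy hy'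
  have lXY : ∀ x ∈ Icc 0 xr, ∀ x' ∈ Icc 0 xr, ∀ y ∈ Icc 0 yr, ∀ y' ∈ Icc 0 yr,
      |c x y - c x y' - (c x' y - c x' y')| ≤ K4 * |y - y'| * |x - x'| := by
    intro x hx x' hx' y hy y' hy'
    refine abs_sub_le_of_hasDerivWithinAt (sub xr) (f := fun x => F (x, y, 0) - F (x, y', 0))
      (fun z hz => (hasDerivWithinAt_pdX (n := 2) two_ne_zero hFc (sub _ hz) (sub _ hy) ht).sub
        (hasDerivWithinAt_pdX (n := 2) two_ne_zero hFc (sub _ hz) (sub _ hy') ht))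
      (fun z hz => ?_) hx hx'
    exact abs_sub_le_of_hasDerivWithinAt (sub yr) (f := fun y => pdX D F (z, y, 0))
      (fun w hw => hasDerivWithinAt_pdY (n := 1) one_ne_zero hX (sub _ hz) (sub _ hw) ht)
      (fun w hw => b4 z hz w hw 0 ht) hy hy'
  have lXX : ∀ y ∈ Icc 0 yr, ∀ x ∈ Icc 0 xr, ∀ δ : ℝ, x - δ ∈ Icc 0 xr → x + δ ∈ Icc 0 xr →
      |2 * c x y - c (x - δ) y - c (x + δ) y| ≤ 2 * K3 * δ ^ 2 := by
    intro y hy x hx δ hm hp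
    have tay : ∀ z ∈ Icc 0 xr, |c z y - ∑ k ∈ Finset.range 2, (pdX D)^[k] F (x, y, 0)
        * ((z - x) ^ k / k.factorial)| ≤ K3 * |z - x| ^ 2 := fun z hz => by
      have hsub : uIcc x z ⊆ Icc 0 xr := uIcc_subset_Icc hx hz
      exact abs_sub_taylor_le 2 (fun k x => (pdX D)^[k] F (x, y, 0)) (hsub.trans (sub xr))
        (fun k hk w hw => by
          rw [Function.iterate_succ_apply']
          exact hasDerivWithinAt_pdX one_ne_zero
            (contDiffOn_pdir_iterate (n := 2) hS (by omega) hFc _) (sub _ (hsub hw)) (sub _ hy) ht)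
        (fun w hw => b3 w (hsub hw) y hy 0 ht)
    have e1 := tay _ hp
    have e2 := tay _ hm
    rw [add_sub_cancel_left, sq_abs] at e1
    rw [sub_sub_cancel_left, abs_neg, sq_abs] at e2
    simp only [Finset.sum_range_succ, Finset.sum_range_zero, Nat.factorial] at e1 e2
    norm_num [hF] at e1 e2
    rw [abs_le] at e1 e2 ⊢
    constructor <;> linarith [e1.1, e1.2, e2.1, e2.2]
  set Q := K1 + 2 * K3 with hQ
  refine ⟨K0 + K1 + K2 + K4 + Q * (M + 1), by positivity, fun S hSS Nx Ny => ?_⟩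
  have hQM : 0 < Q * (M + 1) := by positivity
  have nx := fun i : Fin (Nx - 1) => Ioo_subset_Icc_self (node_mem_Ioo hxr i)
  have ny := fun j : Fin (Ny - 1) => Ioo_subset_Icc_self (node_mem_Ioo hyr j)
  refine ⟨fun i j => ?_, fun i l j => ?_, fun i j m => ?_, fun i l j m => ?_, fun i j => ?_⟩
  · exact (b0 _ (nx i) _ (ny j) 0 ht).trans (by linarith)
  · refine (lX _ (ny j) _ (nx i) _ (nx l)).trans ?_
    rw [abs_node_sub hxr]
    exact mul_le_mul_of_nonneg_right (by linarith) (by unfold nodeLen; positivity)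
  · refine (lY _ (nx i) _ (ny j) _ (ny m)).trans ?_
    rw [abs_node_sub hyr]
    exact mul_le_mul_of_nonneg_right (by linarith) (by unfold nodeLen; positivity)
  · refine (lXY _ (nx i) _ (nx l) _ (ny j) _ (ny m)).trans ?_
    rw [abs_node_sub hyr, abs_node_sub hxr, mul_right_comm]
    have hl : 0 ≤ nodeLen (xr / Nx) i l := by unfold nodeLen; positivity
    have hm : 0 ≤ nodeLen (yr / Ny) j m := by unfold nodeLen; positivity
    gcongr
    linarith
  · have hi := i.2
    have hN : 0 < Nx := by omega
    have hN' : (0 : ℝ) < Nx := by exact_mod_cast hN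
    have hh : 0 < xr / Nx := by positivity
    have nn : ∀ l : ℕ, l < Nx - 1 → ((l : ℝ) + 1) * (xr / Nx) ∈ Icc 0 xr := fun l hl =>
      nx ⟨l, hl⟩
    have e := abs_sum_weight_sub_le (K := Q) (n := Nx - 1) h1 h2 hh hM0.le (by positivity)
      (fun R hR => hM Nx hN R (by omega))
      (fun l => c (((l : ℝ) + 1) * (xr / Nx)) (((j : ℕ) + 1) * (yr / Ny))) (fun i hi l hl r hr => by
        refine (lX _ (ny j) _ (nn i hi) _ (nn l hl)).trans ?_
        rw [← sub_mul, abs_mul, abs_of_pos hh, add_sub_add_right_eq_sub]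
        have : |(i : ℝ) - l| = r := by
          rcases hr with rfl | rfl
          · push_cast; rw [add_sub_cancel_left, Nat.abs_cast]
          · push_cast; rw [sub_add_cancel_left, abs_neg, Nat.abs_cast]
        rw [this]
        gcongr
        linarith) (fun i r hr hir => by
        have k := lXX _ (ny j) _ (nn i (by omega)) (r * (xr / Nx))
          (by convert nn (i - r) (by omega) using 1; rw [Nat.cast_sub hr]; ring)
          (by convert nn (i + r) hir using 1; push_cast; ring)
        rw [Nat.cast_sub hr]
        push_cast
        rw [show ((i : ℝ) - r + 1) * (xr / Nx) = (i + 1) * (xr / Nx) - r * (xr / Nx) by ring,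
          show ((i : ℝ) + r + 1) * (xr / Nx) = (i + 1) * (xr / Nx) + r * (xr / Nx) by ring]
        refine k.trans ?_
        gcongr
        linarith) i
    refine le_trans e ?_
    gcongr
    linarith

/-! ### Algebra of the grid operators -/

section operators

variable {α β θ τ xr yr : ℝ} {a b : ℝ → ℝ → ℝ} {Nx Ny : ℕ}

lemma sample_apply (w : ℝ → ℝ → ℝ) (i : Fin (Nx - 1)) (j : Fin (Ny - 1)) :
    sample xr yr Nx Ny w i j = w (((i : ℕ) + 1) * (xr / Nx)) (((j : ℕ) + 1) * (yr / Ny)) := rfl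

lemma opX_apply (v : Grid Nx Ny) (i : Fin (Nx - 1)) (j : Fin (Ny - 1)) :
    opX α xr yr a v i j
      = sample xr yr Nx Ny a i j * ∑ l, nablaMat α (xr / Nx) (Nx - 1) i l * v l j := rfl

lemma opY_apply (v : Grid Nx Ny) (i : Fin (Nx - 1)) (j : Fin (Ny - 1)) :
    opY β xr yr b v i j
      = sample xr yr Nx Ny b i j * ∑ l, nablaMat β (yr / Ny) (Ny - 1) j l * v i l := rfl

lemma opX_add (v w : Grid Nx Ny) : opX α xr yr a (v + w) = opX α xr yr a v + opX α xr yr a w := by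
  ext i j
  simp only [opX_apply, Matrix.add_apply, mul_add, Finset.sum_add_distrib]

lemma opX_smul (c : ℝ) (v : Grid Nx Ny) : opX α xr yr a (c • v) = c • opX α xr yr a v := by
  ext i j
  simp only [opX_apply, Matrix.smul_apply, smul_eq_mul, mul_left_comm _ c, ← Finset.mul_sum]

lemma opX_sub (v w : Grid Nx Ny) : opX α xr yr a (v - w) = opX α xr yr a v - opX α xr yr a w := by
  ext i j
  simp only [opX_apply, Matrix.sub_apply, mul_sub, Finset.sum_sub_distrib]

lemma opY_add (v w : Grid Nx Ny) : opY β xr yr b (v + w) = opY β xr yr b v + opY β xr yr b w := by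
  ext i j
  simp only [opY_apply, Matrix.add_apply, mul_add, Finset.sum_add_distrib]

lemma opY_smul (c : ℝ) (v : Grid Nx Ny) : opY β xr yr b (c • v) = c • opY β xr yr b v := by
  ext i j
  simp only [opY_apply, Matrix.smul_apply, smul_eq_mul, mul_left_comm _ c, ← Finset.mul_sum]

lemma opY_sub (v w : Grid Nx Ny) : opY β xr yr b (v - w) = opY β xr yr b v - opY β xr yr b w := by
  ext i j
  simp only [opY_apply, Matrix.sub_apply, mul_sub, Finset.sum_sub_distrib]

lemma adiOp_eq (v : Grid Nx Ny) :
    adiOp α β θ τ xr yr a b v = v - (θ * τ ^ 2) • (opX α xr yr a v + opY β xr yr b v)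
      + (θ ^ 2 * τ ^ 4) • opX α xr yr a (opY β xr yr b v) := by
  rw [adiOp]
  simp only [opX_sub, opX_smul, smul_sub, smul_add, smul_smul]
  rw [show θ * τ ^ 2 * (θ * τ ^ 2) = θ ^ 2 * τ ^ 4 by ring]
  abel

end operators

/-! ### The residual of the exact solution in the difference scheme -/

/-- The data of the initial boundary value problem. -/
structure IsWaveProblem (α β T xr yr a₀ a₁ b₀ b₁ : ℝ) (a b : ℝ → ℝ → ℝ) (f : ℝ → ℝ → ℝ → ℝ)
    (φ ψ : ℝ → ℝ → ℝ) (u : ℝ → ℝ → ℝ → ℝ) : Prop where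
  hα : 1 < α ∧ α ≤ 2
  hβ : 1 < β ∧ β ≤ 2
  hT : 0 < T
  hxr : 0 < xr
  hyr : 0 < yr
  ha₀ : 0 < a₀
  hb₀ : 0 < b₀
  ha : ∀ x ∈ Ioo 0 xr, ∀ y ∈ Ioo 0 yr, a₀ ≤ a x y ∧ a x y ≤ a₁
  hb : ∀ x ∈ Ioo 0 xr, ∀ y ∈ Ioo 0 yr, b₀ ≤ b x y ∧ b x y ≤ b₁
  ha_smooth : ContDiffOn ℝ 2 (fun p : ℝ × ℝ => a p.1 p.2) (Icc 0 xr ×ˢ Icc 0 yr)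
  hb_smooth : ContDiffOn ℝ 2 (fun p : ℝ × ℝ => b p.1 p.2) (Icc 0 xr ×ˢ Icc 0 yr)
  sol : IsExactSolution α β T xr yr a b f φ ψ u
  reg : IsRegular α β T xr yr u

namespace IsWaveProblem

variable {α β T xr yr a₀ a₁ b₀ b₁ : ℝ} {a b : ℝ → ℝ → ℝ} {f : ℝ → ℝ → ℝ → ℝ}
    {φ ψ : ℝ → ℝ → ℝ} {u : ℝ → ℝ → ℝ → ℝ}

/-- The exact solution as a function on `ℝ³`. -/
abbrev field (u : ℝ → ℝ → ℝ → ℝ) (p : ℝ × ℝ × ℝ) : ℝ := u p.1 p.2.1 p.2.2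

lemma contDiffOn (P : IsWaveProblem α β T xr yr a₀ a₁ b₀ b₁ a b f φ ψ u) :
    ContDiffOn ℝ 8 (field u) (cyl α β T xr yr) := P.reg

lemma vanishX (P : IsWaveProblem α β T xr yr a₀ a₁ b₀ b₁ a b f φ ψ u) :
    VanishX (cyl α β T xr yr) (Ioo 0 xr) (field u) :=
  fun x y t hp hx => P.sol.dirichlet x y (fun h => hx h.1) t hp.2.2

lemma vanishY (P : IsWaveProblem α β T xr yr a₀ a₁ b₀ b₁ a b f φ ψ u) :
    VanishY (cyl α β T xr yr) (Ioo 0 yr) (field u) :=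
  fun x y t hp hy => P.sol.dirichlet x y (fun h => hy h.2) t hp.2.2

lemma exists_abs_a_le (P : IsWaveProblem α β T xr yr a₀ a₁ b₀ b₁ a b f φ ψ u) :
    ∃ S : ℝ, 1 ≤ S ∧ (∀ (Nx Ny : ℕ) i j, |sample xr yr Nx Ny a i j| ≤ S)
      ∧ ∀ (Nx Ny : ℕ) i j, |sample xr yr Nx Ny b i j| ≤ S := by
  refine ⟨|a₁| + |b₁| + 1, by linarith [abs_nonneg a₁, abs_nonneg b₁], fun Nx Ny i j => ?_,
    fun Nx Ny i j => ?_⟩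
  · have h := P.ha _ (node_mem_Ioo P.hxr i) _ (node_mem_Ioo P.hyr j)
    rw [sample_apply, abs_of_pos (P.ha₀.trans_le h.1)]
    linarith [h.2, le_abs_self a₁, abs_nonneg b₁]
  · have h := P.hb _ (node_mem_Ioo P.hxr i) _ (node_mem_Ioo P.hyr j)
    rw [sample_apply, abs_of_pos (P.hb₀.trans_le h.1)]
    linarith [h.2, le_abs_self b₁, abs_nonneg a₁]

/-- The composition of the two discrete operators stays bounded on the exact solution. -/
lemma exists_abs_opX_opY_le (P : IsWaveProblem α β T xr yr a₀ a₁ b₀ b₁ a b f φ ψ u) :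
    ∃ K : ℝ, 0 < K ∧ ∀ t ∈ Icc 0 T, ∀ (Nx Ny : ℕ) i j,
      |opX α xr yr a (opY β xr yr b (sample xr yr Nx Ny fun x y => u x y t)) i j| ≤ K := by
  obtain ⟨S, hS1, hSa, hSb⟩ := P.exists_abs_a_le
  obtain ⟨S', hS', hc⟩ := exists_isGridCoeff P.hα.1 P.hα.2 P.hxr P.hyr P.hb_smooth
  obtain ⟨K, hK, h1⟩ := exists_abs_nablaAt_xy_le P.hα P.hβ P.hT P.hxr P.hyr P.contDiffOn
    P.vanishX P.vanishY
  obtain ⟨K', hK', h2⟩ := exists_abs_nablaAt_y_sub_le P.hβ P.hT P.hxr P.hyr P.contDiffOn P.vanishY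
  obtain ⟨M, hM, h3⟩ := exists_abs_comm_nabla_le P.hα.1 P.hα.2 P.hxr
  have hxr := P.hxr
  refine ⟨S * (S * K + (S' ^ 2 * M + M * K' ^ 2 + 2 * S' * (K' * xr + 1 + M * K' ^ 2))),
    by positivity, fun t ht Nx Ny i j => ?_⟩
  -- The coefficient `b` is commuted past the `x` operator. The main part is the composed operator
  -- without coefficients; the commutator is bounded because `W` is Lipschitz and vanishes at both
  -- ends.
  set W : ℝ → ℝ := fun x => nablaAt β yr Ny (fun y => u x y t) j with hW
  have hz : ∀ x ∈ Icc 0 xr, x ∉ Ioo 0 xr → W x = 0 := fun x hx hx' =>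
    nablaAt_eq_zero P.hyr (fun y _ => P.sol.dirichlet x y (fun h => hx' h.1) t ht) j
  have hl := isLipGrid_of_lipschitz P.hxr (w := W) (fun x hx x' hx' => h2 x hx x' hx' t ht Ny j)
    (hz 0 ⟨le_rfl, P.hxr.le⟩ (by simp)) (hz xr ⟨P.hxr.le, le_rfl⟩ (by simp)) Nx
  have g := hc S' le_rfl Nx Ny
  have e1 := h3 Nx (fun i => sample xr yr Nx Ny b i j) _ S' K' hS'.le hK'.le
    (fun i l => g.lipX i l j) (fun i => g.secondX i j) hl i
  have e2 : |∑ l, nablaMat α (xr / Nx) (Nx - 1) i l * W (((l : ℕ) + 1) * (xr / Nx))| ≤ K :=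
    h1 t ht Nx Ny i j
  have e3 : opX α xr yr a (opY β xr yr b (sample xr yr Nx Ny fun x y => u x y t)) i j
      = sample xr yr Nx Ny a i j * ∑ l, nablaMat α (xr / Nx) (Nx - 1) i l
        * (sample xr yr Nx Ny b l j * W (((l : ℕ) + 1) * (xr / Nx))) := rfl
  rw [e3, abs_mul]
  refine mul_le_mul (hSa Nx Ny i j) ?_ (abs_nonneg _) (by linarith)
  have e4 := abs_add_le (sample xr yr Nx Ny b i j
      * ∑ l, nablaMat α (xr / Nx) (Nx - 1) i l * W (((l : ℕ) + 1) * (xr / Nx)))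
    (∑ l, nablaMat α (xr / Nx) (Nx - 1) i l
        * (sample xr yr Nx Ny b l j * W (((l : ℕ) + 1) * (xr / Nx))) - sample xr yr Nx Ny b i j
      * ∑ l, nablaMat α (xr / Nx) (Nx - 1) i l * W (((l : ℕ) + 1) * (xr / Nx)))
  rw [add_sub_cancel] at e4
  refine e4.trans (add_le_add ?_ e1)
  rw [abs_mul]
  exact mul_le_mul (hSb Nx Ny i j) e2 (abs_nonneg _) (by linarith)

/-- The exact solution satisfies the difference scheme up to second order. -/
lemma exists_abs_residual_le (P : IsWaveProblem α β T xr yr a₀ a₁ b₀ b₁ a b f φ ψ u) :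
    ∃ K : ℝ, 0 < K ∧ ∀ θ : ℝ, 1 / 4 ≤ θ → θ ≤ 1 → ∀ s τ : ℝ, s ∈ Icc 0 T → s - τ ∈ Icc 0 T →
      s + τ ∈ Icc 0 T → ∀ (Nx Ny : ℕ) i j, ∀ V : ℝ → Grid Nx Ny,
      (∀ t, V t = sample xr yr Nx Ny fun x y => u x y t) →
      |adiOp α β θ τ xr yr a b (V (s + τ) - (2 : ℝ) • V s + V (s - τ)) i j
        - τ ^ 2 * (opX α xr yr a (V s) + opY β xr yr b (V s)
          + sample xr yr Nx Ny fun x y => f x y s) i j|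
        ≤ K * τ ^ 2 * (τ ^ 2 + (xr / Nx) ^ 2 + (yr / Ny) ^ 2) := by
  obtain ⟨S, hS1, hSa, hSb⟩ := P.exists_abs_a_le
  have hF := P.contDiffOn
  obtain ⟨K1, k1, b1⟩ := exists_abs_time_second_diff_sub_le P.hT P.hxr P.hyr (hF.of_le (by norm_num))
  obtain ⟨K2, k2, b2⟩ := exists_abs_nablaAt_x_sub_rieszDeriv_le P.hα.1 P.hα.2 P.hT P.hxr P.hyr
    (hF.of_le (by norm_num)) P.vanishX
  obtain ⟨K3, k3, b3⟩ := exists_abs_nablaAt_x_sub_rieszDeriv_le P.hβ.1 P.hβ.2 P.hT P.hyr P.hxr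
    (contDiffOn_swapXY (n := 4) (hF.of_le (by norm_num))) P.vanishY.swapXY
  obtain ⟨K4, k4, b4⟩ := exists_abs_nablaAt_x_second_diff_le P.hα.1 P.hα.2 P.hT P.hxr P.hyr
    hF P.vanishX
  obtain ⟨K5, k5, b5⟩ := exists_abs_nablaAt_x_second_diff_le P.hβ.1 P.hβ.2 P.hT P.hyr P.hxr
    (contDiffOn_swapXY (n := 8) hF) P.vanishY.swapXY
  obtain ⟨K6, k6, b6⟩ := P.exists_abs_opX_opY_le
  have S0 : 0 < S := by linarith
  refine ⟨K1 + S * K2 + S * K3 + (S * K4 + S * K5) + 4 * K6, by positivity,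
    fun θ hθ hθ1 s τ hs hm hp Nx Ny i j V hV => ?_⟩
  have hi := node_mem_Ioo P.hxr i
  have hj := node_mem_Ioo P.hyr j
  set x := ((i : ℕ) + 1 : ℝ) * (xr / Nx) with hx
  set y := ((j : ℕ) + 1 : ℝ) * (yr / Ny) with hy
  have q1 := b1 x hi y hj s τ hs hm hp
  have q2 := b2 y (Ioo_subset_Icc_self hj) s hs Nx i
  have q3 := b3 x (Ioo_subset_Icc_self hi) s hs Ny j
  have q4 := b4 y (Ioo_subset_Icc_self hj) s τ hs hm hp Nx i
  have q5 := b5 x (Ioo_subset_Icc_self hi) s τ hs hm hp Ny j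
  have q6 := b6 _ hp Nx Ny i j
  have q7 := b6 _ hs Nx Ny i j
  have q8 := b6 _ hm Nx Ny i j
  rw [← hV] at q6 q7 q8
  have eq := P.sol.equation x hi y hj s hs
  set ga := sample xr yr Nx Ny a i j with hga
  set gb := sample xr yr Nx Ny b i j with hgb
  have ea : a x y = ga := rfl
  have eb : b x y = gb := rfl
  rw [ea, eb] at eq
  have hAx := hSa Nx Ny i j
  have hBy := hSb Nx Ny i j
  rw [← hga] at hAx
  rw [← hgb] at hBy
  have vX : ∀ t, opX α xr yr a (V t) i j = ga * nablaAt α xr Nx (fun x => u x y t) i := fun t => by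
    rw [hV]; rfl
  have vY : ∀ t, opY β xr yr b (V t) i j = gb * nablaAt β yr Ny (fun y => u x y t) j := fun t => by
    rw [hV]; rfl
  have vV : ∀ t, V t i j = u x y t := fun t => by rw [hV]; rfl
  have vf : (sample xr yr Nx Ny fun x y => f x y s) i j = f x y s := rfl
  simp only [swapXY, IsWaveProblem.field] at q1 q2 q3 q4 q5
  rw [← hx] at q2
  rw [← hy] at q3
  simp only [adiOp_eq, opX_add, opX_sub, opX_smul, opY_add, opY_sub, opY_smul, Matrix.add_apply,
    Matrix.sub_apply, Matrix.smul_apply, smul_eq_mul, vX, vY, vV, vf]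
  have T2 : |ga * (nablaAt α xr Nx (fun x => u x y s) i - rieszDeriv α xr (fun x => u x y s) x)
      + gb * (nablaAt β yr Ny (fun y => u x y s) j - rieszDeriv β yr (fun y => u x y s) y)|
      ≤ S * (K2 * (xr / Nx) ^ 2) + S * (K3 * (yr / Ny) ^ 2) := by
    refine (abs_add_le _ _).trans ?_
    rw [abs_mul, abs_mul]
    gcongr
  have T3 : |ga * (nablaAt α xr Nx (fun x => u x y (s + τ)) i
        - 2 * nablaAt α xr Nx (fun x => u x y s) i + nablaAt α xr Nx (fun x => u x y (s - τ)) i)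
      + gb * (nablaAt β yr Ny (fun y => u x y (s + τ)) j
        - 2 * nablaAt β yr Ny (fun y => u x y s) j + nablaAt β yr Ny (fun y => u x y (s - τ)) j)|
      ≤ S * (K4 * τ ^ 2) + S * (K5 * τ ^ 2) := by
    refine (abs_add_le _ _).trans ?_
    rw [abs_mul, abs_mul]
    gcongr
  -- Boundedness suffices: the splitting term carries `θ² τ⁴`, which already is `τ²` times second
  -- order, so no smallness of this time difference is needed.
  have T4 : |opX α xr yr a (opY β xr yr b (V (s + τ))) i j
      - 2 * opX α xr yr a (opY β xr yr b (V s)) i j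
      + opX α xr yr a (opY β xr yr b (V (s - τ))) i j| ≤ 4 * K6 := by
    rw [abs_le] at q6 q7 q8 ⊢
    constructor <;> linarith [q6.1, q6.2, q7.1, q7.2, q8.1, q8.2]
  have split : ∀ D w n n' r r' N N' Q F : ℝ, w = ga * r + gb * r' + F →
      D - θ * τ ^ 2 * (ga * N + gb * N') + θ ^ 2 * τ ^ 4 * Q
        - τ ^ 2 * (ga * n + gb * n' + F)
      = (D - τ ^ 2 * w) - τ ^ 2 * (ga * (n - r) + gb * (n' - r'))
        - θ * τ ^ 2 * (ga * N + gb * N') + θ ^ 2 * τ ^ 4 * Q := fun D w n n' r r' N N' Q F h => by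
    rw [h]; ring
  have e := split (u x y (s + τ) - 2 * u x y s + u x y (s - τ)) _
    (nablaAt α xr Nx (fun x => u x y s) i) (nablaAt β yr Ny (fun y => u x y s) j) _ _
    (nablaAt α xr Nx (fun x => u x y (s + τ)) i
        - 2 * nablaAt α xr Nx (fun x => u x y s) i + nablaAt α xr Nx (fun x => u x y (s - τ)) i)
    (nablaAt β yr Ny (fun y => u x y (s + τ)) j
        - 2 * nablaAt β yr Ny (fun y => u x y s) j + nablaAt β yr Ny (fun y => u x y (s - τ)) j)
    (opX α xr yr a (opY β xr yr b (V (s + τ))) i j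
      - 2 * opX α xr yr a (opY β xr yr b (V s)) i j
      + opX α xr yr a (opY β xr yr b (V (s - τ))) i j) _ eq
  refine le_trans (le_of_eq (congrArg abs (Eq.trans ?_ e))) ?_
  · ring
  refine (abs_add_le _ _).trans ?_
  refine (add_le_add_left ((abs_sub _ _).trans (add_le_add_left (abs_sub _ _) _)) _).trans ?_
  rw [abs_mul (τ ^ 2), abs_mul (θ * τ ^ 2), abs_mul (θ ^ 2 * τ ^ 4), abs_of_nonneg (sq_nonneg τ),
    abs_of_nonneg (by positivity : 0 ≤ θ * τ ^ 2), abs_of_nonneg (by positivity : 0 ≤ θ ^ 2 * τ ^ 4)]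
  calc _ ≤ K1 * τ ^ 4 + τ ^ 2 * (S * (K2 * (xr / Nx) ^ 2) + S * (K3 * (yr / Ny) ^ 2))
        + 1 * τ ^ 2 * (S * (K4 * τ ^ 2) + S * (K5 * τ ^ 2)) + 1 ^ 2 * τ ^ 4 * (4 * K6) := by
        gcongr
    _ = (K1 + (S * K4 + S * K5) + 4 * K6) * τ ^ 2 * τ ^ 2 + S * K2 * τ ^ 2 * (xr / Nx) ^ 2
        + S * K3 * τ ^ 2 * (yr / Ny) ^ 2 := by ring
    _ ≤ (K1 + S * K2 + S * K3 + (S * K4 + S * K5) + 4 * K6) * τ ^ 2 * τ ^ 2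
        + (K1 + S * K2 + S * K3 + (S * K4 + S * K5) + 4 * K6) * τ ^ 2 * (xr / Nx) ^ 2
        + (K1 + S * K2 + S * K3 + (S * K4 + S * K5) + 4 * K6) * τ ^ 2 * (yr / Ny) ^ 2 := by
        have := mul_pos S0 k2
        have := mul_pos S0 k3
        have := mul_pos S0 k4
        have := mul_pos S0 k5
        gcongr <;> linarith
    _ = _ := by ring

end IsWaveProblem

/-! ### Grid functions of small energy -/

section small

variable {ι κ : Type*} [Fintype ι] [Fintype κ] {gx : ι → Option ι → ℝ} {gy : κ → Option κ → ℝ}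

lemma gradX_gradY_comm (v : ι → κ → ℝ) (e : ι × Option ι) (f : κ × Option κ) :
    gradX gx (gradY gy v) e f = gradY gy (gradX gx v) e f := by
  obtain ⟨i, _ | l⟩ := e <;> obtain ⟨j, _ | m⟩ := f <;>
    simp only [gradX, gradY, grad, tgt] <;> ring

/-- Smallness of a grid function together with its discrete gradients. -/
structure IsSmall (gx : ι → Option ι → ℝ) (gy : κ → Option κ → ℝ) (H τ δ : ℝ) (v : ι → κ → ℝ) :
    Prop where
  zero : H * nrm v ≤ τ * δ
  X : H * nrm (gradX gx v) ≤ δ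
  Y : H * nrm (gradY gy v) ≤ δ
  XY : H * (τ * nrm (gradX gx (gradY gy v))) ≤ δ

variable {H τ δ δ' : ℝ} {v w : ι → κ → ℝ}

lemma IsSmall.add (hH : 0 ≤ H) (hτ : 0 ≤ τ) (hv : IsSmall gx gy H τ δ v)
    (hw : IsSmall gx gy H τ δ' w) : IsSmall gx gy H τ (δ + δ') (fun i j => v i j + w i j) := by
  have eY : ∀ i f, gradY gy (fun i j => v i j + w i j) i f = gradY gy v i f + gradY gy w i f :=
    fun i f => grad_add gy (v i) (w i) f
  have eX : ∀ e j, gradX gx (fun i j => v i j + w i j) e j = gradX gx v e j + gradX gx w e j :=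
    fun e j => grad_add gx (fun i => v i j) (fun i => w i j) e
  have tri : ∀ {x y z p q : ℝ}, x ≤ y + z → H * y ≤ p → H * z ≤ q → H * x ≤ p + q :=
    fun h h1 h2 => (mul_le_mul_of_nonneg_left h hH).trans (by rw [mul_add]; exact add_le_add h1 h2)
  refine ⟨?_, tri ?_ hv.X hw.X, tri ?_ hv.Y hw.Y, tri ?_ hv.XY hw.XY⟩
  · rw [mul_add]
    exact tri (nrm_add_le v w) hv.zero hw.zero
  · rw [nrm_eq_of_forall eX]
    exact nrm_add_le _ _
  · rw [nrm_eq_of_forall eY]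
    exact nrm_add_le _ _
  · rw [← mul_add]
    refine mul_le_mul_of_nonneg_left ?_ hτ
    rw [nrm_eq_of_forall (g := fun e f => gradX gx (gradY gy v) e f + gradX gx (gradY gy w) e f)
      fun e f => ?_]
    · exact nrm_add_le _ _
    · rw [show gradY gy (fun i j => v i j + w i j) = fun i f => gradY gy v i f + gradY gy w i f from
        funext fun i => funext fun f => eY i f]
      exact grad_add gx (fun i => gradY gy v i f) (fun i => gradY gy w i f) e

lemma IsSmall.swap (hv : IsSmall gy gx H τ δ (fun j i => v i j)) : IsSmall gx gy H τ δ v where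
  zero := by rw [← nrm_swap]; exact hv.zero
  X := by rw [← nrm_swap]; exact hv.Y
  Y := by rw [← nrm_swap]; exact hv.X
  XY := by
    rw [← nrm_swap, nrm_eq_of_forall fun f e => gradX_gradY_comm v e f]
    exact hv.XY

/-- Meant for the first step: since `e^0 = 0`, the difference and the sum of the first two errors
coincide, and the weights `1 / 4` and `θ - 1 / 4` add up to `θ`. -/
lemma IsSmall.modEnergy_le {a b : ι → κ → ℝ} {θ S : ℝ} (hH : 0 ≤ H) (hτ : 0 < τ) (hτ1 : τ ≤ 1)
    (hθ : 1 / 4 ≤ θ) (hθ1 : θ ≤ 1) (hS : 1 ≤ S) (ha : ∀ i j, |a i j| ≤ S) (hb : ∀ i j, |b i j| ≤ S)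
    (hv : IsSmall gx gy H τ δ v) :
    H ^ 2 * modEnergy gx gy a b θ τ v v ≤ 5 * S ^ 2 * δ ^ 2 := by
  have n0 := nrm_nonneg v
  have nX := nrm_nonneg (gradX gx v)
  have nY := nrm_nonneg (gradY gy v)
  have nXY := nrm_nonneg (gradX gx (gradY gy v))
  have q0 := pow_le_pow_left₀ (by positivity) hv.zero 2
  have qX := pow_le_pow_left₀ (by positivity) hv.X 2
  have qY := pow_le_pow_left₀ (by positivity) hv.Y 2
  have qXY := pow_le_pow_left₀ (by positivity) hv.XY 2
  have wX : wsq (fun (e : ι × Option ι) j => a e.1 j) (gradX gx v) ≤ S * nrm (gradX gx v) ^ 2 :=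
    wsq_le_mul_nrm_sq fun e j => (le_abs_self _).trans (ha _ _)
  have wY : wsq (fun i (f : κ × Option κ) => b i f.1) (gradY gy v) ≤ S * nrm (gradY gy v) ^ 2 :=
    wsq_le_mul_nrm_sq fun i f => (le_abs_self _).trans (hb _ _)
  have wXY : wsq (fun (e : ι × Option ι) (f : κ × Option κ) => a e.1 f.1 * b e.1 f.1)
      (gradX gx (gradY gy v)) ≤ S * S * nrm (gradX gx (gradY gy v)) ^ 2 :=
    wsq_le_mul_nrm_sq fun e f => (le_abs_self _).trans (by
      rw [abs_mul]; exact mul_le_mul (ha _ _) (hb _ _) (abs_nonneg _) (by linarith))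
  have form : formSum gx gy a b v ≤ S * nrm (gradX gx v) ^ 2 + S * nrm (gradY gy v) ^ 2 :=
    add_le_add wX wY
  rw [modEnergy]
  have e1 : H ^ 2 * (nrm v ^ 2 / τ ^ 2) ≤ δ ^ 2 := by
    rw [mul_div_assoc', div_le_iff₀ (by positivity)]
    calc _ = (H * nrm v) ^ 2 := by ring
      _ ≤ _ := q0
      _ = _ := by ring
  have e2 : H ^ 2 * (θ * formSum gx gy a b v) ≤ 2 * S * δ ^ 2 := by
    calc _ ≤ H ^ 2 * (θ * (S * nrm (gradX gx v) ^ 2 + S * nrm (gradY gy v) ^ 2)) := by gcongr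
      _ ≤ H ^ 2 * (1 * (S * nrm (gradX gx v) ^ 2 + S * nrm (gradY gy v) ^ 2)) := by gcongr
      _ = S * (H * nrm (gradX gx v)) ^ 2 + S * (H * nrm (gradY gy v)) ^ 2 := by ring
      _ ≤ S * δ ^ 2 + S * δ ^ 2 := by gcongr
      _ = _ := by ring
  have e3 : H ^ 2 * (θ ^ 2 * τ ^ 2 * wsq (fun (e : ι × Option ι) (f : κ × Option κ) =>
      a e.1 f.1 * b e.1 f.1) (gradX gx (gradY gy v))) ≤ S ^ 2 * δ ^ 2 := by
    calc _ ≤ H ^ 2 * (θ ^ 2 * τ ^ 2 * (S * S * nrm (gradX gx (gradY gy v)) ^ 2)) := by gcongr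
      _ ≤ H ^ 2 * (1 ^ 2 * τ ^ 2 * (S * S * nrm (gradX gx (gradY gy v)) ^ 2)) := by gcongr
      _ = S ^ 2 * (H * (τ * nrm (gradX gx (gradY gy v)))) ^ 2 := by ring
      _ ≤ _ := by gcongr
  have e4 : H ^ 2 * (τ ^ 2 * nrm (gradY gy v) ^ 2) ≤ δ ^ 2 := by
    calc _ ≤ H ^ 2 * (1 ^ 2 * nrm (gradY gy v) ^ 2) := by gcongr
      _ = (H * nrm (gradY gy v)) ^ 2 := by ring
      _ ≤ _ := qY
  have hS2 : S ≤ S ^ 2 := by nlinarith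
  have hδ : 0 ≤ δ ^ 2 := sq_nonneg _
  have := mul_le_mul_of_nonneg_right hS2 hδ
  have := mul_le_mul_of_nonneg_right (hS.trans hS2) hδ
  linarith

end small

/-! ### From bounds at the nodes to smallness of the discrete gradients -/

section nodes

variable {α β xr yr τ K : ℝ} {Nx Ny : ℕ}

lemma nrm_le_of_abs_le {c : ℝ} (hxr : 0 < xr) (hyr : 0 < yr)
    {v : Fin (Nx - 1) → Fin (Ny - 1) → ℝ} (hNx : 0 < Nx) (hNy : 0 < Ny) (hc : 0 ≤ c)
    (hv : ∀ i j, |v i j| ≤ c) : √(xr / Nx * (yr / Ny)) * nrm v ≤ √(xr * yr) * c := by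
  have hx : (0 : ℝ) < Nx := by exact_mod_cast hNx
  have hy : (0 : ℝ) < Ny := by exact_mod_cast hNy
  have h : nrm v ≤ √((Nx : ℝ) * Ny) * c := by
    refine nrm_le_of_sq_le (by positivity) ?_
    calc ∑ i, ∑ j, v i j ^ 2 ≤ ∑ _i : Fin (Nx - 1), ∑ _j : Fin (Ny - 1), c ^ 2 :=
          Finset.sum_le_sum fun i _ => Finset.sum_le_sum fun j _ => by
            rw [← sq_abs]; exact pow_le_pow_left₀ (abs_nonneg _) (hv i j) 2
      _ = ((Nx - 1 : ℕ) : ℝ) * (((Ny - 1 : ℕ) : ℝ) * c ^ 2) := by simp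
      _ ≤ Nx * (Ny * c ^ 2) := by
          have h1 : ((Nx - 1 : ℕ) : ℝ) ≤ Nx := by exact_mod_cast Nat.sub_le _ _
          have h2 : ((Ny - 1 : ℕ) : ℝ) ≤ Ny := by exact_mod_cast Nat.sub_le _ _
          gcongr
      _ = _ := by rw [mul_pow, Real.sq_sqrt (by positivity)]; ring
  calc _ ≤ √(xr / Nx * (yr / Ny)) * (√((Nx : ℝ) * Ny) * c) := by gcongr
    _ = √(xr / Nx * (yr / Ny) * (Nx * Ny)) * c := by
        rw [Real.sqrt_mul (by positivity : 0 ≤ xr / Nx * (yr / Ny))]; ring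
    _ = _ := by congr 2; field_simp

/-- The estimate behind it costs `h^{-α/2}`; since `h ≤ L`, this is replaced by `h^{-1}`, which
suffices against the factor `h²` of a truncation error. -/
lemma exists_nrm_gradX_le {α L : ℝ} (h1 : 1 < α) (h2 : α ≤ 2) (hL : 0 < L) :
    ∃ C : ℝ, 0 < C ∧ ∀ N : ℕ, 0 < N → ∀ {γ : Type} [Fintype γ] (v : Fin (N - 1) → γ → ℝ),
      nrm (gradX (edgeW α (L / N) (N - 1)) v) ≤ C / (L / N) * nrm v := by
  have hk := kappa_neg h1 h2
  refine ⟨√(4 * |wsCoeff α 1| * (-kappa α * L ^ (2 - α))) + 1, by positivity, fun N hN γ _ v => ?_⟩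
  have hN' : (1 : ℝ) ≤ N := by exact_mod_cast hN
  have hh : 0 < L / N := by positivity
  set h := L / N with hhd
  have hs : lineScale α h ≤ -kappa α * L ^ (2 - α) / h ^ 2 := by
    rw [le_div_iff₀ (by positivity), lineScale_mul_sq hh]
    have : h ^ (2 - α) ≤ L ^ (2 - α) :=
      Real.rpow_le_rpow hh.le (div_le_self hL.le hN') (by linarith)
    exact mul_le_mul_of_nonneg_left this (by linarith)
  set Q := 4 * |wsCoeff α 1| * (-kappa α * L ^ (2 - α)) with hQ
  have hQ0 : 0 ≤ Q := by
    have : 0 ≤ -kappa α := by linarith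
    positivity
  have h3 : nrm (gradX (edgeW α h (N - 1)) v) ≤ √Q / h * nrm v := by
    refine nrm_le_of_sq_le (mul_nonneg (by positivity) (nrm_nonneg _)) ?_
    rw [mul_pow, nrm_sq, div_pow, Real.sq_sqrt hQ0, Finset.sum_comm,
      Finset.sum_comm (s := Finset.univ (α := Fin (N - 1))), Finset.mul_sum]
    refine Finset.sum_le_sum fun j _ => ?_
    refine (sum_grad_sq_le h1 h2 hh fun i => v i j).trans ?_
    refine mul_le_mul_of_nonneg_right ?_ (Finset.sum_nonneg fun _ _ => sq_nonneg _)
    calc _ ≤ 4 * |wsCoeff α 1| * (-kappa α * L ^ (2 - α) / h ^ 2) := by gcongr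
      _ = _ := by rw [hQ]; ring
  refine h3.trans ?_
  have := nrm_nonneg v
  gcongr
  linarith

/-- Interpolation: `‖gradX v‖² = ⟨A v, v⟩`, and the mixed gradient satisfies `‖gradX gradY v‖² = ⟨B
v, A v⟩`, so no bound on the composed operator is required. -/
lemma isSmall_of_mul (hα : 1 < α ∧ α ≤ 2) (hβ : 1 < β ∧ β ≤ 2) (hxr : 0 < xr) (hyr : 0 < yr)
    (hNx : 0 < Nx) (hNy : 0 < Ny) (hK : 0 ≤ K) (hτ : 0 < τ) (hτ1 : τ ≤ 1)
    {v : Fin (Nx - 1) → Fin (Ny - 1) → ℝ} (hv : ∀ i j, |v i j| ≤ K * τ ^ 3)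
    (hX : ∀ i j, |mulX (-nablaMat α (xr / Nx) (Nx - 1)) v i j| ≤ K * τ ^ 3)
    (hY : ∀ i j, |mulY (-nablaMat β (yr / Ny) (Ny - 1)) v i j| ≤ K * τ ^ 3) :
    IsSmall (edgeW α (xr / Nx) (Nx - 1)) (edgeW β (yr / Ny) (Ny - 1)) √(xr / Nx * (yr / Ny)) τ
      (√(xr * yr) * (K * τ ^ 2)) v := by
  have hx : (0 : ℝ) < Nx := by exact_mod_cast hNx
  have hy : (0 : ℝ) < Ny := by exact_mod_cast hNy
  have hA := isForm_nabla hα.1 hα.2 (by positivity : 0 < xr / Nx) (Nx - 1)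
  have hB := isForm_nabla hβ.1 hβ.2 (by positivity : 0 < yr / Ny) (Ny - 1)
  have c0 : 0 ≤ K * τ ^ 3 := by positivity
  have b0 := nrm_le_of_abs_le hxr hyr hNx hNy c0 hv
  have bX := nrm_le_of_abs_le hxr hyr hNx hNy c0 hX
  have bY := nrm_le_of_abs_le hxr hyr hNx hNy c0 hY
  set H := √(xr / Nx * (yr / Ny)) with hH
  have H0 : 0 ≤ H := Real.sqrt_nonneg _
  set D := √(xr * yr) * (K * τ ^ 3) with hD
  have D0 : 0 ≤ D := by positivity
  have hDτ : D ≤ √(xr * yr) * (K * τ ^ 2) := by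
    have : τ ^ 3 ≤ τ ^ 2 := pow_le_pow_of_le_one hτ.le hτ1 (by norm_num)
    rw [hD]; gcongr
  have key : ∀ {ι κ : Type} [Fintype ι] [Fintype κ] (g : ι → κ → ℝ) (p q : Fin (Nx - 1) → Fin (Ny - 1) → ℝ),
      nrm g ^ 2 = ∑ i, ∑ j, p i j * q i j → H * nrm p ≤ D → H * nrm q ≤ D → H * nrm g ≤ D := by
    intro ι κ _ _ g p q hg hp hq
    refine abs_le_of_sq_le_sq' ?_ D0 |>.2
    have h1 := (le_abs_self _).trans (abs_sum_mul_le_nrm p q)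
    calc _ = H ^ 2 * nrm g ^ 2 := by ring
      _ ≤ H ^ 2 * (nrm p * nrm q) := by rw [hg]; gcongr
      _ = (H * nrm p) * (H * nrm q) := by ring
      _ ≤ D * D := mul_le_mul hp hq (mul_nonneg H0 (nrm_nonneg _)) D0
      _ = D ^ 2 := by ring
  refine ⟨b0.trans (le_of_eq (by rw [hD]; ring)), ?_, ?_, ?_⟩
  · refine (key _ (mulX (-nablaMat α (xr / Nx) (Nx - 1)) v) v ?_ bX b0).trans hDτ
    rw [hA.sum_mulX, nrm_sq]
    simp only [sq]
  · refine (key _ (mulY (-nablaMat β (yr / Ny) (Ny - 1)) v) v ?_ bY b0).trans hDτ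
    rw [hB.sum_mulY, nrm_sq]
    simp only [sq]
  · have h := key (gradX (edgeW α (xr / Nx) (Nx - 1)) (gradY (edgeW β (yr / Ny) (Ny - 1)) v))
      (mulY (-nablaMat β (yr / Ny) (Ny - 1)) v) (mulX (-nablaMat α (xr / Nx) (Nx - 1)) v) (by
        rw [hB.sum_mulY]
        simp only [gradY_mulX]
        rw [nrm_sq]
        simp only [sq]
        rw [← hA.sum_mulX]
        exact Finset.sum_congr rfl fun i _ => Finset.sum_congr rfl fun f _ => mul_comm _ _) bY bX
    have hn := nrm_nonneg (gradX (edgeW α (xr / Nx) (Nx - 1)) (gradY (edgeW β (yr / Ny) (Ny - 1)) v))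
    calc _ ≤ H * (1 * nrm (gradX (edgeW α (xr / Nx) (Nx - 1))
          (gradY (edgeW β (yr / Ny) (Ny - 1)) v))) := by gcongr
      _ ≤ D := by rw [one_mul]; exact h
      _ ≤ _ := hDτ

/-- Tailored to `τ²` times a truncation error in `x`. The `x` gradient comes from the inverse
estimate and costs one of the two powers of `h`; the `y` gradient uses the Lipschitz bound in `y`.
What remains is at most a constant times `τ²` or `h²`, so no condition links `τ` and `h`. -/
lemma exists_isSmall_of_isLipGrid (hα : 1 < α ∧ α ≤ 2) (hβ : 1 < β ∧ β ≤ 2) (hxr : 0 < xr)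
    (hyr : 0 < yr) :
    ∃ C : ℝ, 0 < C ∧ ∀ Nx Ny : ℕ, 0 < Nx → 0 < Ny → ∀ K τ : ℝ, 0 ≤ K → 0 < τ → τ ≤ 1 →
      ∀ v : Fin (Nx - 1) → Fin (Ny - 1) → ℝ, (∀ i j, |v i j| ≤ K * τ ^ 2 * (xr / Nx) ^ 2) →
      (∀ i, IsLipGrid yr Ny (K * τ ^ 2 * (xr / Nx) ^ 2) (v i)) →
      IsSmall (edgeW α (xr / Nx) (Nx - 1)) (edgeW β (yr / Ny) (Ny - 1)) √(xr / Nx * (yr / Ny)) τ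
        (C * K * (τ ^ 2 + (xr / Nx) ^ 2)) v := by
  obtain ⟨C, hC, hi⟩ := exists_nrm_gradX_le hα.1 hα.2 hxr
  obtain ⟨M, hM, hl⟩ := exists_sum_grad_sq_le_of_lipschitz hβ.1 hβ.2 hyr
  refine ⟨√(xr * yr) * (1 + C * xr) * (1 + √M), by positivity,
    fun Nx Ny hNx hNy K τ hK hτ hτ1 v hv hv' => ?_⟩
  have hx : (1 : ℝ) ≤ Nx := by exact_mod_cast hNx
  have hy : (0 : ℝ) < Ny := by exact_mod_cast hNy
  have hp : 0 < xr / Nx := by positivity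
  have hpx : xr / Nx ≤ xr := div_le_self hxr.le hx
  have b0 := nrm_le_of_abs_le hxr hyr hNx hNy (by positivity) hv
  have bX := hi Nx hNx v
  have bXY := hi Nx hNx (gradY (edgeW β (yr / Ny) (Ny - 1)) v)
  have bY : √(xr / Nx * (yr / Ny)) * nrm (gradY (edgeW β (yr / Ny) (Ny - 1)) v)
      ≤ √(xr * yr) * (√M * (K * τ ^ 2 * (xr / Nx) ^ 2)) := by
    set Q := K * τ ^ 2 * (xr / Nx) ^ 2 with hQ
    have hQ0 : 0 ≤ Q := by positivity
    have : nrm (gradY (edgeW β (yr / Ny) (Ny - 1)) v) ≤ √((Nx : ℝ) * Ny) * (√M * Q) := by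
      refine nrm_le_of_sq_le (by positivity) ?_
      calc _ ≤ ∑ _i : Fin (Nx - 1), M * Q ^ 2 * Ny := Finset.sum_le_sum fun i _ =>
            hl Ny hNy (v i) Q hQ0 (hv' i).lip (hv' i).left (hv' i).right
        _ = ((Nx - 1 : ℕ) : ℝ) * (M * Q ^ 2 * Ny) := by simp
        _ ≤ Nx * (M * Q ^ 2 * Ny) := by
            have h1 : ((Nx - 1 : ℕ) : ℝ) ≤ Nx := by exact_mod_cast Nat.sub_le _ _
            gcongr
        _ = _ := by rw [mul_pow √_, mul_pow √M, Real.sq_sqrt (by positivity), Real.sq_sqrt hM.le]; ring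
    calc _ ≤ √(xr / Nx * (yr / Ny)) * (√((Nx : ℝ) * Ny) * (√M * Q)) := by gcongr
      _ = √(xr / Nx * (yr / Ny) * (Nx * Ny)) * (√M * Q) := by
          rw [Real.sqrt_mul (by positivity : 0 ≤ xr / Nx * (yr / Ny))]; ring
      _ = _ := by
          congr 2; field_simp
  set H := √(xr / Nx * (yr / Ny)) with hH
  have H0 : 0 ≤ H := Real.sqrt_nonneg _
  set D := √(xr * yr) with hD
  have D0 : 0 ≤ D := Real.sqrt_nonneg _
  have R0 : 0 ≤ √M := Real.sqrt_nonneg _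
  set h := xr / (Nx : ℝ) with hh
  have hτ2 : τ ^ 2 ≤ τ := by nlinarith
  have big : ∀ {c z : ℝ}, c ≤ (1 + C * xr) * (1 + √M) → 0 ≤ c → z ≤ τ ^ 2 + h ^ 2 → 0 ≤ z →
      D * c * K * z ≤ D * (1 + C * xr) * (1 + √M) * K * (τ ^ 2 + h ^ 2) := by
    intro c z hc hc0 hz hz0
    rw [mul_assoc D (1 + C * xr)]
    gcongr
  have hCx : 0 ≤ C * xr := by positivity
  have hCM : 0 ≤ C * xr * √M := by positivity
  have ex : (1 + C * xr) * (1 + √M) = 1 + √M + C * xr + C * xr * √M := by ring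
  have hCh : C * h ≤ C * xr := mul_le_mul_of_nonneg_left hpx hC.le
  have hChM : C * h * √M ≤ C * xr * √M := mul_le_mul_of_nonneg_right hCh R0
  have hh2 : 0 ≤ h ^ 2 := sq_nonneg h
  have ht2 : 0 ≤ τ ^ 2 := sq_nonneg τ
  have hth : τ * h ^ 2 ≤ 1 * h ^ 2 := mul_le_mul_of_nonneg_right hτ1 hh2
  have hth2 : τ ^ 2 * h ^ 2 ≤ 1 * h ^ 2 := mul_le_mul_of_nonneg_right (hτ2.trans hτ1) hh2
  refine ⟨?_, ?_, ?_, ?_⟩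
  · refine b0.trans ?_
    calc _ = τ * (D * 1 * K * (τ * h ^ 2)) := by ring
      _ ≤ _ := by
        refine mul_le_mul_of_nonneg_left (big (by linarith) zero_le_one ?_ (by positivity)) hτ.le
        linarith
  · calc _ ≤ H * (C / h * nrm v) := by gcongr
      _ = C / h * (H * nrm v) := by ring
      _ ≤ C / h * (D * (K * τ ^ 2 * h ^ 2)) := by gcongr
      _ = D * (C * h) * K * τ ^ 2 := by field_simp
      _ ≤ _ := big (by linarith) (by positivity)
        (by linarith) (by positivity)
  · refine bY.trans ?_
    calc _ = D * √M * K * (τ ^ 2 * h ^ 2) := by ring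
      _ ≤ _ := big (by linarith) R0 (by linarith)
        (by positivity)
  · calc _ ≤ H * (1 * (C / h * nrm (gradY (edgeW β (yr / Ny) (Ny - 1)) v))) := by
          have := nrm_nonneg (gradX (edgeW α h (Nx - 1)) (gradY (edgeW β (yr / Ny) (Ny - 1)) v))
          gcongr
      _ = C / h * (H * nrm (gradY (edgeW β (yr / Ny) (Ny - 1)) v)) := by ring
      _ ≤ C / h * (D * (√M * (K * τ ^ 2 * h ^ 2))) := by gcongr
      _ = D * (C * h * √M) * K * τ ^ 2 := by field_simp
      _ ≤ _ := big (by linarith) (by positivity) (by linarith) (by positivity)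

end nodes

/-! ### The square root of the discrete Riesz operator -/

section root

variable {ι κ γ : Type*} [Fintype ι] [Fintype κ] [Fintype γ]

lemma IsForm.nrm_mulX_root {g : ι → Option ι → ℝ} {A R : Matrix ι ι ℝ} (h : IsForm g A)
    (hR : R * R = A) (hs : R.transpose = R) (v : ι → γ → ℝ) : nrm (mulX R v) = nrm (gradX g v) := by
  have e : nrm (mulX R v) ^ 2 = nrm (gradX g v) ^ 2 := by
    rw [nrm_sq, nrm_sq]
    simp only [sq]
    rw [← h.sum_mulX, Finset.sum_comm, Finset.sum_comm (f := fun i j => mulX A v i j * v i j)]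
    refine Finset.sum_congr rfl fun j _ => ?_
    have e1 : ∀ i, mulX R v i j = (R.mulVec fun l => v l j) i := fun i => rfl
    have e2 : ∀ i, mulX A v i j = (R.mulVec (R.mulVec fun l => v l j)) i := fun i => by
      rw [Matrix.mulVec_mulVec, hR]; rfl
    simp only [e1, e2]
    have e3 := Matrix.dotProduct_mulVec (R.mulVec fun l => v l j) R (fun l => v l j)
    rw [← Matrix.mulVec_transpose, hs] at e3
    exact e3
  exact (pow_left_inj₀ (nrm_nonneg _) (nrm_nonneg _) two_ne_zero).1 e

lemma IsForm.nrm_mulY_root {g : κ → Option κ → ℝ} {B R : Matrix κ κ ℝ} (h : IsForm g B)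
    (hR : R * R = B) (hs : R.transpose = R) (v : γ → κ → ℝ) : nrm (mulY R v) = nrm (gradY g v) := by
  have e := h.nrm_mulX_root (γ := γ) hR hs (fun j i => v i j)
  rw [← nrm_swap, ← nrm_swap (gradY g v)]
  exact e

lemma gradX_mulY (g : ι → Option ι → ℝ) (B : Matrix κ κ ℝ) (v : ι → κ → ℝ) (e : ι × Option ι)
    (j : κ) : gradX g (mulY B v) e j = mulY B (gradX g v) e j :=
  gradY_mulX g B (fun j i => v i j) j e

end root

lemma posSemidef_neg_nablaMat {α h : ℝ} (h1 : 1 < α) (h2 : α ≤ 2) (hh : 0 < h) (n : ℕ) :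
    (-nablaMat α h n).PosSemidef := by
  refine Matrix.PosSemidef.of_dotProduct_mulVec_nonneg ?_ fun x => ?_
  · ext i l
    rw [Matrix.conjTranspose_apply, neg_nablaMat_apply, neg_nablaMat_apply, nodeDist_comm]
    simp only [eq_comm, star_trivial]
  · have e := isForm_nabla h1 h2 hh n x x
    have : star x ⬝ᵥ (-nablaMat α h n).mulVec x
        = ∑ e, grad (edgeW α h n) x e * grad (edgeW α h n) x e := by
      rw [← e]
      exact Finset.sum_congr rfl fun i _ => mul_comm _ _
    rw [this]
    exact Finset.sum_nonneg fun _ _ => mul_self_nonneg _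

lemma lambdaMat_mul_self {α h : ℝ} (h1 : 1 < α) (h2 : α ≤ 2) (hh : 0 < h) (n : ℕ) :
    lambdaMat α h n * lambdaMat α h n = -nablaMat α h n :=
  CFC.sqrt_mul_sqrt_self _ (posSemidef_neg_nablaMat h1 h2 hh n).nonneg

lemma lambdaMat_transpose (α h : ℝ) (n : ℕ) :
    (lambdaMat α h n).transpose = lambdaMat α h n := by
  have : (lambdaMat α h n).IsHermitian :=
    (Matrix.nonneg_iff_posSemidef.1 (CFC.sqrt_nonneg (-nablaMat α h n))).1
  rwa [Matrix.IsHermitian, Matrix.conjTranspose_eq_transpose_of_trivial] at this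

/-! ### Comparison of the energies -/

section energy

variable {α β θ τ xr yr S m : ℝ} {a b : ℝ → ℝ → ℝ} {Nx Ny : ℕ}

lemma normSq_pmul_le {hx hy : ℝ} {c v : Grid Nx Ny} (h : 0 ≤ hx * hy) (hS : ∀ i j, c i j ^ 2 ≤ S) :
    normSq hx hy (pmul c v) ≤ hx * hy * (S * nrm v ^ 2) := by
  rw [normSq]
  refine mul_le_mul_of_nonneg_left ?_ h
  have e : nrm v ^ 2 = ∑ i, ∑ j, v i j ^ 2 := nrm_sq v
  rw [e, Finset.mul_sum]
  refine Finset.sum_le_sum fun i _ => ?_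
  rw [Finset.mul_sum]
  refine Finset.sum_le_sum fun j _ => ?_
  rw [pmul, Matrix.of_apply, mul_pow]
  exact mul_le_mul_of_nonneg_right (hS i j) (sq_nonneg _)

/-- `Λ` is nonlocal, so a weight at the nodes is not the same as a weight on the edges. Both
energies are compared with unweighted gradient norms, through `m ≤ a, b ≤ S`, at the price of powers
of `S / m`. In the mixed term `τ⁶` and the two powers of `1 / τ` leave `τ⁴ ≤ τ²`. -/
lemma energy_le (hα : 1 < α ∧ α ≤ 2) (hβ : 1 < β ∧ β ≤ 2) (hxr : 0 < xr) (hyr : 0 < yr)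
    (hNx : 0 < Nx) (hNy : 0 < Ny) (hm : 0 < m) (hm1 : m ≤ 1) (hS : 1 ≤ S)
    (ha0 : ∀ i j, m ≤ sample xr yr Nx Ny a i j) (hb0 : ∀ i j, m ≤ sample xr yr Nx Ny b i j)
    (ha1 : ∀ i j, sample xr yr Nx Ny a i j ≤ S) (hb1 : ∀ i j, sample xr yr Nx Ny b i j ≤ S)
    (hτ : 0 < τ) (hτ1 : τ ≤ 1) (hθ : 1 / 4 ≤ θ) (e : ℕ → Grid Nx Ny) (k : ℕ) :
    energy α β θ τ xr yr a b e k
      ≤ (S / m) ^ 2 * (xr / Nx * (yr / Ny) * modEnergy (edgeW α (xr / Nx) (Nx - 1))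
        (edgeW β (yr / Ny) (Ny - 1)) (sample xr yr Nx Ny a) (sample xr yr Nx Ny b) θ τ
        (e (k + 1) - e k) (e (k + 1) + e k)) := by
  have hx : (0 : ℝ) < Nx := by exact_mod_cast hNx
  have hy : (0 : ℝ) < Ny := by exact_mod_cast hNy
  have px : 0 < xr / Nx := by positivity
  have py : 0 < yr / Ny := by positivity
  set gx := edgeW α (xr / Nx) (Nx - 1) with hgx
  set gy := edgeW β (yr / Ny) (Ny - 1) with hgy
  set H := xr / Nx * (yr / Ny) with hH
  have H0 : 0 < H := by positivity
  set d := e (k + 1) - e k with hd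
  set s := e (k + 1) + e k with hs
  have rX : ∀ {γ : Type} [Fintype γ] (v : Fin (Nx - 1) → γ → ℝ),
      nrm (mulX (lambdaMat α (xr / Nx) (Nx - 1)) v) = nrm (gradX gx v) := fun v =>
    (isForm_nabla hα.1 hα.2 px (Nx - 1)).nrm_mulX_root
      (lambdaMat_mul_self hα.1 hα.2 px _) (lambdaMat_transpose _ _ _) v
  have rY : ∀ {γ : Type} [Fintype γ] (v : γ → Fin (Ny - 1) → ℝ),
      nrm (mulY (lambdaMat β (yr / Ny) (Ny - 1)) v) = nrm (gradY gy v) := fun v =>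
    (isForm_nabla hβ.1 hβ.2 py (Ny - 1)).nrm_mulY_root
      (lambdaMat_mul_self hβ.1 hβ.2 py _) (lambdaMat_transpose _ _ _) v
  have pa : ∀ i j, 0 ≤ sample xr yr Nx Ny a i j := fun i j => hm.le.trans (ha0 i j)
  have pb : ∀ i j, 0 ≤ sample xr yr Nx Ny b i j := fun i j => hm.le.trans (hb0 i j)
  have sa : ∀ i j, (sample xr yr Nx Ny fun x y => √(a x y)) i j ^ 2 ≤ S := fun i j => by
    exact (Real.sq_sqrt (pa i j)).trans_le (ha1 i j)
  have sb : ∀ i j, (sample xr yr Nx Ny fun x y => √(b x y)) i j ^ 2 ≤ S := fun i j => by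
    exact (Real.sq_sqrt (pb i j)).trans_le (hb1 i j)
  have sab : ∀ i j, (sample xr yr Nx Ny fun x y => √(a x y * b x y)) i j ^ 2 ≤ S * S :=
    fun i j => by
      exact (Real.sq_sqrt (mul_nonneg (pa i j) (pb i j))).trans_le
        (mul_le_mul (ha1 i j) (hb1 i j) (pb i j) (by linarith))
  have linX : ∀ v w : Grid Nx Ny, actX (lambdaMat α (xr / Nx) (Nx - 1)) (v + w)
      = actX (lambdaMat α (xr / Nx) (Nx - 1)) v + actX (lambdaMat α (xr / Nx) (Nx - 1)) w :=
    fun v w => by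
      ext i j
      simp only [actX, Matrix.of_apply, Matrix.add_apply, mul_add, Finset.sum_add_distrib]
  have linX' : ∀ v w : Grid Nx Ny, actX (lambdaMat α (xr / Nx) (Nx - 1)) (v - w)
      = actX (lambdaMat α (xr / Nx) (Nx - 1)) v - actX (lambdaMat α (xr / Nx) (Nx - 1)) w :=
    fun v w => by
      ext i j
      simp only [actX, Matrix.of_apply, Matrix.sub_apply, mul_sub, Finset.sum_sub_distrib]
  have linY : ∀ v w : Grid Nx Ny, actY (lambdaMat β (yr / Ny) (Ny - 1)) (v + w)
      = actY (lambdaMat β (yr / Ny) (Ny - 1)) v + actY (lambdaMat β (yr / Ny) (Ny - 1)) w :=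
    fun v w => by
      ext i j
      simp only [actY, Matrix.of_apply, Matrix.add_apply, mul_add, Finset.sum_add_distrib]
  have linY' : ∀ v w : Grid Nx Ny, actY (lambdaMat β (yr / Ny) (Ny - 1)) (v - w)
      = actY (lambdaMat β (yr / Ny) (Ny - 1)) v - actY (lambdaMat β (yr / Ny) (Ny - 1)) w :=
    fun v w => by
      ext i j
      simp only [actY, Matrix.of_apply, Matrix.sub_apply, mul_sub, Finset.sum_sub_distrib]
  have t1 : normSq (xr / Nx) (yr / Ny) (τ⁻¹ • d) = H * (nrm d ^ 2 / τ ^ 2) := by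
    have e : nrm d ^ 2 = ∑ i, ∑ j, d i j ^ 2 := nrm_sq d
    rw [normSq, e, Finset.sum_div]
    congr 1
    refine Finset.sum_congr rfl fun i _ => ?_
    rw [Finset.sum_div]
    refine Finset.sum_congr rfl fun j _ => ?_
    rw [Matrix.smul_apply, smul_eq_mul, mul_pow, inv_pow]; ring
  have t2 : ∀ v : Grid Nx Ny, normSq (xr / Nx) (yr / Ny)
      (pmul (sample xr yr Nx Ny fun x y => √(a x y)) (actX (lambdaMat α (xr / Nx) (Nx - 1)) v))
      ≤ H * (S * nrm (gradX gx v) ^ 2) := fun v => by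
    rw [← rX v]; exact normSq_pmul_le H0.le sa
  have t3 : ∀ v : Grid Nx Ny, normSq (xr / Nx) (yr / Ny)
      (pmul (sample xr yr Nx Ny fun x y => √(b x y)) (actY (lambdaMat β (yr / Ny) (Ny - 1)) v))
      ≤ H * (S * nrm (gradY gy v) ^ 2) := fun v => by
    rw [← rY v]; exact normSq_pmul_le H0.le sb
  have t4 : normSq (xr / Nx) (yr / Ny) (pmul (sample xr yr Nx Ny fun x y => √(a x y * b x y))
      (actX (lambdaMat α (xr / Nx) (Nx - 1)) (actY (lambdaMat β (yr / Ny) (Ny - 1)) (τ⁻¹ • d))))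
      ≤ H * (S * S * ((τ⁻¹) ^ 2 * nrm (gradX gx (gradY gy d)) ^ 2)) := by
    have e1 : actX (lambdaMat α (xr / Nx) (Nx - 1)) (actY (lambdaMat β (yr / Ny) (Ny - 1)) (τ⁻¹ • d))
        = fun i j => τ⁻¹ * mulX (lambdaMat α (xr / Nx) (Nx - 1))
          (mulY (lambdaMat β (yr / Ny) (Ny - 1)) d) i j := by
      funext i j
      simp only [actX, actY, mulX, mulY, Matrix.of_apply, Matrix.smul_apply, smul_eq_mul,
        Finset.mul_sum]
      exact Finset.sum_congr rfl fun l _ => Finset.sum_congr rfl fun p _ => by ring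
    have e2 : nrm (actX (lambdaMat α (xr / Nx) (Nx - 1))
        (actY (lambdaMat β (yr / Ny) (Ny - 1)) (τ⁻¹ • d))) ^ 2
        = (τ⁻¹) ^ 2 * nrm (gradX gx (gradY gy d)) ^ 2 := by
      rw [e1, nrm_smul, mul_pow, sq_abs, rX,
        nrm_eq_of_forall (gradX_mulY gx (lambdaMat β (yr / Ny) (Ny - 1)) d), rY,
        nrm_eq_of_forall (fun e f => (gradX_gradY_comm d e f).symm)]
    rw [← e2]; exact normSq_pmul_le H0.le sab
  rw [energy]
  simp only [← linX, ← linX', ← linY, ← linY']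
  rw [← hd, ← hs, t1]
  set r := S / m with hr
  have hSr : S = r * m := by rw [hr]; field_simp
  have hr1 : 1 ≤ r := by rw [hr, le_div_iff₀ hm]; linarith
  have hr2 : r ≤ r ^ 2 := by nlinarith
  have wX : ∀ v : Grid Nx Ny, S * nrm (gradX gx v) ^ 2 ≤ r ^ 2 * wsq (fun (e : _ × Option _) j => sample xr yr Nx Ny a e.1 j)
      (gradX gx v) := fun v => by
    have := mul_nrm_sq_le_wsq (f := gradX gx v) (m := m)
      (c := fun (e : _ × Option _) j => sample xr yr Nx Ny a e.1 j) fun e j => ha0 _ _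
    calc _ = r * (m * nrm (gradX gx v) ^ 2) := by rw [hSr]; ring
      _ ≤ r ^ 2 * (m * nrm (gradX gx v) ^ 2) := by gcongr
      _ ≤ _ := by gcongr
  have wY : ∀ v : Grid Nx Ny, S * nrm (gradY gy v) ^ 2 ≤ r ^ 2 * wsq (fun i (f : _ × Option _) => sample xr yr Nx Ny b i f.1)
      (gradY gy v) := fun v => by
    have := mul_nrm_sq_le_wsq (f := gradY gy v) (m := m)
      (c := fun i (f : _ × Option _) => sample xr yr Nx Ny b i f.1) fun e j => hb0 _ _
    calc _ = r * (m * nrm (gradY gy v) ^ 2) := by rw [hSr]; ring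
      _ ≤ r ^ 2 * (m * nrm (gradY gy v) ^ 2) := by gcongr
      _ ≤ _ := by gcongr
  have wXY : S * S * nrm (gradX gx (gradY gy d)) ^ 2
      ≤ r ^ 2 * wsq (fun (e : _ × Option _) (f : _ × Option _) =>
        sample xr yr Nx Ny a e.1 f.1 * sample xr yr Nx Ny b e.1 f.1) (gradX gx (gradY gy d)) := by
    have := mul_nrm_sq_le_wsq (f := gradX gx (gradY gy d)) (m := m * m)
      (c := fun (e : _ × Option _) (f : _ × Option _) =>
        sample xr yr Nx Ny a e.1 f.1 * sample xr yr Nx Ny b e.1 f.1)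
      fun e f => mul_le_mul (ha0 _ _) (hb0 _ _) hm.le (pa _ _)
    calc _ = r ^ 2 * (m * m * nrm (gradX gx (gradY gy d)) ^ 2) := by rw [hSr]; ring
      _ ≤ _ := by gcongr
  simp only [modEnergy, formSum]
  have hθ' : 0 ≤ 1 / 4 * (4 * θ - 1) := by linarith
  have u1 : nrm d ^ 2 / τ ^ 2 ≤ r ^ 2 * (nrm d ^ 2 / τ ^ 2) :=
    le_mul_of_one_le_left (by positivity) (hr1.trans hr2)
  have u2 := (t2 s).trans (mul_le_mul_of_nonneg_left (wX s) H0.le)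
  have u3 := mul_le_mul_of_nonneg_left ((t2 d).trans (mul_le_mul_of_nonneg_left (wX d) H0.le)) hθ'
  have u4 := (t3 s).trans (mul_le_mul_of_nonneg_left (wY s) H0.le)
  have u5 := mul_le_mul_of_nonneg_left ((t3 d).trans (mul_le_mul_of_nonneg_left (wY d) H0.le)) hθ'
  have u1' := mul_le_mul_of_nonneg_left u1 H0.le
  have u7 : 0 ≤ H * (r ^ 2 * (τ ^ 2 * nrm (gradY gy d) ^ 2)) := by positivity
  have u6 : θ ^ 2 * τ ^ 6 * (H * (S * S * ((τ⁻¹) ^ 2 * nrm (gradX gx (gradY gy d)) ^ 2)))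
      ≤ θ ^ 2 * τ ^ 2 * (H * (r ^ 2 * wsq (fun (e : _ × Option _) (f : _ × Option _) =>
        sample xr yr Nx Ny a e.1 f.1 * sample xr yr Nx Ny b e.1 f.1) (gradX gx (gradY gy d)))) := by
    calc _ = θ ^ 2 * (τ ^ 2 * τ ^ 2) * (H * (S * S * nrm (gradX gx (gradY gy d)) ^ 2)) := by
          field_simp
      _ ≤ θ ^ 2 * (τ ^ 2 * 1) * (H * (S * S * nrm (gradX gx (gradY gy d)) ^ 2)) := by
          have : τ ^ 2 ≤ 1 := pow_le_one₀ hτ.le hτ1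
          gcongr
      _ ≤ _ := by rw [mul_one]; gcongr
  have u6' := (mul_le_mul_of_nonneg_left t4 (by positivity : 0 ≤ θ ^ 2 * τ ^ 6)).trans u6
  linarith only [u1', u2, u3, u4, u5, u6', u7]

end energy

/-! ### The error of the starting values -/

section start

variable {α β T xr yr : ℝ} {F : ℝ × ℝ × ℝ → ℝ} {c : ℝ → ℝ → ℝ}

lemma IsLipGrid.mul {L : ℝ} {N : ℕ} {K S B r : ℝ} {v c : Fin (N - 1) → ℝ} (hL : 0 ≤ L)
    (hv : IsLipGrid L N K v) (hB : ∀ i, |v i| ≤ B) (hB0 : 0 ≤ B) (hS : 0 ≤ S) (hc : ∀ i, |c i| ≤ S)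
    (hl : ∀ i l, |c i - c l| ≤ S * nodeLen (L / N) i l) :
    IsLipGrid L N (|r| * (S * K + S * B)) (fun i => r * (c i * v i)) := by
  have hh : 0 ≤ L / N := by positivity
  have bd : ∀ i : Fin (N - 1), ∀ z : ℝ, 0 ≤ z → |v i| ≤ K * z →
      |r * (c i * v i)| ≤ |r| * (S * K + S * B) * z := fun i z hz h => by
    rw [abs_mul, abs_mul, mul_assoc |r|]
    refine mul_le_mul_of_nonneg_left ?_ (abs_nonneg _)
    have := mul_le_mul (hc i) h (abs_nonneg _) hS
    have : 0 ≤ S * B * z := by positivity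
    linarith
  refine ⟨fun i l => ?_, fun i => bd i _ (by positivity) (hv.left i),
    fun i => bd i _ (by positivity) (hv.right i)⟩
  have e : r * (c i * v i) - r * (c l * v l) = r * (c i * (v i - v l) + (c i - c l) * v l) := by ring
  rw [e, abs_mul, mul_assoc |r|]
  refine mul_le_mul_of_nonneg_left ((abs_add_le _ _).trans ?_) (abs_nonneg _)
  rw [abs_mul, abs_mul]
  have h1 := mul_le_mul (hc i) (hv.lip i l) (abs_nonneg _) hS
  have h2 := mul_le_mul (hl i l) (hB l) (abs_nonneg _) ((abs_nonneg _).trans (hl i l))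
  linarith

lemma exists_isSmall_truncX (hα : 1 < α ∧ α ≤ 2) (hβ : 1 < β ∧ β ≤ 2) (hT : 0 < T) (hxr : 0 < xr)
    (hyr : 0 < yr) (hF : ContDiffOn ℝ 8 F (cyl α β T xr yr))
    (h0 : VanishX (cyl α β T xr yr) (Ioo 0 xr) F) (h0' : VanishY (cyl α β T xr yr) (Ioo 0 yr) F)
    (hc : ContDiffOn ℝ 2 (fun p : ℝ × ℝ => c p.1 p.2) (Icc 0 xr ×ˢ Icc 0 yr)) :
    ∃ C : ℝ, 0 < C ∧ ∀ Nx Ny : ℕ, 0 < Nx → 0 < Ny → ∀ τ : ℝ, 0 < τ → τ ≤ 1 →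
      IsSmall (edgeW α (xr / Nx) (Nx - 1)) (edgeW β (yr / Ny) (Ny - 1)) √(xr / Nx * (yr / Ny)) τ
        (C * (τ ^ 2 + (xr / Nx) ^ 2)) fun i j => -(τ ^ 2 / 2) * (sample xr yr Nx Ny c i j
          * truncX α xr F Nx i (((j : ℕ) + 1) * (yr / Ny)) 0) := by
  obtain ⟨C, hC, hs⟩ := exists_isSmall_of_isLipGrid hα hβ hxr hyr
  obtain ⟨S, hS, hg⟩ := exists_isGridCoeff hα.1 hα.2 hxr hyr hc
  obtain ⟨K₁, hK₁, hb⟩ := exists_abs_nablaAt_x_sub_rieszDeriv_le hα.1 hα.2 hT hxr hyr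
    (hF.of_le (by norm_num)) h0
  obtain ⟨K₂, hK₂, hl⟩ := exists_abs_truncX_sub_le hα.1 hα.2 hT hxr hyr hF h0
  have t0 : (0 : ℝ) ∈ Icc 0 T := ⟨le_rfl, hT.le⟩
  refine ⟨C * (S * (K₁ + K₂)), by positivity, fun Nx Ny hNx hNy τ hτ hτ1 => ?_⟩
  have g := hg S le_rfl Nx Ny
  have bv : ∀ (i : Fin (Nx - 1)) (j : Fin (Ny - 1)),
      |truncX α xr F Nx i (((j : ℕ) + 1) * (yr / Ny)) 0| ≤ (K₁ + K₂) * (xr / Nx) ^ 2 := fun i j =>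
    (hb _ (Ioo_subset_Icc_self (node_mem_Ioo hyr j)) 0 t0 Nx i).trans
      (mul_le_mul_of_nonneg_right (by linarith) (sq_nonneg _))
  have r0 : |-(τ ^ 2 / 2)| = τ ^ 2 / 2 := by rw [abs_neg, abs_of_nonneg (by positivity)]
  have hvanish : ∀ i : Fin (Nx - 1), ∀ y ∈ Icc 0 yr, y ∉ Ioo 0 yr → truncX α xr F Nx i y 0 = 0 :=
    fun i y hy hy' => truncX_eq_zero hα.1 hα.2 hT hxr hyr (hF.of_le (by norm_num)) h0 h0' hy hy' t0 i
  refine hs Nx Ny hNx hNy (S * (K₁ + K₂)) τ (by positivity) hτ hτ1 _ (fun i j => ?_) fun i => ?_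
  · rw [abs_mul, abs_mul, r0]
    calc _ ≤ τ ^ 2 / 2 * (S * ((K₁ + K₂) * (xr / Nx) ^ 2)) := by
          have := g.bound i j
          have := bv i j
          gcongr
      _ ≤ τ ^ 2 * (S * ((K₁ + K₂) * (xr / Nx) ^ 2)) := by
          have : τ ^ 2 / 2 ≤ τ ^ 2 := by linarith [sq_nonneg τ]
          gcongr
      _ = _ := by ring
  · have lv : IsLipGrid yr Ny ((K₁ + K₂) * (xr / Nx) ^ 2)
        fun j => truncX α xr F Nx i (((j : ℕ) + 1) * (yr / Ny)) 0 :=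
      isLipGrid_of_lipschitz hyr (w := fun y => truncX α xr F Nx i y 0)
        (fun y hy y' hy' => (hl y hy y' hy' 0 t0 Nx i).trans (by gcongr; linarith))
        (hvanish i 0 ⟨le_rfl, hyr.le⟩ (by simp)) (hvanish i yr ⟨hyr.le, le_rfl⟩ (by simp)) Ny
    have := lv.mul (r := -(τ ^ 2 / 2)) hyr.le (bv i) (by positivity) hS.le (g.bound i)
      (fun j l => g.lipY i j l)
    rw [r0] at this
    convert this using 1
    ring

lemma IsSmall.mono {ι κ : Type*} [Fintype ι] [Fintype κ] {gx : ι → Option ι → ℝ}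
    {gy : κ → Option κ → ℝ} {H τ δ δ' : ℝ} {v : ι → κ → ℝ} (hv : IsSmall gx gy H τ δ v)
    (hτ : 0 ≤ τ) (h : δ ≤ δ') : IsSmall gx gy H τ δ' v :=
  ⟨hv.zero.trans (mul_le_mul_of_nonneg_left h hτ), hv.X.trans h, hv.Y.trans h, hv.XY.trans h⟩

end start

namespace IsWaveProblem

variable {α β T xr yr a₀ a₁ b₀ b₁ : ℝ} {a b : ℝ → ℝ → ℝ} {f : ℝ → ℝ → ℝ → ℝ}
    {φ ψ : ℝ → ℝ → ℝ} {u : ℝ → ℝ → ℝ → ℝ}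

lemma exists_isSmall_start (P : IsWaveProblem α β T xr yr a₀ a₁ b₀ b₁ a b f φ ψ u) :
    ∃ C : ℝ, 0 < C ∧ ∀ Nx Ny : ℕ, 0 < Nx → 0 < Ny → ∀ τ : ℝ, 0 < τ → τ ≤ 1 → τ ∈ Icc 0 T →
      IsSmall (edgeW α (xr / Nx) (Nx - 1)) (edgeW β (yr / Ny) (Ny - 1)) √(xr / Nx * (yr / Ny)) τ
        (C * (τ ^ 2 + (xr / Nx) ^ 2 + (yr / Ny) ^ 2)) fun i j =>
          timeRem T (field u) τ (((i : ℕ) + 1) * (xr / Nx)) (((j : ℕ) + 1) * (yr / Ny))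
          + (-(τ ^ 2 / 2) * (sample xr yr Nx Ny a i j
              * truncX α xr (field u) Nx i (((j : ℕ) + 1) * (yr / Ny)) 0)
            + -(τ ^ 2 / 2) * (sample xr yr Nx Ny b i j
              * truncX β yr (swapXY (field u)) Ny j (((i : ℕ) + 1) * (xr / Nx)) 0)) := by
  have hF := P.contDiffOn
  have hF' := contDiffOn_swapXY (n := 8) hF
  have hxr := P.hxr
  have hyr := P.hyr
  obtain ⟨K₁, hK₁, b₁⟩ := exists_abs_timeRem_le P.hT hxr hyr (hF.of_le (by norm_num))
  obtain ⟨K₂, hK₂, b₂⟩ := exists_abs_nablaAt_x_timeRem_le P.hα.1 P.hα.2 P.hT hxr hyr hF P.vanishX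
  obtain ⟨K₃, hK₃, b₃⟩ := exists_abs_nablaAt_x_timeRem_le P.hβ.1 P.hβ.2 P.hT hyr hxr hF'
    P.vanishY.swapXY
  obtain ⟨C₁, hC₁, s₁⟩ := exists_isSmall_truncX P.hα P.hβ P.hT hxr hyr hF P.vanishX P.vanishY
    P.ha_smooth
  obtain ⟨C₂, hC₂, s₂⟩ := exists_isSmall_truncX (c := fun y x => b x y) P.hβ P.hα P.hT hyr hxr hF'
    P.vanishY.swapXY P.vanishX.swapXY
    (P.hb_smooth.comp (contDiff_snd.prodMk contDiff_fst).contDiffOn fun p hp => ⟨hp.2, hp.1⟩)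
  refine ⟨√(xr * yr) * (K₁ + K₂ + K₃) + (C₁ + C₂), by positivity,
    fun Nx Ny hNx hNy τ hτ hτ1 hτT => ?_⟩
  have hx : (0 : ℝ) < Nx := by exact_mod_cast hNx
  have hy : (0 : ℝ) < Ny := by exact_mod_cast hNy
  have up : ∀ {K : ℝ}, K ≤ K₁ + K₂ + K₃ → K * τ ^ 3 ≤ (K₁ + K₂ + K₃) * τ ^ 3 := fun h =>
    mul_le_mul_of_nonneg_right h (by positivity)
  have s₀ : IsSmall (edgeW α (xr / Nx) (Nx - 1)) (edgeW β (yr / Ny) (Ny - 1))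
      √(xr / Nx * (yr / Ny)) τ (√(xr * yr) * ((K₁ + K₂ + K₃) * τ ^ 2)) fun i j =>
          timeRem T (field u) τ (((i : ℕ) + 1) * (xr / Nx)) (((j : ℕ) + 1) * (yr / Ny)) := by
    refine isSmall_of_mul P.hα P.hβ hxr hyr hNx hNy (by positivity) hτ hτ1
      (fun i j => (b₁ _ (node_mem_Ioo hxr i) _ (node_mem_Ioo hyr j) τ hτT).trans (up (by linarith)))
      (fun i j => ?_) fun i j => ?_
    · refine le_trans (le_of_eq ?_) ((b₂ _ (node_mem_Ioo hyr j) τ hτT Nx i).trans (up (by linarith)))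
      simp only [mulX, nablaAt, Matrix.neg_apply, neg_mul, Finset.sum_neg_distrib, abs_neg]
    · refine le_trans (le_of_eq ?_) ((b₃ _ (node_mem_Ioo hxr i) τ hτT Ny j).trans (up (by linarith)))
      simp only [mulY, nablaAt, Matrix.neg_apply, neg_mul, Finset.sum_neg_distrib, abs_neg]
      rfl
  -- The truncation error in `y` is that of the swapped field in `x`; `IsSmall.swap` brings it back.
  have s₂' := s₂ Ny Nx hNy hNx τ hτ hτ1
  rw [mul_comm (yr / (Ny : ℝ))] at s₂'
  have h := s₀.add (Real.sqrt_nonneg _) hτ.le ((s₁ Nx Ny hNx hNy τ hτ hτ1).add (Real.sqrt_nonneg _)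
    hτ.le (IsSmall.swap (v := fun i j => -(τ ^ 2 / 2) * (sample xr yr Nx Ny b i j
      * truncX β yr (swapXY (field u)) Ny j (((i : ℕ) + 1) * (xr / Nx)) 0)) s₂'))
  refine h.mono hτ.le ?_
  have q1 : 0 ≤ √(xr * yr) * (K₁ + K₂ + K₃) * ((xr / Nx) ^ 2 + (yr / Ny) ^ 2) := by positivity
  have q2 : 0 ≤ C₁ * (yr / Ny) ^ 2 + C₂ * (xr / Nx) ^ 2 := by positivity
  linarith

end IsWaveProblem

/-! ### The error equation and convergence -/

lemma adiOp_sub {α β θ τ xr yr : ℝ} {a b : ℝ → ℝ → ℝ} {Nx Ny : ℕ} (v w : Grid Nx Ny) :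
    adiOp α β θ τ xr yr a b (v - w)
      = adiOp α β θ τ xr yr a b v - adiOp α β θ τ xr yr a b w := by
  ext i j
  simp only [adiOp_eq, opX_sub, opY_sub, Matrix.add_apply, Matrix.sub_apply, Matrix.smul_apply,
    smul_eq_mul]
  ring

lemma adiOp_second_diff {α β θ τ xr yr : ℝ} {a b : ℝ → ℝ → ℝ} {Nx Ny : ℕ} (v w z : Grid Nx Ny) :
    adiOp α β θ τ xr yr a b (v - (2 : ℝ) • w + z)
      = adiOp α β θ τ xr yr a b v - (2 : ℝ) • adiOp α β θ τ xr yr a b w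
        + adiOp α β θ τ xr yr a b z := by
  ext i j
  simp only [adiOp_eq, opX_sub, opY_sub, opX_add, opY_add, opX_smul, opY_smul, Matrix.add_apply,
    Matrix.sub_apply, Matrix.smul_apply, smul_eq_mul]
  ring

namespace IsWaveProblem

variable {α β T xr yr a₀ a₁ b₀ b₁ : ℝ} {a b : ℝ → ℝ → ℝ} {f : ℝ → ℝ → ℝ → ℝ}
    {φ ψ : ℝ → ℝ → ℝ} {u : ℝ → ℝ → ℝ → ℝ}

lemma exists_abs_error_residual_le (P : IsWaveProblem α β T xr yr a₀ a₁ b₀ b₁ a b f φ ψ u) :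
    ∃ K : ℝ, 0 < K ∧ ∀ θ : ℝ, 1 / 4 ≤ θ → θ ≤ 1 → ∀ (Nx Ny Nt : ℕ) (U : ℕ → Grid Nx Ny),
      IsSchemeSolution α β θ T xr yr a b f φ ψ Nx Ny Nt U → ∀ e : ℕ → Grid Nx Ny,
      e = gridError T xr yr u Nt U → ∀ τ : ℝ, τ = T / Nt → ∀ k, k + 2 ≤ Nt → ∀ i j,
      |adiOp α β θ τ xr yr a b (e (k + 2) - (2 : ℝ) • e (k + 1) + e k) i j
        - τ ^ 2 * (opX α xr yr a (e (k + 1)) + opY β xr yr b (e (k + 1))) i j|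
        ≤ K * τ ^ 2 * (τ ^ 2 + (xr / Nx) ^ 2 + (yr / Ny) ^ 2) := by
  obtain ⟨K, hK, h⟩ := P.exists_abs_residual_le
  refine ⟨K, hK, fun θ hθ hθ1 Nx Ny Nt U hU e he τ hτ k hk i j => ?_⟩
  have hN : (0 : ℝ) < Nt := by exact_mod_cast (by omega : 0 < Nt)
  have hT := P.hT
  have hτ0 : 0 < τ := by rw [hτ]; positivity
  have mem : ∀ l : ℕ, l ≤ Nt → (l : ℝ) * τ ∈ Icc 0 T := fun l hl => by
    refine ⟨by positivity, ?_⟩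
    rw [hτ, mul_div_assoc', div_le_iff₀ hN, mul_comm T]
    have : (l : ℝ) ≤ Nt := by exact_mod_cast hl
    gcongr
  set V : ℝ → Grid Nx Ny := fun t => sample xr yr Nx Ny fun x y => u x y t with hV
  have m0 : ((k + 1 : ℕ) : ℝ) * τ - τ = (k : ℝ) * τ := by push_cast; ring
  have m2 : ((k + 1 : ℕ) : ℝ) * τ + τ = ((k + 2 : ℕ) : ℝ) * τ := by push_cast; ring
  have r := h θ hθ hθ1 (((k + 1 : ℕ) : ℝ) * τ) τ (mem _ (by omega))
    (by rw [m0]; exact mem _ (by omega)) (by rw [m2]; exact mem _ hk) Nx Ny i j V fun _ => rfl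
  rw [m0, m2] at r
  have st := congrFun (congrFun (hU.step (k + 1) (by omega) hk) i) j
  rw [← hτ, Nat.add_sub_cancel] at st
  have ee : ∀ l : ℕ, e l = V (l * τ) - U l := fun l => by rw [he, hτ]; rfl
  refine le_trans (le_of_eq (congrArg abs ?_)) r
  rw [ee, ee, ee]
  simp only [adiOp_second_diff, adiOp_sub, opX_sub, opY_sub, Matrix.add_apply, Matrix.sub_apply,
    Matrix.smul_apply, smul_eq_mul] at st ⊢
  linear_combination -st

lemma error_zero (P : IsWaveProblem α β T xr yr a₀ a₁ b₀ b₁ a b f φ ψ u) {θ : ℝ} {Nx Ny Nt : ℕ}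
    {U : ℕ → Grid Nx Ny} (hU : IsSchemeSolution α β θ T xr yr a b f φ ψ Nx Ny Nt U) :
    U 0 = sample xr yr Nx Ny fun x y => u x y 0 := by
  rw [hU.start_zero]
  ext i j
  exact (P.sol.initial_value _ (node_mem_Ioo P.hxr i) _ (node_mem_Ioo P.hyr j)).symm

/-- The equation at `t = 0` expresses `u_tt` by the Riesz derivatives and `f`. Compared with the
starting formula, only the Taylor remainder in time and the two truncation errors are left. -/
lemma error_one (P : IsWaveProblem α β T xr yr a₀ a₁ b₀ b₁ a b f φ ψ u) {θ : ℝ} {Nx Ny Nt : ℕ}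
    {U : ℕ → Grid Nx Ny} (hU : IsSchemeSolution α β θ T xr yr a b f φ ψ Nx Ny Nt U)
    (i : Fin (Nx - 1)) (j : Fin (Ny - 1)) :
    gridError T xr yr u Nt U 1 i j
      = timeRem T (field u) (T / Nt) (((i : ℕ) + 1) * (xr / Nx)) (((j : ℕ) + 1) * (yr / Ny))
        + (-((T / Nt) ^ 2 / 2) * (sample xr yr Nx Ny a i j
            * truncX α xr (field u) Nx i (((j : ℕ) + 1) * (yr / Ny)) 0)
          + -((T / Nt) ^ 2 / 2) * (sample xr yr Nx Ny b i j
            * truncX β yr (swapXY (field u)) Ny j (((i : ℕ) + 1) * (xr / Nx)) 0)) := by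
  have hi := node_mem_Ioo P.hxr i
  have hj := node_mem_Ioo P.hyr j
  have eX : opX α xr yr a (U 0) i j = sample xr yr Nx Ny a i j
      * nablaAt α xr Nx (fun x => u x (((j : ℕ) + 1) * (yr / Ny)) 0) i := by
    rw [P.error_zero hU]; rfl
  have eY : opY β xr yr b (U 0) i j = sample xr yr Nx Ny b i j
      * nablaAt β yr Ny (fun y => u (((i : ℕ) + 1) * (xr / Nx)) y 0) j := by
    rw [P.error_zero hU]; rfl
  have e1 := congrFun (congrFun hU.start_one i) j
  simp only [Matrix.add_apply, Matrix.smul_apply, smul_eq_mul, eX, eY, sample_apply] at e1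
  rw [← P.sol.initial_value _ hi _ hj, ← P.sol.initial_velocity _ hi _ hj] at e1
  have eq := P.sol.equation _ hi _ hj 0 ⟨le_rfl, P.hT.le⟩
  have e0 : gridError T xr yr u Nt U 1 i j
      = u (((i : ℕ) + 1) * (xr / Nx)) (((j : ℕ) + 1) * (yr / Ny)) (T / Nt) - U 1 i j := by
    simp only [gridError, Nat.cast_one, one_mul, Matrix.sub_apply, sample_apply]
  rw [e0, e1]
  simp only [timeRem, truncX, swapXY, field, sample_apply]
  rw [eq]
  ring

/-- Second order convergence of the difference scheme in the energy norm. -/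
theorem exists_energy_error_le (P : IsWaveProblem α β T xr yr a₀ a₁ b₀ b₁ a b f φ ψ u) :
    ∃ C τ₀ : ℝ, 0 < C ∧ 0 < τ₀ ∧ ∀ θ : ℝ, 1 / 4 ≤ θ → θ ≤ 1 → ∀ Nx Ny Nt : ℕ, 0 < Nx → 0 < Ny →
      0 < Nt → T / Nt ≤ τ₀ → ∀ U : ℕ → Grid Nx Ny,
      IsSchemeSolution α β θ T xr yr a b f φ ψ Nx Ny Nt U → ∀ k : ℕ, k + 1 ≤ Nt →
      energy α β θ (T / Nt) xr yr a b (gridError T xr yr u Nt U) k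
        ≤ C * ((T / Nt) ^ 2 + (xr / Nx) ^ 2 + (yr / Ny) ^ 2) ^ 2 := by
  have hxr := P.hxr
  have hyr := P.hyr
  have hT := P.hT
  obtain ⟨S₁, hS₁, hSa, hSb⟩ := P.exists_abs_a_le
  obtain ⟨S₂, hS₂, ga⟩ := exists_isGridCoeff P.hα.1 P.hα.2 hxr hyr P.ha_smooth
  obtain ⟨S₃, hS₃, gb⟩ := exists_isGridCoeff P.hα.1 P.hα.2 hxr hyr P.hb_smooth
  obtain ⟨M₁, hM₁, lx⟩ := exists_moment_le P.hα.1 P.hα.2 hxr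
  obtain ⟨M₂, hM₂, ly⟩ := exists_moment_le P.hβ.1 P.hβ.2 hyr
  obtain ⟨K, hK, hres⟩ := P.exists_abs_error_residual_le
  obtain ⟨D, hD, hstart⟩ := P.exists_isSmall_start
  set S := S₁ + S₂ + S₃ + M₁ + M₂ with hS
  have S1 : 1 ≤ S := by linarith
  have SS : S ≤ S ^ 2 := by nlinarith
  set m := min 1 (min a₀ b₀) with hm
  have m0 : 0 < m := lt_min one_pos (lt_min P.ha₀ P.hb₀)
  have m1 : m ≤ 1 := min_le_left _ _
  set C₁ := 2000 * S ^ 5 * (1 / m) ^ 2 with hC₁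
  have C0 : 0 < C₁ := by positivity
  -- The factors stem from the comparison of the energies, Gronwall's inequality, the starting error
  -- and the residual. In `τ₀`, the bound `1 / (2 C₁)` is what Gronwall's inequality asks for, and
  -- `τ ≤ 1` orders the powers of `τ`.
  refine ⟨(S / m) ^ 2 * (Real.exp (4 * C₁ * T) * (5 * S ^ 2 * D ^ 2
    + 2 * T * (√(xr * yr) * K) ^ 2)), min 1 (min T (1 / (2 * C₁))), by positivity,
    lt_min one_pos (lt_min hT (by positivity)),
    fun θ hθ hθ1 Nx Ny Nt hNx hNy hNt hτs U hU k hk => ?_⟩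
  have hx : (0 : ℝ) < Nx := by exact_mod_cast hNx
  have hy : (0 : ℝ) < Ny := by exact_mod_cast hNy
  have hN : (0 : ℝ) < Nt := by exact_mod_cast hNt
  set τ := T / (Nt : ℝ) with hτ
  have τ0 : 0 < τ := by positivity
  have τ1 : τ ≤ 1 := hτs.trans (min_le_left _ _)
  have τT : τ ≤ T := hτs.trans ((min_le_right _ _).trans (min_le_left _ _))
  have τC : C₁ * τ ≤ 1 / 2 := by
    have := hτs.trans ((min_le_right _ _).trans (min_le_right _ _))
    rw [le_div_iff₀ (by positivity)] at this
    linarith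
  set A := -nablaMat α (xr / Nx) (Nx - 1) with hA
  set B := -nablaMat β (yr / Ny) (Ny - 1) with hB
  set gx := edgeW α (xr / Nx) (Nx - 1) with hgx
  set gy := edgeW β (yr / Ny) (Ny - 1) with hgy
  set va := sample xr yr Nx Ny a with hva
  set vb := sample xr yr Nx Ny b with hvb
  set ε := τ ^ 2 + (xr / Nx) ^ 2 + (yr / Ny) ^ 2 with hε
  have ε0 : 0 ≤ ε := by positivity
  set e := gridError T xr yr u Nt U with he
  have hX : IsLineForm A gx (nodeLen (xr / Nx)) S :=
    isLineForm_nabla P.hα.1 P.hα.2 (by positivity) fun R hR =>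
      (lx Nx hNx R (hR.trans (Nat.sub_le _ _))).trans (by linarith)
  have hY : IsLineForm B gy (nodeLen (yr / Ny)) S :=
    isLineForm_nabla P.hβ.1 P.hβ.2 (by positivity) fun R hR =>
      (ly Ny hNy R (hR.trans (Nat.sub_le _ _))).trans (by linarith)
  have gA := ga S (by linarith) Nx Ny
  have gB := gb S (by linarith) Nx Ny
  have ha0 : ∀ i j, m ≤ va i j := fun i j =>
    ((min_le_right _ _).trans (min_le_left _ _)).trans
      (P.ha _ (node_mem_Ioo hxr i) _ (node_mem_Ioo hyr j)).1
  have hb0 : ∀ i j, m ≤ vb i j := fun i j =>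
    ((min_le_right _ _).trans (min_le_right _ _)).trans
      (P.hb _ (node_mem_Ioo hxr i) _ (node_mem_Ioo hyr j)).1
  have haS : ∀ i j, |va i j| ≤ S := gA.bound
  have hbS : ∀ i j, |vb i j| ≤ S := gB.bound
  set H := √(xr / Nx * (yr / Ny)) with hH
  have H0 : 0 ≤ H := Real.sqrt_nonneg _
  have HH : H ^ 2 = xr / Nx * (yr / Ny) := Real.sq_sqrt (by positivity)
  -- The factor `H² = h_x h_y` turns the plain `ℓ²` norms into grid norms.
  set E : ℕ → ℝ := fun k => H ^ 2 * modEnergy gx gy va vb θ τ (e (k + 1) - e k) (e (k + 1) + e k)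
    with hE
  have hE0 : ∀ k, 0 ≤ E k := fun k =>
    mul_nonneg (sq_nonneg _) (modEnergy_nonneg m0.le ha0 hb0 hθ _ _)
  have hstep : ∀ k, k + 1 < Nt → E (k + 1) - E k
      ≤ C₁ * τ * (E (k + 1) + E k) + τ * (√(xr * yr) * K * ε) ^ 2 := fun k hk => by
    set p : Grid Nx Ny := e (k + 2) - (2 : ℝ) • e (k + 1) + e k with hp
    set R : Fin (Nx - 1) → Fin (Ny - 1) → ℝ := fun i j => (adiOp α β θ τ xr yr a b p i j
      - τ ^ 2 * (opX α xr yr a (e (k + 1)) + opY β xr yr b (e (k + 1))) i j) / τ ^ 2 with hR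
    have hRb : ∀ i j, |R i j| ≤ K * ε := fun i j => by
      rw [hR]
      simp only
      rw [abs_div, abs_of_pos (by positivity : 0 < τ ^ 2), div_le_iff₀ (by positivity)]
      exact (hres θ hθ hθ1 Nx Ny Nt U hU e he τ hτ k hk i j).trans (le_of_eq (by rw [← hε]; ring))
    have oX : ∀ (v : Grid Nx Ny) i j, va i j * mulX A v i j = -opX α xr yr a v i j :=
      fun v i j => by
        simp only [opX_apply, mulX, hA, Matrix.neg_apply, neg_mul, Finset.sum_neg_distrib, mul_neg]
        rfl
    have oY : ∀ (v : Grid Nx Ny) i j, vb i j * mulY B v i j = -opY β xr yr b v i j :=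
      fun v i j => by
        simp only [opY_apply, mulY, hB, Matrix.neg_apply, neg_mul, Finset.sum_neg_distrib, mul_neg]
        rfl
    have oXY : ∀ (v : Grid Nx Ny) i j, va i j * mulX A (fun i j => vb i j * mulY B v i j) i j
        = opX α xr yr a (opY β xr yr b v) i j := fun v i j => by
      rw [show (fun i j => vb i j * mulY B v i j) = ((-1 : ℝ) • opY β xr yr b v : Grid Nx Ny) from
        funext fun i => funext fun j => by
          rw [oY, Matrix.smul_apply, smul_eq_mul, neg_one_mul], oX, opX_smul, Matrix.smul_apply,
        smul_eq_mul, neg_one_mul, neg_neg]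
    -- With `p` the second difference and `s' = e^{k+2} + 2 e^{k+1} + e^k = p + 4 e^{k+1}`, the
    -- combination `θ p + e^{k+1}` in the scheme becomes `(θ - 1 / 4) p + s' / 4`. This is where the
    -- threshold `θ ≥ 1 / 4` comes from.
    have h := modEnergy_step hX hY S1 gA gB m0 m1 ha0 hb0 τ0 τ1 hθ hθ1
      (d₁ := e (k + 2) - e (k + 1)) (d₀ := e (k + 1) - e k) (s₁ := e (k + 2) + e (k + 1))
      (s₀ := e (k + 1) + e k) (p := p) (q := e (k + 2) - e k)
      (s' := p + (4 : ℝ) • e (k + 1)) (R := R)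
      (fun i j => by
        simp only [hp, Matrix.sub_apply, Matrix.add_apply, Matrix.smul_apply, smul_eq_mul]; ring)
      (fun i j => by simp only [Matrix.sub_apply]; ring)
      (fun i j => by simp only [Matrix.sub_apply, Matrix.add_apply]; ring)
      (fun i j => by
        simp only [hp, Matrix.sub_apply, Matrix.add_apply, Matrix.smul_apply, smul_eq_mul]; ring)
      (fun i j => by
        rw [oX p, oY p, oXY, oX (p + (4 : ℝ) • e (k + 1)), oY (p + (4 : ℝ) • e (k + 1)), hR,
          mul_div_cancel₀ _ (by positivity : τ ^ 2 ≠ 0)]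
        simp only [adiOp_eq, opX_add, opY_add, opX_smul, opY_smul, Matrix.add_apply,
          Matrix.sub_apply, Matrix.smul_apply, smul_eq_mul]
        ring)
    have hn := nrm_le_of_abs_le hxr hyr hNx hNy (by positivity) hRb
    have hn2 := pow_le_pow_left₀ (mul_nonneg H0 (nrm_nonneg R)) hn 2
    have h' := mul_le_mul_of_nonneg_left h (sq_nonneg H)
    have hn3 := mul_le_mul_of_nonneg_left hn2 τ0.le
    simp only [hE]
    rw [← hC₁] at h'
    calc _ = _ := (mul_sub _ _ _).symm
      _ ≤ _ := h'
      _ = C₁ * τ * (H ^ 2 * modEnergy gx gy va vb θ τ (e (k + 2) - e (k + 1))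
            (e (k + 2) + e (k + 1))
          + H ^ 2 * modEnergy gx gy va vb θ τ (e (k + 1) - e k) (e (k + 1) + e k))
          + τ * (H * nrm R) ^ 2 := by ring
      _ ≤ _ := add_le_add le_rfl (hn3.trans (le_of_eq (by ring)))
  have hN' : Nt * τ ≤ T := by rw [hτ]; exact (mul_div_cancel₀ T hN.ne').le
  have gr := discrete_gronwall hE0 C0.le τ0 τC hN' hstep (sq_nonneg _) k hk
  have hz : e 0 = 0 := by
    rw [he, gridError, P.error_zero hU, Nat.cast_zero, zero_mul, sub_self]
  have hinit : E 0 ≤ 5 * S ^ 2 * (D * ε) ^ 2 := by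
    have hs : IsSmall gx gy H τ (D * ε) (e 1) := by
      rw [show e 1 = _ from funext fun i => funext fun j => P.error_one hU i j]
      exact hstart Nx Ny hNx hNy τ τ0 τ1 ⟨τ0.le, τT⟩
    simp only [hE, zero_add, hz, sub_zero, add_zero]
    exact hs.modEnergy_le H0 τ0 τ1 hθ hθ1 S1 haS hbS
  have fin := energy_le P.hα P.hβ hxr hyr hNx hNy m0 m1 S1 ha0 hb0
    (fun i j => (le_abs_self _).trans (haS i j)) (fun i j => (le_abs_self _).trans (hbS i j))
    τ0 τ1 hθ e k
  rw [← HH] at fin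
  refine fin.trans ?_
  rw [mul_assoc ((S / m) ^ 2)]
  refine mul_le_mul_of_nonneg_left (gr.trans ?_) (sq_nonneg _)
  rw [mul_assoc (Real.exp _)]
  refine mul_le_mul_of_nonneg_left ?_ (Real.exp_pos _).le
  linarith

end IsWaveProblem

end RieszWave

end

theorem theorem3p3 (α β T xr yr a₀ a₁ b₀ b₁ : ℝ)
    (hα : 1 < α ∧ α ≤ 2) (hβ : 1 < β ∧ β ≤ 2)
    (hT : 0 < T) (hxr : 0 < xr) (hyr : 0 < yr) (ha₀ : 0 < a₀) (hb₀ : 0 < b₀)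
    (a b : ℝ → ℝ → ℝ) (f : ℝ → ℝ → ℝ → ℝ) (φ ψ : ℝ → ℝ → ℝ) (u : ℝ → ℝ → ℝ → ℝ)
    (ha : ∀ x ∈ Set.Ioo 0 xr, ∀ y ∈ Set.Ioo 0 yr, a₀ ≤ a x y ∧ a x y ≤ a₁)
    (hb : ∀ x ∈ Set.Ioo 0 xr, ∀ y ∈ Set.Ioo 0 yr, b₀ ≤ b x y ∧ b x y ≤ b₁)
    (ha_smooth : ContDiffOn ℝ 2 (fun p : ℝ × ℝ => a p.1 p.2) (Set.Icc 0 xr ×ˢ Set.Icc 0 yr))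
    (hb_smooth : ContDiffOn ℝ 2 (fun p : ℝ × ℝ => b p.1 p.2) (Set.Icc 0 xr ×ˢ Set.Icc 0 yr))
    (hu : RieszWave.IsExactSolution α β T xr yr a b f φ ψ u)
    (hu_reg : RieszWave.IsRegular α β T xr yr u) :
    ∃ C τ₀ : ℝ, 0 < C ∧ 0 < τ₀ ∧
      ∀ θ : ℝ, 1 / 4 ≤ θ → θ ≤ 1 → ∀ Nx Ny Nt : ℕ, 0 < Nx → 0 < Ny → 0 < Nt → T / Nt ≤ τ₀ →
        ∀ U : ℕ → RieszWave.Grid Nx Ny,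
          RieszWave.IsSchemeSolution α β θ T xr yr a b f φ ψ Nx Ny Nt U →
          ∀ k : ℕ, k + 1 ≤ Nt →
            RieszWave.energy α β θ (T / Nt) xr yr a b
                (RieszWave.gridError T xr yr u Nt U) k
              ≤ C * ((T / Nt) ^ 2 + (xr / Nx) ^ 2 + (yr / Ny) ^ 2) ^ 2 :=
  RieszWave.IsWaveProblem.exists_energy_error_le
    ⟨hα, hβ, hT, hxr, hyr, ha₀, hb₀, ha, hb, ha_smooth, hb_smooth, hu, hu_reg⟩
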